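/- **Theorem (shifted interior Carleman estimate).** There are absolute constants $K,c>0$ and, for every integer $n\ge 1$, a constant $c_n>0$ such that the following holds. *Setting.* Write points of $\mathbb{R}^{2+n}=\mathbb{R}^2\times\mathbb{R}^n$ as $(t,x)$, with the flat metric $g=-dt_1^2-dt_2^2+dx_1^2+\dots+dx_n^2$ and wave operator $\square=-\partial_{t_1}^2-\partial_{t_2}^2+\Delta_x$. Fix $Q=(t(Q),x(Q))\in\mathbb{R}^{2+n}$ and put $$t_Q=t-t(Q),\quad x_Q=x-x(Q),\quad \tau_Q=|t_Q|,\quad r_Q=|x_Q|,$$ $$u_Q=\tfrac12(\tau_Q-r_Q),\quad v_Q=\tfrac12(\tau_Q+r_Q),\quad f_Q=-u_Qv_Q=\tfrac14(r_Q^2-\tau_Q^2),\quad \mathfrak{D}_Q=\{f_Q>0\}.$$ Let $\partial_{u_Q}=\partial_{\tau_Q}-\partial_{r_Q}$ and $\partial_{v_Q}=\partial_{\tau_Q}+\partial_{r_Q}$ be the null coordinate vector fields; let $g^{ab}\slashed\nabla^Q_az\slashed\nabla^Q_bz\ge 0$ be the squared length of the part of $\nabla_xz$ tangent to the spheres $r_Q=\mathrm{const}$,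 and $g^{CD}\tilde\nabla^Q_Cz\tilde\nabla^Q_Dz\le 0$ minus the squared length of the part of $\nabla_tz$ tangent to the circles $\tau_Q=\mathrm{const}$. For $a,b,\varepsilon>0$ let $$\zeta^Q_{a,b;\varepsilon}=\left\{\frac{f_Q}{(1+\varepsilon u_Q)(1-\varepsilon v_Q)}\exp\left[\frac{2bf_Q^{1/2}}{(1-\varepsilon u_Q)^{1/2}(1+\varepsilon v_Q)^{1/2}}\right]\right\}^{2a}.$$ *Domain.* Let $R,\sigma>0$, let $\Omega\subset\mathbb{R}^n$ be open with smooth boundary (lying locally on one side of it) and $\Omega\subseteq\{r_Q<R\}$, let $\nu$ be its outward unit normal, and set $\mathfrak{U}=\mathbb{R}^2\times\Omega$, $$\Gamma_+^Q=\{x\in\partial\Omega:\nu(x)\cdot(x-x(Q))>0\}=\{\nu\cdot\nabla r_Q>0\},$$ $$\omega_Q=\{y\in\Omega:|y-x|<\sigma\text{ for some }x\in\Gamma_+^Q\}.$$ *Conclusion.* There is $C>0$, depending only on $n,\Omega,Q,R,\sigma$, such that for all $a,b,\varepsilon>0$ with $$a\ge(n+2)^2,\qquad a\ge KR,\qquad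 \varepsilon\le c_n b,\qquad b\le cR^{-1},$$ and all real-valued $z\in C^2(\mathfrak{U})\cap C^1(\bar{\mathfrak{U}})$ with $z|_{\partial\mathfrak{U}\cap\mathfrak{D}_Q}=0$, $$\begin{aligned} &C\varepsilon\int_{\mathfrak{U}\cap\mathfrak{D}_Q}\zeta^Q_{a,b;\varepsilon}\,r_Q^{-1}\left(|u_Q\partial_{u_Q}z|^2+|v_Q\partial_{v_Q}z|^2+f_Qg^{ab}\slashed\nabla^Q_az\slashed\nabla^Q_bz-f_Qg^{CD}\tilde\nabla^Q_Cz\tilde\nabla^Q_Dz\right)\\ &\quad+Cba^2\int_{\mathfrak{U}\cap\mathfrak{D}_Q}\zeta^Q_{a,b;\varepsilon}f_Q^{-1/2}z^2\\ &\le\frac1a\int_{\mathfrak{U}\cap\mathfrak{D}_Q}\zeta^Q_{a,b;\varepsilon}f_Q|\square z|^2+a^2R^3\int_{(\mathbb{R}^2\times\omega_Q)\cap\mathfrak{D}_Q}\zeta^Q_{a,b;\varepsilon}f_Q^{-2}\left(z_{t_1}^2+z_{t_2}^2\right)\\ &\quad+a^4R^4\int_{(\mathbb{R}^2\times\omega_Q)\cap\mathfrak{D}_Q}\zeta^Q_{a,b;\varepsilon}f_Q^{-3}z^2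 . \end{aligned}$$ All integrals are Lebesgue integrals of nonnegative functions, with values in $[0,\infty]$. -/

import Mathlib

open scoped ContDiff

noncomputable section

namespace ShiftedCarleman

/-- The space `ℝ² × ℝⁿ` of points `(t, x)`, with Lebesgue measure as its `volume`. -/
abbrev Spacetime (n : ℕ) : Type :=
  EuclideanSpace ℝ (Fin 2) × EuclideanSpace ℝ (Fin n)

/-! ### Shifted coordinates with centre `Q` -/

/-- `t_Q = t - t(Q)`. -/
def tShift {n : ℕ} (Q p : Spacetime n) : EuclideanSpace ℝ (Fin 2) := p.1 - Q.1

/-- `x_Q = x - x(Q)`. -/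
def xShift {n : ℕ} (Q p : Spacetime n) : EuclideanSpace ℝ (Fin n) := p.2 - Q.2

/-- `τ_Q = |t_Q|`. -/
def tauQ {n : ℕ} (Q p : Spacetime n) : ℝ := ‖tShift Q p‖

/-- `r_Q = |x_Q|`. -/
def rQ {n : ℕ} (Q p : Spacetime n) : ℝ := ‖xShift Q p‖

/-- `u_Q = (τ_Q - r_Q) / 2`. -/
def uQ {n : ℕ} (Q p : Spacetime n) : ℝ := (1 / 2) * (tauQ Q p - rQ Q p)

/-- `v_Q = (τ_Q + r_Q) / 2`. -/
def vQ {n : ℕ} (Q p : Spacetime n) : ℝ := (1 / 2) * (tauQ Q p + rQ Q p)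

/-- `f_Q = - u_Q v_Q`. -/
def fQ {n : ℕ} (Q p : Spacetime n) : ℝ := -(uQ Q p * vQ Q p)

/-- The exterior `𝔇_Q = {f_Q > 0}` of the null cone with vertex `Q`. -/
def exteriorCone {n : ℕ} (Q : Spacetime n) : Set (Spacetime n) := {p | 0 < fQ Q p}

/-- The Carleman weight `ζ^Q_{a,b;ε}`. -/
def weight {n : ℕ} (Q : Spacetime n) (a b ε : ℝ) (p : Spacetime n) : ℝ :=
  (fQ Q p / ((1 + ε * uQ Q p) * (1 - ε * vQ Q p)) *
    Real.exp (2 * b * fQ Q p ^ (1 / 2 : ℝ) /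
      ((1 - ε * uQ Q p) ^ (1 / 2 : ℝ) * (1 + ε * vQ Q p) ^ (1 / 2 : ℝ)))) ^ (2 * a)

/-! ### Derivatives -/

/-- `∇_t z`, the Euclidean gradient in the two time variables. -/
def gradT {n : ℕ} (z : Spacetime n → ℝ) (p : Spacetime n) : EuclideanSpace ℝ (Fin 2) :=
  gradient (fun s => z (s, p.2)) p.1

/-- `∇_x z`, the Euclidean gradient in the space variables. -/
def gradX {n : ℕ} (z : Spacetime n → ℝ) (p : Spacetime n) : EuclideanSpace ℝ (Fin n) :=
  gradient (fun y => z (p.1, y)) p.2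

/-- The wave operator `□ z = -∂²_{t₁} z - ∂²_{t₂} z + Δ_x z` of the metric
`g = -dt₁² - dt₂² + dx₁² + ⋯ + dxₙ²`. -/
def box {n : ℕ} (z : Spacetime n → ℝ) (p : Spacetime n) : ℝ :=
  -Laplacian.laplacian (fun s => z (s, p.2)) p.1 +
    Laplacian.laplacian (fun y => z (p.1, y)) p.2

/-- The temporal angle `t_Q / τ_Q` on the unit circle (used off the null set `τ_Q = 0`). -/
def omegaT {n : ℕ} (Q p : Spacetime n) : EuclideanSpace ℝ (Fin 2) :=
  (tauQ Q p)⁻¹ • tShift Q p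

/-- The spatial angle `x_Q / r_Q` on the unit sphere (used only where `r_Q ≠ 0`). -/
def omegaX {n : ℕ} (Q p : Spacetime n) : EuclideanSpace ℝ (Fin n) :=
  (rQ Q p)⁻¹ • xShift Q p

/-- `∂_{τ_Q} z`. -/
def dTau {n : ℕ} (Q : Spacetime n) (z : Spacetime n → ℝ) (p : Spacetime n) : ℝ :=
  inner ℝ (omegaT Q p) (gradT z p)

/-- `∂_{r_Q} z`. -/
def dR {n : ℕ} (Q : Spacetime n) (z : Spacetime n → ℝ) (p : Spacetime n) : ℝ :=
  inner ℝ (omegaX Q p) (gradX z p)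

/-- `∂_{u_Q} z`; since `τ = u + v` and `r = v - u`, this is `∂_τ z - ∂_r z`. -/
def dU {n : ℕ} (Q : Spacetime n) (z : Spacetime n → ℝ) (p : Spacetime n) : ℝ :=
  dTau Q z p - dR Q z p

/-- `∂_{v_Q} z = ∂_τ z + ∂_r z`. -/
def dV {n : ℕ} (Q : Spacetime n) (z : Spacetime n → ℝ) (p : Spacetime n) : ℝ :=
  dTau Q z p + dR Q z p

/-- The spatial angular gradient: the part of `∇_x z` tangent to the spheres `r_Q = const`. -/
def angGradX {n : ℕ} (Q : Spacetime n) (z : Spacetime n → ℝ) (p : Spacetime n) :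
    EuclideanSpace ℝ (Fin n) :=
  gradX z p - dR Q z p • omegaX Q p

/-- The temporal angular gradient: the part of `∇_t z` tangent to the circles `τ_Q = const`. -/
def angGradT {n : ℕ} (Q : Spacetime n) (z : Spacetime n → ℝ) (p : Spacetime n) :
    EuclideanSpace ℝ (Fin 2) :=
  gradT z p - dTau Q z p • omegaT Q p

/-- The contraction of the spatial angular derivatives of `z` with themselves by `g`, which is
positive definite on the spheres `r_Q = const`. -/
def gAngX {n : ℕ} (Q : Spacetime n) (z : Spacetime n → ℝ) (p : Spacetime n) : ℝ :=
  ‖angGradX Q z p‖ ^ 2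

/-- The contraction of the temporal angular derivatives of `z` with themselves by `g`, which is
negative definite on the circles `τ_Q = const`. -/
def gAngT {n : ℕ} (Q : Spacetime n) (z : Spacetime n → ℝ) (p : Spacetime n) : ℝ :=
  -‖angGradT Q z p‖ ^ 2

/-! ### The spatial domain, its boundary and the observation set -/

/-- `ρ` is a smooth function without critical points on the open set `V`, and `Ω` is
`{ρ < 0}` inside `V`. -/
def IsDefiningFunctionOn {n : ℕ} (Ω V : Set (EuclideanSpace ℝ (Fin n)))
    (ρ : EuclideanSpace ℝ (Fin n) → ℝ) : Prop :=
  IsOpen V ∧ ContDiffOn ℝ ∞ ρ V ∧ (∀ y ∈ V, gradient ρ y ≠ 0) ∧ Ω ∩ V = {y ∈ V | ρ y < 0}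

/-- `Ω` has a smooth boundary (and lies locally on one side of it). -/
def HasSmoothBoundary {n : ℕ} (Ω : Set (EuclideanSpace ℝ (Fin n))) : Prop :=
  ∀ x ∈ frontier Ω, ∃ V ρ, x ∈ V ∧ IsDefiningFunctionOn Ω V ρ

/-- `ν` is the outward pointing unit normal of `Ω` at the boundary point `x`. -/
def IsOutwardUnitNormal {n : ℕ} (Ω : Set (EuclideanSpace ℝ (Fin n)))
    (x ν : EuclideanSpace ℝ (Fin n)) : Prop :=
  ∃ V ρ, x ∈ V ∧ IsDefiningFunctionOn Ω V ρ ∧ ν = ‖gradient ρ x‖⁻¹ • gradient ρ x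

/-- `Γ₊^Q = {ν r_Q > 0} = {x ∈ ∂Ω | ν · (x - x(Q)) > 0}`. -/
def gammaPlus {n : ℕ} (Ω : Set (EuclideanSpace ℝ (Fin n))) (Q : Spacetime n) :
    Set (EuclideanSpace ℝ (Fin n)) :=
  {x | x ∈ frontier Ω ∧ ∃ ν, IsOutwardUnitNormal Ω x ν ∧ 0 < inner ℝ ν (x - Q.2)}

/-- `ω_Q`: the points of `Ω` at distance less than `σ` from some point of `Γ₊^Q`. -/
def observationSet {n : ℕ} (Ω : Set (EuclideanSpace ℝ (Fin n))) (Q : Spacetime n) (σ : ℝ) :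
    Set (EuclideanSpace ℝ (Fin n)) :=
  {y | ∃ x ∈ gammaPlus Ω Q, ‖y - x‖ < σ} ∩ Ω

/-- The cylinder `ℝ² × S`. -/
def cylinder {n : ℕ} (S : Set (EuclideanSpace ℝ (Fin n))) : Set (Spacetime n) :=
  Set.univ ×ˢ S

/-- The integral over `S` of a function that is nonnegative there, as a number in `[0, ∞]`. -/
def integralOn {n : ℕ} (S : Set (Spacetime n)) (h : Spacetime n → ℝ) : ENNReal :=
  ∫⁻ p in S, ENNReal.ofReal (h p)

end ShiftedCarleman

end

/-! Put f = f_Q, r = r_Q, and write the weight as e^{2aΦ} with Φ = `phase`. The g-gradient of Φ is W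
S, where W = `speedF` is positive and S = `multField` is spanned by the position vector X and its
spatial part x. The conjugated function ψ = e^{aΦ} z satisfies an equation with first order term 2aW
Sψ and potential −A, where A = g(∇aΦ, ∇aΦ). Multiplying □ψ by m = Sψ + qψ and collecting a
divergence leaves the deformation form of S, the square 2aW m², a mixed term in ψ m, and a multiple
of ψ² (`sum_pd_carlemanCurrent`).

For b = ε = 0 one has S = X/2, which is conformal Killing. With the right q the deformation form,
the mixed term and the zeroth order coefficient then all vanish: f^a is exactly borderline. The two
parameters break this degeneracy. The parameter ε makes the deformation form at least a multiple of
ε/r times a positive form in the gradient, up to multiples of (Sψ)² (`deformForm_ge`). The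
exponential with b gives the zeroth order coefficient a lower bound of order a² b f^{-1/2}
(`potential_bound`). The losses in (Sψ)² go into 2aW m², because W is comparable to 1/f and a is
large. The term □q has to stay below b f^{-1/2}. It is estimated by a small symbol calculus
(`exists_multWeight_bounds`), and this is where ε ≤ c_n b enters. The outcome is
`carleman_pointwise`.

On the lateral boundary z = 0, so the gradient is normal and the flux of the current has the sign of
ν · x_Q (`carlemanCurrent_flux`). It is favourable off Γ₊. Replacing z by χz, with χ = 0 on Γ₊,
removes the unfavourable part; the price is commutators near Γ₊ containing the full gradient of z.
The divergence of e^{2aΦ} φ² z ∇z trades spatial derivatives for time derivatives, □z and z²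
(`local_pointwise`), so only z_t and z are observed. Adding the two currents with suitable factors
gives one inequality of the form bulk ≤ source + divergence (`bulkDensity_le`).

Since z is C² only in the interior, the inequality is integrated against cutoffs
(`lintegral_le_of_le_add_div`). Near the boundary the current is continuous and its flux has a sign,
so a layer of width δ contributes at most an arbitrarily small amount. Near the cone the current is
O(f²), against cutoff derivatives O(1/δ). Fatou's lemma handles the left side and dominated
convergence the right side. Finally the positive form is compared with the null frame expression
(`null_frame_le`). -/

open scoped ContDiff

noncomputable section

namespace ShiftedCarleman

open MeasureTheory Set Filter Topology

/-! ### Cartesian coordinates on spacetime -/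

/-- Indices of the Cartesian coordinates: two times and `n` space variables. -/
abbrev Idx (n : ℕ) : Type := Fin 2 ⊕ Fin n

/-- The Cartesian coordinate vectors. -/
def stdVec {n : ℕ} : Idx n → Spacetime n :=
  Sum.elim (fun k => (EuclideanSpace.single k 1, 0)) (fun j => (0, EuclideanSpace.single j 1))

/-- The signs of the metric on the coordinate vectors. -/
def sgn {n : ℕ} : Idx n → ℝ := Sum.elim (fun _ => -1) (fun _ => 1)

@[simp] lemma sgn_inl {n : ℕ} (k : Fin 2) : sgn (Sum.inl k : Idx n) = -1 := rfl
@[simp] lemma sgn_inr {n : ℕ} (j : Fin n) : sgn (Sum.inr j : Idx n) = 1 := rfl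

lemma sgn_mul_self {n : ℕ} (i : Idx n) : sgn i * sgn i = 1 := by
  cases i <;> simp

/-- The partial derivative in the `i`-th Cartesian coordinate. -/
def pd {n : ℕ} (i : Idx n) (h : Spacetime n → ℝ) (p : Spacetime n) : ℝ :=
  fderiv ℝ h p (stdVec i)

section Derivatives

variable {n : ℕ} {i : Idx n} {g h : Spacetime n → ℝ} {p : Spacetime n}

lemma pd_add (hg : DifferentiableAt ℝ g p) (hh : DifferentiableAt ℝ h p) :
    pd i (fun x => g x + h x) p = pd i g p + pd i h p := by
  simp [pd, fderiv_fun_add hg hh]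

lemma pd_sub (hg : DifferentiableAt ℝ g p) (hh : DifferentiableAt ℝ h p) :
    pd i (fun x => g x - h x) p = pd i g p - pd i h p := by
  simp [pd, fderiv_fun_sub hg hh]

lemma pd_mul (hg : DifferentiableAt ℝ g p) (hh : DifferentiableAt ℝ h p) :
    pd i (fun x => g x * h x) p = pd i g p * h p + g p * pd i h p := by
  simp [pd, fderiv_fun_mul hg hh]; ring

lemma pd_const_mul (c : ℝ) (hh : DifferentiableAt ℝ h p) :
    pd i (fun x => c * h x) p = c * pd i h p := by
  simp [pd, fderiv_const_mul hh]

lemma pd_sq (hh : DifferentiableAt ℝ h p) :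
    pd i (fun x => h x ^ 2) p = 2 * h p * pd i h p := by
  simp [pd, fderiv_fun_pow 2 hh]

lemma pd_const (c : ℝ) : pd i (fun _ : Spacetime n => c) p = 0 := by
  simp [pd]

lemma pd_sum {ι : Type*} {s : Finset ι} {F : ι → Spacetime n → ℝ}
    (hF : ∀ j ∈ s, DifferentiableAt ℝ (F j) p) :
    pd i (fun x => ∑ j ∈ s, F j x) p = ∑ j ∈ s, pd i (F j) p := by
  simp [pd, fderiv_fun_sum hF]

lemma pd_congr (hgh : g =ᶠ[𝓝 p] h) : pd i g p = pd i h p := by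
  simp [pd, hgh.fderiv_eq]

lemma HasFDerivAt.pd_eq {L : Spacetime n →L[ℝ] ℝ} (hg : HasFDerivAt g L p) :
    pd i g p = L (stdVec i) := by
  simp [pd, hg.fderiv]

/-- Chain rule for a function of one real variable. -/
lemma pd_comp {φ : ℝ → ℝ} {φ' : ℝ} (hφ : HasDerivAt φ φ' (h p)) (hh : DifferentiableAt ℝ h p) :
    pd i (fun x => φ (h x)) p = φ' * pd i h p := by
  have := (hφ.comp_hasFDerivAt p hh.hasFDerivAt)
  rw [show (fun x => φ (h x)) = φ ∘ h from rfl, HasFDerivAt.pd_eq this]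
  simp [pd]

lemma contDiffAt_pd {k m : ℕ∞} (hkm : k + 1 ≤ m) (hh : ContDiffAt ℝ m h p) :
    ContDiffAt ℝ k (pd i h) p :=
  ContDiffAt.clm_apply (hh.fderiv_right (by exact_mod_cast hkm)) contDiffAt_const

lemma differentiableAt_pd (hh : ContDiffAt ℝ 2 h p) : DifferentiableAt ℝ (pd i h) p :=
  (contDiffAt_pd (k := 1) (m := 2) (by norm_num) hh).differentiableAt (by norm_num)

lemma pd_comm {j : Idx n} (hh : ContDiffAt ℝ 2 h p) : pd i (pd j h) p = pd j (pd i h) p := by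
  have hd : DifferentiableAt ℝ (fderiv ℝ h) p :=
    (hh.fderiv_right (m := 1) (by norm_num)).differentiableAt (by norm_num)
  have key : ∀ a b : Idx n, pd a (pd b h) p = fderiv ℝ (fderiv ℝ h) p (stdVec a) (stdVec b) := by
    intro a b
    have : HasFDerivAt (pd b h) _ p :=
      hd.hasFDerivAt.clm_apply (hasFDerivAt_const (stdVec b) p)
    rw [HasFDerivAt.pd_eq this]; simp
  rw [key, key]
  exact (hh.isSymmSndFDerivAt (by simp)) _ _

end Derivatives

/-! ### The operators of the statement in coordinates -/

lemma gradT_apply {n : ℕ} {z : Spacetime n → ℝ} {p : Spacetime n} (hz : DifferentiableAt ℝ z p)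
    (k : Fin 2) : gradT z p k = pd (Sum.inl k) z p := by
  have h1 : HasFDerivAt (fun s => z (s, p.2))
      ((fderiv ℝ z p).comp (ContinuousLinearMap.inl ℝ _ _)) p.1 :=
    HasFDerivAt.comp (f := fun s => (s, p.2)) (g := z) p.1 hz.hasFDerivAt
      (hasFDerivAt_prodMk_left p.1 p.2)
  have h2 : gradT z p k = inner ℝ (gradient (fun s => z (s, p.2)) p.1)
      (EuclideanSpace.single k (1 : ℝ)) := by
    rw [EuclideanSpace.inner_single_right]; simp [gradT]
  rw [h2, gradient, InnerProductSpace.toDual_symm_apply, h1.fderiv]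
  simp [pd, stdVec]

lemma gradX_apply {n : ℕ} {z : Spacetime n → ℝ} {p : Spacetime n} (hz : DifferentiableAt ℝ z p)
    (j : Fin n) : gradX z p j = pd (Sum.inr j) z p := by
  have h1 : HasFDerivAt (fun y => z (p.1, y))
      ((fderiv ℝ z p).comp (ContinuousLinearMap.inr ℝ _ _)) p.2 :=
    HasFDerivAt.comp (f := fun y => (p.1, y)) (g := z) p.2 hz.hasFDerivAt
      (hasFDerivAt_prodMk_right p.1 p.2)
  have h2 : gradX z p j = inner ℝ (gradient (fun y => z (p.1, y)) p.2)
      (EuclideanSpace.single j (1 : ℝ)) := by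
    rw [EuclideanSpace.inner_single_right]; simp [gradX]
  rw [h2, gradient, InnerProductSpace.toDual_symm_apply, h1.fderiv]
  simp [pd, stdVec]

/-- Since `ι` has constant derivative, no term with the second derivative of `ι` appears. -/
lemma iteratedFDeriv_comp_affine {E F : Type*} [NormedAddCommGroup E] [NormedSpace ℝ E]
    [NormedAddCommGroup F] [NormedSpace ℝ F] {z : F → ℝ} {ι : E → F} {L : E →L[ℝ] F} {x : E}
    (hι : ∀ y, HasFDerivAt ι L y) (hz : ContDiffAt ℝ 2 z (ι x)) (v : E) :
    iteratedFDeriv ℝ 2 (fun s => z (ι s)) x ![v, v] =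
      fderiv ℝ (fun p => fderiv ℝ z p (L v)) (ι x) (L v) := by
  have hev : (fderiv ℝ fun s => z (ι s)) =ᶠ[𝓝 x] fun s => (fderiv ℝ z (ι s)).comp L := by
    have h1 : ∀ᶠ q in 𝓝 (ι x), DifferentiableAt ℝ z q :=
      (hz.eventually (by simp)).mono fun q hq => hq.differentiableAt (by norm_num)
    filter_upwards [(hι x).continuousAt.eventually h1] with s hs
    exact (hs.hasFDerivAt.comp s (hι s)).fderiv
  have hd : DifferentiableAt ℝ (fderiv ℝ z) (ι x) :=
    (hz.fderiv_right (m := 1) (by norm_num)).differentiableAt (by norm_num)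
  have h2 : HasFDerivAt (fun s => (fderiv ℝ z (ι s)).comp L) _ x :=
    (hd.hasFDerivAt.comp x (hι x)).clm_comp (hasFDerivAt_const L x)
  have h3 : HasFDerivAt (fun p => fderiv ℝ z p (L v)) _ (ι x) :=
    hd.hasFDerivAt.clm_apply (hasFDerivAt_const (L v) (ι x))
  rw [iteratedFDeriv_two_apply, hev.fderiv_eq, h2.fderiv, h3.fderiv]
  simp

lemma box_eq {n : ℕ} {z : Spacetime n → ℝ} {p : Spacetime n} (hz : ContDiffAt ℝ 2 z p) :
    box z p = ∑ i, sgn i * pd i (pd i z) p := by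
  have h1 : ∀ k : Fin 2, iteratedFDeriv ℝ 2 (fun s => z (s, p.2)) p.1
      ![EuclideanSpace.single k 1, EuclideanSpace.single k 1]
        = pd (Sum.inl k) (pd (Sum.inl k) z) p := by
    intro k
    rw [iteratedFDeriv_comp_affine (ι := fun s => (s, p.2))
      (fun y => hasFDerivAt_prodMk_left y p.2) hz]
    simp only [pd, stdVec, Sum.elim_inl, ContinuousLinearMap.inl_apply]
    rfl
  have h2 : ∀ j : Fin n, iteratedFDeriv ℝ 2 (fun y => z (p.1, y)) p.2
      ![EuclideanSpace.single j 1, EuclideanSpace.single j 1]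
        = pd (Sum.inr j) (pd (Sum.inr j) z) p := by
    intro j
    rw [iteratedFDeriv_comp_affine (ι := fun y => (p.1, y))
      (fun y => hasFDerivAt_prodMk_right p.1 y) hz]
    simp only [pd, stdVec, Sum.elim_inr, ContinuousLinearMap.inr_apply]
    rfl
  rw [box, InnerProductSpace.laplacian_eq_iteratedFDeriv_orthonormalBasis _
    (EuclideanSpace.basisFun (Fin 2) ℝ),
    InnerProductSpace.laplacian_eq_iteratedFDeriv_orthonormalBasis _
    (EuclideanSpace.basisFun (Fin n) ℝ)]
  simp only [EuclideanSpace.basisFun_apply, h1, h2, Fintype.sum_sum_type, sgn_inl, sgn_inr]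
  simp

/-! ### Integration by parts for compactly supported fields -/

instance {n : ℕ} : Measure.IsAddHaarMeasure (volume : Measure (Spacetime n)) :=
  inferInstanceAs (Measure.IsAddHaarMeasure ((volume : Measure (EuclideanSpace ℝ (Fin 2))).prod
    (volume : Measure (EuclideanSpace ℝ (Fin n)))))

lemma continuous_pd {n : ℕ} {i : Idx n} {h : Spacetime n → ℝ} (hh : ContDiff ℝ 1 h) :
    Continuous (pd i h) :=
  (hh.continuous_fderiv (by norm_num)).clm_apply continuous_const

lemma integral_pd_eq_zero {n : ℕ} (i : Idx n) {h : Spacetime n → ℝ} (hh : ContDiff ℝ 1 h)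
    (hc : HasCompactSupport h) : ∫ p, pd i h p = 0 := by
  have hi : Integrable (pd i h) :=
    (continuous_pd hh).integrable_of_hasCompactSupport
      ((hc.fderiv ℝ).mono' fun p hp => subset_tsupport _ fun h0 => hp (by simp [pd, h0]))
  -- Integration by parts against the constant 1, whose derivative vanishes.
  have := integral_mul_fderiv_eq_neg_fderiv_mul_of_integrable (μ := (volume : Measure (Spacetime n)))
    (f := fun _ => (1 : ℝ)) (g := h) (v := stdVec i) (by simp) (by simp only [one_mul]; exact hi)
    (by simpa using hh.continuous.integrable_of_hasCompactSupport hc)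
    (fun x _ => differentiableAt_const _) (fun x _ => hh.differentiable (by norm_num) x)
  simpa [pd] using this

/-! ### The smooth step -/

/-- Each such point is a global minimum, so the endpoint 0 needs no separate treatment. -/
lemma deriv_smoothTransition_of_nonpos {x : ℝ} (hx : x ≤ 0) :
    deriv Real.smoothTransition x = 0 := by
  apply IsLocalMin.deriv_eq_zero
  filter_upwards with y
  rw [Real.smoothTransition.zero_of_nonpos hx]
  exact Real.smoothTransition.nonneg y

lemma deriv_smoothTransition_of_one_le {x : ℝ} (hx : 1 ≤ x) :
    deriv Real.smoothTransition x = 0 := by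
  apply IsLocalMax.deriv_eq_zero
  filter_upwards with y
  rw [Real.smoothTransition.one_of_one_le hx]
  exact Real.smoothTransition.le_one y

lemma deriv_smoothTransition_nonneg (x : ℝ) : 0 ≤ deriv Real.smoothTransition x :=
  Real.smoothTransition.monotone.deriv_nonneg

lemma contDiff_smoothTransition : ContDiff ℝ 1 Real.smoothTransition :=
  Real.smoothTransition.contDiff (n := 1)

lemma continuous_deriv_smoothTransition : Continuous (deriv Real.smoothTransition) :=
  contDiff_smoothTransition.continuous_deriv le_rfl

lemma exists_deriv_smoothTransition_le : ∃ M : ℝ, 0 < M ∧ ∀ x, deriv Real.smoothTransition x ≤ M := by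
  obtain ⟨M, hM⟩ := (isCompact_Icc (a := (0 : ℝ)) (b := 1)).exists_bound_of_continuousOn
    continuous_deriv_smoothTransition.continuousOn
  refine ⟨|M| + 1, by positivity, fun x => ?_⟩
  rcases le_total x 0 with h | h
  · rw [deriv_smoothTransition_of_nonpos h]; positivity
  rcases le_total 1 x with h1 | h1
  · rw [deriv_smoothTransition_of_one_le h1]; positivity
  have := hM x ⟨h, h1⟩
  rw [Real.norm_eq_abs] at this
  linarith [le_abs_self (deriv Real.smoothTransition x), le_abs_self M]

/-! ### A limit criterion for lower integrals -/

/-- Fatou's lemma, for densities whose integrability is not known beforehand. -/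
lemma lintegral_le_of_tendsto {α : Type*} [MeasurableSpace α] {μ : Measure α}
    {g : ℕ → α → ENNReal} {G : α → ENNReal} {c : ℕ → ENNReal} {C : ENNReal}
    (hg : ∀ k, AEMeasurable (g k) μ) (hlim : ∀ᵐ x ∂μ, Tendsto (fun k => g k x) atTop (𝓝 (G x)))
    (hle : ∀ k, ∫⁻ x, g k x ∂μ ≤ c k) (hc : Tendsto c atTop (𝓝 C)) : ∫⁻ x, G x ∂μ ≤ C := by
  calc ∫⁻ x, G x ∂μ = ∫⁻ x, liminf (fun k => g k x) atTop ∂μ := by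
        apply lintegral_congr_ae
        filter_upwards [hlim] with x hx using hx.liminf_eq.symm
    _ ≤ liminf (fun k => ∫⁻ x, g k x ∂μ) atTop := lintegral_liminf_le' hg
    _ ≤ liminf c atTop := liminf_le_liminf (Eventually.of_forall hle)
    _ = C := hc.liminf_eq

/-! ### Cutoffs adapted to a boundary chart -/

/-- Inside the open set `N` the open set `O` is `{ρ < 0}` with `ρ` smooth and free of critical
points, and `φ ≥ 0` is a test function supported in `N`. -/
structure CutoffChart {n : ℕ} (O N : Set (Spacetime n)) (ρ φ : Spacetime n → ℝ) : Prop where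
  isOpen_domain : IsOpen O
  isOpen_chart : IsOpen N
  contDiffOn : ContDiffOn ℝ ∞ ρ N
  exists_pd_ne_zero : ∀ p ∈ N, ∃ i, pd i ρ p ≠ 0
  mem_iff : ∀ p ∈ N, p ∈ O ↔ ρ p < 0
  contDiff : ContDiff ℝ ∞ φ
  hasCompactSupport : HasCompactSupport φ
  tsupport_subset : tsupport φ ⊆ N
  nonneg : ∀ p, 0 ≤ φ p

namespace CutoffChart

variable {n : ℕ} {O N : Set (Spacetime n)} {ρ φ : Spacetime n → ℝ}

/-- The factor with `s` vanishes as soon as ρ > −δ, hence in a neighbourhood of every point of the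
support with ρ ≥ 0. Regularity of `g` inside the domain therefore suffices for global regularity of
the product. -/
lemma contDiff_mul_comp_mul (hC : CutoffChart O N ρ φ) {k : ℕ∞} {ψ g : Spacetime n → ℝ}
    {s : ℝ → ℝ} {δ : ℝ} (hδ : 0 < δ) (hψ : ContDiff ℝ k ψ) (hψN : tsupport ψ ⊆ N)
    (hs : ContDiff ℝ k s) (hs0 : ∀ x ≤ 0, s x = 0) (hg : ContDiffOn ℝ k g (O ∩ N)) :
    ContDiff ℝ k (fun p => ψ p * s (-ρ p / δ - 1) * g p) := by
  rw [contDiff_iff_contDiffAt]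
  intro p
  by_cases hp : p ∈ tsupport ψ
  · have hpN := hψN hp
    have hρp : ContDiffAt ℝ k ρ p :=
      ((hC.contDiffOn p hpN).contDiffAt (hC.isOpen_chart.mem_nhds hpN)).of_le
        (by exact_mod_cast le_top)
    by_cases h0 : ρ p < 0
    · have hgp : ContDiffAt ℝ k g p :=
        hg.contDiffAt ((hC.isOpen_domain.inter hC.isOpen_chart).mem_nhds
          ⟨(hC.mem_iff p hpN).2 h0, hpN⟩)
      exact (hψ.contDiffAt.mul (hs.contDiffAt.comp p
        ((hρp.neg.div_const δ).sub contDiffAt_const))).mul hgp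
    · have : ∀ᶠ q in 𝓝 p, -δ < ρ q :=
        hρp.continuousAt.eventually (lt_mem_nhds (by linarith))
      refine ContDiffAt.congr_of_eventuallyEq (contDiffAt_const (c := (0 : ℝ))) ?_
      filter_upwards [this] with q hq
      rw [hs0 _ (by rw [sub_nonpos, div_le_one hδ]; linarith)]; simp
  · refine ContDiffAt.congr_of_eventuallyEq (contDiffAt_const (c := (0 : ℝ))) ?_
    filter_upwards [notMem_tsupport_iff_eventuallyEq.1 hp] with q hq
    simp [hq]

lemma integrable_mul_comp_mul (hC : CutoffChart O N ρ φ) {ψ g : Spacetime n → ℝ}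
    {s : ℝ → ℝ} {δ : ℝ} (hδ : 0 < δ) (hψ : Continuous ψ) (hψN : tsupport ψ ⊆ tsupport φ)
    (hs : Continuous s) (hs0 : ∀ x ≤ 0, s x = 0) (hg : ContinuousOn g (O ∩ N)) :
    Integrable (fun p => ψ p * s (-ρ p / δ - 1) * g p) := by
  have h1 : ContDiff ℝ ((0 : ℕ∞) : WithTop ℕ∞) (fun p => ψ p * s (-ρ p / δ - 1) * g p) :=
    hC.contDiff_mul_comp_mul hδ (contDiff_zero.2 hψ) (hψN.trans hC.tsupport_subset)
      (contDiff_zero.2 hs) hs0 (contDiffOn_zero.2 hg)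
  refine h1.continuous.integrable_of_hasCompactSupport
    (HasCompactSupport.of_support_subset_isCompact hC.hasCompactSupport fun p hp =>
      hψN (subset_tsupport _ fun h0 => hp ?_))
  simp [h0]

lemma tsupport_pd_subset (i : Idx n) : tsupport (pd i φ) ⊆ tsupport φ := by
  refine closure_minimal (fun p hp => ?_) (isClosed_tsupport _)
  by_contra h
  apply hp
  rw [pd_congr (notMem_tsupport_iff_eventuallyEq.1 h)]
  exact pd_const 0

lemma contDiffAt (hC : CutoffChart O N ρ φ) {p : Spacetime n} (hp : p ∈ N) :
    ContDiffAt ℝ ∞ ρ p :=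
  (hC.contDiffOn p hp).contDiffAt (hC.isOpen_chart.mem_nhds hp)

lemma continuousOn_pd_defining (hC : CutoffChart O N ρ φ) (i : Idx n) :
    ContDiffOn ℝ ∞ (pd i ρ) N := fun p hp =>
  (contDiffAt_pd (k := ⊤) (m := ⊤) (by simp) (hC.contDiffAt hp)).contDiffWithinAt

/-- Integration by parts against the cutoff `φ η(-ρ/δ - 1)`. -/
lemma integral_cutoff (hC : CutoffChart O N ρ φ) {G : Idx n → Spacetime n → ℝ}
    (hG : ∀ i, ContDiffOn ℝ 1 (G i) (O ∩ N)) {δ : ℝ} (hδ : 0 < δ) :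
    (∫ p in O, φ p * Real.smoothTransition (-ρ p / δ - 1) * ∑ i, pd i (G i) p)
      = (∫ p in O, φ p * deriv Real.smoothTransition (-ρ p / δ - 1) *
          ((∑ i, G i p * pd i ρ p) / δ))
        - ∫ p in O, ∑ i, pd i φ p * Real.smoothTransition (-ρ p / δ - 1) * G i p := by
  set η := Real.smoothTransition with hη
  have hη0 : ∀ x ≤ 0, η x = 0 := fun x hx => Real.smoothTransition.zero_of_nonpos hx
  have hopen : IsOpen (O ∩ N) := hC.isOpen_domain.inter hC.isOpen_chart
  have hφ1 : ContDiff ℝ 1 φ := hC.contDiff.of_le (by simp)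
  have hcd : ∀ i, ContDiff ℝ 1 (fun p => φ p * η (-ρ p / δ - 1) * G i p) := fun i =>
    hC.contDiff_mul_comp_mul (k := 1) hδ hφ1 hC.tsupport_subset contDiff_smoothTransition hη0 (hG i)
  have hcs : ∀ i, HasCompactSupport (fun p => φ p * η (-ρ p / δ - 1) * G i p) := fun i =>
    HasCompactSupport.of_support_subset_isCompact hC.hasCompactSupport fun p hp =>
      subset_tsupport _ fun h0 => hp (by simp [h0])
  have hzero : ∀ i, ∫ p, pd i (fun p => φ p * η (-ρ p / δ - 1) * G i p) p = 0 := fun i =>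
    integral_pd_eq_zero i (hcd i) (hcs i)
  have hpdG : ∀ i, ContinuousOn (pd i (G i)) (O ∩ N) := fun i p hp =>
    (contDiffAt_pd (k := 0) (m := 1) (by norm_num)
      ((hG i).contDiffAt (hopen.mem_nhds hp))).continuousAt.continuousWithinAt
  have hpdρ : ∀ i, ContinuousOn (pd i ρ) (O ∩ N) := fun i =>
    (hC.continuousOn_pd_defining i).continuousOn.mono inter_subset_right
  have hI1 : ∀ i, Integrable (fun p => φ p * η (-ρ p / δ - 1) * pd i (G i) p) := fun i =>
    hC.integrable_mul_comp_mul hδ hφ1.continuous subset_rfl Real.smoothTransition.continuous hη0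
      (hpdG i)
  have hI2 : ∀ i, Integrable (fun p => pd i φ p * η (-ρ p / δ - 1) * G i p) := fun i =>
    hC.integrable_mul_comp_mul hδ (continuous_pd hφ1) (tsupport_pd_subset i)
      Real.smoothTransition.continuous hη0 (hG i).continuousOn
  have hI3 : ∀ i, Integrable (fun p => φ p * deriv η (-ρ p / δ - 1) * (G i p * pd i ρ p / δ)) :=
    fun i => hC.integrable_mul_comp_mul hδ hφ1.continuous subset_rfl
      continuous_deriv_smoothTransition (fun x hx => deriv_smoothTransition_of_nonpos hx)
      (((hG i).continuousOn.mul (hpdρ i)).div_const δ)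
  -- The minus sign comes from the inner derivative −1/δ. Off the support of φ every term vanishes,
  -- so nothing is asked of ρ or `G` there.
  have hin : ∀ i, ∀ p ∈ O, pd i (fun p => φ p * η (-ρ p / δ - 1) * G i p) p =
      φ p * η (-ρ p / δ - 1) * pd i (G i) p + pd i φ p * η (-ρ p / δ - 1) * G i p
        - φ p * deriv η (-ρ p / δ - 1) * (G i p * pd i ρ p / δ) := by
    intro i p hp
    by_cases hpK : p ∈ tsupport φ
    · have hpN := hC.tsupport_subset hpK
      have hd1 : DifferentiableAt ℝ φ p := hφ1.differentiable (by norm_num) p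
      have hdρ : DifferentiableAt ℝ ρ p := (hC.contDiffAt hpN).differentiableAt (by simp)
      have hdG : DifferentiableAt ℝ (G i) p :=
        ((hG i).contDiffAt (hopen.mem_nhds ⟨hp, hpN⟩)).differentiableAt (by norm_num)
      have hin1 : HasDerivAt (fun x : ℝ => η (-x / δ - 1)) (deriv η (-ρ p / δ - 1) * (-1 / δ))
          (ρ p) := by
        have h1 : HasDerivAt η (deriv η (-ρ p / δ - 1)) (-ρ p / δ - 1) :=
          (contDiff_smoothTransition.differentiable (by norm_num) _).hasDerivAt
        have h2 : HasDerivAt (fun x : ℝ => -x / δ - 1) (-1 / δ) (ρ p) :=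
          (((hasDerivAt_id (ρ p)).neg).div_const δ).sub_const 1
        exact h1.comp (ρ p) h2
      have hdη : DifferentiableAt ℝ (fun p => η (-ρ p / δ - 1)) p :=
        (hin1.differentiableAt.comp p hdρ)
      rw [pd_mul (hd1.fun_mul hdη) hdG, pd_mul hd1 hdη, pd_comp hin1 hdρ]
      ring
    · have h0 : φ =ᶠ[𝓝 p] 0 := notMem_tsupport_iff_eventuallyEq.1 hpK
      have h1 : (fun p => φ p * η (-ρ p / δ - 1) * G i p) =ᶠ[𝓝 p] fun _ => 0 := by
        filter_upwards [h0] with q hq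
        simp [hq]
      rw [pd_congr h1, pd_const, pd_congr h0, h0.eq_of_nhds]
      change (0 : ℝ) = (0 : ℝ) * _ * _ + pd i (fun _ => 0) p * _ * _ - (0 : ℝ) * _ * _
      rw [pd_const]; ring
  have hout : ∀ i, ∀ p ∉ O, pd i (fun p => φ p * η (-ρ p / δ - 1) * G i p) p = 0 := by
    intro i p hp
    have h1 : (fun p => φ p * η (-ρ p / δ - 1) * G i p) =ᶠ[𝓝 p] fun _ => 0 := by
      by_cases hpK : p ∈ tsupport φ
      · have hpN := hC.tsupport_subset hpK
        have h2 : ¬ ρ p < 0 := fun h => hp ((hC.mem_iff p hpN).2 h)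
        have : ∀ᶠ q in 𝓝 p, -δ < ρ q :=
          (hC.contDiffAt hpN).continuousAt.eventually (lt_mem_nhds (by linarith))
        filter_upwards [this] with q hq
        rw [hη0 _ (by rw [sub_nonpos, div_le_one hδ]; linarith)]; simp
      · filter_upwards [notMem_tsupport_iff_eventuallyEq.1 hpK] with q hq
        simp [hq]
    rw [pd_congr h1, pd_const]
  have hO : MeasurableSet O := hC.isOpen_domain.measurableSet
  have hmain : ∀ i, (∫ p in O, φ p * η (-ρ p / δ - 1) * pd i (G i) p)
      + (∫ p in O, pd i φ p * η (-ρ p / δ - 1) * G i p)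
      - (∫ p in O, φ p * deriv η (-ρ p / δ - 1) * (G i p * pd i ρ p / δ)) = 0 := by
    intro i
    have hI12 : Integrable (fun p => φ p * η (-ρ p / δ - 1) * pd i (G i) p
      + pd i φ p * η (-ρ p / δ - 1) * G i p) := (hI1 i).add (hI2 i)
    rw [← integral_add (hI1 i).integrableOn (hI2 i).integrableOn,
      ← integral_sub hI12.integrableOn (hI3 i).integrableOn,
      ← setIntegral_congr_fun hO (fun p hp => hin i p hp),
      setIntegral_eq_integral_of_forall_compl_eq_zero (hout i), hzero i]
  have e1 : (∫ p in O, φ p * η (-ρ p / δ - 1) * ∑ i, pd i (G i) p)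
      = ∑ i, ∫ p in O, φ p * η (-ρ p / δ - 1) * pd i (G i) p := by
    rw [← integral_finsetSum _ fun i _ => (hI1 i).integrableOn]
    simp only [Finset.mul_sum]
  have e2 : (∫ p in O, φ p * deriv η (-ρ p / δ - 1) * ((∑ i, G i p * pd i ρ p) / δ))
      = ∑ i, ∫ p in O, φ p * deriv η (-ρ p / δ - 1) * (G i p * pd i ρ p / δ) := by
    rw [← integral_finsetSum _ fun i _ => (hI3 i).integrableOn]
    simp only [Finset.mul_sum, Finset.sum_div]
  have e3 : (∫ p in O, ∑ i, pd i φ p * η (-ρ p / δ - 1) * G i p)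
      = ∑ i, ∫ p in O, pd i φ p * η (-ρ p / δ - 1) * G i p :=
    integral_finsetSum _ fun i _ => (hI2 i).integrableOn
  rw [e1, e2, e3, ← Finset.sum_sub_distrib]
  exact Finset.sum_congr rfl fun i _ => by linarith [hmain i]

end CutoffChart

/-! ### Passage to the limit in the boundary layer. -/

namespace CutoffChart

variable {n : ℕ} {O N : Set (Spacetime n)} {ρ φ : Spacetime n → ℝ}

lemma eq_zero_of_notMem (p : Spacetime n) (hp : p ∉ tsupport φ) : φ p = 0 :=
  image_eq_zero_of_notMem_tsupport hp

lemma pd_eq_zero_of_notMem (i : Idx n) (p : Spacetime n) (hp : p ∉ tsupport φ) : pd i φ p = 0 :=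
  image_eq_zero_of_notMem_tsupport fun h => hp (tsupport_pd_subset i h)

/-- The mass of the boundary layer of width `δ` is at most of order `δ`. -/
lemma exists_layer_bound (hC : CutoffChart O N ρ φ) :
    ∃ C : ℝ, 0 ≤ C ∧ ∀ δ : ℝ, 0 < δ →
      ∫ p in O, φ p * deriv Real.smoothTransition (-ρ p / δ - 1) * (1 / δ) ≤ C := by
  set K := tsupport φ with hK
  have hKc : IsCompact K := hC.hasCompactSupport
  have hφ1 : ContDiff ℝ 1 φ := hC.contDiff.of_le (by simp)
  have hpd : ∀ i, ContDiffOn ℝ ∞ (pd i ρ) N := hC.continuousOn_pd_defining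
  have hpdK : ∀ i, ContinuousOn (pd i ρ) K := fun i => (hpd i).continuousOn.mono hC.tsupport_subset
  have hpd2 : ∀ i, ContinuousOn (pd i (pd i ρ)) K := fun i p hp =>
    (contDiffAt_pd (k := 0) (m := 1) (by norm_num) (((hpd i).contDiffAt
      (hC.isOpen_chart.mem_nhds (hC.tsupport_subset hp))).of_le
        (by simp))).continuousAt.continuousWithinAt
  -- Compactness of the support turns ∇ρ ≠ 0 into a uniform lower bound for |∇ρ|². The empty support
  -- is separate because there is no minimizer.
  obtain ⟨c0, hc0, hc0le⟩ : ∃ c0 : ℝ, 0 < c0 ∧ ∀ p ∈ K, c0 ≤ ∑ i, pd i ρ p * pd i ρ p := by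
    rcases K.eq_empty_or_nonempty with h | h
    · exact ⟨1, one_pos, by simp [h]⟩
    · obtain ⟨p0, hp0, hmin⟩ := hKc.exists_isMinOn h
        (continuousOn_finsetSum Finset.univ fun i _ => (hpdK i).mul (hpdK i))
      refine ⟨_, ?_, fun p hp => hmin hp⟩
      obtain ⟨i, hi⟩ := hC.exists_pd_ne_zero p0 (hC.tsupport_subset hp0)
      exact Finset.sum_pos' (fun j _ => mul_self_nonneg _)
        ⟨i, Finset.mem_univ i, mul_self_pos.2 hi⟩
  obtain ⟨M1, hM1⟩ := hKc.exists_bound_of_continuousOn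
    (hφ1.continuous.continuousOn.mul (continuousOn_finsetSum Finset.univ fun i _ => hpd2 i))
  obtain ⟨M2, hM2⟩ := hKc.exists_bound_of_continuousOn (continuousOn_finsetSum Finset.univ
    fun i _ => ((continuous_pd (i := i) hφ1).continuousOn (s := K)).mul (hpdK i))
  set I : ℝ → ℝ := fun M => ∫ p in O, K.indicator (fun _ => |M|) p with hI
  have hint : ∀ M : ℝ, IntegrableOn (K.indicator fun _ => |M|) O := fun M =>
    ((integrable_indicator_iff hKc.measurableSet).2
      (integrableOn_const hKc.measure_lt_top.ne)).integrableOn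
  have hI0 : ∀ M, 0 ≤ I M := fun M => integral_nonneg fun p =>
    indicator_nonneg (fun _ _ => abs_nonneg M) p
  refine ⟨(I M1 + I M2) / c0, div_nonneg (add_nonneg (hI0 _) (hI0 _)) hc0.le, fun δ hδ => ?_⟩
  -- Testing with the field ∇ρ makes the layer integrand at least c0 φ η'/δ. The other two integrals
  -- are bounded independently of δ because |η| ≤ 1, so the layer mass is controlled without
  -- computing any volume.
  have key := hC.integral_cutoff (G := fun i => pd i ρ)
    (fun i => ((hpd i).mono inter_subset_right).of_le (by simp)) hδ
  set η := Real.smoothTransition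
  have hη01 : ∀ x, |η x| ≤ 1 := fun x =>
    abs_le.2 ⟨by linarith [Real.smoothTransition.nonneg x], Real.smoothTransition.le_one x⟩
  have b1 : |∫ p in O, φ p * η (-ρ p / δ - 1) * ∑ i, pd i (pd i ρ) p| ≤ I M1 := by
    rw [← Real.norm_eq_abs]
    refine norm_integral_le_of_norm_le (hint M1) (Eventually.of_forall fun p => ?_)
    by_cases hp : p ∈ K
    · rw [indicator_of_mem hp, Real.norm_eq_abs, mul_right_comm, abs_mul]
      have h1 := hM1 p hp
      rw [Real.norm_eq_abs] at h1
      exact (mul_le_of_le_one_right (abs_nonneg _) (hη01 _)).trans (h1.trans (le_abs_self _))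
    · simp [indicator_of_notMem hp, eq_zero_of_notMem p hp]
  have b2 : |∫ p in O, ∑ i, pd i φ p * η (-ρ p / δ - 1) * pd i ρ p| ≤ I M2 := by
    rw [← Real.norm_eq_abs]
    refine norm_integral_le_of_norm_le (hint M2) (Eventually.of_forall fun p => ?_)
    by_cases hp : p ∈ K
    · rw [indicator_of_mem hp, Real.norm_eq_abs]
      have e : ∑ i, pd i φ p * η (-ρ p / δ - 1) * pd i ρ p
          = (∑ i, pd i φ p * pd i ρ p) * η (-ρ p / δ - 1) := by
        rw [Finset.sum_mul]; exact Finset.sum_congr rfl fun i _ => by ring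
      rw [e, abs_mul]
      have h1 := hM2 p hp
      rw [Real.norm_eq_abs] at h1
      exact (mul_le_of_le_one_right (abs_nonneg _) (hη01 _)).trans (h1.trans (le_abs_self _))
    · simp [indicator_of_notMem hp, pd_eq_zero_of_notMem _ p hp]
  have b3 : c0 * ∫ p in O, φ p * deriv η (-ρ p / δ - 1) * (1 / δ) ≤
      ∫ p in O, φ p * deriv η (-ρ p / δ - 1) * ((∑ i, pd i ρ p * pd i ρ p) / δ) := by
    rw [← integral_const_mul]
    refine integral_mono_of_nonneg (Eventually.of_forall fun p => ?_) ?_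
      (Eventually.of_forall fun p => ?_)
    · exact mul_nonneg hc0.le (mul_nonneg (mul_nonneg (hC.nonneg p)
        (deriv_smoothTransition_nonneg _)) (by positivity))
    · refine (hC.integrable_mul_comp_mul hδ hφ1.continuous subset_rfl
        continuous_deriv_smoothTransition (fun x hx => deriv_smoothTransition_of_nonpos hx)
        (ContinuousOn.div_const (continuousOn_finsetSum Finset.univ fun i _ => ?_) δ)).integrableOn
      exact (hpd i).continuousOn.mono inter_subset_right |>.mul
        ((hpd i).continuousOn.mono inter_subset_right)
    · by_cases hp : p ∈ K
      · have h1 : 0 ≤ φ p * deriv η (-ρ p / δ - 1) :=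
          mul_nonneg (hC.nonneg p) (deriv_smoothTransition_nonneg _)
        have h2 : c0 / δ ≤ (∑ i, pd i ρ p * pd i ρ p) / δ :=
          div_le_div_of_nonneg_right (hc0le p hp) hδ.le
        calc c0 * (φ p * deriv η (-ρ p / δ - 1) * (1 / δ))
            = φ p * deriv η (-ρ p / δ - 1) * (c0 / δ) := by ring
          _ ≤ _ := mul_le_mul_of_nonneg_left h2 h1
      · simp [eq_zero_of_notMem p hp]
  rw [le_div_iff₀ hc0]
  have := (abs_le.1 b1).2
  have := (abs_le.1 b2).2
  linarith

/-- The points of the support with ρ ≤ 0 and F ≥ e form a compact set. It misses {ρ = 0}, where F ≤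
0, so ρ has a negative maximum on it, and a thinner layer avoids the set. -/
lemma exists_layer_small (hC : CutoffChart O N ρ φ) {F : Spacetime n → ℝ}
    (hF : ContinuousOn F {p ∈ N | ρ p ≤ 0}) (hFb : ∀ p ∈ N, ρ p = 0 → F p ≤ 0) {e : ℝ}
    (he : 0 < e) :
    ∃ δ0 : ℝ, 0 < δ0 ∧ ∀ p ∈ tsupport φ, -(2 * δ0) ≤ ρ p → ρ p ≤ 0 → F p ≤ e := by
  have hKc : IsCompact (tsupport φ) := hC.hasCompactSupport
  have hρK : ContinuousOn ρ (tsupport φ) := hC.contDiffOn.continuousOn.mono hC.tsupport_subset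
  have hK1 : IsClosed (tsupport φ ∩ ρ ⁻¹' Iic 0) :=
    hρK.preimage_isClosed_of_isClosed (isClosed_tsupport φ) isClosed_Iic
  have hZc : IsClosed ((tsupport φ ∩ ρ ⁻¹' Iic 0) ∩ F ⁻¹' Ici e) :=
    (hF.mono fun p hp => ⟨hC.tsupport_subset hp.1, hp.2⟩).preimage_isClosed_of_isClosed
      hK1 isClosed_Ici
  have hZ : IsCompact ((tsupport φ ∩ ρ ⁻¹' Iic 0) ∩ F ⁻¹' Ici e) :=
    hKc.of_isClosed_subset hZc (inter_subset_left.trans inter_subset_left)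
  rcases ((tsupport φ ∩ ρ ⁻¹' Iic 0) ∩ F ⁻¹' Ici e).eq_empty_or_nonempty with h | h
  · refine ⟨1, one_pos, fun p hp _ h0 => ?_⟩
    by_contra hlt
    have : p ∈ (tsupport φ ∩ ρ ⁻¹' Iic 0) ∩ F ⁻¹' Ici e := ⟨⟨hp, h0⟩, (not_le.1 hlt).le⟩
    rw [h] at this
    exact this
  · obtain ⟨p0, hp0, hmax⟩ := hZ.exists_isMaxOn h
      (hρK.mono (inter_subset_left.trans inter_subset_left))
    have hneg : ρ p0 < 0 := by
      rcases lt_or_eq_of_le (show ρ p0 ≤ 0 from hp0.1.2) with h1 | h1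
      · exact h1
      · have h2 := hFb p0 (hC.tsupport_subset hp0.1.1) h1
        have h3 : e ≤ F p0 := hp0.2
        linarith
    -- One third ensures 2δ0 < −ρ(p0). The layer must reach down to depth 2δ0 because η'(−ρ/δ − 1)
    -- lives on δ ≤ −ρ ≤ 2δ.
    refine ⟨-ρ p0 / 3, by linarith, fun p hp h1 h0 => ?_⟩
    by_contra hlt
    have : ρ p ≤ ρ p0 := hmax ⟨⟨hp, h0⟩, (not_le.1 hlt).le⟩
    linarith

/-- The sequence is eventually constant: the value is 1 once (k + 1)(−x) ≥ 2. -/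
lemma tendsto_cutoff {x : ℝ} (hx : x < 0) :
    Tendsto (fun k : ℕ => Real.smoothTransition (-x / (1 / ((k : ℝ) + 1)) - 1)) atTop (𝓝 1) := by
  refine tendsto_const_nhds.congr' ?_
  obtain ⟨k0, hk0⟩ := exists_nat_ge (2 / -x)
  filter_upwards [eventually_ge_atTop k0] with k hk
  have h1 : (k0 : ℝ) ≤ k := by exact_mod_cast hk
  rw [Real.smoothTransition.one_of_one_le]
  rw [div_div_eq_mul_div, div_one]
  have h2 : 2 ≤ (k : ℝ) * -x := (div_le_iff₀ (by linarith)).1 (hk0.trans h1)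
  nlinarith

/-- The divergence inequality against a test function supported in a boundary chart, for a field
which does not point outwards along the boundary. -/
theorem lintegral_le (hC : CutoffChart O N ρ φ) {J : Idx n → Spacetime n → ℝ}
    {B H : Spacetime n → ℝ} (hJ : ∀ i, ContDiffOn ℝ 1 (J i) O)
    (hJc : ∀ i, ContinuousOn (J i) {p ∈ N | ρ p ≤ 0})
    (hJb : ∀ p ∈ N, ρ p = 0 → ∑ i, J i p * pd i ρ p ≤ 0)
    (hB : ContinuousOn B O) (hH : ContinuousOn H O) (hB0 : ∀ p ∈ O, 0 ≤ B p)
    (hHi : IntegrableOn H O) (hle : ∀ p ∈ O, B p ≤ H p + ∑ i, pd i (J i) p) :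
    0 ≤ (∫ p in O, φ p * H p) - (∫ p in O, ∑ i, pd i φ p * J i p) ∧
    ∫⁻ p in O, ENNReal.ofReal (φ p * B p) ≤
      ENNReal.ofReal ((∫ p in O, φ p * H p) - ∫ p in O, ∑ i, pd i φ p * J i p) := by
  set K := tsupport φ with hK
  have hKc : IsCompact K := hC.hasCompactSupport
  have hO : MeasurableSet O := hC.isOpen_domain.measurableSet
  have hφ1 : ContDiff ℝ 1 φ := hC.contDiff.of_le (by simp)
  set η := Real.smoothTransition with hη
  have hη0 : ∀ x ≤ 0, η x = 0 := fun x hx => Real.smoothTransition.zero_of_nonpos hx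
  have hη01 : ∀ x, |η x| ≤ 1 := fun x =>
    abs_le.2 ⟨by linarith [Real.smoothTransition.nonneg x], Real.smoothTransition.le_one x⟩
  have hpdρ : ∀ i, ContinuousOn (pd i ρ) {p ∈ N | ρ p ≤ 0} := fun i =>
    (hC.continuousOn_pd_defining i).continuousOn.mono fun p hp => hp.1
  have hF : ContinuousOn (fun p => ∑ i, J i p * pd i ρ p) {p ∈ N | ρ p ≤ 0} :=
    continuousOn_finsetSum Finset.univ fun i _ => (hJc i).mul (hpdρ i)
  obtain ⟨C0, hC0, hlayer⟩ := hC.exists_layer_bound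
  -- bounds for the two limits by dominated convergence
  obtain ⟨Mφ, hMφ⟩ := hKc.exists_bound_of_continuousOn hφ1.continuous.continuousOn
  have hφM : ∀ p, ‖φ p‖ ≤ |Mφ| := fun p => by
    by_cases hp : p ∈ K
    · exact (hMφ p hp).trans (le_abs_self _)
    · rw [eq_zero_of_notMem p hp]; simp
  have hφH : IntegrableOn (fun p => φ p * H p) O :=
    hHi.bdd_mul hφ1.continuous.aestronglyMeasurable (Eventually.of_forall hφM)
  have hK1 : IsCompact (K ∩ ρ ⁻¹' Iic 0) :=
    hKc.of_isClosed_subset ((hC.contDiffOn.continuousOn.mono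
      hC.tsupport_subset).preimage_isClosed_of_isClosed (isClosed_tsupport φ) isClosed_Iic)
      inter_subset_left
  obtain ⟨MJ, hMJ⟩ := hK1.exists_bound_of_continuousOn (f := fun p => ∑ i, pd i φ p * J i p)
    (continuousOn_finsetSum Finset.univ fun i _ => (continuous_pd hφ1).continuousOn.mul
      ((hJc i).mono fun p hp => ⟨hC.tsupport_subset hp.1, hp.2⟩))
  have hdomJ : IntegrableOn (K.indicator fun _ => |MJ|) O :=
    ((integrable_indicator_iff hKc.measurableSet).2
      (integrableOn_const hKc.measure_lt_top.ne)).integrableOn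
  have hmJ : ∀ i, AEStronglyMeasurable (J i) (volume.restrict O) := fun i =>
    (hJ i).continuousOn.aestronglyMeasurable hO
  have hboundJ : ∀ p ∈ O, ‖∑ i, pd i φ p * J i p‖ ≤ K.indicator (fun _ => |MJ|) p := by
    intro p hp
    by_cases hpK : p ∈ K
    · rw [indicator_of_mem hpK]
      exact (hMJ p ⟨hpK, ((hC.mem_iff p (hC.tsupport_subset hpK)).1 hp).le⟩).trans (le_abs_self _)
    · simp [indicator_of_notMem hpK, pd_eq_zero_of_notMem _ p hpK]
  set d : ℕ → ℝ := fun k => 1 / ((k : ℝ) + 1) with hd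
  have hdpos : ∀ k, 0 < d k := fun k => by positivity
  have hdlim : Tendsto d atTop (𝓝 0) := tendsto_one_div_add_atTop_nhds_zero_nat
  have hctsρ : ContinuousOn ρ (O ∩ K) :=
    hC.contDiffOn.continuousOn.mono (inter_subset_right.trans hC.tsupport_subset)
  have hlim1 : Tendsto (fun k => ∫ p in O, φ p * η (-ρ p / d k - 1) * H p) atTop
      (𝓝 (∫ p in O, φ p * H p)) := by
    refine tendsto_integral_of_dominated_convergence (fun p => ‖φ p * H p‖) (fun k => ?_)
      hφH.norm (fun k => Eventually.of_forall fun p => ?_) ?_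
    · exact (hC.integrable_mul_comp_mul (hdpos k) hφ1.continuous subset_rfl
        Real.smoothTransition.continuous hη0
        (hH.mono inter_subset_left)).aestronglyMeasurable.restrict
    · rw [mul_right_comm, norm_mul]
      exact mul_le_of_le_one_right (norm_nonneg _) (hη01 _)
    · filter_upwards [ae_restrict_mem hO] with p hp
      by_cases hpK : p ∈ K
      · have h := tendsto_cutoff ((hC.mem_iff p (hC.tsupport_subset hpK)).1 hp)
        have h' := (h.const_mul (φ p)).mul_const (H p)
        rwa [mul_one] at h'
      · simp [eq_zero_of_notMem p hpK]
  have hlim2 : Tendsto (fun k => ∫ p in O, ∑ i, pd i φ p * η (-ρ p / d k - 1) * J i p) atTop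
      (𝓝 (∫ p in O, ∑ i, pd i φ p * J i p)) := by
    refine tendsto_integral_of_dominated_convergence (K.indicator fun _ => |MJ|) (fun k => ?_)
      hdomJ (fun k => ?_) ?_
    · refine Finset.aestronglyMeasurable_fun_sum _ fun i _ => ?_
      exact (hC.integrable_mul_comp_mul (hdpos k) (continuous_pd hφ1) (tsupport_pd_subset i)
        Real.smoothTransition.continuous hη0
        ((hJ i).continuousOn.mono inter_subset_left)).aestronglyMeasurable.restrict
    · filter_upwards [ae_restrict_mem hO] with p hp
      have e : ∑ i, pd i φ p * η (-ρ p / d k - 1) * J i p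
          = (∑ i, pd i φ p * J i p) * η (-ρ p / d k - 1) := by
        rw [Finset.sum_mul]; exact Finset.sum_congr rfl fun i _ => by ring
      rw [e, norm_mul]
      exact (mul_le_of_le_one_right (norm_nonneg _) (hη01 _)).trans (hboundJ p hp)
    · filter_upwards [ae_restrict_mem hO] with p hp
      by_cases hpK : p ∈ K
      · have h := tendsto_cutoff ((hC.mem_iff p (hC.tsupport_subset hpK)).1 hp)
        refine tendsto_finsetSum _ fun i _ => ?_
        have h' := (h.const_mul (pd i φ p)).mul_const (J i p)
        rwa [mul_one] at h'
      · simp [pd_eq_zero_of_notMem _ p hpK]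
  set X := (∫ p in O, φ p * H p) - ∫ p in O, ∑ i, pd i φ p * J i p with hX
  have hBint : ∀ k, Integrable (fun p => φ p * η (-ρ p / d k - 1) * B p) := fun k =>
    hC.integrable_mul_comp_mul (hdpos k) hφ1.continuous subset_rfl
      Real.smoothTransition.continuous hη0 (hB.mono inter_subset_left)
  have hφη : ∀ k p, 0 ≤ φ p * η (-ρ p / d k - 1) := fun k p =>
    mul_nonneg (hC.nonneg p) (Real.smoothTransition.nonneg _)
  -- the inequality at positive width
  have hk : ∀ e : ℝ, 0 < e → ∀ᶠ k in atTop, ∫ p in O, φ p * η (-ρ p / d k - 1) * B p ≤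
      (∫ p in O, φ p * η (-ρ p / d k - 1) * H p)
        - (∫ p in O, ∑ i, pd i φ p * η (-ρ p / d k - 1) * J i p) + e * C0 := by
    intro e he
    -- In a thin layer J · ∇ρ ≤ e by continuity, so the layer integral is at most e times the layer
    -- mass, hence at most e C0. No bound on div J or `B` up to the boundary is needed.
    obtain ⟨δ0, hδ0, hsm⟩ := hC.exists_layer_small hF hJb he
    filter_upwards [hdlim.eventually (gt_mem_nhds hδ0)] with k hkδ
    have hdiv : ∀ i, ContinuousOn (pd i (J i)) O := fun i p hp =>
      (contDiffAt_pd (k := 0) (m := 1) (by norm_num)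
        ((hJ i).contDiffAt (hC.isOpen_domain.mem_nhds hp))).continuousAt.continuousWithinAt
    have h1 : ∫ p in O, φ p * η (-ρ p / d k - 1) * B p ≤
        (∫ p in O, φ p * η (-ρ p / d k - 1) * H p)
          + ∫ p in O, φ p * η (-ρ p / d k - 1) * ∑ i, pd i (J i) p := by
      have hi1 : Integrable (fun p => φ p * η (-ρ p / d k - 1) * H p) :=
        hC.integrable_mul_comp_mul (hdpos k) hφ1.continuous subset_rfl
          Real.smoothTransition.continuous hη0 (hH.mono inter_subset_left)
      have hi2 : Integrable (fun p => φ p * η (-ρ p / d k - 1) * ∑ i, pd i (J i) p) :=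
        hC.integrable_mul_comp_mul (hdpos k) hφ1.continuous subset_rfl
          Real.smoothTransition.continuous hη0
          ((continuousOn_finsetSum Finset.univ fun i _ => hdiv i).mono inter_subset_left)
      rw [← integral_add hi1.integrableOn hi2.integrableOn]
      refine setIntegral_mono_on (hBint k).integrableOn (hi1.add hi2).integrableOn hO
        fun p hp => ?_
      rw [← mul_add]
      exact mul_le_mul_of_nonneg_left (hle p hp) (hφη k p)
    have h2 := hC.integral_cutoff (fun i => (hJ i).mono inter_subset_left) (hdpos k)
    have h3 : ∫ p in O, φ p * deriv η (-ρ p / d k - 1) * ((∑ i, J i p * pd i ρ p) / d k)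
        ≤ e * C0 := by
      refine le_trans ?_ (mul_le_mul_of_nonneg_left (hlayer (d k) (hdpos k)) he.le)
      rw [← integral_const_mul]
      refine setIntegral_mono_on ?_ ?_ hO fun p hp => ?_
      · exact (hC.integrable_mul_comp_mul (hdpos k) hφ1.continuous subset_rfl
          continuous_deriv_smoothTransition (fun x hx => deriv_smoothTransition_of_nonpos hx)
          ((hF.mono fun p hp => ⟨hp.2, ((hC.mem_iff p hp.2).1 hp.1).le⟩).div_const
            (d k))).integrableOn
      · exact ((hC.integrable_mul_comp_mul (hdpos k) hφ1.continuous subset_rfl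
          continuous_deriv_smoothTransition (fun x hx => deriv_smoothTransition_of_nonpos hx)
          (continuousOn_const (c := 1 / d k))).const_mul e).integrableOn
      · by_cases hpK : p ∈ K
        · have hρp := (hC.mem_iff p (hC.tsupport_subset hpK)).1 hp
          have hφη' : 0 ≤ φ p * deriv η (-ρ p / d k - 1) :=
            mul_nonneg (hC.nonneg p) (deriv_smoothTransition_nonneg _)
          by_cases hfar : -(2 * δ0) ≤ ρ p
          · have h4 := hsm p hpK hfar hρp.le
            have h5 : (∑ i, J i p * pd i ρ p) / d k ≤ e / d k :=
              div_le_div_of_nonneg_right h4 (hdpos k).le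
            calc _ ≤ φ p * deriv η (-ρ p / d k - 1) * (e / d k) :=
                  mul_le_mul_of_nonneg_left h5 hφη'
              _ = _ := by ring
          -- At depth beyond 2δ0 > 2 d_k the cutoff is already constant.
          · have h6 : 1 ≤ -ρ p / d k - 1 := by
              have : 2 ≤ -ρ p / d k := by
                rw [le_div_iff₀ (hdpos k)]; push Not at hfar; linarith
              linarith
            have h7 : deriv η (-ρ p / d k - 1) = 0 := deriv_smoothTransition_of_one_le h6
            rw [h7]; simp
        · simp [eq_zero_of_notMem p hpK]
    rw [h2] at h1
    linarith
  have hXlim : ∀ e : ℝ, Tendsto (fun k => (∫ p in O, φ p * η (-ρ p / d k - 1) * H p)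
        - (∫ p in O, ∑ i, pd i φ p * η (-ρ p / d k - 1) * J i p) + e * C0) atTop
        (𝓝 (X + e * C0)) := fun e => (hlim1.sub hlim2).add_const _
  -- First k → ∞ at fixed e, with Fatou on the left because φB is not known to be integrable;
  -- afterwards e → 0. The nonnegativity of X is kept because `ENNReal.ofReal` truncates and the
  -- contributions of several charts are summed later.
  have hgoal : ∀ e : ℝ, 0 < e → 0 ≤ X + e * C0 ∧
      ∫⁻ p in O, ENNReal.ofReal (φ p * B p) ≤ ENNReal.ofReal (X + e * C0) := by
    intro e he
    obtain ⟨k0, hk0⟩ := eventually_atTop.1 (hk e he)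
    refine ⟨ge_of_tendsto (hXlim e) ?_, ?_⟩
    · filter_upwards [eventually_ge_atTop k0] with k hkk
      refine le_trans (setIntegral_nonneg hO fun p hp => ?_) (hk0 k hkk)
      exact mul_nonneg (hφη k p) (hB0 p hp)
    · refine lintegral_le_of_tendsto
        (g := fun k p => ENNReal.ofReal (φ p * η (-ρ p / d (k + k0) - 1) * B p))
        (c := fun k => ENNReal.ofReal ((∫ p in O, φ p * η (-ρ p / d (k + k0) - 1) * H p)
        - (∫ p in O, ∑ i, pd i φ p * η (-ρ p / d (k + k0) - 1) * J i p) + e * C0))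
        (fun k => (hBint _).aestronglyMeasurable.aemeasurable.ennreal_ofReal.restrict) ?_
        (fun k => ?_) ?_
      · filter_upwards [ae_restrict_mem hO] with p hp
        refine (ENNReal.continuous_ofReal.tendsto _).comp ?_
        by_cases hpK : p ∈ K
        · have h := (tendsto_cutoff ((hC.mem_iff p (hC.tsupport_subset hpK)).1 hp)).comp
            (tendsto_add_atTop_nat k0)
          have h' := (h.const_mul (φ p)).mul_const (B p)
          rwa [mul_one] at h'
        · simp [eq_zero_of_notMem p hpK]
      · rw [← ofReal_integral_eq_lintegral_ofReal (hBint _).integrableOn]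
        · exact ENNReal.ofReal_le_ofReal (hk0 _ (by omega))
        · filter_upwards [ae_restrict_mem hO] with p hp
          exact mul_nonneg (hφη _ p) (hB0 p hp)
      · exact (ENNReal.continuous_ofReal.tendsto _).comp
          ((hXlim e).comp (tendsto_add_atTop_nat k0))
  have hlimE : Tendsto (fun k => X + d k * C0) atTop (𝓝 X) := by
    simpa using (hdlim.mul_const C0).const_add X
  exact ⟨ge_of_tendsto' hlimE fun k => (hgoal _ (hdpos k)).1,
    ge_of_tendsto' ((ENNReal.continuous_ofReal.tendsto _).comp hlimE)
      fun k => (hgoal _ (hdpos k)).2⟩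

end CutoffChart

/-! ### Coordinates centred at `Q` -/

/-- The Cartesian coordinates of `p - Q`. -/
def coord {n : ℕ} (Q : Spacetime n) : Idx n → Spacetime n → ℝ :=
  Sum.elim (fun k p => tShift Q p k) (fun j p => xShift Q p j)

lemma hasFDerivAt_coord {n : ℕ} (Q : Spacetime n) (j : Idx n) (p : Spacetime n) :
    ∃ L : Spacetime n →L[ℝ] ℝ, HasFDerivAt (coord Q j) L p ∧
      ∀ i, L (stdVec i) = if i = j then 1 else 0 := by
  rcases j with k | j
  · refine ⟨(EuclideanSpace.proj k).comp (ContinuousLinearMap.fst ℝ _ _), ?_, ?_⟩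
    · have h := ((EuclideanSpace.proj (𝕜 := ℝ) k).comp (ContinuousLinearMap.fst ℝ
        (EuclideanSpace ℝ (Fin 2)) (EuclideanSpace ℝ (Fin n)))).hasFDerivAt (x := p)
      refine (h.sub_const (Q.1 k)).congr_of_eventuallyEq (Eventually.of_forall fun q => ?_)
      simp [coord, tShift]
    · rintro (i | i) <;> simp [stdVec, eq_comm]
  · refine ⟨(EuclideanSpace.proj j).comp (ContinuousLinearMap.snd ℝ _ _), ?_, ?_⟩
    · have h := ((EuclideanSpace.proj (𝕜 := ℝ) j).comp (ContinuousLinearMap.snd ℝ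
        (EuclideanSpace ℝ (Fin 2)) (EuclideanSpace ℝ (Fin n)))).hasFDerivAt (x := p)
      refine (h.sub_const (Q.2 j)).congr_of_eventuallyEq (Eventually.of_forall fun q => ?_)
      simp [coord, xShift]
    · rintro (i | i) <;> simp [stdVec, eq_comm]

lemma pd_coord {n : ℕ} (Q : Spacetime n) (i j : Idx n) (p : Spacetime n) :
    pd i (coord Q j) p = if i = j then 1 else 0 := by
  obtain ⟨L, hL, h⟩ := hasFDerivAt_coord Q j p
  rw [HasFDerivAt.pd_eq hL, h]

@[fun_prop]
lemma contDiff_coord {n : ℕ} (Q : Spacetime n) (j : Idx n) {k : WithTop ℕ∞} :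
    ContDiff ℝ k (coord Q j) := by
  rcases j with j | j
  · have h : coord Q (Sum.inl j) = fun p : Spacetime n => p.1 j - Q.1 j := by
      ext p; simp [coord, tShift]
    rw [h]; fun_prop
  · have h : coord Q (Sum.inr j) = fun p : Spacetime n => p.2 j - Q.2 j := by
      ext p; simp [coord, xShift]
    rw [h]; fun_prop

lemma rQ_sq {n : ℕ} (Q p : Spacetime n) : rQ Q p ^ 2 = ∑ j, coord Q (Sum.inr j) p ^ 2 := by
  simp [rQ, EuclideanSpace.norm_sq_eq, coord]

lemma tauQ_sq {n : ℕ} (Q p : Spacetime n) : tauQ Q p ^ 2 = ∑ k, coord Q (Sum.inl k) p ^ 2 := by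
  simp [tauQ, EuclideanSpace.norm_sq_eq, coord]

lemma rQ_nonneg {n : ℕ} (Q p : Spacetime n) : 0 ≤ rQ Q p := norm_nonneg _

lemma tauQ_nonneg {n : ℕ} (Q p : Spacetime n) : 0 ≤ tauQ Q p := norm_nonneg _

lemma fQ_eq {n : ℕ} (Q p : Spacetime n) : fQ Q p = (rQ Q p ^ 2 - tauQ Q p ^ 2) / 4 := by
  simp only [fQ, uQ, vQ]; ring

lemma fQ_eq_sum {n : ℕ} (Q p : Spacetime n) :
    fQ Q p = ∑ i, sgn i * (coord Q i p ^ 2 / 4) := by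
  rw [fQ_eq, rQ_sq, tauQ_sq, Fintype.sum_sum_type]
  simp only [sgn_inl, sgn_inr, ← Finset.mul_sum, ← Finset.sum_div]
  ring

lemma contDiff_fQ {n : ℕ} (Q : Spacetime n) {k : WithTop ℕ∞} : ContDiff ℝ k (fQ Q) := by
  have h : fQ Q = fun p => ∑ i, sgn i * (coord Q i p ^ 2 / 4) := funext fun p => fQ_eq_sum Q p
  rw [h]; fun_prop

lemma pd_fQ {n : ℕ} (Q : Spacetime n) (i : Idx n) (p : Spacetime n) :
    pd i (fQ Q) p = sgn i * coord Q i p / 2 := by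
  have h : fQ Q = fun p => ∑ j, sgn j / 4 * coord Q j p ^ 2 := by
    funext p; rw [fQ_eq_sum]; exact Finset.sum_congr rfl fun j _ => by ring
  have hd : ∀ j, DifferentiableAt ℝ (coord Q j) p := fun j =>
    (contDiff_coord Q j (k := 1)).differentiable (by norm_num) p
  rw [h, pd_sum fun j _ => ((hd j).fun_pow 2).const_mul _]
  have : ∀ j, pd i (fun x => sgn j / 4 * coord Q j x ^ 2) p
      = if i = j then sgn j * coord Q j p / 2 else 0 := fun j => by
    rw [pd_const_mul _ ((hd j).fun_pow 2), pd_sq (hd j), pd_coord]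
    split_ifs <;> ring
  simp [this]

lemma isOpen_exteriorCone {n : ℕ} (Q : Spacetime n) : IsOpen (exteriorCone Q) :=
  isOpen_lt continuous_const (contDiff_fQ Q (k := 0)).continuous

lemma tauQ_lt_rQ {n : ℕ} {Q p : Spacetime n} (hp : p ∈ exteriorCone Q) : tauQ Q p < rQ Q p := by
  have h : 0 < fQ Q p := hp
  rw [fQ_eq] at h
  exact lt_of_pow_lt_pow_left₀ 2 (rQ_nonneg Q p) (by linarith)

lemma rQ_pos {n : ℕ} {Q p : Spacetime n} (hp : p ∈ exteriorCone Q) : 0 < rQ Q p :=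
  (tauQ_nonneg Q p).trans_lt (tauQ_lt_rQ hp)

lemma abs_coord_le {n : ℕ} {Q p : Spacetime n} (hp : p ∈ exteriorCone Q) (i : Idx n) :
    |coord Q i p| ≤ rQ Q p := by
  rcases i with k | j
  · have h1 : |coord Q (Sum.inl k) p| ≤ tauQ Q p := by
      simpa [coord, tauQ] using PiLp.norm_apply_le (tShift Q p) k
    exact h1.trans (tauQ_lt_rQ hp).le
  · simpa [coord, rQ] using PiLp.norm_apply_le (xShift Q p) j

/-! ### The cylinder over the domain -/

section Domain

variable {n : ℕ} {Ω : Set (EuclideanSpace ℝ (Fin n))} {Q : Spacetime n} {R : ℝ}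

lemma closure_cylinder (Ω : Set (EuclideanSpace ℝ (Fin n))) :
    closure (cylinder Ω) = univ ×ˢ closure Ω := by
  rw [cylinder, closure_prod_eq, closure_univ]

lemma frontier_cylinder (Ω : Set (EuclideanSpace ℝ (Fin n))) :
    frontier (cylinder Ω) = univ ×ˢ frontier Ω := by
  rw [cylinder, frontier_univ_prod_eq]

lemma isOpen_cylinder (hΩ : IsOpen Ω) : IsOpen (cylinder Ω) := isOpen_univ.prod hΩ

lemma rQ_le_of_mem_closure (hR : ∀ x ∈ Ω, ‖x - Q.2‖ < R) {p : Spacetime n}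
    (hp : p ∈ closure (cylinder Ω)) : rQ Q p ≤ R := by
  rw [closure_cylinder] at hp
  have h : closure Ω ⊆ {x | ‖x - Q.2‖ ≤ R} :=
    closure_minimal (fun x hx => (hR x hx).le) (isClosed_le (by fun_prop) continuous_const)
  exact h hp.2

lemma rQ_lt_of_mem (hR : ∀ x ∈ Ω, ‖x - Q.2‖ < R) {p : Spacetime n}
    (hp : p ∈ cylinder Ω) : rQ Q p < R := hR p.2 hp.2

/-- The cylinder is unbounded in time, but τ < r inside the cone. The part that matters is therefore
bounded in the maximum norm of the product. -/
lemma mem_closedBall_of_mem_exteriorCone {p : Spacetime n} (hp : p ∈ exteriorCone Q)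
    (hr : rQ Q p ≤ R) : p ∈ Metric.closedBall Q R := by
  rw [Metric.mem_closedBall, dist_eq_norm, Prod.norm_def]
  exact max_le ((tauQ_lt_rQ hp).le.trans hr) hr

lemma isCompact_closure_inter (hR : ∀ x ∈ Ω, ‖x - Q.2‖ < R) {δ : ℝ} (hδ : 0 < δ) :
    IsCompact (closure (cylinder Ω) ∩ {p | δ ≤ fQ Q p}) := by
  refine (isCompact_closedBall Q R).of_isClosed_subset (isClosed_closure.inter
    (isClosed_le continuous_const (contDiff_fQ Q (k := 0)).continuous)) fun p hp => ?_
  exact mem_closedBall_of_mem_exteriorCone (hδ.trans_le hp.2) (rQ_le_of_mem_closure hR hp.1)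

lemma volume_domain_lt_top (hR : ∀ x ∈ Ω, ‖x - Q.2‖ < R) :
    volume (cylinder Ω ∩ exteriorCone Q) < ⊤ :=
  (measure_mono fun _ hp => mem_closedBall_of_mem_exteriorCone hp.2
    (rQ_lt_of_mem hR hp.1).le).trans_lt (isCompact_closedBall Q R).measure_lt_top

lemma IsDefiningFunctionOn.contDiffAt {V : Set (EuclideanSpace ℝ (Fin n))}
    {ρ : EuclideanSpace ℝ (Fin n) → ℝ} (h : IsDefiningFunctionOn Ω V ρ)
    {y : EuclideanSpace ℝ (Fin n)} (hy : y ∈ V) : ContDiffAt ℝ ∞ ρ y :=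
  h.2.1.contDiffAt (h.1.mem_nhds hy)

lemma IsDefiningFunctionOn.mem_iff {V : Set (EuclideanSpace ℝ (Fin n))}
    {ρ : EuclideanSpace ℝ (Fin n) → ℝ} (h : IsDefiningFunctionOn Ω V ρ)
    {y : EuclideanSpace ℝ (Fin n)} (hy : y ∈ V) : y ∈ Ω ↔ ρ y < 0 := by
  have h1 : y ∈ Ω ∩ V ↔ y ∈ {y ∈ V | ρ y < 0} := by rw [h.2.2.2]
  simpa [hy] using h1

/-- A zero of ρ outside the closure of `Ω` would be a local minimum of ρ, against the absence of
critical points. -/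
lemma IsDefiningFunctionOn.mem_frontier {V : Set (EuclideanSpace ℝ (Fin n))}
    {ρ : EuclideanSpace ℝ (Fin n) → ℝ} (hΩ : IsOpen Ω) (h : IsDefiningFunctionOn Ω V ρ)
    {y : EuclideanSpace ℝ (Fin n)} (hy : y ∈ V) (h0 : ρ y = 0) : y ∈ frontier Ω := by
  rw [hΩ.frontier_eq]
  refine ⟨?_, fun hyΩ => by linarith [(h.mem_iff hy).1 hyΩ]⟩
  by_contra hcl
  have hmin : IsLocalMin ρ y := by
    filter_upwards [h.1.mem_nhds hy, isClosed_closure.isOpen_compl.mem_nhds hcl] with w hw hwc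
    rw [h0]
    by_contra hlt
    exact hwc (subset_closure ((h.mem_iff hw).2 (not_le.1 hlt)))
  apply h.2.2.1 y hy
  rw [gradient, hmin.fderiv_eq_zero, map_zero]

lemma pd_comp_snd {ρ : EuclideanSpace ℝ (Fin n) → ℝ} {p : Spacetime n}
    (hρ : DifferentiableAt ℝ ρ p.2) (i : Idx n) :
    pd i (fun q => ρ q.2) p = Sum.elim (fun _ => 0) (fun j => gradient ρ p.2 j) i := by
  have h1 : HasFDerivAt (fun q : Spacetime n => ρ q.2) _ p :=
    HasFDerivAt.comp p hρ.hasFDerivAt hasFDerivAt_snd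
  rw [HasFDerivAt.pd_eq h1]
  rcases i with k | j
  · simp [stdVec]
  · have h2 : gradient ρ p.2 j
        = inner ℝ (gradient ρ p.2) (EuclideanSpace.single j (1 : ℝ)) := by
      rw [EuclideanSpace.inner_single_right]; simp
    simp only [Sum.elim_inr, h2]
    rw [gradient, InnerProductSpace.toDual_symm_apply]
    simp [stdVec]

/-- Every point of the closed domain inside the cone has a chart of the kind used in
`CutoffChart`. -/
lemma exists_chart (hΩ : IsOpen Ω) (hs : HasSmoothBoundary Ω) {p : Spacetime n}
    (hp : p ∈ closure (cylinder Ω) ∩ exteriorCone Q) :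
    ∃ (N : Set (Spacetime n)) (ρ : Spacetime n → ℝ), p ∈ N ∧ IsOpen N ∧ N ⊆ exteriorCone Q ∧
      ContDiffOn ℝ ∞ ρ N ∧ (∀ q ∈ N, ∃ i, pd i ρ q ≠ 0) ∧
      (∀ q ∈ N, q ∈ cylinder Ω ∩ exteriorCone Q ↔ ρ q < 0) ∧
      (∀ q ∈ N, ρ q ≤ 0 → q ∈ closure (cylinder Ω)) ∧
      (∀ J : Idx n → Spacetime n → ℝ,
        (∀ q ∈ frontier (cylinder Ω) ∩ exteriorCone Q, ∀ V ρ', q.2 ∈ V →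
          IsDefiningFunctionOn Ω V ρ' → ∑ j, J (Sum.inr j) q * gradient ρ' q.2 j ≤ 0) →
        ∀ q ∈ N, ρ q = 0 → ∑ i, J i q * pd i ρ q ≤ 0) := by
  by_cases hpU : p ∈ cylinder Ω
  · refine ⟨(cylinder Ω ∩ exteriorCone Q) ∩ {q | coord p (Sum.inl 0) q < 1},
      fun q => coord p (Sum.inl 0) q - 1, ⟨⟨hpU, hp.2⟩, by simp [coord, tShift]⟩,
      ((isOpen_cylinder hΩ).inter (isOpen_exteriorCone Q)).inter
        (isOpen_lt (contDiff_coord p _ (k := 0)).continuous continuous_const),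
      fun q hq => hq.1.2, ((contDiff_coord p _).sub contDiff_const).contDiffOn,
      fun q _ => ⟨Sum.inl 0, ?_⟩, fun q hq => ⟨fun _ => by have := hq.2; simp at this ⊢; linarith,
        fun _ => hq.1⟩, fun q hq _ => subset_closure hq.1.1, fun J _ q hq h0 => ?_⟩
    · rw [pd_sub ((contDiff_coord p _ (k := 1)).differentiable (by norm_num) q)
        (differentiableAt_const _), pd_coord, pd_const]
      simp
    · have := hq.2; simp at this; linarith
  · have hfr : p.2 ∈ frontier Ω := by
      rw [hΩ.frontier_eq]
      have h1 := hp.1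
      rw [closure_cylinder] at h1
      exact ⟨h1.2, fun h => hpU ⟨trivial, h⟩⟩
    obtain ⟨V, ρ, hV, hdef⟩ := hs p.2 hfr
    have hpd : ∀ q : Spacetime n, q.2 ∈ V → ∀ i, pd i (fun q : Spacetime n => ρ q.2) q
        = Sum.elim (fun _ => 0) (fun j => gradient ρ q.2 j) i := fun q hq =>
      pd_comp_snd ((hdef.contDiffAt hq).differentiableAt (by simp))
    have hfr' : ∀ q : Spacetime n, q.2 ∈ V → ρ q.2 = 0 → q ∈ frontier (cylinder Ω) := by
      intro q hq h0
      rw [frontier_cylinder]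
      exact ⟨trivial, hdef.mem_frontier hΩ hq h0⟩
    refine ⟨exteriorCone Q ∩ Prod.snd ⁻¹' V, fun q => ρ q.2, ⟨hp.2, hV⟩,
      (isOpen_exteriorCone Q).inter (hdef.1.preimage continuous_snd), inter_subset_left,
      fun q hq => ?_, fun q hq => ?_, fun q hq => ?_, fun q hq h0 => ?_, fun J hJ q hq h0 => ?_⟩
    · exact ((hdef.contDiffAt hq.2).comp q contDiffAt_snd).contDiffWithinAt
    · by_contra hall
      push Not at hall
      apply hdef.2.2.1 q.2 hq.2
      ext j
      have := hall (Sum.inr j)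
      rw [hpd q hq.2] at this
      simpa using this
    · rw [← hdef.mem_iff hq.2]
      exact ⟨fun h => h.1.2, fun h => ⟨⟨trivial, h⟩, hq.1⟩⟩
    · rcases lt_or_eq_of_le h0 with h1 | h1
      · exact subset_closure ⟨trivial, (hdef.mem_iff hq.2).2 h1⟩
      · exact frontier_subset_closure (hfr' q hq.2 h1)
    · have h1 := hJ q ⟨hfr' q hq.2 h0, hq.1⟩ V ρ hq.2 hdef
      rw [Fintype.sum_sum_type]
      simpa [hpd q hq.2] using h1

end Domain

/-! ### The divergence inequality between the lateral boundary and the null cone. -/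

section Domain

variable {n : ℕ} {Ω : Set (EuclideanSpace ℝ (Fin n))} {Q : Spacetime n} {R : ℝ}

/-- The cutoff near the null cone. -/
def coneCutoff (Q : Spacetime n) (δ : ℝ) (p : Spacetime n) : ℝ :=
  Real.smoothTransition (fQ Q p / δ - 1)

lemma contDiff_coneCutoff (Q : Spacetime n) (δ : ℝ) : ContDiff ℝ ∞ (coneCutoff Q δ) :=
  (Real.smoothTransition.contDiff (n := ⊤)).comp
    (((contDiff_fQ Q).div_const δ).sub contDiff_const)

lemma coneCutoff_eq_zero {δ : ℝ} (hδ : 0 < δ) {p : Spacetime n} (hp : fQ Q p ≤ δ) :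
    coneCutoff Q δ p = 0 :=
  Real.smoothTransition.zero_of_nonpos (by rw [sub_nonpos, div_le_one hδ]; exact hp)

lemma pd_coneCutoff (Q : Spacetime n) (δ : ℝ) (i : Idx n) (p : Spacetime n) :
    pd i (coneCutoff Q δ) p =
      deriv Real.smoothTransition (fQ Q p / δ - 1) * (1 / δ) * (sgn i * coord Q i p / 2) := by
  have h1 : HasDerivAt (fun x : ℝ => Real.smoothTransition (x / δ - 1))
      (deriv Real.smoothTransition (fQ Q p / δ - 1) * (1 / δ)) (fQ Q p) := by
    have h1 : HasDerivAt Real.smoothTransition _ (fQ Q p / δ - 1) :=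
      (contDiff_smoothTransition.differentiable (by norm_num) _).hasDerivAt
    exact h1.comp (fQ Q p) (((hasDerivAt_id (fQ Q p)).div_const δ).sub_const 1)
  have h2 := pd_comp (i := i) h1 ((contDiff_fQ Q (k := 1)).differentiable (by norm_num) p)
  rw [pd_fQ] at h2
  exact h2

/-- The divergence inequality with a cutoff near the null cone. -/
lemma lintegral_coneCutoff_le (hΩ : IsOpen Ω) (hs : HasSmoothBoundary Ω)
    (hR : ∀ x ∈ Ω, ‖x - Q.2‖ < R) {J : Idx n → Spacetime n → ℝ} {B H : Spacetime n → ℝ}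
    (hJ : ∀ i, ContDiffOn ℝ 1 (J i) (cylinder Ω ∩ exteriorCone Q))
    (hJc : ∀ i, ContinuousOn (J i) (closure (cylinder Ω) ∩ exteriorCone Q))
    (hJb : ∀ q ∈ frontier (cylinder Ω) ∩ exteriorCone Q, ∀ V ρ', q.2 ∈ V →
      IsDefiningFunctionOn Ω V ρ' → ∑ j, J (Sum.inr j) q * gradient ρ' q.2 j ≤ 0)
    (hB : ContinuousOn B (cylinder Ω ∩ exteriorCone Q))
    (hH : ContinuousOn H (cylinder Ω ∩ exteriorCone Q))
    (hB0 : ∀ p ∈ cylinder Ω ∩ exteriorCone Q, 0 ≤ B p)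
    (hHi : IntegrableOn H (cylinder Ω ∩ exteriorCone Q))
    (hle : ∀ p ∈ cylinder Ω ∩ exteriorCone Q, B p ≤ H p + ∑ i, pd i (J i) p)
    {δ : ℝ} (hδ : 0 < δ) :
    ∫⁻ p in cylinder Ω ∩ exteriorCone Q, ENNReal.ofReal (coneCutoff Q δ p * B p) ≤
      ENNReal.ofReal ((∫ p in cylinder Ω ∩ exteriorCone Q, coneCutoff Q δ p * H p)
        - ∫ p in cylinder Ω ∩ exteriorCone Q, ∑ i, pd i (coneCutoff Q δ) p * J i p) := by
  set O := cylinder Ω ∩ exteriorCone Q with hOdef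
  have hOo : IsOpen O := (isOpen_cylinder hΩ).inter (isOpen_exteriorCone Q)
  have hO : MeasurableSet O := hOo.measurableSet
  set K := closure (cylinder Ω) ∩ {p | δ ≤ fQ Q p} with hK
  have hKc : IsCompact K := isCompact_closure_inter hR hδ
  have hKD : ∀ p ∈ K, p ∈ closure (cylinder Ω) ∩ exteriorCone Q := fun p hp =>
    ⟨hp.1, hδ.trans_le hp.2⟩
  choose! N ρ hmem hNo hND hρ hρ0 hNO hNcl hNb using
    fun p (hp : p ∈ K) => exists_chart (Q := Q) hΩ hs (hKD p hp)
  -- The charts are intersected with unit balls so that the pieces of the partition of unity get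
  -- compact supports.
  obtain ⟨t, htK⟩ := hKc.elim_nhds_subcover' (fun x _ => N x ∩ Metric.ball x 1)
    (fun x hx => Filter.inter_mem ((hNo x hx).mem_nhds (hmem x hx)) (Metric.ball_mem_nhds x one_pos))
  obtain ⟨χ, hχ⟩ := SmoothPartitionOfUnity.exists_isSubordinate (modelWithCornersSelf ℝ (Spacetime n))
    hKc.isClosed (fun x : t => N x.1.1 ∩ Metric.ball x.1.1 1)
    (fun x => (hNo _ x.1.2).inter Metric.isOpen_ball)
    (by
      intro p hp
      obtain ⟨x, hx, hpx⟩ := mem_iUnion₂.1 (htK hp)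
      exact mem_iUnion.2 ⟨⟨x, hx⟩, hpx⟩)
  set φ : t → Spacetime n → ℝ := fun x p => coneCutoff Q δ p * χ x p with hφ
  have hts : ∀ x, tsupport (φ x) ⊆ tsupport (χ x) := fun x => by
    exact tsupport_mul_subset_right
  have hchart : ∀ x : t, CutoffChart O (N x.1.1) (ρ x.1.1) (φ x) := fun x =>
    { isOpen_domain := hOo
      isOpen_chart := hNo _ x.1.2
      contDiffOn := hρ _ x.1.2
      exists_pd_ne_zero := hρ0 _ x.1.2
      mem_iff := hNO _ x.1.2
      contDiff := (contDiff_coneCutoff Q δ).mul (χ x).contMDiff.contDiff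
      hasCompactSupport := HasCompactSupport.of_support_subset_isCompact
        (isCompact_closedBall x.1.1 1) (((subset_tsupport _).trans ((hts x).trans (hχ x))).trans
          (inter_subset_right.trans Metric.ball_subset_closedBall))
      tsupport_subset := ((hts x).trans (hχ x)).trans inter_subset_left
      nonneg := fun p => mul_nonneg (Real.smoothTransition.nonneg _) (χ.nonneg x p) }
  -- The partition sums to 1 only on `K`. Where f < δ the cone cutoff vanishes, so the products sum
  -- to the cone cutoff on all of `O`.
  have hsum : ∀ p ∈ O, ∑ x, φ x p = coneCutoff Q δ p := by
    intro p hp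
    rw [← Finset.mul_sum]
    by_cases hf : δ ≤ fQ Q p
    · have h1 := χ.sum_eq_one (x := p) ⟨subset_closure hp.1, hf⟩
      rw [finsum_eq_sum_of_fintype] at h1
      rw [h1, mul_one]
    · rw [coneCutoff_eq_zero hδ (not_le.1 hf).le, zero_mul]
  have hpdsum : ∀ i, ∀ p ∈ O, ∑ x, pd i (φ x) p = pd i (coneCutoff Q δ) p := by
    intro i p hp
    rw [← pd_sum fun x _ => (hchart x).contDiff.differentiable (by simp) p]
    exact pd_congr (by filter_upwards [hOo.mem_nhds hp] with q hq using hsum q hq)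
  have hloc : ∀ x : t, _ := fun x => (hchart x).lintegral_le (J := J) (B := B) (H := H) hJ
    (fun i => (hJc i).mono fun p hp => ⟨hNcl _ x.1.2 p hp.1 hp.2, hND _ x.1.2 hp.1⟩)
    (hNb _ x.1.2 J hJb) hB hH hB0 hHi hle
  have hφb : ∀ x p, ‖φ x p‖ ≤ 1 := fun x p => by
    rw [Real.norm_eq_abs, abs_of_nonneg ((hchart x).nonneg p)]
    exact mul_le_one₀ (Real.smoothTransition.le_one _) (χ.nonneg x p) (χ.le_one x p)
  have hI1 : ∀ x : t, IntegrableOn (fun p => φ x p * H p) O := fun x =>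
    hHi.bdd_mul (hchart x).contDiff.continuous.aestronglyMeasurable
      (Eventually.of_forall (hφb x))
  have hI2 : ∀ x : t, IntegrableOn (fun p => ∑ i, pd i (φ x) p * J i p) O := by
    intro x
    have hφ1 : ContDiff ℝ 1 (φ x) := (hchart x).contDiff.of_le (by simp)
    have hcts : ∀ i, Continuous (pd i (φ x)) := fun i => continuous_pd hφ1
    have hcl : IsCompact (tsupport (φ x) ∩ K) := hKc.inter_left (isClosed_tsupport _)
    obtain ⟨M, hM⟩ := hKc.exists_bound_of_continuousOn (f := fun p => ∑ i, pd i (φ x) p * J i p)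
      (continuousOn_finsetSum Finset.univ fun i _ => (hcts i).continuousOn.mul
        ((hJc i).mono hKD))
    refine Integrable.mono' (g := fun _ => |M|)
      (integrableOn_const (volume_domain_lt_top hR).ne) ?_ ?_
    · exact ContinuousOn.aestronglyMeasurable (continuousOn_finsetSum Finset.univ fun i _ =>
        (hcts i).continuousOn.mul (hJ i).continuousOn) hO
    · filter_upwards [ae_restrict_mem hO] with p hp
      by_cases hf : δ ≤ fQ Q p
      · exact (hM p ⟨subset_closure hp.1, hf⟩).trans (le_abs_self M)
      · have h0 : φ x =ᶠ[𝓝 p] fun _ => 0 := by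
          have : ∀ᶠ q in 𝓝 p, fQ Q q < δ :=
            (contDiff_fQ Q (k := 0)).continuous.continuousAt.eventually
              (gt_mem_nhds (not_le.1 hf))
          filter_upwards [this] with q hq
          simp only [hφ]
          rw [coneCutoff_eq_zero hδ hq.le, zero_mul]
        have : ∀ i, pd i (φ x) p = 0 := fun i => by rw [pd_congr h0, pd_const]
        simp [this]
  calc ∫⁻ p in O, ENNReal.ofReal (coneCutoff Q δ p * B p)
      = ∫⁻ p in O, ∑ x, ENNReal.ofReal (φ x p * B p) := by
        refine setLIntegral_congr_fun hO fun p hp => ?_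
        rw [← hsum p hp, Finset.sum_mul, ENNReal.ofReal_sum_of_nonneg]
        exact fun x _ => mul_nonneg ((hchart x).nonneg p) (hB0 p hp)
    _ = ∑ x, ∫⁻ p in O, ENNReal.ofReal (φ x p * B p) := by
        refine lintegral_finsetSum' _ fun x _ => ?_
        exact (((hchart x).contDiff.continuous.continuousOn.mul hB).aemeasurable hO).ennreal_ofReal
    _ ≤ ∑ x, ENNReal.ofReal ((∫ p in O, φ x p * H p)
          - ∫ p in O, ∑ i, pd i (φ x) p * J i p) :=
        Finset.sum_le_sum fun x _ => (hloc x).2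
    _ = ENNReal.ofReal (∑ x, ((∫ p in O, φ x p * H p)
          - ∫ p in O, ∑ i, pd i (φ x) p * J i p)) :=
        (ENNReal.ofReal_sum_of_nonneg fun x _ => (hloc x).1).symm
    _ = _ := by
        congr 1
        rw [Finset.sum_sub_distrib, ← integral_finsetSum _ fun x _ => hI1 x,
          ← integral_finsetSum _ fun x _ => hI2 x]
        congr 1
        · refine setIntegral_congr_fun hO fun p hp => ?_
          rw [← hsum p hp, Finset.sum_mul]
        · refine setIntegral_congr_fun hO fun p hp => ?_
          rw [Finset.sum_comm]
          refine Finset.sum_congr rfl fun i _ => ?_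
          rw [← hpdsum i p hp, Finset.sum_mul]

/-- The divergence inequality on the part of the cylinder outside the null cone, for a field which
does not point outwards along the lateral boundary and vanishes to second order on the cone. -/
theorem lintegral_le_of_le_add_div (hΩ : IsOpen Ω) (hs : HasSmoothBoundary Ω) (hR0 : 0 < R)
    (hR : ∀ x ∈ Ω, ‖x - Q.2‖ < R) {J : Idx n → Spacetime n → ℝ} {B H : Spacetime n → ℝ}
    (hJ : ∀ i, ContDiffOn ℝ 1 (J i) (cylinder Ω ∩ exteriorCone Q))
    (hJc : ∀ i, ContinuousOn (J i) (closure (cylinder Ω) ∩ exteriorCone Q))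
    (hJ0 : ∃ M : ℝ, ∀ i, ∀ p ∈ cylinder Ω ∩ exteriorCone Q, |J i p| ≤ M * fQ Q p ^ 2)
    (hJb : ∀ q ∈ frontier (cylinder Ω) ∩ exteriorCone Q, ∀ V ρ', q.2 ∈ V →
      IsDefiningFunctionOn Ω V ρ' → ∑ j, J (Sum.inr j) q * gradient ρ' q.2 j ≤ 0)
    (hB : ContinuousOn B (cylinder Ω ∩ exteriorCone Q))
    (hH : ContinuousOn H (cylinder Ω ∩ exteriorCone Q))
    (hB0 : ∀ p ∈ cylinder Ω ∩ exteriorCone Q, 0 ≤ B p)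
    (hH0 : ∀ p ∈ cylinder Ω ∩ exteriorCone Q, 0 ≤ H p)
    (hle : ∀ p ∈ cylinder Ω ∩ exteriorCone Q, B p ≤ H p + ∑ i, pd i (J i) p) :
    integralOn (cylinder Ω ∩ exteriorCone Q) B ≤ integralOn (cylinder Ω ∩ exteriorCone Q) H := by
  set O := cylinder Ω ∩ exteriorCone Q with hOdef
  have hOo : IsOpen O := (isOpen_cylinder hΩ).inter (isOpen_exteriorCone Q)
  have hO : MeasurableSet O := hOo.measurableSet
  unfold integralOn
  -- If the right side is infinite there is nothing to prove. Otherwise `H` is integrable, as the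
  -- limit arguments require.
  by_cases htop : ∫⁻ p in O, ENNReal.ofReal (H p) = ⊤
  · rw [htop]; exact le_top
  have hH0' : 0 ≤ᵐ[volume.restrict O] H := by
    filter_upwards [ae_restrict_mem hO] with p hp using hH0 p hp
  have hHi : IntegrableOn H O := by
    refine ⟨hH.aestronglyMeasurable hO, ?_⟩
    rw [hasFiniteIntegral_iff_ofReal hH0']
    exact lt_top_iff_ne_top.2 htop
  rw [← ofReal_integral_eq_lintegral_ofReal hHi hH0']
  obtain ⟨M0, hM0⟩ := hJ0
  obtain ⟨Mσ, hMσ, hσ⟩ := exists_deriv_smoothTransition_le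
  set M := |M0|
  set C := Fintype.card (Idx n) * (Mσ * R * 2 * M) * volume.real O with hC
  set d : ℕ → ℝ := fun k => 1 / ((k : ℝ) + 1) with hd
  have hdpos : ∀ k, 0 < d k := fun k => by positivity
  have hdlim : Tendsto d atTop (𝓝 0) := tendsto_one_div_add_atTop_nhds_zero_nat
  have hκ0 : ∀ k p, 0 ≤ coneCutoff Q (d k) p := fun k p => Real.smoothTransition.nonneg _
  have hκ1 : ∀ k p, coneCutoff Q (d k) p ≤ 1 := fun k p => Real.smoothTransition.le_one _
  -- The error at the cone: the cutoff varies only for δ ≤ f ≤ 2δ, with derivative O(1/δ), and J =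
  -- O(f²) = O(δ²) there. The total is O(δ) on a set of finite volume.
  have hJk : ∀ k, |∫ p in O, ∑ i, pd i (coneCutoff Q (d k)) p * J i p| ≤ C * d k := by
    intro k
    have hb : ∀ p ∈ O, ‖∑ i, pd i (coneCutoff Q (d k)) p * J i p‖
        ≤ Fintype.card (Idx n) * (Mσ * R * 2 * M) * d k := by
      intro p hp
      have hf : 0 < fQ Q p := hp.2
      refine (norm_sum_le _ _).trans ((Finset.sum_le_card_nsmul _ _ (Mσ * R * 2 * M * d k)
        fun i _ => ?_).trans (by simp [mul_assoc]))
      rw [pd_coneCutoff]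
      rcases le_or_gt (2 * d k) (fQ Q p) with h2 | h2
      · rw [deriv_smoothTransition_of_one_le]
        · have := hdpos k
          have : 0 < Mσ * R * 2 := by positivity
          simp only [zero_mul, norm_zero]; positivity
        · have : 2 ≤ fQ Q p / d k := by rwa [le_div_iff₀ (hdpos k)]
          linarith
      · have hJi : |J i p| ≤ M * fQ Q p ^ 2 :=
          (hM0 i p hp).trans (mul_le_mul_of_nonneg_right (le_abs_self M0) (sq_nonneg _))
        have hc : |coord Q i p| ≤ R := (abs_coord_le hp.2 i).trans (rQ_lt_of_mem hR hp.1).le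
        have hsg : |(sgn i : ℝ)| = 1 := by cases i <;> simp
        have hsc : |sgn i * coord Q i p / 2| = |coord Q i p| / 2 := by
          rw [abs_div, abs_mul, hsg, one_mul, abs_two]
        rw [Real.norm_eq_abs, abs_mul, abs_mul, abs_mul, hsc,
          abs_of_nonneg (deriv_smoothTransition_nonneg _), abs_of_pos (one_div_pos.2 (hdpos k))]
        have hfle : fQ Q p ^ 2 ≤ 4 * d k ^ 2 := by nlinarith
        have hM' : (0 : ℝ) ≤ M := abs_nonneg _
        calc deriv Real.smoothTransition (fQ Q p / d k - 1) * (1 / d k) * (|coord Q i p| / 2) * |J i p|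
            ≤ Mσ * (1 / d k) * (R / 2) * (M * (4 * d k ^ 2)) := by
              have := hdpos k
              gcongr
              · exact hσ _
              · exact hJi.trans (by gcongr)
          _ = Mσ * R * 2 * M * d k := by
              have := (hdpos k).ne'
              field_simp
              ring
    have := norm_setIntegral_le_of_norm_le_const (volume_domain_lt_top hR) hb
    rw [Real.norm_eq_abs] at this
    calc _ ≤ _ := this
      _ = C * d k := by rw [hC]; ring
  refine lintegral_le_of_tendsto (g := fun k p => ENNReal.ofReal (coneCutoff Q (d k) p * B p))
    (c := fun k => ENNReal.ofReal ((∫ p in O, H p) + C * d k)) (fun k => ?_) ?_ (fun k => ?_) ?_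
  · exact (((contDiff_coneCutoff Q (d k)).continuous.continuousOn.mul hB).aemeasurable
      hO).ennreal_ofReal
  · filter_upwards [ae_restrict_mem hO] with p hp
    refine (ENNReal.continuous_ofReal.tendsto _).comp ?_
    have h := (CutoffChart.tendsto_cutoff (x := -fQ Q p) (by have : 0 < fQ Q p := hp.2; linarith)).mul_const
      (B p)
    rw [one_mul] at h
    rw [neg_neg] at h
    exact h
  · refine (lintegral_coneCutoff_le hΩ hs hR hJ hJc hJb hB hH hB0 hHi hle (hdpos k)).trans
      (ENNReal.ofReal_le_ofReal ?_)
    have h1 : ∫ p in O, coneCutoff Q (d k) p * H p ≤ ∫ p in O, H p := by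
      refine setIntegral_mono_on ?_ hHi hO fun p hp => ?_
      · refine hHi.bdd_mul (c := 1) (contDiff_coneCutoff Q (d k)).continuous.aestronglyMeasurable
          (Eventually.of_forall fun p => ?_)
        rw [Real.norm_eq_abs, abs_of_nonneg (hκ0 k p)]
        exact hκ1 k p
      · exact mul_le_of_le_one_left (hH0 p hp) (hκ1 k p)
    have h2 := (abs_le.1 (hJk k)).1
    linarith
  · refine (ENNReal.continuous_ofReal.tendsto _).comp ?_
    simpa using (hdlim.const_mul C).const_add (∫ p in O, H p)

end Domain

/-! ### Functions that are continuously differentiable up to the boundary -/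

/-- Near a boundary point, `ContDiffOn` supplies a continuous field of derivatives along the
closure. At interior points it must be `fderiv`, so `fderiv` has a limit at the boundary point, and
that limit is still a derivative along the closure. The limits fit together into a continuous
extension. -/
lemma exists_fderiv_extension {E : Type*} [NormedAddCommGroup E] [NormedSpace ℝ E] {U : Set E}
    (hU : IsOpen U) {z : E → ℝ} (hz : ContDiffOn ℝ 1 z (closure U)) :
    ∃ G : E → E →L[ℝ] ℝ, ContinuousOn G (closure U) ∧ (∀ p ∈ U, G p = fderiv ℝ z p) ∧
      ∀ p ∈ closure U, HasFDerivWithinAt z (G p) (closure U) p := by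
  have key : ∀ p ∈ closure U, ∃ L, Tendsto (fderiv ℝ z) (𝓝[U] p) (𝓝 L) ∧
      HasFDerivWithinAt z L (closure U) p := by
    intro p hp
    have h1 : ContDiffWithinAt ℝ (0 + 1) z (closure U) p := by simpa using hz p hp
    obtain ⟨u, hu, -, f', hf', hc⟩ :=
      (contDiffWithinAt_succ_iff_hasFDerivWithinAt (by simp)).1 h1
    rw [insert_eq_of_mem hp] at hu
    have hpu : p ∈ u := mem_of_mem_nhdsWithin hp hu
    refine ⟨f' p, ?_, ((hf' p hpu).mono_of_mem_nhdsWithin hu)⟩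
    obtain ⟨v, hv, hpv, hvu⟩ := mem_nhdsWithin.1 hu
    have hcw : Tendsto f' (𝓝[U] p) (𝓝 (f' p)) :=
      hc.continuousWithinAt.mono_left (nhdsWithin_le_of_mem
        (mem_of_superset (nhdsWithin_mono p subset_closure hu) subset_rfl))
    refine hcw.congr' ?_
    filter_upwards [self_mem_nhdsWithin, mem_nhdsWithin_of_mem_nhds (hv.mem_nhds hpv)]
      with y hyU hyv
    have hy : u ∈ 𝓝 y := mem_of_superset ((hv.inter hU).mem_nhds ⟨hyv, hyU⟩)
      fun w hw => hvu ⟨hw.1, subset_closure hw.2⟩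
    exact ((hf' y (mem_of_mem_nhds hy)).hasFDerivAt hy).fderiv.symm
  refine ⟨extendFrom U (fderiv ℝ z), continuousOn_extendFrom subset_rfl fun p hp =>
    (key p hp).imp fun _ h => h.1, fun p hp => ?_, fun p hp => ?_⟩
  · obtain ⟨L, hL, hd⟩ := key p (subset_closure hp)
    rw [extendFrom_eq (subset_closure hp) hL]
    exact ((hd.mono subset_closure).hasFDerivAt (hU.mem_nhds hp)).fderiv.symm
  · obtain ⟨L, hL, hd⟩ := key p hp
    rwa [extendFrom_eq hp hL]

/-! ### The boundary gradient of a function vanishing on the boundary. -/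

section Domain

variable {n : ℕ} {Ω : Set (EuclideanSpace ℝ (Fin n))} {Q : Spacetime n}

/-- A function vanishing on the lateral boundary has vanishing tangential derivatives there. -/
lemma fderiv_extension_tangent (hΩ : IsOpen Ω) {z : Spacetime n → ℝ}
    (hz0 : ∀ p ∈ frontier (cylinder Ω) ∩ exteriorCone Q, z p = 0) {p : Spacetime n}
    (hp : p ∈ frontier (cylinder Ω) ∩ exteriorCone Q) {L : Spacetime n →L[ℝ] ℝ}
    (hL : HasFDerivWithinAt z L (closure (cylinder Ω)) p)
    {V : Set (EuclideanSpace ℝ (Fin n))} {ρ : EuclideanSpace ℝ (Fin n) → ℝ} (hpV : p.2 ∈ V)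
    (hdef : IsDefiningFunctionOn Ω V ρ) {v : Spacetime n}
    (hv : inner ℝ (gradient ρ p.2) v.2 = 0) : L v = 0 := by
  set ν := gradient ρ p.2 with hν
  have hν0 : 0 < ‖ν‖ := norm_pos_iff.2 (hdef.2.2.1 p.2 hpV)
  have hfr : ∀ q : Spacetime n, q.2 ∈ V → ρ q.2 = 0 → q ∈ frontier (cylinder Ω) := by
    intro q hq h0
    rw [frontier_cylinder]
    exact ⟨trivial, hdef.mem_frontier hΩ hq h0⟩
  have hρp : ρ p.2 = 0 := by
    have h1 := hp.1
    rw [frontier_cylinder, hΩ.frontier_eq] at h1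
    have hge : 0 ≤ ρ p.2 := not_lt.1 fun h => h1.2.2 ((hdef.mem_iff hpV).2 h)
    refine le_antisymm (not_lt.1 fun h => ?_) hge
    have h2 : ∀ᶠ y in 𝓝 p.2, y ∈ V ∧ 0 < ρ y :=
      Filter.Eventually.and (hdef.1.mem_nhds hpV) ((hdef.contDiffAt hpV).continuousAt.eventually (lt_mem_nhds h))
    obtain ⟨y, hy, hyΩ⟩ := mem_closure_iff_nhds.1 h1.2.1 _ h2
    linarith [(hdef.mem_iff hy.1).1 hyΩ, hy.2]
  have hρd : HasFDerivAt ρ (fderiv ℝ ρ p.2) p.2 :=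
    ((hdef.contDiffAt hpV).differentiableAt (by simp)).hasFDerivAt
  have hρinner : ∀ w, fderiv ℝ ρ p.2 w = inner ℝ ν w := fun w => by
    rw [hν, gradient, InnerProductSpace.toDual_symm_apply]
  have hzp : z p = 0 := hz0 p hp
  -- quantitative version
  have key : ∀ e : ℝ, 0 < e → |L v| ≤ e * (‖L‖ * ‖ν‖ + (‖v‖ + e * ‖ν‖)) := by
    intro e he
    set A := ‖v‖ + e * ‖ν‖ with hA
    have hA0 : 0 < A := by positivity
    have h1 : ∀ᶠ q in 𝓝 p, q ∈ closure (cylinder Ω) → ‖z q - z p - L (q - p)‖ ≤ e * ‖q - p‖ :=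
      eventually_nhdsWithin_iff.1 (hL.isLittleO.def he)
    -- The tolerance is chosen so that, along the segment used below, the remainder of ρ is at most
    -- s e |ν|²/2. This is half of the linear variation s e |ν|² at θ = ±e.
    have h2 : ∀ᶠ y in 𝓝 p.2, ‖ρ y - ρ p.2 - fderiv ℝ ρ p.2 (y - p.2)‖
        ≤ (e * ‖ν‖ ^ 2 / (2 * A)) * ‖y - p.2‖ :=
      hρd.isLittleO.def (by positivity)
    have h3 : ∀ᶠ q in 𝓝 p, q ∈ exteriorCone Q := (isOpen_exteriorCone Q).mem_nhds hp.2
    obtain ⟨d1, hd1, H1⟩ := Metric.eventually_nhds_iff.1 (h1.and h3)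
    obtain ⟨d2, hd2, H2⟩ := Metric.eventually_nhds_iff.1 (h2.and (hdef.1.mem_nhds hpV))
    set s := min d1 d2 / (2 * A) with hs
    have hs0 : 0 < s := by positivity
    have hsA : s * A < min d1 d2 := by
      rw [hs]; field_simp; linarith [lt_min hd1 hd2]
    set q : ℝ → Spacetime n := fun θ => p + s • (v + θ • ((0, ν) : Spacetime n)) with hq
    have hnorm : ∀ θ ∈ Icc (-e) e, ‖q θ - p‖ ≤ s * A := by
      intro θ hθ
      have : q θ - p = s • (v + θ • ((0, ν) : Spacetime n)) := by simp [hq]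
      rw [this, norm_smul, Real.norm_eq_abs, abs_of_pos hs0]
      refine mul_le_mul_of_nonneg_left ((norm_add_le _ _).trans ?_) hs0.le
      have hν1 : ‖((0, ν) : Spacetime n)‖ = ‖ν‖ := by
        rw [Prod.norm_mk, norm_zero, max_eq_right (norm_nonneg ν)]
      rw [norm_smul, hν1, Real.norm_eq_abs]
      exact add_le_add_right (mul_le_mul_of_nonneg_right (abs_le.2 hθ) (norm_nonneg _)) _
    have hnorm2 : ∀ θ ∈ Icc (-e) e, ‖(q θ).2 - p.2‖ ≤ s * A := fun θ hθ =>
      (norm_snd_le (q θ - p)).trans (hnorm θ hθ)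
    have hH1 : ∀ θ ∈ Icc (-e) e, _ := fun θ hθ => H1 (y := q θ) (by
      rw [dist_eq_norm]; exact (hnorm θ hθ).trans_lt (hsA.trans_le (min_le_left _ _)))
    have hH2 : ∀ θ ∈ Icc (-e) e, _ := fun θ hθ => H2 (y := (q θ).2) (by
      rw [dist_eq_norm]; exact (hnorm2 θ hθ).trans_lt (hsA.trans_le (min_le_right _ _)))
    have hlin : ∀ θ, fderiv ℝ ρ p.2 ((q θ).2 - p.2) = s * θ * ‖ν‖ ^ 2 := by
      intro θ
      have : (q θ).2 - p.2 = s • (v.2 + θ • ν) := by simp [hq]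
      rw [this, hρinner, inner_smul_right, inner_add_right, inner_smul_right, hv,
        real_inner_self_eq_norm_sq]
      ring
    have hρθ : ∀ θ ∈ Icc (-e) e, |ρ (q θ).2 - s * θ * ‖ν‖ ^ 2| ≤ s * e * ‖ν‖ ^ 2 / 2 := by
      intro θ hθ
      have h := (hH2 θ hθ).1
      rw [hρp, sub_zero, hlin, Real.norm_eq_abs] at h
      refine h.trans ((mul_le_mul_of_nonneg_left (hnorm2 θ hθ) (by positivity)).trans_eq ?_)
      field_simp
    have hcont : ContinuousOn (fun θ => ρ (q θ).2) (Icc (-e) e) := by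
      intro θ hθ
      refine ContinuousAt.continuousWithinAt ?_
      have hc2 : Continuous fun θ => (q θ).2 := by
        simp only [hq]; fun_prop
      exact ContinuousAt.comp (f := fun θ => (q θ).2) (hdef.contDiffAt (hH2 θ hθ).2).continuousAt
        hc2.continuousAt
    -- ρ changes sign between θ = −e and θ = e, so moving p + s v by at most s e |ν| in the normal
    -- direction reaches the boundary. There z = 0, and the expansion of z, valid only along the
    -- closure, applies.
    obtain ⟨θ, hθ, hθ0⟩ : ∃ θ ∈ Icc (-e) e, ρ (q θ).2 = 0 := by
      have hle : -e ≤ e := by linarith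
      have hpos : 0 < s * e * ‖ν‖ ^ 2 := by positivity
      have ha := (abs_le.1 (hρθ (-e) ⟨le_rfl, hle⟩)).2
      have hb := (abs_le.1 (hρθ e ⟨hle, le_rfl⟩)).1
      exact intermediate_value_Icc hle hcont ⟨by nlinarith, by nlinarith⟩
    have hqf : q θ ∈ frontier (cylinder Ω) := hfr _ (hH2 θ hθ).2 hθ0
    have hzq : z (q θ) = 0 := hz0 _ ⟨hqf, (hH1 θ hθ).2⟩
    have h4 := (hH1 θ hθ).1 (frontier_subset_closure hqf)
    have hLq : L (q θ - p) = s * (L v + θ * L (0, ν)) := by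
      have : q θ - p = s • (v + θ • ((0, ν) : Spacetime n)) := by simp [hq]
      rw [this, map_smul, map_add, map_smul]; simp
    rw [hzq, hzp, hLq, sub_zero, zero_sub, norm_neg, Real.norm_eq_abs, abs_mul,
      abs_of_pos hs0] at h4
    have h5 : |L v + θ * L (0, ν)| ≤ e * A := by
      have := h4.trans (mul_le_mul_of_nonneg_left (hnorm θ hθ) he.le)
      have h6 : s * |L v + θ * L (0, ν)| ≤ s * (e * A) := by linarith
      exact le_of_mul_le_mul_left h6 hs0
    have h7 : |θ * L (0, ν)| ≤ e * (‖L‖ * ‖ν‖) := by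
      rw [abs_mul]
      refine mul_le_mul (abs_le.2 hθ) ?_ (abs_nonneg _) he.le
      have := L.le_opNorm ((0, ν) : Spacetime n)
      rwa [Prod.norm_mk, norm_zero, max_eq_right (norm_nonneg ν), Real.norm_eq_abs] at this
    have h8 : |L v| ≤ |L v + θ * L (0, ν)| + |θ * L (0, ν)| := by
      have := abs_sub (L v + θ * L (0, ν)) (θ * L (0, ν))
      simpa using this
    calc |L v| ≤ e * A + e * (‖L‖ * ‖ν‖) := by linarith
      _ = _ := by ring
  have hlim : Tendsto (fun e : ℝ => e * (‖L‖ * ‖ν‖ + (‖v‖ + e * ‖ν‖))) (𝓝[>] 0) (𝓝 0) := by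
    have : Continuous fun e : ℝ => e * (‖L‖ * ‖ν‖ + (‖v‖ + e * ‖ν‖)) := by fun_prop
    have h := this.tendsto 0
    simp only [zero_mul] at h
    exact h.mono_left nhdsWithin_le_nhds
  have h0 : |L v| ≤ 0 := ge_of_tendsto hlim (by
    filter_upwards [self_mem_nhdsWithin] with e he using key e he)
  exact abs_nonpos_iff.1 h0

/-- On the lateral boundary the gradient of a function vanishing there is normal. -/
lemma exists_fderiv_extension_normal (hΩ : IsOpen Ω) {z : Spacetime n → ℝ}
    (hz0 : ∀ p ∈ frontier (cylinder Ω) ∩ exteriorCone Q, z p = 0) {p : Spacetime n}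
    (hp : p ∈ frontier (cylinder Ω) ∩ exteriorCone Q) {L : Spacetime n →L[ℝ] ℝ}
    (hL : HasFDerivWithinAt z L (closure (cylinder Ω)) p)
    {V : Set (EuclideanSpace ℝ (Fin n))} {ρ : EuclideanSpace ℝ (Fin n) → ℝ} (hpV : p.2 ∈ V)
    (hdef : IsDefiningFunctionOn Ω V ρ) :
    ∃ c : ℝ, ∀ i, L (stdVec i) = c * Sum.elim (fun _ => 0) (fun j => gradient ρ p.2 j) i := by
  set ν := gradient ρ p.2 with hν
  have hν0 : ‖ν‖ ≠ 0 := norm_ne_zero_iff.2 (hdef.2.2.1 p.2 hpV)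
  refine ⟨L (0, ν) / ‖ν‖ ^ 2, ?_⟩
  rintro (k | j)
  · have := fderiv_extension_tangent hΩ hz0 hp hL hpV hdef (v := stdVec (Sum.inl k))
      (by simp [stdVec])
    simp [this]
  · have h := fderiv_extension_tangent hΩ hz0 hp hL hpV hdef
      (v := stdVec (Sum.inr j) - (ν j / ‖ν‖ ^ 2) • ((0, ν) : Spacetime n)) (by
        simp only [stdVec, Sum.elim_inr, Prod.snd_sub, Prod.smul_snd]
        rw [inner_sub_right, inner_smul_right, ← hν, real_inner_self_eq_norm_sq,
          EuclideanSpace.inner_single_right]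
        field_simp
        simp)
    rw [map_sub, map_smul, sub_eq_zero] at h
    rw [h]
    simp only [Sum.elim_inr, smul_eq_mul]
    ring

end Domain

/-! ### The current of a first order multiplier -/

/-- The current of the multiplier `∑ Sʲ ∂ⱼ + q` for the wave operator with potential `A`; the
derivatives of `ψ` enter through `ξ`. -/
def multiplierCurrent {n : ℕ} (S : Idx n → Spacetime n → ℝ) (q A ψ : Spacetime n → ℝ)
    (ξ : Idx n → Spacetime n → ℝ) (i : Idx n) (p : Spacetime n) : ℝ :=
  sgn i * (ξ i p * ((∑ j, S j p * ξ j p) + q p * ψ p))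
    - (1 / 2) * (S i p * ∑ j, sgn j * ξ j p ^ 2)
    - (1 / 2) * sgn i * (ψ p ^ 2 * pd i q p) + (1 / 2) * (A p * ψ p ^ 2 * S i p)

/-- This is the divergence of the stress tensor contracted with S, plus lower order corrections. The
Hessian terms of ψ contracted with S cancel by symmetry, leaving only □ψ. The last part of the
current supplies A ψ Sψ, which later cancels against the potential of the conjugated equation. -/
lemma sum_pd_multiplierCurrent {n : ℕ} {S : Idx n → Spacetime n → ℝ} {q A ψ : Spacetime n → ℝ}
    {p : Spacetime n} (hS : ∀ j, DifferentiableAt ℝ (S j) p) (hq : ContDiffAt ℝ 2 q p)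
    (hA : DifferentiableAt ℝ A p) (hψ : ContDiffAt ℝ 2 ψ p) :
    ∑ i, pd i (multiplierCurrent S q A ψ (fun j => pd j ψ) i) p =
      box ψ p * ((∑ j, S j p * pd j ψ p) + q p * ψ p)
      + (∑ i, ∑ j, sgn i * pd i ψ p * pd i (S j) p * pd j ψ p)
      + (q p - (∑ i, pd i (S i) p) / 2) * (∑ i, sgn i * pd i ψ p ^ 2)
      - box q p * ψ p ^ 2 / 2
      + ((∑ i, S i p * pd i A p) + A p * ∑ i, pd i (S i) p) * ψ p ^ 2 / 2
      + A p * ψ p * ∑ i, S i p * pd i ψ p := by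
  have hψd : DifferentiableAt ℝ ψ p := hψ.differentiableAt (by norm_num)
  have hqd : DifferentiableAt ℝ q p := hq.differentiableAt (by norm_num)
  have hξ : ∀ j, DifferentiableAt ℝ (pd j ψ) p := fun j => differentiableAt_pd hψ
  have hqj : ∀ j, DifferentiableAt ℝ (pd j q) p := fun j => differentiableAt_pd hq
  have hSξ : ∀ j, DifferentiableAt ℝ (fun x => S j x * pd j ψ x) p := fun j =>
    (hS j).fun_mul (hξ j)
  have hsum : DifferentiableAt ℝ (fun x => ∑ j, S j x * pd j ψ x) p :=
    DifferentiableAt.fun_sum fun j _ => hSξ j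
  have hqψ := hqd.fun_mul hψd
  have hG1 : ∀ j, DifferentiableAt ℝ (fun x => sgn j * pd j ψ x ^ 2) p := fun j =>
    ((hξ j).fun_pow 2).const_mul _
  have hG : DifferentiableAt ℝ (fun x => ∑ j, sgn j * pd j ψ x ^ 2) p :=
    DifferentiableAt.fun_sum fun j _ => hG1 j
  have hi : ∀ i, pd i (multiplierCurrent S q A ψ (fun j => pd j ψ) i) p =
      (sgn i * pd i (pd i ψ) p) * ((∑ j, S j p * pd j ψ p) + q p * ψ p)
      + (∑ j, sgn i * pd i ψ p * pd i (S j) p * pd j ψ p)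
      + (∑ j, sgn i * pd i ψ p * S j p * pd i (pd j ψ) p)
      - (∑ j, sgn j * pd j ψ p * S i p * pd i (pd j ψ) p)
      + q p * (sgn i * pd i ψ p ^ 2)
      - pd i (S i) p * ((∑ j, sgn j * pd j ψ p ^ 2) / 2)
      - (sgn i * pd i (pd i q) p) * (ψ p ^ 2 / 2)
      + ((S i p * pd i A p) + A p * pd i (S i) p) * (ψ p ^ 2 / 2)
      + A p * ψ p * (S i p * pd i ψ p) := by
    intro i
    unfold multiplierCurrent
    have e1 : DifferentiableAt ℝ (fun x => pd i ψ x * ((∑ j, S j x * pd j ψ x) + q x * ψ x)) p :=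
      (hξ i).fun_mul (hsum.fun_add hqψ)
    have e2 : DifferentiableAt ℝ (fun x => S i x * ∑ j, sgn j * pd j ψ x ^ 2) p :=
      (hS i).fun_mul hG
    have e3 : DifferentiableAt ℝ (fun x => ψ x ^ 2 * pd i q x) p := (hψd.fun_pow 2).fun_mul (hqj i)
    have e4 : DifferentiableAt ℝ (fun x => A x * ψ x ^ 2 * S i x) p :=
      (hA.fun_mul (hψd.fun_pow 2)).fun_mul (hS i)
    rw [pd_add (((e1.const_mul _).fun_sub (e2.const_mul _)).fun_sub (e3.const_mul _))
        (e4.const_mul _),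
      pd_sub ((e1.const_mul _).fun_sub (e2.const_mul _)) (e3.const_mul _),
      pd_sub (e1.const_mul _) (e2.const_mul _), pd_const_mul _ e1, pd_const_mul _ e2,
      pd_const_mul _ e3, pd_const_mul _ e4, pd_mul (hξ i) (hsum.fun_add hqψ), pd_add hsum hqψ,
      pd_mul hqd hψd, pd_sum fun j _ => hSξ j, pd_mul (hS i) hG, pd_sum fun j _ => hG1 j,
      pd_mul (hψd.fun_pow 2) (hqj i), pd_sq hψd, pd_mul (hA.fun_mul (hψd.fun_pow 2)) (hS i),
      pd_mul hA (hψd.fun_pow 2), pd_sq hψd]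
    have f1 : ∑ j, pd i (fun x => S j x * pd j ψ x) p
        = (∑ j, pd i (S j) p * pd j ψ p) + ∑ j, S j p * pd i (pd j ψ) p := by
      rw [← Finset.sum_add_distrib]
      exact Finset.sum_congr rfl fun j _ => pd_mul (hS j) (hξ j)
    have f2 : ∑ j, pd i (fun x => sgn j * pd j ψ x ^ 2) p
        = 2 * ∑ j, sgn j * pd j ψ p * pd i (pd j ψ) p := by
      rw [Finset.mul_sum]
      refine Finset.sum_congr rfl fun j _ => ?_
      rw [pd_const_mul _ ((hξ j).fun_pow 2), pd_sq (hξ j)]; ring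
    have f3 : ∑ j, sgn i * pd i ψ p * pd i (S j) p * pd j ψ p
        = sgn i * pd i ψ p * ∑ j, pd i (S j) p * pd j ψ p := by
      rw [Finset.mul_sum]; exact Finset.sum_congr rfl fun j _ => by ring
    have f4 : ∑ j, sgn i * pd i ψ p * S j p * pd i (pd j ψ) p
        = sgn i * pd i ψ p * ∑ j, S j p * pd i (pd j ψ) p := by
      rw [Finset.mul_sum]; exact Finset.sum_congr rfl fun j _ => by ring
    have f5 : ∑ j, sgn j * pd j ψ p * S i p * pd i (pd j ψ) p
        = S i p * ∑ j, sgn j * pd j ψ p * pd i (pd j ψ) p := by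
      rw [Finset.mul_sum]; exact Finset.sum_congr rfl fun j _ => by ring
    rw [f1, f2, f3, f4, f5]
    ring
  -- The symmetry of the Hessian, after exchanging the two summation indices.
  have hcancel : ∑ i, ∑ j, sgn i * pd i ψ p * S j p * pd i (pd j ψ) p
      = ∑ i, ∑ j, sgn j * pd j ψ p * S i p * pd i (pd j ψ) p := by
    rw [Finset.sum_comm]
    refine Finset.sum_congr rfl fun i _ => Finset.sum_congr rfl fun j _ => ?_
    rw [pd_comm hψ]
  rw [Finset.sum_congr rfl fun i _ => hi i]
  simp only [Finset.sum_add_distrib, Finset.sum_sub_distrib, ← Finset.sum_mul, ← Finset.mul_sum]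
  rw [hcancel, box_eq hψ, box_eq hq]
  ring

/-! ### Functions of `f_Q` and `r_Q` -/

/-- The spatial coordinates centred at `Q`; the time components are zero. -/
def spat {n : ℕ} (Q : Spacetime n) : Idx n → Spacetime n → ℝ :=
  Sum.elim (fun _ _ => 0) (fun j => coord Q (Sum.inr j))

@[simp] lemma spat_inl {n : ℕ} (Q : Spacetime n) (k : Fin 2) (p : Spacetime n) :
    spat Q (Sum.inl k) p = 0 := rfl
@[simp] lemma spat_inr {n : ℕ} (Q : Spacetime n) (j : Fin n) (p : Spacetime n) :
    spat Q (Sum.inr j) p = coord Q (Sum.inr j) p := rfl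

/-- `h` is differentiable at `p` with the differential `hf df_Q + hr dr_Q`. -/
def HasFRDeriv {n : ℕ} (Q : Spacetime n) (h : Spacetime n → ℝ) (hf hr : ℝ) (p : Spacetime n) :
    Prop :=
  DifferentiableAt ℝ h p ∧
    ∀ i, pd i h p = hf * (sgn i * coord Q i p / 2) + hr * (spat Q i p / rQ Q p)

section FR

variable {n : ℕ} {Q p : Spacetime n} {g h : Spacetime n → ℝ} {gf gr hf hr : ℝ}

lemma contDiffAt_rQ (hr0 : 0 < rQ Q p) {k : WithTop ℕ∞} : ContDiffAt ℝ k (rQ Q) p := by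
  have : ContDiffAt ℝ k (fun p : Spacetime n => ‖xShift Q p‖) p := by
    refine ContDiffAt.norm ℝ ?_ (norm_pos_iff.1 hr0)
    unfold xShift; fun_prop
  exact this

lemma pd_rQ (hr0 : 0 < rQ Q p) (i : Idx n) : pd i (rQ Q) p = spat Q i p / rQ Q p := by
  have hd : DifferentiableAt ℝ (rQ Q) p := (contDiffAt_rQ hr0 (k := 1)).differentiableAt (by norm_num)
  have hc : ∀ j, DifferentiableAt ℝ (coord Q j) p := fun j =>
    (contDiff_coord Q j (k := 1)).differentiable (by norm_num) p
  have h1 : pd i (fun x => rQ Q x ^ 2) p = 2 * spat Q i p := by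
    have : (fun x => rQ Q x ^ 2) = fun x => ∑ j, coord Q (Sum.inr j) x ^ 2 :=
      funext fun x => rQ_sq Q x
    rw [this, pd_sum fun j _ => (hc _).fun_pow 2]
    simp only [pd_sq (hc _), pd_coord]
    rcases i with i | i <;> simp
  rw [pd_sq hd] at h1
  rw [eq_div_iff hr0.ne']
  linarith

lemma hasFRDeriv_rQ (hr0 : 0 < rQ Q p) : HasFRDeriv Q (rQ Q) 0 1 p :=
  ⟨(contDiffAt_rQ hr0 (k := 1)).differentiableAt (by norm_num), fun i => by rw [pd_rQ hr0]; ring⟩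

lemma hasFRDeriv_fQ : HasFRDeriv Q (fQ Q) 1 0 p :=
  ⟨(contDiff_fQ Q (k := 1)).differentiable (by norm_num) p, fun i => by rw [pd_fQ]; ring⟩

lemma hasFRDeriv_const (c : ℝ) : HasFRDeriv Q (fun _ => c) 0 0 p :=
  ⟨differentiableAt_const c, fun i => by rw [pd_const]; ring⟩

namespace HasFRDeriv

lemma add (hg : HasFRDeriv Q g gf gr p) (hh : HasFRDeriv Q h hf hr p) :
    HasFRDeriv Q (fun x => g x + h x) (gf + hf) (gr + hr) p :=
  ⟨hg.1.fun_add hh.1, fun i => by rw [pd_add hg.1 hh.1, hg.2, hh.2]; ring⟩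

lemma sub (hg : HasFRDeriv Q g gf gr p) (hh : HasFRDeriv Q h hf hr p) :
    HasFRDeriv Q (fun x => g x - h x) (gf - hf) (gr - hr) p :=
  ⟨hg.1.fun_sub hh.1, fun i => by rw [pd_sub hg.1 hh.1, hg.2, hh.2]; ring⟩

lemma mul (hg : HasFRDeriv Q g gf gr p) (hh : HasFRDeriv Q h hf hr p) :
    HasFRDeriv Q (fun x => g x * h x) (gf * h p + g p * hf) (gr * h p + g p * hr) p :=
  ⟨hg.1.fun_mul hh.1, fun i => by rw [pd_mul hg.1 hh.1, hg.2, hh.2]; ring⟩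

lemma const_mul (c : ℝ) (hh : HasFRDeriv Q h hf hr p) :
    HasFRDeriv Q (fun x => c * h x) (c * hf) (c * hr) p :=
  ⟨hh.1.const_mul c, fun i => by rw [pd_const_mul c hh.1, hh.2]; ring⟩

lemma comp {φ : ℝ → ℝ} {φ' : ℝ} (hφ : HasDerivAt φ φ' (h p)) (hh : HasFRDeriv Q h hf hr p) :
    HasFRDeriv Q (fun x => φ (h x)) (φ' * hf) (φ' * hr) p :=
  ⟨hφ.differentiableAt.comp p hh.1, fun i => by rw [pd_comp hφ hh.1, hh.2]; ring⟩

lemma inv (hh : HasFRDeriv Q h hf hr p) (h0 : h p ≠ 0) :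
    HasFRDeriv Q (fun x => (h x)⁻¹) (-hf / h p ^ 2) (-hr / h p ^ 2) p := by
  have := hh.comp (hasDerivAt_inv h0)
  refine ⟨this.1, fun i => ?_⟩
  rw [this.2]; ring

lemma div (hg : HasFRDeriv Q g gf gr p) (hh : HasFRDeriv Q h hf hr p) (h0 : h p ≠ 0) :
    HasFRDeriv Q (fun x => g x / h x) ((gf * h p - g p * hf) / h p ^ 2)
      ((gr * h p - g p * hr) / h p ^ 2) p := by
  have := hg.mul (hh.inv h0)
  refine ⟨by simpa only [div_eq_mul_inv] using this.1, fun i => ?_⟩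
  simp only [div_eq_mul_inv] at this ⊢
  rw [this.2]; field_simp; ring

lemma sqrt (hh : HasFRDeriv Q h hf hr p) (h0 : 0 < h p) :
    HasFRDeriv Q (fun x => √(h x)) (1 / (2 * √(h p)) * hf) (1 / (2 * √(h p)) * hr) p :=
  hh.comp (Real.hasDerivAt_sqrt h0.ne')

lemma log (hh : HasFRDeriv Q h hf hr p) (h0 : 0 < h p) :
    HasFRDeriv Q (fun x => Real.log (h x)) ((h p)⁻¹ * hf) ((h p)⁻¹ * hr) p :=
  hh.comp (Real.hasDerivAt_log h0.ne')

lemma congr_deriv (hh : HasFRDeriv Q h hf hr p) {hf' hr' : ℝ} (e1 : hf = hf') (e2 : hr = hr') :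
    HasFRDeriv Q h hf' hr' p := by rwa [← e1, ← e2]

end HasFRDeriv

/-! ### Contractions with the radial fields -/

lemma sum_sgn_coord_sq : ∑ i, sgn i * coord Q i p ^ 2 = 4 * fQ Q p := by
  rw [fQ_eq_sum, Finset.mul_sum]; exact Finset.sum_congr rfl fun i _ => by ring

lemma sum_spat_sq : ∑ i, spat Q i p ^ 2 = rQ Q p ^ 2 := by
  rw [rQ_sq, Fintype.sum_sum_type]; simp

lemma coord_mul_spat (i : Idx n) : coord Q i p * spat Q i p = spat Q i p ^ 2 := by
  rcases i with i | i <;> simp [sq]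

lemma sgn_mul_spat (i : Idx n) : sgn i * spat Q i p = spat Q i p := by
  rcases i with i | i <;> simp

/-- Homogeneity about Q: X f = 2f and X r = r. -/
lemma sum_coord_mul_pd (hh : HasFRDeriv Q h hf hr p) :
    ∑ i, coord Q i p * pd i h p = 2 * fQ Q p * hf + rQ Q p * hr := by
  have e : ∀ i, coord Q i p * pd i h p
      = hf / 2 * (sgn i * coord Q i p ^ 2) + hr / rQ Q p * (spat Q i p ^ 2) := fun i => by
    rw [hh.2, ← coord_mul_spat]; ring
  rw [Finset.sum_congr rfl fun i _ => e i, Finset.sum_add_distrib, ← Finset.mul_sum,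
    ← Finset.mul_sum, sum_sgn_coord_sq, sum_spat_sq]
  field_simp
  ring

/-- Here x f = r²/2 and x r = r, since x does not see the time variables. -/
lemma sum_spat_mul_pd (hh : HasFRDeriv Q h hf hr p) (hr0 : 0 < rQ Q p) :
    ∑ i, spat Q i p * pd i h p = rQ Q p ^ 2 / 2 * hf + rQ Q p * hr := by
  have e : ∀ i, spat Q i p * pd i h p
      = (hf / 2 + hr / rQ Q p) * (spat Q i p ^ 2) := fun i => by
    rw [hh.2]
    have h1 := coord_mul_spat (Q := Q) (p := p) i
    have h2 := sgn_mul_spat (Q := Q) (p := p) i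
    calc spat Q i p * (hf * (sgn i * coord Q i p / 2) + hr * (spat Q i p / rQ Q p))
        = hf / 2 * (coord Q i p * (sgn i * spat Q i p)) + hr / rQ Q p * spat Q i p ^ 2 := by ring
      _ = _ := by rw [h2, h1]; ring
  rw [Finset.sum_congr rfl fun i _ => e i, ← Finset.mul_sum, sum_spat_sq]
  field_simp

lemma sum_sgn_mul_pd (hh : HasFRDeriv Q h hf hr p) (ξ : Idx n → ℝ) :
    ∑ i, sgn i * ξ i * pd i h p
      = hf / 2 * (∑ i, coord Q i p * ξ i) + hr / rQ Q p * ∑ i, spat Q i p * ξ i := by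
  rw [Finset.mul_sum, Finset.mul_sum, ← Finset.sum_add_distrib]
  refine Finset.sum_congr rfl fun i _ => ?_
  rw [hh.2]
  calc sgn i * ξ i * (hf * (sgn i * coord Q i p / 2) + hr * (spat Q i p / rQ Q p))
      = (sgn i * sgn i) * (hf / 2 * (coord Q i p * ξ i))
        + hr / rQ Q p * ((sgn i * spat Q i p) * ξ i) := by ring
    _ = _ := by rw [sgn_mul_self, sgn_mul_spat, one_mul]

lemma differentiableAt_spat (i : Idx n) : DifferentiableAt ℝ (spat Q i) p := by
  rcases i with i | i
  · exact differentiableAt_const _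
  · exact (contDiff_coord Q (Sum.inr i) (k := 1)).differentiable (by norm_num) p

lemma contDiff_spat (i : Idx n) {k : WithTop ℕ∞} : ContDiff ℝ k (spat Q i) := by
  rcases i with i | i
  · exact contDiff_const
  · exact contDiff_coord Q (Sum.inr i)

lemma pd_spat (i j : Idx n) :
    pd i (spat Q j) p = if i = j then Sum.elim (fun _ => 0) (fun _ => 1) j else 0 := by
  rcases j with j | j
  · have : spat Q (Sum.inl j) = fun _ => 0 := rfl
    rw [this, pd_const]; simp
  · exact pd_coord Q i (Sum.inr j) p

/-- The field `α X + δ x`, where `X` is the position vector and `x` its spatial part. -/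
def radialField (Q : Spacetime n) (α δ : Spacetime n → ℝ) (i : Idx n) (p : Spacetime n) : ℝ :=
  α p * coord Q i p + δ p * spat Q i p

section Radial

variable {α δ : Spacetime n → ℝ} {αf αr δf δr : ℝ}

lemma differentiableAt_radialField (hα : DifferentiableAt ℝ α p) (hδ : DifferentiableAt ℝ δ p)
    (j : Idx n) : DifferentiableAt ℝ (radialField Q α δ j) p :=
  (hα.fun_mul ((contDiff_coord Q j (k := 1)).differentiable (by norm_num) p)).fun_add
    (hδ.fun_mul (differentiableAt_spat j))

lemma pd_radialField (hα : DifferentiableAt ℝ α p) (hδ : DifferentiableAt ℝ δ p) (i j : Idx n) :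
    pd i (radialField Q α δ j) p = pd i α p * coord Q j p + pd i δ p * spat Q j p
      + if i = j then α p + δ p * Sum.elim (fun _ => 0) (fun _ => 1) j else 0 := by
  have hc : DifferentiableAt ℝ (coord Q j) p :=
    (contDiff_coord Q j (k := 1)).differentiable (by norm_num) p
  unfold radialField
  rw [pd_add (hα.fun_mul hc) (hδ.fun_mul (differentiableAt_spat j)), pd_mul hα hc,
    pd_mul hδ (differentiableAt_spat j), pd_coord, pd_spat]
  split_ifs <;> ring

lemma sum_radialField_mul (ξ : Idx n → ℝ) :
    ∑ i, radialField Q α δ i p * ξ i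
      = α p * (∑ i, coord Q i p * ξ i) + δ p * ∑ i, spat Q i p * ξ i := by
  rw [Finset.mul_sum, Finset.mul_sum, ← Finset.sum_add_distrib]
  exact Finset.sum_congr rfl fun i _ => by unfold radialField; ring

lemma sum_radialField_mul_pd (hh : HasFRDeriv Q h hf hr p) (hr0 : 0 < rQ Q p) :
    ∑ i, radialField Q α δ i p * pd i h p =
      (2 * α p * fQ Q p + δ p * rQ Q p ^ 2 / 2) * hf + (α p + δ p) * rQ Q p * hr := by
  rw [sum_radialField_mul, sum_coord_mul_pd hh, sum_spat_mul_pd hh hr0]; ring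

/-- The divergence of a radial field. -/
lemma sum_pd_radialField (hα : HasFRDeriv Q α αf αr p) (hδ : HasFRDeriv Q δ δf δr p)
    (hr0 : 0 < rQ Q p) :
    ∑ i, pd i (radialField Q α δ i) p = (n + 2) * α p + n * δ p
      + (2 * fQ Q p * αf + rQ Q p * αr) + (rQ Q p ^ 2 / 2 * δf + rQ Q p * δr) := by
  rw [← sum_coord_mul_pd hα, ← sum_spat_mul_pd hδ hr0]
  have e : ∀ i, pd i (radialField Q α δ i) p = coord Q i p * pd i α p + spat Q i p * pd i δ p
      + (α p + δ p * Sum.elim (fun _ => 0) (fun _ => 1) i) := fun i => by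
    rw [pd_radialField hα.1 hδ.1]; simp; ring
  rw [Finset.sum_congr rfl fun i _ => e i]
  simp only [Finset.sum_add_distrib, ← Finset.mul_sum]
  simp [Fintype.sum_sum_type]
  ring

/-- The deformation of a radial field. -/
lemma sum_deformation_radialField (hα : HasFRDeriv Q α αf αr p) (hδ : HasFRDeriv Q δ δf δr p)
    (ξ : Idx n → ℝ) :
    ∑ i, ∑ j, sgn i * ξ i * pd i (radialField Q α δ j) p * ξ j =
      α p * (∑ i, sgn i * ξ i ^ 2) + δ p * (∑ j : Fin n, ξ (Sum.inr j) ^ 2)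
      + (αf / 2 * (∑ i, coord Q i p * ξ i) + αr / rQ Q p * ∑ i, spat Q i p * ξ i)
          * (∑ i, coord Q i p * ξ i)
      + (δf / 2 * (∑ i, coord Q i p * ξ i) + δr / rQ Q p * ∑ i, spat Q i p * ξ i)
          * ∑ i, spat Q i p * ξ i := by
  rw [← sum_sgn_mul_pd hα, ← sum_sgn_mul_pd hδ]
  have e : ∀ i, ∑ j, sgn i * ξ i * pd i (radialField Q α δ j) p * ξ j
      = sgn i * ξ i * pd i α p * (∑ j, coord Q j p * ξ j)
        + sgn i * ξ i * pd i δ p * (∑ j, spat Q j p * ξ j)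
        + (α p * (sgn i * ξ i ^ 2)
          + δ p * (sgn i * Sum.elim (fun _ => 0) (fun _ => 1) i * ξ i ^ 2)) := by
    intro i
    have e1 : ∀ j, sgn i * ξ i * pd i (radialField Q α δ j) p * ξ j
        = sgn i * ξ i * pd i α p * (coord Q j p * ξ j)
          + sgn i * ξ i * pd i δ p * (spat Q j p * ξ j)
          + if i = j then sgn i * ξ i * ξ j *
            (α p + δ p * Sum.elim (fun _ => 0) (fun _ => 1) j) else 0 := fun j => by
      rw [pd_radialField hα.1 hδ.1]; split_ifs <;> ring
    rw [Finset.sum_congr rfl fun j _ => e1 j]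
    simp only [Finset.sum_add_distrib, ← Finset.mul_sum, Finset.sum_ite_eq, Finset.mem_univ,
      if_true]
    ring
  rw [Finset.sum_congr rfl fun i _ => e i]
  simp only [Finset.sum_add_distrib, ← Finset.sum_mul, ← Finset.mul_sum]
  have e2 : ∑ i : Idx n, sgn i * Sum.elim (fun _ => (0 : ℝ)) (fun _ => 1) i * ξ i ^ 2
      = ∑ j : Fin n, ξ (Sum.inr j) ^ 2 := by
    simp [Fintype.sum_sum_type]
  rw [e2]
  ring

end Radial

end FR

/-! ### The phase and the multiplier field -/

section Phase

variable {n : ℕ}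

/-- `(1 + ε u_Q) (1 - ε v_Q)`. -/
def pMinus (Q : Spacetime n) (ε : ℝ) (p : Spacetime n) : ℝ := 1 - ε * rQ Q p + ε ^ 2 * fQ Q p

/-- `(1 - ε u_Q) (1 + ε v_Q)`. -/
def pPlus (Q : Spacetime n) (ε : ℝ) (p : Spacetime n) : ℝ := 1 + ε * rQ Q p + ε ^ 2 * fQ Q p

/-- The logarithm of the weight is `2 a` times this function. -/
def phase (Q : Spacetime n) (b ε : ℝ) (p : Spacetime n) : ℝ :=
  Real.log (fQ Q p) - Real.log (pMinus Q ε p) + 2 * b * (√(fQ Q p) / √(pPlus Q ε p))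

/-- The ratio of the two contributions to the gradient of the phase. -/
def betaF (Q : Spacetime n) (b ε : ℝ) (p : Spacetime n) : ℝ :=
  b * (√(fQ Q p) * pMinus Q ε p / (pPlus Q ε p * √(pPlus Q ε p)))

/-- The Cayley transform of `betaF`. -/
def thetaF (Q : Spacetime n) (b ε : ℝ) (p : Spacetime n) : ℝ :=
  (1 - betaF Q b ε p) / (1 + betaF Q b ε p)

/-- The coefficient of the position vector in the multiplier field. -/
def alphaF (Q : Spacetime n) (b ε : ℝ) (p : Spacetime n) : ℝ :=
  1 / 2 * (1 - ε * (thetaF Q b ε p * rQ Q p))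

/-- The coefficient of the spatial position vector in the multiplier field. -/
def deltaF (Q : Spacetime n) (b ε : ℝ) (p : Spacetime n) : ℝ :=
  ε * (thetaF Q b ε p * fQ Q p / rQ Q p)

/-- The factor between the gradient of the phase and the multiplier field. -/
def speedF (Q : Spacetime n) (b ε : ℝ) (p : Spacetime n) : ℝ :=
  (1 + betaF Q b ε p) / (fQ Q p * pMinus Q ε p)

/-- The multiplier field has the square length `f_Q` times this function. -/
def pTheta (Q : Spacetime n) (b ε : ℝ) (p : Spacetime n) : ℝ :=
  1 - ε * (thetaF Q b ε p * rQ Q p) + ε ^ 2 * (thetaF Q b ε p * thetaF Q b ε p * fQ Q p)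

/-- The square length of the gradient of `a` times the phase. -/
def potential (Q : Spacetime n) (a b ε : ℝ) (p : Spacetime n) : ℝ :=
  a ^ 2 * (speedF Q b ε p * speedF Q b ε p * (fQ Q p * pTheta Q b ε p))

/-- The multiplier field. -/
abbrev multField (Q : Spacetime n) (b ε : ℝ) : Idx n → Spacetime n → ℝ :=
  radialField Q (alphaF Q b ε) (deltaF Q b ε)

/-- The part of the cone on which `ε r_Q` and `b f_Q^{1/2}` are small. -/
def goodRegion (Q : Spacetime n) (b ε : ℝ) : Set (Spacetime n) :=
  exteriorCone Q ∩ {p | ε * rQ Q p < 1 / 100 ∧ b * √(fQ Q p) < 1 / 100}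

variable {Q p : Spacetime n} {a b ε : ℝ}

lemma continuous_rQ : Continuous (rQ Q) := by
  unfold rQ xShift; fun_prop

lemma isOpen_goodRegion : IsOpen (goodRegion Q b ε) := by
  refine (isOpen_exteriorCone Q).inter (IsOpen.inter ?_ ?_)
  · exact isOpen_lt (continuous_const.mul continuous_rQ) continuous_const
  · exact isOpen_lt (continuous_const.mul (contDiff_fQ Q (k := 0)).continuous.sqrt)
      continuous_const

lemma four_fQ_le : 4 * fQ Q p ≤ rQ Q p ^ 2 := by
  rw [fQ_eq]; nlinarith [sq_nonneg (tauQ Q p)]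

/-- Elementary bounds on the good region. -/
structure GoodBounds (Q : Spacetime n) (b ε : ℝ) (p : Spacetime n) : Prop where
  f_pos : 0 < fQ Q p
  r_pos : 0 < rQ Q p
  four_f_le : 4 * fQ Q p ≤ rQ Q p ^ 2
  er_lt : ε * rQ Q p < 1 / 100
  ef_le : ε ^ 2 * fQ Q p ≤ ε * rQ Q p / 400
  pMinus_ge : 99 / 100 ≤ pMinus Q ε p
  pMinus_le : pMinus Q ε p ≤ 1
  pPlus_ge : 1 ≤ pPlus Q ε p
  pPlus_le : pPlus Q ε p ≤ 102 / 100
  beta_ge : 95 / 100 * (b * √(fQ Q p)) ≤ betaF Q b ε p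
  beta_le : betaF Q b ε p ≤ b * √(fQ Q p)
  beta_pos : 0 < betaF Q b ε p
  beta_lt : betaF Q b ε p < 1 / 100

lemma goodBounds (hb : 0 < b) (hε : 0 < ε) (hp : p ∈ goodRegion Q b ε) : GoodBounds Q b ε p := by
  have hf : 0 < fQ Q p := hp.1
  have hr : 0 < rQ Q p := rQ_pos hp.1
  have hy : ε * rQ Q p < 1 / 100 := hp.2.1
  have hβ : b * √(fQ Q p) < 1 / 100 := hp.2.2
  have h4 := four_fQ_le (Q := Q) (p := p)
  have hy0 : 0 < ε * rQ Q p := mul_pos hε hr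
  -- From 4f ≤ r² one gets ε²f ≤ (εr)²/4, and one factor εr is below 1/100.
  have hg : ε ^ 2 * fQ Q p ≤ ε * rQ Q p / 400 := by
    have : ε ^ 2 * (4 * fQ Q p) ≤ ε ^ 2 * rQ Q p ^ 2 := by gcongr
    nlinarith
  have hg0 : 0 < ε ^ 2 * fQ Q p := by positivity
  have hm1 : 99 / 100 ≤ pMinus Q ε p := by unfold pMinus; linarith
  have hm2 : pMinus Q ε p ≤ 1 := by unfold pMinus; linarith
  have hp1 : 1 ≤ pPlus Q ε p := by unfold pPlus; linarith
  have hp2 : pPlus Q ε p ≤ 102 / 100 := by unfold pPlus; linarith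
  have hs0 : 0 < b * √(fQ Q p) := mul_pos hb (Real.sqrt_pos.2 hf)
  have ht1 : 1 ≤ √(pPlus Q ε p) := Real.one_le_sqrt.2 hp1
  have ht2 : √(pPlus Q ε p) ≤ 102 / 100 :=
    Real.sqrt_le_iff.2 ⟨by norm_num, by linarith⟩
  have hden : 0 < pPlus Q ε p * √(pPlus Q ε p) := by positivity
  have e : betaF Q b ε p = b * √(fQ Q p) * (pMinus Q ε p / (pPlus Q ε p * √(pPlus Q ε p))) := by
    unfold betaF; ring
  have hq1 : pMinus Q ε p / (pPlus Q ε p * √(pPlus Q ε p)) ≤ 1 := by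
    rw [div_le_one hden]; nlinarith
  have hq2 : 95 / 100 ≤ pMinus Q ε p / (pPlus Q ε p * √(pPlus Q ε p)) := by
    rw [le_div_iff₀ hden]
    have : pPlus Q ε p * √(pPlus Q ε p) ≤ 102 / 100 * (102 / 100) := by gcongr
    linarith
  have b1 : 95 / 100 * (b * √(fQ Q p)) ≤ betaF Q b ε p := by rw [e]; nlinarith
  have b2 : betaF Q b ε p ≤ b * √(fQ Q p) := by rw [e]; nlinarith
  exact ⟨hf, hr, h4, hy, hg, hm1, hm2, hp1, hp2, b1, b2, by linarith, by linarith⟩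

lemma hasFRDeriv_pMinus (hr0 : 0 < rQ Q p) : HasFRDeriv Q (pMinus Q ε) (ε ^ 2) (-ε) p :=
  (((hasFRDeriv_const 1).sub ((hasFRDeriv_rQ hr0).const_mul ε)).add
    (hasFRDeriv_fQ.const_mul (ε ^ 2))).congr_deriv (by ring) (by ring)

lemma hasFRDeriv_pPlus (hr0 : 0 < rQ Q p) : HasFRDeriv Q (pPlus Q ε) (ε ^ 2) ε p :=
  (((hasFRDeriv_const 1).add ((hasFRDeriv_rQ hr0).const_mul ε)).add
    (hasFRDeriv_fQ.const_mul (ε ^ 2))).congr_deriv (by ring) (by ring)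

/-- `∂_f β`. -/
def betaDf (Q : Spacetime n) (b ε : ℝ) (p : Spacetime n) : ℝ :=
  betaF Q b ε p * (1 / (2 * fQ Q p) + ε ^ 2 / pMinus Q ε p - 3 * ε ^ 2 / (2 * pPlus Q ε p))

/-- `∂_r β`. -/
def betaDr (Q : Spacetime n) (b ε : ℝ) (p : Spacetime n) : ℝ :=
  -(betaF Q b ε p * (ε * (1 / pMinus Q ε p + 3 / (2 * pPlus Q ε p))))

lemma hasFRDeriv_betaF (h : GoodBounds Q b ε p) :
    HasFRDeriv Q (betaF Q b ε) (betaDf Q b ε p) (betaDr Q b ε p) p := by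
  have hm : 0 < pMinus Q ε p := by linarith [h.pMinus_ge]
  have hp : 0 < pPlus Q ε p := by linarith [h.pPlus_ge]
  have ht := Real.sqrt_pos.2 hp
  have hs := Real.sqrt_pos.2 h.f_pos
  have h1 := ((((hasFRDeriv_fQ (p := p) (Q := Q)).sqrt h.f_pos).mul
    (hasFRDeriv_pMinus (ε := ε) h.r_pos)).div ((hasFRDeriv_pPlus (ε := ε) h.r_pos).mul
      ((hasFRDeriv_pPlus (ε := ε) h.r_pos).sqrt hp)) (by positivity)).const_mul b
  refine h1.congr_deriv ?_ ?_
  · unfold betaDf betaF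
    have e1 := Real.sq_sqrt h.f_pos.le
    have e2 := Real.sq_sqrt hp.le
    revert hs ht e1 e2 hm
    generalize √(fQ Q p) = s
    generalize √(pPlus Q ε p) = t
    generalize pMinus Q ε p = m
    intro hm ht hs e1 e2
    -- In the variables s = √f and t = √`pPlus` the claim is a rational identity.
    rw [← e1, ← e2]
    field_simp
    ring
  · unfold betaDr betaF
    have e2 := Real.sq_sqrt hp.le
    revert hs ht e2 hm
    generalize √(fQ Q p) = s
    generalize √(pPlus Q ε p) = t
    generalize pMinus Q ε p = m
    intro hm ht hs e2
    rw [← e2]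
    field_simp
    ring

/-- `∂_f θ`. -/
def thetaDf (Q : Spacetime n) (b ε : ℝ) (p : Spacetime n) : ℝ :=
  -2 / (1 + betaF Q b ε p) ^ 2 * betaDf Q b ε p

/-- `∂_r θ`. -/
def thetaDr (Q : Spacetime n) (b ε : ℝ) (p : Spacetime n) : ℝ :=
  -2 / (1 + betaF Q b ε p) ^ 2 * betaDr Q b ε p

lemma hasFRDeriv_thetaF (h : GoodBounds Q b ε p) :
    HasFRDeriv Q (thetaF Q b ε) (thetaDf Q b ε p) (thetaDr Q b ε p) p := by
  have hβ := h.beta_pos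
  have h1 := ((hasFRDeriv_const 1).sub (hasFRDeriv_betaF h)).div
    ((hasFRDeriv_const 1).add (hasFRDeriv_betaF h)) (by positivity)
  refine h1.congr_deriv ?_ ?_
  · unfold thetaDf; field_simp; ring
  · unfold thetaDr; field_simp; ring

lemma hasFRDeriv_alphaF (h : GoodBounds Q b ε p) :
    HasFRDeriv Q (alphaF Q b ε) (-(ε * rQ Q p * thetaDf Q b ε p) / 2)
      (-(ε * (thetaF Q b ε p + rQ Q p * thetaDr Q b ε p)) / 2) p :=
  (((hasFRDeriv_const 1).sub (((hasFRDeriv_thetaF h).mul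
    (hasFRDeriv_rQ h.r_pos)).const_mul ε)).const_mul (1 / 2)).congr_deriv (by ring) (by ring)

lemma hasFRDeriv_deltaF (h : GoodBounds Q b ε p) :
    HasFRDeriv Q (deltaF Q b ε)
      (ε * (thetaF Q b ε p + fQ Q p * thetaDf Q b ε p) / rQ Q p)
      (ε * fQ Q p * (thetaDr Q b ε p / rQ Q p - thetaF Q b ε p / rQ Q p ^ 2)) p := by
  have hr := h.r_pos
  refine ((((hasFRDeriv_thetaF h).mul hasFRDeriv_fQ).div
    (hasFRDeriv_rQ hr) hr.ne').const_mul ε).congr_deriv ?_ ?_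
  · field_simp; ring
  · field_simp; ring

lemma hasFRDeriv_speedF (h : GoodBounds Q b ε p) :
    HasFRDeriv Q (speedF Q b ε)
      (speedF Q b ε p * (betaDf Q b ε p / (1 + betaF Q b ε p) - 1 / fQ Q p
        - ε ^ 2 / pMinus Q ε p))
      (speedF Q b ε p * (betaDr Q b ε p / (1 + betaF Q b ε p) + ε / pMinus Q ε p)) p := by
  have hm : 0 < pMinus Q ε p := by linarith [h.pMinus_ge]
  have hf := h.f_pos
  have hβ := h.beta_pos
  have h1 := ((hasFRDeriv_const 1).add (hasFRDeriv_betaF h)).div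
    (hasFRDeriv_fQ.mul (hasFRDeriv_pMinus (ε := ε) h.r_pos)) (by positivity)
  refine h1.congr_deriv ?_ ?_
  · unfold speedF; field_simp; ring
  · unfold speedF; field_simp; ring

/-- This is where θ comes from. Direct differentiation gives (1 − εr) + β(1 + εr) and ε(1 − β), up
to the denominators. These are (1 + β)(1 − εθr) and (1 + β)εθ, so the same factor W comes out of
both derivatives. -/
lemma hasFRDeriv_phase (h : GoodBounds Q b ε p) :
    HasFRDeriv Q (phase Q b ε) (speedF Q b ε p * (1 - ε * (thetaF Q b ε p * rQ Q p)))
      (speedF Q b ε p * (ε * (thetaF Q b ε p * fQ Q p))) p := by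
  have hm : 0 < pMinus Q ε p := by linarith [h.pMinus_ge]
  have hp : 0 < pPlus Q ε p := by linarith [h.pPlus_ge]
  have ht := Real.sqrt_pos.2 hp
  have hs := Real.sqrt_pos.2 h.f_pos
  have hβ := h.beta_pos
  have h1 := ((hasFRDeriv_fQ.log h.f_pos).sub ((hasFRDeriv_pMinus (ε := ε) h.r_pos).log hm)).add
    (((hasFRDeriv_fQ.sqrt h.f_pos).div ((hasFRDeriv_pPlus (ε := ε) h.r_pos).sqrt hp)
      ht.ne').const_mul (2 * b))
  have e1 : speedF Q b ε p * (1 - ε * (thetaF Q b ε p * rQ Q p)) =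
      ((1 - ε * rQ Q p) + betaF Q b ε p * (1 + ε * rQ Q p)) / (fQ Q p * pMinus Q ε p) := by
    unfold speedF thetaF; field_simp; ring
  have e2 : speedF Q b ε p * (ε * (thetaF Q b ε p * fQ Q p)) =
      ε * (1 - betaF Q b ε p) / pMinus Q ε p := by
    have hf := h.f_pos
    unfold speedF thetaF; field_simp
  rw [e1, e2]
  have q1 := Real.sq_sqrt h.f_pos.le
  have q2 := Real.sq_sqrt hp.le
  have q3 : rQ Q p * ε = 1 + ε ^ 2 * fQ Q p - pMinus Q ε p := by unfold pMinus; ring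
  have q4 : pPlus Q ε p = 2 + 2 * ε ^ 2 * fQ Q p - pMinus Q ε p := by unfold pPlus pMinus; ring
  have q5 : ε * rQ Q p = 1 + ε ^ 2 * fQ Q p - pMinus Q ε p := by unfold pMinus; ring
  refine h1.congr_deriv ?_ ?_
  · unfold betaF
    rw [q5]
    revert hs ht q1 q2 q4 hm
    generalize √(fQ Q p) = s
    generalize √(pPlus Q ε p) = t
    generalize pMinus Q ε p = m
    intro hm ht hs q1 q2 q4
    rw [← q2] at q4 ⊢
    rw [← q1] at q4 ⊢
    -- The relation `pMinus` + `pPlus` = 2 + 2ε²f eliminates `pMinus`.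
    have hmt : m = 2 + 2 * ε ^ 2 * s ^ 2 - t ^ 2 := by linarith
    field_simp
    rw [hmt]
    ring
  · unfold betaF
    revert hs ht q1 q2 hm
    generalize √(fQ Q p) = s
    generalize √(pPlus Q ε p) = t
    generalize pMinus Q ε p = m
    intro hm ht hs q1 q2
    rw [← q2]
    field_simp
    ring

/-- The gradient of the phase is parallel to the multiplier field. -/
lemma pd_phase (h : GoodBounds Q b ε p) (i : Idx n) :
    pd i (phase Q b ε) p = speedF Q b ε p * (sgn i * multField Q b ε i p) := by
  rw [(hasFRDeriv_phase h).2 i]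
  have h1 := sgn_mul_spat (Q := Q) (p := p) i
  have hr := h.r_pos
  have e : sgn i * multField Q b ε i p
      = alphaF Q b ε p * (sgn i * coord Q i p) + deltaF Q b ε p * spat Q i p := by
    calc sgn i * multField Q b ε i p
        = alphaF Q b ε p * (sgn i * coord Q i p) + deltaF Q b ε p * (sgn i * spat Q i p) := by
          simp only [multField, radialField]; ring
      _ = _ := by rw [h1]
  rw [e]
  unfold alphaF deltaF
  field_simp

/-- `pTheta` is `pMinus` with εθ in place of ε: the field keeps the algebraic shape it has for b =
0, when θ = 1. -/
lemma sum_sgn_multField_sq (h : GoodBounds Q b ε p) :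
    ∑ i, sgn i * multField Q b ε i p ^ 2 = fQ Q p * pTheta Q b ε p := by
  have e : ∀ i, sgn i * multField Q b ε i p ^ 2 = alphaF Q b ε p ^ 2 * (sgn i * coord Q i p ^ 2)
      + (2 * alphaF Q b ε p * deltaF Q b ε p + deltaF Q b ε p ^ 2) * spat Q i p ^ 2 := fun i => by
    have h1 := sgn_mul_spat (Q := Q) (p := p) i
    have h2 := coord_mul_spat (Q := Q) (p := p) i
    calc sgn i * multField Q b ε i p ^ 2
        = alphaF Q b ε p ^ 2 * (sgn i * coord Q i p ^ 2)
          + 2 * alphaF Q b ε p * deltaF Q b ε p * (coord Q i p * (sgn i * spat Q i p))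
          + deltaF Q b ε p ^ 2 * (spat Q i p * (sgn i * spat Q i p)) := by
            simp only [multField, radialField]; ring
      _ = _ := by rw [h1, h2]; ring
  have hr := h.r_pos
  rw [Finset.sum_congr rfl fun i _ => e i, Finset.sum_add_distrib, ← Finset.mul_sum,
    ← Finset.mul_sum, sum_sgn_coord_sq, sum_spat_sq]
  unfold alphaF deltaF pTheta
  field_simp
  ring

lemma hasFRDeriv_pTheta (h : GoodBounds Q b ε p) :
    HasFRDeriv Q (pTheta Q b ε)
      (-(ε * rQ Q p * thetaDf Q b ε p) + ε ^ 2 * (thetaF Q b ε p ^ 2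
        + 2 * thetaF Q b ε p * thetaDf Q b ε p * fQ Q p))
      (-(ε * (thetaF Q b ε p + rQ Q p * thetaDr Q b ε p))
        + ε ^ 2 * (2 * thetaF Q b ε p * thetaDr Q b ε p * fQ Q p)) p := by
  have hθ := hasFRDeriv_thetaF h
  exact (((hasFRDeriv_const 1).sub ((hθ.mul (hasFRDeriv_rQ h.r_pos)).const_mul ε)).add
    (((hθ.mul hθ).mul hasFRDeriv_fQ).const_mul (ε ^ 2))).congr_deriv (by ring) (by ring)

lemma hasFRDeriv_potential {wf wr tf tr : ℝ}
    (hw : HasFRDeriv Q (speedF Q b ε) (speedF Q b ε p * wf) (speedF Q b ε p * wr) p)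
    (ht : HasFRDeriv Q (pTheta Q b ε) tf tr p) :
    HasFRDeriv Q (potential Q a b ε)
      (a ^ 2 * speedF Q b ε p ^ 2 * (2 * wf * fQ Q p * pTheta Q b ε p
        + pTheta Q b ε p + fQ Q p * tf))
      (a ^ 2 * speedF Q b ε p ^ 2 * (2 * wr * fQ Q p * pTheta Q b ε p + fQ Q p * tr)) p :=
  (((hw.mul hw).mul (hasFRDeriv_fQ.mul ht)).const_mul (a ^ 2)).congr_deriv (by ring) (by ring)

end Phase

/-! ### Scalar estimates -/

/-- The discriminant is negative: 4 · 0.12 · 4 = 1.92 exceeds 1.2² = 1.44. -/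
lemma quadratic_nonneg {P M R x w : ℝ} (hP : 12 / 100 ≤ P) (hR : 4 ≤ R) (hM : |M| ≤ 12 / 10) :
    0 ≤ P * x ^ 2 + M * x * w + R * w ^ 2 := by
  have h1 := abs_le.1 hM
  nlinarith [sq_nonneg (x + 8 * w), sq_nonneg (x - 8 * w), sq_nonneg x, sq_nonneg w,
    mul_nonneg (sub_nonneg.2 h1.2) (sq_nonneg (3 * x - 20 * w)),
    mul_nonneg (by linarith [h1.1] : 0 ≤ M + 12 / 10) (sq_nonneg (3 * x + 20 * w)),
    mul_nonneg (sub_nonneg.2 hP) (sq_nonneg x), mul_nonneg (sub_nonneg.2 hR) (sq_nonneg w)]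

/-- The mixed form stems from the derivatives of θ and is indefinite. A multiple of β times the
square of Sξ compensates for it. After division by β and with y w as the second variable, the
coefficient of x² is at least 0.12 because of that square, and the other one is at least 4 because
of the lower bound on B. -/
lemma cross_term_bound {y θ β A B x w : ℝ} (hy0 : 0 < y) (hy : y ≤ 1 / 100)
    (hθ0 : 97 / 100 ≤ θ) (hθ1 : θ ≤ 1) (hβ : 0 < β) (hA0 : 9 / 10 * β ≤ A)
    (hA1 : A ≤ 11 / 10 * β) (hB0 : 4 * y * β ≤ B) (hB1 : B ≤ 6 * y * β) :
    0 ≤ y * ((x - w) * (A * x - B * w)) + β / 2 * ((1 - y * θ) / 2 * x + y * θ / 2 * w) ^ 2 := by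
  obtain ⟨a1, rfl⟩ : ∃ a1, A = β * a1 := ⟨A / β, by field_simp⟩
  obtain ⟨b1, rfl⟩ : ∃ b1, B = y * β * b1 := ⟨B / (y * β), by field_simp⟩
  have ha0 : 9 / 10 ≤ a1 := by nlinarith
  have ha1 : a1 ≤ 11 / 10 := by nlinarith
  have hyβ : 0 < y * β := by positivity
  have hb0 : 4 ≤ b1 := by nlinarith
  have hb1 : b1 ≤ 6 := by nlinarith
  have hyθ0 : 0 ≤ y * θ := by nlinarith
  have hyθ1 : y * θ ≤ 1 / 100 := by nlinarith
  have key := quadratic_nonneg (P := y * a1 + (1 - y * θ) ^ 2 / 8)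
    (M := -(a1 + b1 * y) + (1 - y * θ) * θ / 4) (R := b1 + θ ^ 2 / 8) (x := x) (w := y * w)
    (by nlinarith) (by nlinarith) (by
      rw [abs_le]
      have h1 : 0 ≤ (1 - y * θ) * θ := mul_nonneg (by linarith) (by linarith)
      have h2 : (1 - y * θ) * θ ≤ 1 := by nlinarith
      have h3 : 0 ≤ b1 * y := by positivity
      have h4 : b1 * y ≤ 6 / 100 := by nlinarith
      constructor <;> linarith)
  calc (0 : ℝ) ≤ β * _ := mul_nonneg hβ.le key
    _ = _ := by ring

/-- When σ is small, so is x, and hence w is close to −T. The gap T² ≤ (1 − 4κ)E, in the form (1 +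
4κ)T² ≤ E, then pays for the terms in w² and T². -/
lemma deformation_core {κ m σ x w T E : ℝ} (hκ0 : 0 < κ) (hκ : κ ≤ 1 / 4) (hm0 : 0 ≤ m)
    (hm1 : m ≤ 2 / 100) (hx2 : x ^ 2 ≤ 42 / 10 * σ ^ 2) (hwe : w * (1 + 2 * m * κ) = x - T)
    (hT : T ^ 2 ≤ (1 - 4 * κ) * E) (hE : 0 ≤ E) :
    -(2 * σ ^ 2) ≤ κ * (E / 2 - w ^ 2 / 2 - (E - T ^ 2) / 4) ∧
      (x - 2 * m * κ * w) ^ 2 ≤ 9 * σ ^ 2 + κ * (E - T ^ 2) := by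
  have hmκ : 0 ≤ m * κ := by positivity
  have hw2 : w ^ 2 ≤ (x - T) ^ 2 := by
    rw [← hwe, mul_pow]
    have : 1 ≤ (1 + 2 * m * κ) ^ 2 := one_le_pow₀ (by linarith)
    exact le_mul_of_one_le_right (sq_nonneg w) this
  have hΞ : (1 + 4 * κ) * T ^ 2 ≤ E := by
    have h3 : (1 + 4 * κ) * T ^ 2 ≤ (1 + 4 * κ) * ((1 - 4 * κ) * E) :=
      mul_le_mul_of_nonneg_left hT (by linarith)
    have h4 : 0 ≤ κ ^ 2 * E := by positivity
    linarith
  have hx0 := sq_nonneg x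
  have hκx : κ * x ^ 2 ≤ 1 / 4 * x ^ 2 := mul_le_mul_of_nonneg_right hκ hx0
  refine ⟨?_, ?_⟩
  · have h4 : κ * (κ * T ^ 2 + x * T - x ^ 2 / 2)
        ≤ κ * (E / 2 - w ^ 2 / 2 - (E - T ^ 2) / 4) :=
      mul_le_mul_of_nonneg_left (by linarith) hκ0.le
    have h5 := sq_nonneg (κ * T + x / 2)
    linarith
  · have h7 : (x - 2 * m * κ * w) ^ 2 ≤ 2 * x ^ 2 + 8 * (m ^ 2 * (κ ^ 2 * w ^ 2)) := by
      have := sq_nonneg (x + 2 * m * κ * w)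
      linarith
    have hk2 : κ ^ 2 ≤ 1 / 16 := by
      have := mul_self_le_mul_self hκ0.le hκ
      linarith
    have h8 : κ ^ 2 * w ^ 2 ≤ x ^ 2 / 8 + 2 * (κ ^ 2 * T ^ 2) := by
      have h0 : w ^ 2 ≤ 2 * x ^ 2 + 2 * T ^ 2 := by
        have := sq_nonneg (x + T)
        linarith
      have h1 := mul_le_mul_of_nonneg_left h0 (sq_nonneg κ)
      have h2 := mul_le_mul_of_nonneg_right hk2 hx0
      linarith
    have h9 : 4 * (κ ^ 2 * T ^ 2) ≤ κ * (E - T ^ 2) := by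
      have : 4 * κ * T ^ 2 ≤ E - T ^ 2 := by linarith
      have := mul_le_mul_of_nonneg_left this hκ0.le
      linarith
    have hmm : m ^ 2 ≤ 1 / 1000 := by
      have := mul_self_le_mul_self hm0 hm1
      linarith
    have h10 : m ^ 2 * (κ ^ 2 * w ^ 2) ≤ 1 / 1000 * (x ^ 2 / 8 + 2 * (κ ^ 2 * T ^ 2)) :=
      mul_le_mul hmm h8 (by positivity) (by norm_num)
    have := sq_nonneg (κ * T)
    linarith

/-- Lower bound for the deformation form of the multiplier field, with the derivatives of the
function entering through `χ = X ξ`, `w = x ξ`, `T = t ξ`, `Ξ = |ξ_t|²` and `Γ = |ξ_x|²`. -/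
lemma deformation_bound {r y κ θ β A B χ w T Ξ Γ : ℝ} (hr : 0 < r) (hy0 : 0 < y)
    (hy : y ≤ 1 / 100) (hκ0 : 0 < κ) (hκ : κ ≤ 1 / 4) (hθ0 : 97 / 100 ≤ θ) (hθ1 : θ ≤ 1)
    (hβ : 0 < β) (hA0 : 9 / 10 * β ≤ A) (hA1 : A ≤ 11 / 10 * β) (hB0 : 4 * y * β ≤ B)
    (hB1 : B ≤ 6 * y * β) (hχ : χ = w + T) (hΞ : 0 ≤ Ξ) (hT : T ^ 2 ≤ (1 - 4 * κ) * r ^ 2 * Ξ)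
    (hw : w ^ 2 ≤ r ^ 2 * Γ) {σ : ℝ} (hσ : σ = (1 - y * θ) / 2 * χ + y * θ * κ * w) :
    y / r ^ 2 / 8 * (χ ^ 2 + κ * r ^ 2 * (Γ - w ^ 2 / r ^ 2) + κ * r ^ 2 * (Ξ - T ^ 2 / r ^ 2))
      - (4 * (y / r ^ 2) + β / (8 * (κ * r ^ 2))) * σ ^ 2 ≤
    y / r ^ 2 * (-(κ * r ^ 2 / 2) * (Γ - Ξ) + θ * (κ * r ^ 2) * Γ + A / (4 * κ) * χ ^ 2
      - (A + B) / 2 * χ * w + κ * (B - θ) * w ^ 2) := by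
  have hr2 : 0 < r ^ 2 := by positivity
  have hyθ0 : 0 ≤ y * θ := mul_nonneg hy0.le (by linarith)
  have hyθ1 : y * θ ≤ 1 / 100 := by
    have := mul_le_mul_of_nonneg_left hθ1 hy0.le
    linarith
  have h1 := cross_term_bound (x := χ) (w := 2 * κ * w) hy0 hy hθ0 hθ1 hβ hA0 hA1 hB0 hB1
  have hσ' : (1 - y * θ) / 2 * χ + y * θ / 2 * (2 * κ * w) = σ := by rw [hσ]; ring
  rw [hσ'] at h1
  -- x is χ corrected along w so as to be an exact multiple of σ; the number m below measures the
  -- correction.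
  obtain ⟨x, hx⟩ : ∃ x, x = 2 * σ / (1 - y * θ) := ⟨_, rfl⟩
  have hpos : 0 < 1 - y * θ := by linarith
  have hxσ : x * (1 - y * θ) = 2 * σ := by rw [hx]; field_simp
  obtain ⟨m, hm⟩ : ∃ m, m = y * θ / (1 - y * θ) := ⟨_, rfl⟩
  have hm0 : 0 ≤ m := by rw [hm]; positivity
  have hm1 : m ≤ 2 / 100 := by rw [hm, div_le_iff₀ hpos]; linarith
  have hxe : χ + 2 * m * κ * w = x := by
    rw [hx, hm, hσ]; field_simp
  have hx2 : x ^ 2 ≤ 42 / 10 * σ ^ 2 := by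
    have h0 : (x * (1 - y * θ)) ^ 2 = 4 * σ ^ 2 := by rw [hxσ]; ring
    have h99 : (99 / 100) ^ 2 ≤ (1 - y * θ) ^ 2 := by gcongr; linarith
    have h2 := mul_le_mul_of_nonneg_left h99 (sq_nonneg x)
    rw [mul_pow] at h0
    linarith [sq_nonneg σ]
  have hwe : w * (1 + 2 * m * κ) = x - T := by rw [← hxe, hχ]; ring
  obtain ⟨hE2, hχ2⟩ := deformation_core hκ0 hκ hm0 hm1 hx2 hwe
    (E := r ^ 2 * Ξ) (by linarith) (by positivity)
  rw [show x - 2 * m * κ * w = χ by linarith] at hχ2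
  -- clear denominators
  have hang : 0 ≤ κ * (r ^ 2 * Γ - w ^ 2) := mul_nonneg hκ0.le (by linarith)
  -- The inequality multiplied by r². `h11` treats the terms from the derivatives of θ, at the price
  -- of β σ²/(8κ); `h14` treats the rest, at the price of 4yσ².
  have hfin : y / 8 * (χ ^ 2 + κ * (r ^ 2 * Γ - w ^ 2) + κ * (r ^ 2 * Ξ - T ^ 2))
      - 4 * y * σ ^ 2 - β / (8 * κ) * σ ^ 2 ≤
      y * (-(κ * (r ^ 2 * Γ - r ^ 2 * Ξ) / 2) + θ * κ * (r ^ 2 * Γ) - κ * θ * w ^ 2)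
      + 1 / (4 * κ) * (y * ((χ - 2 * κ * w) * (A * χ - B * (2 * κ * w)))) := by
    have h11 : -(β / (8 * κ) * σ ^ 2) ≤
        1 / (4 * κ) * (y * ((χ - 2 * κ * w) * (A * χ - B * (2 * κ * w)))) := by
      have h12 : 0 ≤ 1 / (4 * κ) * (y * ((χ - 2 * κ * w) * (A * χ - B * (2 * κ * w)))
          + β / 2 * σ ^ 2) := mul_nonneg (by positivity) h1
      have h13 : 1 / (4 * κ) * (β / 2 * σ ^ 2) = β / (8 * κ) * σ ^ 2 := by field_simp; ring
      linarith
    have h14 : (χ ^ 2 + κ * (r ^ 2 * Γ - w ^ 2) + κ * (r ^ 2 * Ξ - T ^ 2)) / 8 - 4 * σ ^ 2 ≤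
        -(κ * (r ^ 2 * Γ - r ^ 2 * Ξ) / 2) + θ * κ * (r ^ 2 * Γ) - κ * θ * w ^ 2 := by
      have h15 : 97 / 100 * (κ * (r ^ 2 * Γ - w ^ 2)) ≤ θ * (κ * (r ^ 2 * Γ - w ^ 2)) := by gcongr
      linarith [sq_nonneg σ]
    have h16 := mul_le_mul_of_nonneg_left h14 hy0.le
    linarith
  have hL : y / r ^ 2 / 8 * (χ ^ 2 + κ * r ^ 2 * (Γ - w ^ 2 / r ^ 2)
      + κ * r ^ 2 * (Ξ - T ^ 2 / r ^ 2)) - (4 * (y / r ^ 2) + β / (8 * (κ * r ^ 2))) * σ ^ 2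
      = (y / 8 * (χ ^ 2 + κ * (r ^ 2 * Γ - w ^ 2) + κ * (r ^ 2 * Ξ - T ^ 2))
      - 4 * y * σ ^ 2 - β / (8 * κ) * σ ^ 2) / r ^ 2 := by
    field_simp
    ring
  have hRR : y / r ^ 2 * (-(κ * r ^ 2 / 2) * (Γ - Ξ) + θ * (κ * r ^ 2) * Γ + A / (4 * κ) * χ ^ 2
      - (A + B) / 2 * χ * w + κ * (B - θ) * w ^ 2)
      = (y * (-(κ * (r ^ 2 * Γ - r ^ 2 * Ξ) / 2) + θ * κ * (r ^ 2 * Γ) - κ * θ * w ^ 2)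
      + 1 / (4 * κ) * (y * ((χ - 2 * κ * w) * (A * χ - B * (2 * κ * w))))) / r ^ 2 := by
    field_simp
    ring
  rw [hL, hRR]
  exact div_le_div_of_nonneg_right hfin hr2.le

/-- The logarithmic derivative of the speed along the multiplier field, in scaled variables. -/
lemma speed_derivative_bounds {y κ β θ Pm Pp u1 u2 b1 : ℝ} (hy0 : 0 < y) (hy : y ≤ 1 / 100)
    (hκ0 : 0 < κ) (hκ : κ ≤ 1 / 4) (hβ0 : 0 < β) (hβ : β ≤ 1 / 100)
    (hPm : Pm = 1 - y + y ^ 2 * κ) (hPp : Pp = 1 + y + y ^ 2 * κ)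
    (hθ : θ = (1 - β) / (1 + β)) (hu1 : u1 = 1 / 2 + y ^ 2 * κ / Pm - 3 * (y ^ 2 * κ) / (2 * Pp))
    (hu2 : u2 = 1 / Pm + 3 / (2 * Pp))
    (hb1 : b1 = (1 - y * θ / 2) * (β * u1 / (1 + β) - 1 - y ^ 2 * κ / Pm)
      + ((1 - y * θ) / 2 + y * θ * κ) * (-(β * y * u2) / (1 + β) + y / Pm) + 1 - y * θ + y * κ) :
    97 / 100 ≤ θ ∧ θ ≤ 1 ∧ 47 / 100 ≤ u1 ∧ u1 ≤ 53 / 100 ∧ 24 / 10 ≤ u2 ∧ u2 ≤ 26 / 10 ∧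
      0 ≤ (1 - y * θ / 2) * u1 - ((1 - y * θ) / 2 + y * θ * κ) * (y * u2) ∧
      39 / 100 * β + y * κ ≤ b1 ∧ b1 ≤ β + y * κ := by
  have h1β : 0 < 1 + β := by linarith
  have hy2 : y ^ 2 ≤ 1 / 10000 := by
    have := mul_self_le_mul_self hy0.le hy
    linarith
  have hθ0 : 97 / 100 ≤ θ := by rw [hθ, le_div_iff₀ h1β]; linarith
  have hθ1 : θ ≤ 1 := by rw [hθ, div_le_one h1β]; linarith
  have hη : 1 - θ = 2 * β / (1 + β) := by rw [hθ]; field_simp; ring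
  have hη1 : 1 - θ ≤ 2 * β := by
    rw [hη, div_le_iff₀ h1β]; linarith [sq_nonneg β]
  have hg0 : 0 ≤ y ^ 2 * κ := by positivity
  have hg1 : y ^ 2 * κ ≤ 1 / 10000 := by
    have := mul_le_mul hy2 hκ hκ0.le (by norm_num)
    linarith
  have hPm0 : 98 / 100 ≤ Pm := by rw [hPm]; linarith
  have hPm1 : Pm ≤ 101 / 100 := by rw [hPm]; linarith
  have hPp0 : 1 ≤ Pp := by rw [hPp]; linarith
  have hPp1 : Pp ≤ 102 / 100 := by rw [hPp]; linarith
  have hPmp : 0 < Pm := by linarith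
  have hPpp : 0 < Pp := by linarith
  have g1 : y ^ 2 * κ / Pm ≤ 1 / 100 := by rw [div_le_iff₀ hPmp]; linarith
  have g1' : 0 ≤ y ^ 2 * κ / Pm := by positivity
  have g2 : 3 * (y ^ 2 * κ) / (2 * Pp) ≤ 1 / 100 := by rw [div_le_iff₀ (by linarith)]; linarith
  have g2' : 0 ≤ 3 * (y ^ 2 * κ) / (2 * Pp) := by positivity
  have hu10 : 47 / 100 ≤ u1 := by rw [hu1]; linarith
  have hu11 : u1 ≤ 53 / 100 := by rw [hu1]; linarith
  have g3 : 1 / Pm ≤ 105 / 100 := by rw [div_le_iff₀ hPmp]; linarith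
  have g3' : 98 / 100 ≤ 1 / Pm := by rw [le_div_iff₀ hPmp]; linarith
  have g4 : 3 / (2 * Pp) ≤ 15 / 10 := by rw [div_le_iff₀ (by linarith)]; linarith
  have g4' : 145 / 100 ≤ 3 / (2 * Pp) := by rw [le_div_iff₀ (by linarith)]; linarith
  have hu20 : 24 / 10 ≤ u2 := by rw [hu2]; linarith
  have hu21 : u2 ≤ 26 / 10 := by rw [hu2]; linarith
  have hyθ0 : 0 ≤ y * θ := mul_nonneg hy0.le (by linarith)
  have hyθ1 : y * θ ≤ 1 / 100 := by
    have := mul_le_mul_of_nonneg_left hθ1 hy0.le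
    linarith
  have hv0 : 0 ≤ (1 - y * θ) / 2 + y * θ * κ := by
    have : 0 ≤ y * θ * κ := by positivity
    linarith
  have hv1 : (1 - y * θ) / 2 + y * θ * κ ≤ 51 / 100 := by
    have := mul_le_mul hyθ1 hκ hκ0.le (by norm_num)
    linarith
  have hyu0 : 0 ≤ y * u2 := mul_nonneg hy0.le (by linarith)
  have hyu : y * u2 ≤ 26 / 1000 := by
    have := mul_le_mul hy hu21 (by linarith) (by norm_num)
    linarith
  obtain ⟨s, hs⟩ : ∃ s, s = (1 - y * θ / 2) * u1 - ((1 - y * θ) / 2 + y * θ * κ) * (y * u2) :=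
    ⟨_, rfl⟩
  rw [← hs]
  have hs0 : 44 / 100 ≤ s := by
    have e1 : ((1 - y * θ) / 2 + y * θ * κ) * (y * u2) ≤ 51 / 100 * (26 / 1000) := by gcongr
    have e2 : 99 / 100 * (47 / 100) ≤ (1 - y * θ / 2) * u1 :=
      mul_le_mul (by linarith) hu10 (by norm_num) (by linarith)
    rw [hs]; linarith
  have hs1 : s ≤ 53 / 100 := by
    have e1 : 0 ≤ ((1 - y * θ) / 2 + y * θ * κ) * (y * u2) := mul_nonneg hv0 hyu0
    have e2 : (1 - y * θ / 2) * u1 ≤ 1 * (53 / 100) :=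
      mul_le_mul (by linarith) hu11 (by linarith) (by norm_num)
    rw [hs]; linarith
  -- The decisive cancellation. For β = 0, hence θ = 1, only yκ would remain; every other term
  -- carries β or 1 − θ, and 1 − θ ≤ 2β.
  have hid : b1 = β / (1 + β) * s + y * κ + y * (1 - θ) / 2
      + (1 - θ) * (y ^ 2 * (1 / 2 - κ - y * κ / 2) / Pm) := by
    have h0 : (1 : ℝ) - y + y ^ 2 * κ ≠ 0 := by rw [← hPm]; exact hPmp.ne'
    rw [hb1, hs]
    rw [hPm]
    field_simp
    ring
  have hbr0 : 0 ≤ y ^ 2 * (1 / 2 - κ - y * κ / 2) / Pm := by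
    have : 0 ≤ 1 / 2 - κ - y * κ / 2 := by
      have := mul_le_mul hy hκ hκ0.le (by norm_num)
      linarith
    positivity
  have hbr1 : y ^ 2 * (1 / 2 - κ - y * κ / 2) / Pm ≤ 1 / 1000 := by
    rw [div_le_iff₀ hPmp]
    have h1 : 1 / 2 - κ - y * κ / 2 ≤ 1 / 2 := by
      have : 0 ≤ y * κ := by positivity
      linarith
    have h2 := mul_le_mul_of_nonneg_left h1 (sq_nonneg y)
    linarith
  have hη0 : 0 ≤ 1 - θ := by linarith
  have hβ1 : 99 / 100 * β ≤ β / (1 + β) := by 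
    rw [le_div_iff₀ h1β]
    have := mul_le_mul_of_nonneg_left hβ hβ0.le
    linarith
  have hβ2 : β / (1 + β) ≤ β := by 
    rw [div_le_iff₀ h1β]
    linarith [sq_nonneg β]
  have hβs0 : 99 / 100 * β * (44 / 100) ≤ β / (1 + β) * s := by gcongr
  have hβs1 : β / (1 + β) * s ≤ β * (53 / 100) := by gcongr
  have hp1 : 0 ≤ y * (1 - θ) := mul_nonneg hy0.le hη0
  have hp2 : y * (1 - θ) ≤ 1 / 100 * (2 * β) := by gcongr
  have hp3 : 0 ≤ (1 - θ) * (y ^ 2 * (1 / 2 - κ - y * κ / 2) / Pm) := mul_nonneg hη0 hbr0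
  have hp4 : (1 - θ) * (y ^ 2 * (1 / 2 - κ - y * κ / 2) / Pm) ≤ 2 * β * (1 / 1000) := by gcongr
  refine ⟨hθ0, hθ1, hu10, hu11, hu20, hu21, by linarith, ?_, ?_⟩
  · rw [hid]; linarith
  · rw [hid]; linarith

/-! ### The wave operator on functions of `f_Q` and `r_Q` -/

section BoxFR

variable {n : ℕ} {Q p : Spacetime n} {g h : Spacetime n → ℝ} {gf gr hf hr : ℝ}

lemma box_congr (hg : ContDiffAt ℝ 2 g p) (e : g =ᶠ[𝓝 p] h) : box g p = box h p := by
  rw [box_eq hg, box_eq (hg.congr_of_eventuallyEq e.symm)]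
  refine Finset.sum_congr rfl fun i _ => ?_
  rw [pd_congr (i := i) (g := pd i g) (h := pd i h)]
  filter_upwards [e.eventuallyEq_nhds] with x hx using pd_congr hx

lemma eventually_contDiffAt_two (hg : ContDiffAt ℝ 2 g p) : ∀ᶠ x in 𝓝 p, ContDiffAt ℝ 2 g x :=
  hg.eventually (by simp)

lemma box_add (hg : ContDiffAt ℝ 2 g p) (hh : ContDiffAt ℝ 2 h p) :
    box (fun x => g x + h x) p = box g p + box h p := by
  have e : ∀ i : Idx n, pd i (pd i fun x => g x + h x) p = pd i (pd i g) p + pd i (pd i h) p := by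
    intro i
    rw [← pd_add (differentiableAt_pd hg) (differentiableAt_pd hh)]
    refine pd_congr ?_
    filter_upwards [eventually_contDiffAt_two hg, eventually_contDiffAt_two hh] with x h1 h2
    exact pd_add (h1.differentiableAt (by norm_num)) (h2.differentiableAt (by norm_num))
  rw [box_eq (hg.add hh), box_eq hg, box_eq hh, ← Finset.sum_add_distrib]
  exact Finset.sum_congr rfl fun i _ => by rw [e i]; ring

lemma box_const (c : ℝ) : box (fun _ : Spacetime n => c) p = 0 := by
  rw [box_eq contDiffAt_const]
  refine Finset.sum_eq_zero fun i _ => ?_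
  have : pd i (fun _ : Spacetime n => c) = fun _ => 0 := funext fun x => pd_const c
  rw [this, pd_const, mul_zero]

lemma box_mul (hg : ContDiffAt ℝ 2 g p) (hh : ContDiffAt ℝ 2 h p) :
    box (fun x => g x * h x) p
      = box g p * h p + g p * box h p + 2 * ∑ i, sgn i * pd i g p * pd i h p := by
  have e : ∀ i : Idx n, pd i (pd i fun x => g x * h x) p
      = pd i (pd i g) p * h p + g p * pd i (pd i h) p + 2 * (pd i g p * pd i h p) := by
    intro i
    have hgd : DifferentiableAt ℝ g p := hg.differentiableAt (by norm_num)
    have hhd : DifferentiableAt ℝ h p := hh.differentiableAt (by norm_num)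
    have : pd i (fun x => g x * h x) =ᶠ[𝓝 p] fun x => pd i g x * h x + g x * pd i h x := by
      filter_upwards [eventually_contDiffAt_two hg, eventually_contDiffAt_two hh] with x h1 h2
      exact pd_mul (h1.differentiableAt (by norm_num)) (h2.differentiableAt (by norm_num))
    rw [pd_congr this, pd_add ((differentiableAt_pd hg).fun_mul hhd)
      (hgd.fun_mul (differentiableAt_pd hh)), pd_mul (differentiableAt_pd hg) hhd,
      pd_mul hgd (differentiableAt_pd hh)]
    ring
  rw [box_eq (hg.mul hh), box_eq hg, box_eq hh, Finset.mul_sum, Finset.mul_sum, Finset.sum_mul,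
    ← Finset.sum_add_distrib, ← Finset.sum_add_distrib]
  exact Finset.sum_congr rfl fun i _ => by rw [e i]; ring

/-- The Gram matrix of the two gradients: g(∇f, ∇f) = f, g(∇f, ∇r) = r/2, g(∇r, ∇r) = 1. -/
lemma sum_sgn_pd_mul_pd (hg : HasFRDeriv Q g gf gr p) (hh : HasFRDeriv Q h hf hr p)
    (hr0 : 0 < rQ Q p) :
    ∑ i, sgn i * pd i g p * pd i h p
      = fQ Q p * (gf * hf) + rQ Q p / 2 * (gf * hr + gr * hf) + gr * hr := by
  rw [sum_sgn_mul_pd hh, sum_coord_mul_pd hg, sum_spat_mul_pd hg hr0]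
  field_simp
  ring

/-- The wave operator in terms of the derivatives with respect to `f_Q` and `r_Q`. -/
lemma box_eq_of_hasFRDeriv {H₁ H₂ : Spacetime n → ℝ} {hff hfr hrf hrr : ℝ} (hr0 : 0 < rQ Q p)
    (hh : ContDiffAt ℝ 2 h p) (hev : ∀ᶠ x in 𝓝 p, HasFRDeriv Q h (H₁ x) (H₂ x) x)
    (h₁ : HasFRDeriv Q H₁ hff hfr p) (h₂ : HasFRDeriv Q H₂ hrf hrr p) :
    box h p = ((n : ℝ) + 2) / 2 * H₁ p + fQ Q p * hff + rQ Q p / 2 * (hfr + hrf) + hrr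
      + ((n : ℝ) - 1) / rQ Q p * H₂ p := by
  have hc : ∀ i, DifferentiableAt ℝ (coord Q i) p := fun i =>
    (contDiff_coord Q i (k := 1)).differentiable (by norm_num) p
  have hrd := hasFRDeriv_rQ (Q := Q) hr0
  have hinv := hrd.inv hr0.ne'
  have e : ∀ i : Idx n, sgn i * pd i (pd i h) p
      = 1 / 2 * (coord Q i p * pd i H₁ p) + H₁ p / 2 + 1 / rQ Q p * (spat Q i p * pd i H₂ p)
        + H₂ p * (1 / rQ Q p * Sum.elim (fun _ => 0) (fun _ => 1) i
          - spat Q i p ^ 2 / rQ Q p ^ 3) := by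
    intro i
    have ev : pd i h =ᶠ[𝓝 p] fun x => H₁ x * (sgn i / 2 * coord Q i x)
        + H₂ x * (spat Q i x * (rQ Q x)⁻¹) := by
      filter_upwards [hev] with x hx
      rw [hx.2]; ring
    have d1 : DifferentiableAt ℝ (fun x => sgn i / 2 * coord Q i x) p := (hc i).const_mul _
    have d2 : DifferentiableAt ℝ (fun x => spat Q i x * (rQ Q x)⁻¹) p :=
      (differentiableAt_spat i).fun_mul hinv.1
    rw [pd_congr ev, pd_add (h₁.1.fun_mul d1) (h₂.1.fun_mul d2), pd_mul h₁.1 d1, pd_mul h₂.1 d2,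
      pd_const_mul _ (hc i), pd_mul (differentiableAt_spat i) hinv.1, hinv.2, pd_coord, pd_spat]
    simp only [if_true]
    have s1 := sgn_mul_self i
    have s2 := sgn_mul_spat (Q := Q) (p := p) i
    have s3 : sgn i * Sum.elim (fun _ => (0 : ℝ)) (fun _ => 1) i
        = Sum.elim (fun _ => (0 : ℝ)) (fun _ => 1) i := by rcases i with i | i <;> simp
    generalize Sum.elim (fun _ => (0 : ℝ)) (fun _ => 1) i = s at s3 ⊢
    calc _ = (sgn i * sgn i) * (1 / 2 * (coord Q i p * pd i H₁ p) + H₁ p / 2)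
          + 1 / rQ Q p * ((sgn i * spat Q i p) * pd i H₂ p)
          + H₂ p * (1 / rQ Q p * (sgn i * s)
            - (sgn i * spat Q i p) * spat Q i p / (rQ Q p * rQ Q p ^ 2)) := by
            field_simp
            ring
      _ = _ := by rw [s1, s2, s3]; field_simp
  rw [box_eq hh, Finset.sum_congr rfl fun i _ => e i]
  simp only [Finset.sum_add_distrib, Finset.sum_sub_distrib, ← Finset.mul_sum,
    ← Finset.sum_div]
  rw [sum_coord_mul_pd h₁, sum_spat_mul_pd h₂ hr0, sum_spat_sq]
  simp [Fintype.sum_sum_type]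
  field_simp
  ring

end BoxFR

/-! ### Symbols -/

section Symbols

variable {n : ℕ}

/-- The size of the second derivatives of a symbol. -/
def symbolScale (Q : Spacetime n) (b : ℝ) (p : Spacetime n) : ℝ := 1 / rQ Q p ^ 2 + b / √(fQ Q p)

/-- The bounds which define symbols, at one point. -/
structure SymbolAt (Q : Spacetime n) (b M : ℝ) (h : Spacetime n → ℝ) (p : Spacetime n) : Prop where
  contDiffAt : ContDiffAt ℝ 2 h p
  abs_le : |h p| ≤ M
  deriv : ∃ hf hr, HasFRDeriv Q h hf hr p ∧ |hf| ≤ M * symbolScale Q b p ∧ |hr| ≤ M / rQ Q p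
  box_le : |box h p| ≤ M * symbolScale Q b p

/-- Families of functions with uniform symbol bounds on the good regions. -/
def IsSymbol (h : Spacetime n → ℝ → ℝ → Spacetime n → ℝ) : Prop :=
  ∃ M, 0 ≤ M ∧ ∀ Q b ε p, 0 < b → 0 < ε → p ∈ goodRegion Q b ε → SymbolAt Q b M (h Q b ε) p

lemma symbolScale_pos {Q p : Spacetime n} {b ε : ℝ} (hb : 0 < b) (h : GoodBounds Q b ε p) :
    0 < symbolScale Q b p := by
  have := h.f_pos
  have := h.r_pos
  unfold symbolScale; positivity

lemma inv_rQ_sq_le {Q p : Spacetime n} {b : ℝ} (hb : 0 < b) :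
    1 / rQ Q p ^ 2 ≤ symbolScale Q b p := by
  unfold symbolScale
  have : 0 ≤ b / √(fQ Q p) := by positivity
  linarith

lemma div_sqrt_le {Q p : Spacetime n} {b : ℝ} : b / √(fQ Q p) ≤ symbolScale Q b p := by
  unfold symbolScale
  have : 0 ≤ 1 / rQ Q p ^ 2 := by positivity
  linarith

/-- f times the scale equals f/r² + b√f, at most 1/4 + 1/100. Hence the product of two
f-derivatives, contracted with g(∇f, ∇f) = f, is again of the size of one scale. -/
lemma fQ_mul_symbolScale_sq {Q p : Spacetime n} {b ε : ℝ} (hb : 0 < b) (hε : 0 < ε)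
    (hp : p ∈ goodRegion Q b ε) : fQ Q p * symbolScale Q b p ^ 2 ≤ symbolScale Q b p := by
  have h := goodBounds hb hε hp
  have hb0 : b * √(fQ Q p) < 1 / 100 := hp.2.2
  have hf := h.f_pos
  have hr := h.r_pos
  have hs := Real.sqrt_pos.2 hf
  have h4 := h.four_f_le
  have key : fQ Q p * symbolScale Q b p ≤ 1 := by
    have e : fQ Q p * symbolScale Q b p = fQ Q p / rQ Q p ^ 2 + b * √(fQ Q p) := by
      unfold symbolScale
      nth_rewrite 3 [← Real.sq_sqrt hf.le]
      field_simp
      exact (Real.sq_sqrt hf.le).symm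
    have : fQ Q p / rQ Q p ^ 2 ≤ 1 / 4 := by
      rw [div_le_iff₀ (by positivity)]; linarith
    rw [e]; linarith
  have := symbolScale_pos hb h
  nlinarith

/-- Bound for the scalar product of two gradients. -/
lemma abs_inner_le {Q p : Spacetime n} {b ε M N gf gr hf hr : ℝ} (hb : 0 < b) (hε : 0 < ε)
    (hp : p ∈ goodRegion Q b ε) (hgf : |gf| ≤ M * symbolScale Q b p) (hgr : |gr| ≤ M / rQ Q p)
    (hhf : |hf| ≤ N * symbolScale Q b p) (hhr : |hr| ≤ N / rQ Q p) (hM : 0 ≤ M) (hN : 0 ≤ N) :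
    |fQ Q p * (gf * hf) + rQ Q p / 2 * (gf * hr + gr * hf) + gr * hr|
      ≤ 3 * (M * N) * symbolScale Q b p := by
  have h := goodBounds hb hε hp
  have hf0 := h.f_pos
  have hr0 := h.r_pos
  have hs := symbolScale_pos hb h
  have h1 := fQ_mul_symbolScale_sq hb hε hp
  have h2 : 1 / rQ Q p ^ 2 ≤ symbolScale Q b p := inv_rQ_sq_le hb
  have e1 : |fQ Q p * (gf * hf)| ≤ M * N * symbolScale Q b p := by
    rw [abs_mul, abs_mul, abs_of_pos hf0]
    calc fQ Q p * (|gf| * |hf|)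
        ≤ fQ Q p * (M * symbolScale Q b p * (N * symbolScale Q b p)) := by gcongr
      _ = M * N * (fQ Q p * symbolScale Q b p ^ 2) := by ring
      _ ≤ _ := by gcongr
  have e2 : |rQ Q p / 2 * (gf * hr + gr * hf)| ≤ M * N * symbolScale Q b p := by
    rw [abs_mul, abs_of_pos (by positivity : 0 < rQ Q p / 2)]
    calc rQ Q p / 2 * |gf * hr + gr * hf|
        ≤ rQ Q p / 2 * (|gf| * |hr| + |gr| * |hf|) := by
          gcongr
          exact (abs_add_le _ _).trans (by rw [abs_mul, abs_mul])
      _ ≤ rQ Q p / 2 * (M * symbolScale Q b p * (N / rQ Q p)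
          + M / rQ Q p * (N * symbolScale Q b p)) := by gcongr
      _ = _ := by field_simp; ring
  have e3 : |gr * hr| ≤ M * N * symbolScale Q b p := by
    rw [abs_mul]
    calc |gr| * |hr| ≤ M / rQ Q p * (N / rQ Q p) := by gcongr
      _ = M * N * (1 / rQ Q p ^ 2) := by field_simp
      _ ≤ _ := by gcongr
  calc _ ≤ |fQ Q p * (gf * hf)| + |rQ Q p / 2 * (gf * hr + gr * hf)| + |gr * hr| := abs_add_three _ _ _
    _ ≤ _ := by linarith

namespace IsSymbol

variable {g h : Spacetime n → ℝ → ℝ → Spacetime n → ℝ}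

lemma const (c : ℝ) : IsSymbol (fun (_ : Spacetime n) _ _ _ => c) := by
  refine ⟨|c|, abs_nonneg c, fun Q b ε p hb hε hp => ?_⟩
  have hg := goodBounds hb hε hp
  have hs := symbolScale_pos hb hg
  have hr := hg.r_pos
  refine ⟨contDiffAt_const, le_rfl, ⟨0, 0, hasFRDeriv_const c, ?_, ?_⟩, ?_⟩
  · rw [abs_zero]; positivity
  · rw [abs_zero]; positivity
  · rw [box_const, abs_zero]; positivity

lemma add (hg : IsSymbol g) (hh : IsSymbol h) :
    IsSymbol (fun Q b ε p => g Q b ε p + h Q b ε p) := by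
  obtain ⟨M, hM, hg⟩ := hg
  obtain ⟨N, hN, hh⟩ := hh
  refine ⟨M + N, by positivity, fun Q b ε p hb hε hp => ?_⟩
  obtain ⟨c1, a1, ⟨gf, gr, d1, f1, r1⟩, b1⟩ := hg Q b ε p hb hε hp
  obtain ⟨c2, a2, ⟨hf, hr, d2, f2, r2⟩, b2⟩ := hh Q b ε p hb hε hp
  refine ⟨c1.add c2, (abs_add_le _ _).trans (by linarith), ⟨_, _, d1.add d2,
    (abs_add_le _ _).trans (by linarith), (abs_add_le _ _).trans ?_⟩, ?_⟩
  · rw [add_div]; linarith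
  · rw [box_add c1 c2]
    exact (abs_add_le _ _).trans (by linarith)

/-- The cross term in □(gh) is a scalar product of gradients, which `abs_inner_le` bounds by one
scale. This makes the symbols an algebra. The constant 8 is 2 + 2 · 3. -/
lemma mul (hg : IsSymbol g) (hh : IsSymbol h) :
    IsSymbol (fun Q b ε p => g Q b ε p * h Q b ε p) := by
  obtain ⟨M, hM, hg⟩ := hg
  obtain ⟨N, hN, hh⟩ := hh
  refine ⟨8 * (M * N), by positivity, fun Q b ε p hb hε hp => ?_⟩
  obtain ⟨c1, a1, ⟨gf, gr, d1, f1, r1⟩, b1⟩ := hg Q b ε p hb hε hp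
  obtain ⟨c2, a2, ⟨hf, hr, d2, f2, r2⟩, b2⟩ := hh Q b ε p hb hε hp
  have hgb := goodBounds hb hε hp
  have hs := symbolScale_pos hb hgb
  have hr0 := hgb.r_pos
  have hMN : 0 ≤ M * N := by positivity
  have hab : ∀ {s t u v : ℝ}, |s| ≤ u → |t| ≤ v → |s * t| ≤ u * v := fun h1 h2 => by
    rw [abs_mul]; exact mul_le_mul h1 h2 (abs_nonneg _) ((abs_nonneg _).trans h1)
  have hMNs : 0 ≤ M * N * symbolScale Q b p := by positivity
  refine ⟨c1.mul c2, (hab a1 a2).trans (by linarith), ⟨_, _, d1.mul d2,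
    (abs_add_le _ _).trans ?_, (abs_add_le _ _).trans ?_⟩, ?_⟩
  · have := hab f1 a2
    have := hab a1 f2
    linarith
  · have h1 := hab r1 a2
    have h2 := hab a1 r2
    have h3 : 0 ≤ M * N / rQ Q p := by positivity
    have e1 : M / rQ Q p * N = M * N / rQ Q p := by ring
    have e2 : M * (N / rQ Q p) = M * N / rQ Q p := by ring
    have e3 : 8 * (M * N) / rQ Q p = 8 * (M * N / rQ Q p) := by ring
    rw [e3]; linarith
  · rw [box_mul c1 c2, sum_sgn_pd_mul_pd d1 d2 hr0]
    have h1 := hab b1 a2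
    have h2 := hab a1 b2
    have h3 := abs_inner_le hb hε hp f1 r1 f2 r2 hM hN
    have h4 := abs_add_three (box (g Q b ε) p * h Q b ε p) (g Q b ε p * box (h Q b ε) p)
      (2 * (fQ Q p * (gf * hf) + rQ Q p / 2 * (gf * hr + gr * hf) + gr * hr))
    rw [abs_mul 2, abs_two] at h4
    linarith

lemma const_mul (c : ℝ) (hh : IsSymbol h) : IsSymbol (fun Q b ε p => c * h Q b ε p) :=
  (const c).mul hh

lemma sub (hg : IsSymbol g) (hh : IsSymbol h) :
    IsSymbol (fun Q b ε p => g Q b ε p - h Q b ε p) := by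
  have := hg.add (hh.const_mul (-1))
  simpa only [neg_one_mul, ← sub_eq_add_neg] using this

lemma inv (hh : IsSymbol h) {c : ℝ} (hc : 0 < c)
    (hlow : ∀ Q b ε p, 0 < b → 0 < ε → p ∈ goodRegion Q b ε → c ≤ h Q b ε p) :
    IsSymbol (fun Q b ε p => (h Q b ε p)⁻¹) := by
  obtain ⟨N, hN, hh⟩ := hh
  obtain ⟨k, hk, hck⟩ : ∃ k, 0 < k ∧ k * c = 1 := ⟨c⁻¹, by positivity, by field_simp⟩
  obtain ⟨M, hM⟩ : ∃ M, M = k + k ^ 2 * N := ⟨_, rfl⟩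
  have hM0 : 0 ≤ M := by rw [hM]; positivity
  have hMk : k ≤ M := by rw [hM]; have : 0 ≤ k ^ 2 * N := by positivity
                         linarith
  refine ⟨M + 6 * (k * (N * M)) + k * (N * M), by positivity, fun Q b ε p hb hε hp => ?_⟩
  obtain ⟨c2, a2, ⟨hf, hr, d2, f2, r2⟩, b2⟩ := hh Q b ε p hb hε hp
  have hgb := goodBounds hb hε hp
  have hs := symbolScale_pos hb hgb
  have hr0 := hgb.r_pos
  have hl := hlow Q b ε p hb hε hp
  have h0 : 0 < h Q b ε p := hc.trans_le hl
  have hinv : (h Q b ε p)⁻¹ ≤ k := by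
    rw [inv_le_comm₀ h0 hk]
    calc k⁻¹ = c := by field_simp; linarith
      _ ≤ _ := hl
  have hinv0 : 0 < (h Q b ε p)⁻¹ := inv_pos.2 h0
  have hrest : 0 ≤ 6 * (k * (N * M)) + k * (N * M) := by positivity
  have d1 := d2.inv h0.ne'
  have c1 : ContDiffAt ℝ 2 (fun x => (h Q b ε x)⁻¹) p := c2.inv h0.ne'
  have hM2 : k ^ 2 * N ≤ M := by rw [hM]; linarith
  have hsq : ∀ {s B : ℝ}, |s| ≤ B → |-s / h Q b ε p ^ 2| ≤ k ^ 2 * B := by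
    intro s B hB
    rw [neg_div, abs_neg, abs_div, abs_of_pos (by positivity : 0 < h Q b ε p ^ 2), div_eq_inv_mul,
      ← inv_pow]
    gcongr
  have f1 : |-hf / h Q b ε p ^ 2| ≤ M * symbolScale Q b p :=
    (hsq f2).trans (by rw [← mul_assoc]; gcongr)
  have r1 : |-hr / h Q b ε p ^ 2| ≤ M / rQ Q p :=
    (hsq r2).trans (by rw [← mul_div_assoc]; gcongr)
  have hMle : M ≤ M + 6 * (k * (N * M)) + k * (N * M) := by linarith
  refine ⟨c1, ?_, ⟨_, _, d1, f1.trans (by gcongr), r1.trans (by gcongr)⟩, ?_⟩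
  · rw [abs_of_pos hinv0]; linarith
  -- The product rule for h · h⁻¹ = 1 is solved for □(h⁻¹), which avoids a second order chain rule.
  · have e1 : box (fun x => h Q b ε x * (h Q b ε x)⁻¹) p = 0 := by
      rw [box_congr (h := fun _ => 1) (c2.mul c1), box_const]
      filter_upwards [c2.continuousAt.eventually (lt_mem_nhds h0)] with x hx
      exact mul_inv_cancel₀ (ne_of_gt hx)
    rw [box_mul c2 c1, sum_sgn_pd_mul_pd d2 d1 hr0] at e1
    have h3 := abs_inner_le hb hε hp f2 r2 f1 r1 hN hM0
    set I := fQ Q p * (hf * (-hf / h Q b ε p ^ 2)) + rQ Q p / 2 * (hf * (-hr / h Q b ε p ^ 2)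
      + hr * (-hf / h Q b ε p ^ 2)) + hr * (-hr / h Q b ε p ^ 2)
    have e2 : box (fun x => (h Q b ε x)⁻¹) p
        = -((h Q b ε p)⁻¹ * (box (h Q b ε) p * (h Q b ε p)⁻¹ + 2 * I)) := by
      field_simp at e1 ⊢
      linarith
    rw [e2, abs_neg, abs_mul, abs_of_pos hinv0]
    calc (h Q b ε p)⁻¹ * |box (h Q b ε) p * (h Q b ε p)⁻¹ + 2 * I|
        ≤ k * (N * symbolScale Q b p * M + 2 * (3 * (N * M) * symbolScale Q b p)) := by
          gcongr
          refine (abs_add_le _ _).trans (add_le_add ?_ ?_)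
          · rw [abs_mul, abs_of_pos hinv0]
            gcongr
            linarith
          · rw [abs_mul, abs_two]; gcongr
      _ ≤ _ := by
          have : 0 ≤ M * symbolScale Q b p := by positivity
          linarith

lemma sqrt (hh : IsSymbol h)
    (hlow : ∀ Q b ε p, 0 < b → 0 < ε → p ∈ goodRegion Q b ε → 1 ≤ h Q b ε p) :
    IsSymbol (fun Q b ε p => √(h Q b ε p)) := by
  obtain ⟨N, hN, hh⟩ := hh
  refine ⟨N + 1 + 6 * (N * N), by positivity, fun Q b ε p hb hε hp => ?_⟩
  obtain ⟨c2, a2, ⟨hf, hr, d2, f2, r2⟩, b2⟩ := hh Q b ε p hb hε hp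
  have hgb := goodBounds hb hε hp
  have hs := symbolScale_pos hb hgb
  have hr0 := hgb.r_pos
  have hl := hlow Q b ε p hb hε hp
  have h0 : 0 < h Q b ε p := one_pos.trans_le hl
  have hs1 : 1 ≤ √(h Q b ε p) := Real.one_le_sqrt.2 hl
  have hs0 : 0 < √(h Q b ε p) := by linarith
  have d1 := d2.sqrt h0
  have c1 : ContDiffAt ℝ 2 (fun x => √(h Q b ε x)) p := c2.sqrt h0.ne'
  have hNle : N ≤ N + 1 + 6 * (N * N) := by nlinarith
  have hsq : ∀ {s B : ℝ}, |s| ≤ B → |1 / (2 * √(h Q b ε p)) * s| ≤ B := by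
    intro s B hB
    have h1 : 1 / (2 * √(h Q b ε p)) ≤ 1 := by
      rw [div_le_one (by positivity)]; linarith
    rw [abs_mul, abs_of_pos (by positivity : 0 < 1 / (2 * √(h Q b ε p)))]
    calc _ ≤ 1 * B := by gcongr
      _ = B := one_mul B
  have f1 := hsq f2
  have r1 := hsq r2
  refine ⟨c1, ?_, ⟨_, _, d1, f1.trans (by gcongr), r1.trans (by gcongr)⟩, ?_⟩
  · rw [abs_of_pos hs0]
    have : √(h Q b ε p) ≤ h Q b ε p := by
      rw [Real.sqrt_le_left h0.le]; nlinarith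
    have := le_abs_self (h Q b ε p)
    nlinarith
  -- The same device, applied to √h · √h = h.
  · have e1 : box (fun x => √(h Q b ε x) * √(h Q b ε x)) p = box (h Q b ε) p := by
      refine box_congr (c1.mul c1) ?_
      filter_upwards [c2.continuousAt.eventually (lt_mem_nhds h0)] with x hx
      exact Real.mul_self_sqrt (le_of_lt hx)
    rw [box_mul c1 c1, sum_sgn_pd_mul_pd d1 d1 hr0] at e1
    have h3 := abs_inner_le hb hε hp f1 r1 f1 r1 hN hN
    set I := fQ Q p * (1 / (2 * √(h Q b ε p)) * hf * (1 / (2 * √(h Q b ε p)) * hf))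
      + rQ Q p / 2 * (1 / (2 * √(h Q b ε p)) * hf * (1 / (2 * √(h Q b ε p)) * hr)
      + 1 / (2 * √(h Q b ε p)) * hr * (1 / (2 * √(h Q b ε p)) * hf))
      + 1 / (2 * √(h Q b ε p)) * hr * (1 / (2 * √(h Q b ε p)) * hr)
    have e2 : box (fun x => √(h Q b ε x)) p
        = 1 / (2 * √(h Q b ε p)) * (box (h Q b ε) p - 2 * I) := by
      field_simp
      linarith
    rw [e2]
    refine hsq ?_
    calc |box (h Q b ε) p - 2 * I| ≤ |box (h Q b ε) p| + |2 * I| := abs_sub _ _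
      _ = |box (h Q b ε) p| + 2 * |I| := by rw [abs_mul, abs_two]
      _ ≤ _ := by
        have : 0 ≤ (N * N) * symbolScale Q b p := by positivity
        nlinarith

end IsSymbol

end Symbols

/-! ### The zeroth order part of the multiplier -/

section Corrector

variable {n : ℕ}

/-- `ε r_Q`. -/
def scaledR (Q : Spacetime n) (ε : ℝ) (p : Spacetime n) : ℝ := ε * rQ Q p

/-- `f_Q / r_Q²`. -/
def ratioF (Q : Spacetime n) (p : Spacetime n) : ℝ := fQ Q p / rQ Q p ^ 2

lemma IsSymbol.congr {g h : Spacetime n → ℝ → ℝ → Spacetime n → ℝ} (hg : IsSymbol g)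
    (e : ∀ Q b ε p, g Q b ε p = h Q b ε p) : IsSymbol h := by
  have : g = h := by funext Q b ε p; exact e Q b ε p
  exact this ▸ hg

lemma HasFRDeriv.congr_of_eventuallyEq {Q p : Spacetime n} {g h : Spacetime n → ℝ} {hf hr : ℝ}
    (hg : HasFRDeriv Q g hf hr p) (e : g =ᶠ[𝓝 p] h) : HasFRDeriv Q h hf hr p :=
  ⟨hg.1.congr_of_eventuallyEq e.symm, fun i => by rw [← pd_congr e, hg.2]⟩

lemma eventually_rQ_pos {Q p : Spacetime n} (h : 0 < rQ Q p) : ∀ᶠ x in 𝓝 p, 0 < rQ Q x :=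
  continuous_rQ.continuousAt.eventually (lt_mem_nhds h)

lemma eventually_fQ_pos {Q p : Spacetime n} (h : 0 < fQ Q p) : ∀ᶠ x in 𝓝 p, 0 < fQ Q x :=
  (contDiff_fQ Q (k := 0)).continuous.continuousAt.eventually (lt_mem_nhds h)

lemma box_scaledR {Q p : Spacetime n} {ε : ℝ} (hr : 0 < rQ Q p) :
    box (scaledR Q ε) p = ((n : ℝ) - 1) / rQ Q p * ε := by
  have hc : ContDiffAt ℝ 2 (scaledR Q ε) p := contDiffAt_const.mul (contDiffAt_rQ hr)
  have hev : ∀ᶠ x in 𝓝 p, HasFRDeriv Q (scaledR Q ε) 0 ε x := by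
    filter_upwards [eventually_rQ_pos hr] with x hx
    exact ((hasFRDeriv_rQ hx).const_mul ε).congr_deriv (by ring) (by ring)
  rw [box_eq_of_hasFRDeriv (H₁ := fun _ => 0) (H₂ := fun _ => ε) hr hc hev (hasFRDeriv_const 0)
    (hasFRDeriv_const ε)]
  ring

lemma hasFRDeriv_scaledR {Q p : Spacetime n} {ε : ℝ} (hr : 0 < rQ Q p) :
    HasFRDeriv Q (scaledR Q ε) 0 ε p :=
  ((hasFRDeriv_rQ hr).const_mul ε).congr_deriv (by ring) (by ring)

lemma hasFRDeriv_ratioF {Q p : Spacetime n} (hr : 0 < rQ Q p) :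
    HasFRDeriv Q (ratioF Q) (1 / rQ Q p ^ 2) (-2 * fQ Q p / rQ Q p ^ 3) p := by
  have h1 := hasFRDeriv_rQ (Q := Q) hr
  have h2 := (hasFRDeriv_fQ (Q := Q) (p := p)).div (h1.mul h1) (by positivity)
  have h3 : HasFRDeriv Q (ratioF Q) _ _ p :=
    h2.congr_of_eventuallyEq (Eventually.of_forall fun x => by simp only [ratioF]; ring_nf)
  exact h3.congr_deriv (by field_simp; ring) (by field_simp; ring)

lemma box_ratioF {Q p : Spacetime n} (hr : 0 < rQ Q p) :
    box (ratioF Q) p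
      = (((n : ℝ) - 2) / 2 + (8 - 2 * n) * (fQ Q p / rQ Q p ^ 2)) / rQ Q p ^ 2 := by
  have hc : ContDiffAt ℝ 2 (ratioF Q) p := by
    refine ((contDiff_fQ Q).contDiffAt).div ((contDiffAt_rQ hr).pow 2) ?_
    positivity
  have hev : ∀ᶠ x in 𝓝 p, HasFRDeriv Q (ratioF Q) (1 / rQ Q x ^ 2) (-2 * fQ Q x / rQ Q x ^ 3) x := by
    filter_upwards [eventually_rQ_pos hr] with x hx using hasFRDeriv_ratioF hx
  have h1 := hasFRDeriv_rQ (Q := Q) hr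
  have d1 : HasFRDeriv Q (fun x => 1 / rQ Q x ^ 2) 0 (-2 / rQ Q p ^ 3) p := by
    have h2 := (h1.mul h1).inv (by positivity)
    refine (h2.congr_of_eventuallyEq (Eventually.of_forall fun x => ?_)).congr_deriv ?_ ?_
    · simp only [one_div]; ring_nf
    · simp
    · field_simp; ring
  have d2 : HasFRDeriv Q (fun x => -2 * fQ Q x / rQ Q x ^ 3) (-2 / rQ Q p ^ 3)
      (6 * fQ Q p / rQ Q p ^ 4) p := by
    have h2 := ((hasFRDeriv_fQ (Q := Q) (p := p)).const_mul (-2)).div (h1.mul (h1.mul h1))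
      (by positivity)
    refine (h2.congr_of_eventuallyEq (Eventually.of_forall fun x => ?_)).congr_deriv ?_ ?_
    · ring_nf
    · field_simp; ring
    · field_simp; ring
  rw [box_eq_of_hasFRDeriv hr hc hev d1 d2]
  field_simp
  ring

lemma isSymbol_scaledR : IsSymbol (fun (Q : Spacetime n) _ ε p => scaledR Q ε p) := by
  refine ⟨(n : ℝ) + 1, by positivity, fun Q b ε p hb hε hp => ?_⟩
  have hg := goodBounds hb hε hp
  have hr := hg.r_pos
  have hy := hg.er_lt
  have hy0 : 0 < ε * rQ Q p := by positivity
  have hn : (0 : ℝ) ≤ n := n.cast_nonneg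
  have hs := symbolScale_pos hb hg
  have he : ε ≤ 1 / rQ Q p := by rw [le_div_iff₀ hr]; linarith
  refine ⟨contDiffAt_const.mul (contDiffAt_rQ hr), ?_, ⟨0, ε, hasFRDeriv_scaledR hr, ?_, ?_⟩, ?_⟩
  · simp only [scaledR]; rw [abs_of_pos hy0]; linarith
  · rw [abs_zero]; positivity
  · rw [abs_of_pos hε]
    refine he.trans ?_
    gcongr; linarith
  · rw [box_scaledR hr, abs_mul, abs_div, abs_of_pos hr, abs_of_pos hε]
    have h1 : |(n : ℝ) - 1| ≤ n + 1 := abs_le.2 ⟨by linarith, by linarith⟩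
    calc |(n : ℝ) - 1| / rQ Q p * ε ≤ (n + 1) / rQ Q p * (1 / rQ Q p) := by gcongr
      _ = (n + 1) * (1 / rQ Q p ^ 2) := by field_simp
      _ ≤ _ := by gcongr; exact inv_rQ_sq_le hb

/-- The f-derivative 1/r² accounts for the first term of the scale; f/r² ≤ 1/4 does the rest. -/
lemma isSymbol_ratioF : IsSymbol (fun (Q : Spacetime n) _ _ p => ratioF Q p) := by
  refine ⟨(n : ℝ) + 4, by positivity, fun Q b ε p hb hε hp => ?_⟩
  have hg := goodBounds hb hε hp
  have hr := hg.r_pos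
  have hf := hg.f_pos
  have hn : (0 : ℝ) ≤ n := n.cast_nonneg
  have hk0 : 0 < fQ Q p / rQ Q p ^ 2 := by positivity
  have hk1 : fQ Q p / rQ Q p ^ 2 ≤ 1 / 4 := by
    rw [div_le_iff₀ (by positivity)]; linarith [hg.four_f_le]
  have hs := inv_rQ_sq_le (Q := Q) (p := p) hb
  refine ⟨((contDiff_fQ Q).contDiffAt).div ((contDiffAt_rQ hr).pow 2) (by positivity), ?_,
    ⟨_, _, hasFRDeriv_ratioF hr, ?_, ?_⟩, ?_⟩
  · simp only [ratioF]; rw [abs_of_pos hk0]; linarith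
  · rw [abs_of_pos (by positivity)]
    have : 0 ≤ 1 / rQ Q p ^ 2 := by positivity
    nlinarith
  · have e : -2 * fQ Q p / rQ Q p ^ 3 = -(2 * (fQ Q p / rQ Q p ^ 2) / rQ Q p) := by field_simp
    rw [e, abs_neg, abs_of_pos (by positivity)]
    gcongr; linarith
  · rw [box_ratioF hr, abs_div, abs_of_pos (by positivity : 0 < rQ Q p ^ 2)]
    set k := fQ Q p / rQ Q p ^ 2
    have h1 : |((n : ℝ) - 2) / 2 + (8 - 2 * n) * k| ≤ n + 4 := by
      rw [abs_le]; constructor <;> nlinarith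
    calc _ ≤ ((n : ℝ) + 4) / rQ Q p ^ 2 := by gcongr
      _ = (n + 4) * (1 / rQ Q p ^ 2) := by ring
      _ ≤ _ := by gcongr

/-- The f-derivative b/(2√f) and the wave operator, a multiple of b/√f, account for the second term
of the scale. -/
lemma isSymbol_sqrt_fQ : IsSymbol (fun (Q : Spacetime n) b _ p => b * √(fQ Q p)) := by
  refine ⟨(n : ℝ) + 4, by positivity, fun Q b ε p hb hε hp => ?_⟩
  have hg := goodBounds hb hε hp
  have hr := hg.r_pos
  have hf := hg.f_pos
  have hn : (0 : ℝ) ≤ n := n.cast_nonneg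
  have hs := Real.sqrt_pos.2 hf
  have hb1 : b * √(fQ Q p) < 1 / 100 := hp.2.2
  have hsc : b / √(fQ Q p) ≤ symbolScale Q b p := div_sqrt_le
  have hb0 : 0 < b * √(fQ Q p) := by positivity
  have hbs : 0 < b / √(fQ Q p) := by positivity
  have hd : ∀ x, 0 < fQ Q x → HasFRDeriv Q (fun x => b * √(fQ Q x)) (b / 2 * (√(fQ Q x))⁻¹) 0 x :=
    fun x hx => by
      have := Real.sqrt_pos.2 hx
      exact ((hasFRDeriv_fQ.sqrt hx).const_mul b).congr_deriv (by field_simp) (by ring)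
  have hc : ContDiffAt ℝ 2 (fun x => b * √(fQ Q x)) p :=
    contDiffAt_const.mul ((contDiff_fQ Q).contDiffAt.sqrt hf.ne')
  refine ⟨hc, ?_, ⟨_, _, hd p hf, ?_, ?_⟩, ?_⟩
  · rw [abs_of_pos hb0]; linarith
  · rw [abs_of_pos (by positivity)]
    have : b / 2 * (√(fQ Q p))⁻¹ = 1 / 2 * (b / √(fQ Q p)) := by ring
    rw [this]; nlinarith
  · rw [abs_zero]; positivity
  · have hev : ∀ᶠ x in 𝓝 p, HasFRDeriv Q (fun x => b * √(fQ Q x)) (b / 2 * (√(fQ Q x))⁻¹) 0 x := by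
      filter_upwards [eventually_fQ_pos hf] with x hx using hd x hx
    have d1 := ((hasFRDeriv_fQ.sqrt hf).inv hs.ne').const_mul (b / 2)
    rw [box_eq_of_hasFRDeriv hr hc hev d1 (hasFRDeriv_const 0)]
    have e : ((n : ℝ) + 2) / 2 * (b / 2 * (√(fQ Q p))⁻¹)
        + fQ Q p * (b / 2 * (-(1 / (2 * √(fQ Q p)) * 1) / √(fQ Q p) ^ 2))
        + rQ Q p / 2 * (b / 2 * (-(1 / (2 * √(fQ Q p)) * 0) / √(fQ Q p) ^ 2) + 0) + 0
        + ((n : ℝ) - 1) / rQ Q p * 0 = ((n : ℝ) + 1) / 4 * (b / √(fQ Q p)) := by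
      rw [Real.sq_sqrt hf.le]
      field_simp
      ring
    rw [e, abs_of_pos (by positivity)]
    nlinarith

lemma isSymbol_sq_mul_fQ : IsSymbol (fun (Q : Spacetime n) _ ε p => ε ^ 2 * fQ Q p) := by
  refine ⟨(n : ℝ) + 4, by positivity, fun Q b ε p hb hε hp => ?_⟩
  have hg := goodBounds hb hε hp
  have hr := hg.r_pos
  have hf := hg.f_pos
  have hn : (0 : ℝ) ≤ n := n.cast_nonneg
  have hs := inv_rQ_sq_le (Q := Q) (p := p) hb
  have he : ε ^ 2 ≤ symbolScale Q b p := by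
    refine le_trans ?_ hs
    rw [le_div_iff₀ (by positivity), ← mul_pow]
    exact pow_le_one₀ (by positivity) (by linarith [hg.er_lt])
  have hd : ∀ x, HasFRDeriv Q (fun x => ε ^ 2 * fQ Q x) (ε ^ 2) 0 x := fun x =>
    (hasFRDeriv_fQ.const_mul (ε ^ 2)).congr_deriv (by ring) (by ring)
  have hc : ContDiffAt ℝ 2 (fun x => ε ^ 2 * fQ Q x) p :=
    contDiffAt_const.mul (contDiff_fQ Q).contDiffAt
  have he0 : 0 < ε ^ 2 := by positivity
  refine ⟨hc, ?_, ⟨_, _, hd p, ?_, ?_⟩, ?_⟩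
  · rw [abs_of_pos (by positivity)]; linarith [hg.ef_le, hg.er_lt]
  · rw [abs_of_pos he0]; nlinarith
  · rw [abs_zero]; positivity
  · rw [box_eq_of_hasFRDeriv (H₁ := fun _ => ε ^ 2) (H₂ := fun _ => 0) hr hc
      (Eventually.of_forall hd) (hasFRDeriv_const _) (hasFRDeriv_const _)]
    have e : ((n : ℝ) + 2) / 2 * ε ^ 2 + fQ Q p * 0 + rQ Q p / 2 * (0 + 0) + 0
        + ((n : ℝ) - 1) / rQ Q p * 0 = ((n : ℝ) + 2) / 2 * ε ^ 2 := by ring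
    rw [e, abs_of_pos (by positivity)]
    nlinarith

lemma isSymbol_pMinus : IsSymbol (fun (Q : Spacetime n) _ ε p => pMinus Q ε p) :=
  (((IsSymbol.const 1).sub isSymbol_scaledR).add isSymbol_sq_mul_fQ).congr fun _ _ _ _ => rfl

lemma isSymbol_pPlus : IsSymbol (fun (Q : Spacetime n) _ ε p => pPlus Q ε p) :=
  (((IsSymbol.const 1).add isSymbol_scaledR).add isSymbol_sq_mul_fQ).congr fun _ _ _ _ => rfl

lemma isSymbol_inv_pMinus : IsSymbol (fun (Q : Spacetime n) _ ε p => (pMinus Q ε p)⁻¹) :=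
  isSymbol_pMinus.inv (c := 99 / 100) (by norm_num)
    fun _ _ _ _ hb hε hp => (goodBounds hb hε hp).pMinus_ge

lemma isSymbol_inv_pPlus : IsSymbol (fun (Q : Spacetime n) _ ε p => (pPlus Q ε p)⁻¹) :=
  isSymbol_pPlus.inv one_pos fun _ _ _ _ hb hε hp => (goodBounds hb hε hp).pPlus_ge

lemma isSymbol_betaF : IsSymbol (n := n) betaF := by
  have h1 := isSymbol_pPlus.sqrt (n := n)
    fun _ _ _ _ hb hε hp => (goodBounds hb hε hp).pPlus_ge
  have h2 := h1.inv one_pos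
    fun _ _ _ _ hb hε hp => Real.one_le_sqrt.2 (goodBounds hb hε hp).pPlus_ge
  refine (((isSymbol_sqrt_fQ.mul isSymbol_pMinus).mul isSymbol_inv_pPlus).mul h2).congr ?_
  intro Q b ε p
  unfold betaF
  rw [div_eq_mul_inv, mul_inv]
  ring

lemma isSymbol_inv_one_add_betaF :
    IsSymbol (fun (Q : Spacetime n) b ε p => (1 + betaF Q b ε p)⁻¹) :=
  ((IsSymbol.const 1).add isSymbol_betaF).inv one_pos
    fun _ _ _ _ hb hε hp => by linarith [(goodBounds hb hε hp).beta_pos]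

lemma isSymbol_thetaF : IsSymbol (n := n) thetaF :=
  (((IsSymbol.const 1).sub isSymbol_betaF).mul isSymbol_inv_one_add_betaF).congr
    fun _ _ _ _ => (div_eq_mul_inv _ _).symm

/-- `f_Q ∂_f β = β` times this function. -/
def betaLogF (Q : Spacetime n) (ε : ℝ) (p : Spacetime n) : ℝ :=
  1 / 2 + ε ^ 2 * fQ Q p * (pMinus Q ε p)⁻¹ - 3 / 2 * (ε ^ 2 * fQ Q p * (pPlus Q ε p)⁻¹)

/-- `r_Q ∂_r β = - ε r_Q β` times this function. -/
def betaLogR (Q : Spacetime n) (ε : ℝ) (p : Spacetime n) : ℝ :=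
  (pMinus Q ε p)⁻¹ + 3 / 2 * (pPlus Q ε p)⁻¹

/-- `- f_Q ∂_f θ`. -/
def thetaLogF (Q : Spacetime n) (b ε : ℝ) (p : Spacetime n) : ℝ :=
  2 * (betaF Q b ε p * ((1 + betaF Q b ε p)⁻¹ * (1 + betaF Q b ε p)⁻¹) * betaLogF Q ε p)

/-- `r_Q ∂_r θ`. -/
def thetaLogR (Q : Spacetime n) (b ε : ℝ) (p : Spacetime n) : ℝ :=
  2 * (betaF Q b ε p * ((1 + betaF Q b ε p)⁻¹ * (1 + betaF Q b ε p)⁻¹) *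
    (scaledR Q ε p * betaLogR Q ε p))

/-- The coefficient of `ε r_Q` in `multWeight`. -/
def multCoeff (Q : Spacetime n) (b ε : ℝ) (p : Spacetime n) : ℝ :=
  (n : ℝ) / 2 * (ratioF Q p * thetaF Q b ε p) - (n : ℝ) / 4 * thetaF Q b ε p
    + 1 / 4 * thetaLogF Q b ε p - 1 / 4 * thetaLogR Q b ε p
    + 1 / 2 * (ratioF Q p * (thetaLogR Q b ε p - thetaF Q b ε p - 1))

/-- The zeroth order coefficient of the multiplier. -/
def multWeight (Q : Spacetime n) (b ε : ℝ) (p : Spacetime n) : ℝ :=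
  (n : ℝ) / 4 + scaledR Q ε p * multCoeff Q b ε p

lemma isSymbol_thetaLogR : IsSymbol (n := n) thetaLogR :=
  ((isSymbol_betaF.mul (isSymbol_inv_one_add_betaF.mul isSymbol_inv_one_add_betaF)).mul
    (isSymbol_scaledR.mul (isSymbol_inv_pMinus.add (isSymbol_inv_pPlus.const_mul _)))).const_mul 2

lemma isSymbol_multCoeff : IsSymbol (n := n) multCoeff := by
  have hβ := isSymbol_betaF.mul (isSymbol_inv_one_add_betaF.mul
    (isSymbol_inv_one_add_betaF (n := n)))
  have h1 : IsSymbol (n := n) thetaLogF :=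
    (hβ.mul (((IsSymbol.const _).add (isSymbol_sq_mul_fQ.mul isSymbol_inv_pMinus)).sub
      ((isSymbol_sq_mul_fQ.mul isSymbol_inv_pPlus).const_mul _))).const_mul 2
  have h2 := isSymbol_thetaLogR (n := n)
  exact ((((((isSymbol_ratioF.mul isSymbol_thetaF).const_mul _).sub
    (isSymbol_thetaF.const_mul _)).add (h1.const_mul _)).sub (h2.const_mul _)).add
    ((isSymbol_ratioF.mul ((h2.sub isSymbol_thetaF).sub (IsSymbol.const 1))).const_mul _))

/-- Bounds for the zeroth order coefficient of the multiplier. -/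
lemma exists_multWeight_bounds (n : ℕ) :
    ∃ M : ℝ, 0 < M ∧ ∀ (Q : Spacetime n) (b ε : ℝ) (p : Spacetime n), 0 < b → 0 < ε →
      p ∈ goodRegion Q b ε →
      ContDiffAt ℝ 2 (multWeight Q b ε) p ∧
      |multWeight Q b ε p - n / 4| ≤ M * (ε * rQ Q p) ∧
      |box (multWeight Q b ε) p| ≤ M * (ε / rQ Q p + ε * rQ Q p * (b / √(fQ Q p))) ∧
      (∀ i, fQ Q p * |pd i (multWeight Q b ε) p| ≤ M * rQ Q p) := by
  obtain ⟨M, hM, hF⟩ := isSymbol_multCoeff (n := n)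
  obtain ⟨N, hN, hq⟩ : IsSymbol (n := n) multWeight :=
    (IsSymbol.const _).add (isSymbol_scaledR.mul isSymbol_multCoeff)
  have hn : (0 : ℝ) ≤ n := n.cast_nonneg
  refine ⟨(n + 5) * M + N + 1, by positivity, fun Q b ε p hb hε hp => ?_⟩
  obtain ⟨c1, a1, ⟨gf, gr, d1, f1, r1⟩, b1⟩ := hF Q b ε p hb hε hp
  obtain ⟨c2, -, ⟨hf, hr, d2, f2, r2⟩, -⟩ := hq Q b ε p hb hε hp
  have hg := goodBounds hb hε hp
  have hr0 := hg.r_pos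
  have hf0 := hg.f_pos
  have hs := Real.sqrt_pos.2 hf0
  have hyc : ContDiffAt ℝ 2 (scaledR Q ε) p := contDiffAt_const.mul (contDiffAt_rQ hr0)
  refine ⟨c2, ?_, ?_, fun i => ?_⟩
  · have e : multWeight Q b ε p - n / 4 = ε * rQ Q p * multCoeff Q b ε p := by
      unfold multWeight scaledR; ring
    rw [e, abs_mul, abs_of_pos (by positivity), mul_comm]
    gcongr
    nlinarith
  · have e : box (multWeight Q b ε) p
        = box (scaledR Q ε) p * multCoeff Q b ε p + scaledR Q ε p * box (multCoeff Q b ε) p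
          + 2 * ∑ i, sgn i * pd i (scaledR Q ε) p * pd i (multCoeff Q b ε) p := by
      rw [← box_mul hyc c1]
      have := box_add (p := p) (g := fun _ => (n : ℝ) / 4)
        (h := fun x => scaledR Q ε x * multCoeff Q b ε x) contDiffAt_const (hyc.mul c1)
      rw [box_const, zero_add] at this
      exact this
    rw [e, sum_sgn_pd_mul_pd (hasFRDeriv_scaledR hr0) d1 hr0, box_scaledR hr0]
    set B := ε / rQ Q p + ε * rQ Q p * (b / √(fQ Q p)) with hB
    have hB0 : 0 ≤ B := by positivity
    -- The factor εr in front of the symbol turns 1/r² + b/√f into ε/r + εr b/√f. A bare symbol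
    -- would leave 1/r², which is not small compared with b/√f.
    have hBs : ε * rQ Q p * symbolScale Q b p = B := by
      rw [hB]; unfold symbolScale; field_simp
    have hBr : ε / rQ Q p ≤ B := by
      have : 0 ≤ ε * rQ Q p * (b / √(fQ Q p)) := by positivity
      linarith
    have hn1 : |(n : ℝ) - 1| ≤ n + 1 := abs_le.2 ⟨by linarith, by linarith⟩
    have e1 : |((n : ℝ) - 1) / rQ Q p * ε * multCoeff Q b ε p| ≤ (n + 1) * M * B := by
      rw [show ((n : ℝ) - 1) / rQ Q p * ε * multCoeff Q b ε p
        = ((n : ℝ) - 1) * (multCoeff Q b ε p * (ε / rQ Q p)) by ring, abs_mul, abs_mul,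
        abs_of_pos (by positivity : 0 < ε / rQ Q p), mul_assoc]
      gcongr
    have e2 : |scaledR Q ε p * box (multCoeff Q b ε) p| ≤ M * B := by
      rw [abs_mul]
      calc _ ≤ ε * rQ Q p * (M * symbolScale Q b p) := by
            unfold scaledR
            rw [abs_of_pos (by positivity : 0 < ε * rQ Q p)]
            gcongr
        _ = M * (ε * rQ Q p * symbolScale Q b p) := by ring
        _ = _ := by rw [hBs]
    have e3 : |2 * (fQ Q p * (0 * gf) + rQ Q p / 2 * (0 * gr + ε * gf) + ε * gr)| ≤ 3 * M * B := by
      rw [show 2 * (fQ Q p * (0 * gf) + rQ Q p / 2 * (0 * gr + ε * gf) + ε * gr)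
        = ε * rQ Q p * gf + 2 * ε * gr by ring]
      calc _ ≤ |ε * rQ Q p * gf| + |2 * ε * gr| := abs_add_le _ _
        _ ≤ ε * rQ Q p * (M * symbolScale Q b p) + 2 * ε * (M / rQ Q p) := by
            rw [abs_mul _ gf, abs_mul _ gr, abs_of_pos (by positivity : 0 < ε * rQ Q p),
              abs_of_pos (by positivity : 0 < 2 * ε)]
            gcongr
        _ = M * (ε * rQ Q p * symbolScale Q b p) + 2 * M * (ε / rQ Q p) := by ring
        _ ≤ M * B + 2 * M * B := by rw [hBs]; gcongr
        _ = _ := by ring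
    calc _ ≤ (n + 1) * M * B + M * B + 3 * M * B :=
          (abs_add_three _ _ _).trans (add_le_add (add_le_add e1 e2) e3)
      _ = (n + 5) * M * B := by ring
      _ ≤ _ := by gcongr; linarith
  · rw [d2.2]
    have hc := abs_coord_le hp.1 i
    have hsp : |spat Q i p / rQ Q p| ≤ 1 := by
      rw [abs_div, abs_of_pos hr0, div_le_one hr0]
      rcases i with i | i
      · simp [hr0.le]
      · exact abs_coord_le hp.1 (Sum.inr i)
    have hsg : |sgn i * coord Q i p / 2| ≤ rQ Q p / 2 := by
      have : |sgn i| = 1 := by rcases i with i | i <;> simp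
      rw [abs_div, abs_mul, this, abs_two, one_mul]
      gcongr
    have hfs := fQ_mul_symbolScale_sq hb hε hp
    have hsc := symbolScale_pos hb hg
    have hfs1 : fQ Q p * symbolScale Q b p ≤ 1 := by
      by_contra hcon
      push Not at hcon
      nlinarith
    have hfr : fQ Q p / rQ Q p ≤ rQ Q p / 4 := by
      rw [div_le_iff₀ hr0]; linarith [hg.four_f_le]
    calc fQ Q p * |hf * (sgn i * coord Q i p / 2) + hr * (spat Q i p / rQ Q p)|
        ≤ fQ Q p * (N * symbolScale Q b p * (rQ Q p / 2) + N / rQ Q p * 1) := by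
          gcongr
          refine (abs_add_le _ _).trans ?_
          rw [abs_mul, abs_mul]
          gcongr
      _ = N * (fQ Q p * symbolScale Q b p) * (rQ Q p / 2) + N * (fQ Q p / rQ Q p) := by ring
      _ ≤ N * 1 * (rQ Q p / 2) + N * (rQ Q p / 4) := by gcongr
      _ ≤ _ := by
          have : 0 ≤ N * rQ Q p := by positivity
          have : 0 ≤ ((n : ℝ) + 5) * M * rQ Q p := by positivity
          linarith

end Corrector

/-! ### Pointwise estimates for the multiplier -/

section Pointwise

variable {n : ℕ} {Q p : Spacetime n} {a b ε : ℝ}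

/-- The positive definite form which is controlled by the multiplier. -/
def energyForm (Q : Spacetime n) (ξ : Idx n → ℝ) (p : Spacetime n) : ℝ :=
  (∑ i, coord Q i p * ξ i) ^ 2
    + fQ Q p * ((∑ j : Fin n, ξ (Sum.inr j) ^ 2) - (∑ i, spat Q i p * ξ i) ^ 2 / rQ Q p ^ 2)
    + fQ Q p * ((∑ k : Fin 2, ξ (Sum.inl k) ^ 2)
      - (∑ k : Fin 2, coord Q (Sum.inl k) p * ξ (Sum.inl k)) ^ 2 / rQ Q p ^ 2)

lemma sum_spat_mul (ξ : Idx n → ℝ) :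
    ∑ i, spat Q i p * ξ i = ∑ j : Fin n, coord Q (Sum.inr j) p * ξ (Sum.inr j) := by
  simp [Fintype.sum_sum_type]

lemma sq_sum_spat_mul_le (ξ : Idx n → ℝ) :
    (∑ i, spat Q i p * ξ i) ^ 2 ≤ rQ Q p ^ 2 * ∑ j : Fin n, ξ (Sum.inr j) ^ 2 := by
  rw [sum_spat_mul, rQ_sq]
  exact Finset.sum_mul_sq_le_sq_mul_sq _ _ _

lemma sq_sum_time_mul_le (ξ : Idx n → ℝ) :
    (∑ k : Fin 2, coord Q (Sum.inl k) p * ξ (Sum.inl k)) ^ 2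
      ≤ tauQ Q p ^ 2 * ∑ k : Fin 2, ξ (Sum.inl k) ^ 2 := by
  rw [tauQ_sq]
  exact Finset.sum_mul_sq_le_sq_mul_sq _ _ _

/-- In the time part only T²/r² is subtracted, where T = t_Q · ξ_t. By Cauchy–Schwarz T² ≤ τ²|ξ_t|²,
and τ < r. -/
lemma energyForm_nonneg (hp : p ∈ exteriorCone Q) (ξ : Idx n → ℝ) : 0 ≤ energyForm Q ξ p := by
  have hr : 0 < rQ Q p := rQ_pos hp
  have hf : 0 < fQ Q p := hp
  have h1 : 0 ≤ (∑ j : Fin n, ξ (Sum.inr j) ^ 2) - (∑ i, spat Q i p * ξ i) ^ 2 / rQ Q p ^ 2 := by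
    rw [sub_nonneg, div_le_iff₀ (by positivity), mul_comm]
    exact sq_sum_spat_mul_le ξ
  have h2 : 0 ≤ (∑ k : Fin 2, ξ (Sum.inl k) ^ 2)
      - (∑ k : Fin 2, coord Q (Sum.inl k) p * ξ (Sum.inl k)) ^ 2 / rQ Q p ^ 2 := by
    rw [sub_nonneg, div_le_iff₀ (by positivity), mul_comm]
    refine (sq_sum_time_mul_le ξ).trans ?_
    have : tauQ Q p ≤ rQ Q p := (tauQ_lt_rQ hp).le
    have := tauQ_nonneg Q p
    gcongr
  unfold energyForm
  positivity

lemma energyForm_parallelogram (ξ η : Idx n → ℝ) :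
    energyForm Q (fun i => ξ i + η i) p + energyForm Q (fun i => ξ i - η i) p
      = 2 * energyForm Q ξ p + 2 * energyForm Q η p := by
  have e1 : ∀ {ι : Type} [Fintype ι] (c x y : ι → ℝ),
      ∑ i, c i * (x i + y i) = ∑ i, c i * x i + ∑ i, c i * y i := fun c x y => by
    rw [← Finset.sum_add_distrib]; exact Finset.sum_congr rfl fun i _ => by ring
  have e2 : ∀ {ι : Type} [Fintype ι] (c x y : ι → ℝ),
      ∑ i, c i * (x i - y i) = ∑ i, c i * x i - ∑ i, c i * y i := fun c x y => by
    rw [← Finset.sum_sub_distrib]; exact Finset.sum_congr rfl fun i _ => by ring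
  have e3 : ∀ {ι : Type} [Fintype ι] (x y : ι → ℝ),
      ∑ i, (x i + y i) ^ 2 = 2 * ∑ i, x i ^ 2 + 2 * ∑ i, y i ^ 2 - ∑ i, (x i - y i) ^ 2 :=
    fun x y => by
      rw [Finset.mul_sum, Finset.mul_sum, ← Finset.sum_add_distrib, ← Finset.sum_sub_distrib]
      exact Finset.sum_congr rfl fun i _ => by ring
  unfold energyForm
  rw [e1 (fun i => coord Q i p), e2 (fun i => coord Q i p), e1 (fun i => spat Q i p),
    e2 (fun i => spat Q i p), e3 (fun j => ξ (Sum.inr j)), e3 (fun j => ξ (Sum.inl j)),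
    e1 (fun k => coord Q (Sum.inl k) p) (fun k => ξ (Sum.inl k)),
    e2 (fun k => coord Q (Sum.inl k) p) (fun k => ξ (Sum.inl k))]
  ring

/-- The parallelogram identity with the nonnegative term for the sum dropped. -/
lemma energyForm_sub_le (hp : p ∈ exteriorCone Q) (ξ η : Idx n → ℝ) :
    energyForm Q (fun i => ξ i - η i) p ≤ 2 * energyForm Q ξ p + 2 * energyForm Q η p := by
  have := energyForm_parallelogram (Q := Q) (p := p) ξ η
  have := energyForm_nonneg hp fun i => ξ i + η i
  linarith

lemma energyForm_smul (c : ℝ) (ξ : Idx n → ℝ) :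
    energyForm Q (fun i => c * ξ i) p = c ^ 2 * energyForm Q ξ p := by
  have e1 : ∀ {ι : Type} [Fintype ι] (x y : ι → ℝ), ∑ i, x i * (c * y i) = c * ∑ i, x i * y i :=
    fun x y => by rw [Finset.mul_sum]; exact Finset.sum_congr rfl fun i _ => by ring
  have e2 : ∀ {ι : Type} [Fintype ι] (y : ι → ℝ), ∑ i, (c * y i) ^ 2 = c ^ 2 * ∑ i, y i ^ 2 :=
    fun y => by rw [Finset.mul_sum]; exact Finset.sum_congr rfl fun i _ => by ring
  unfold energyForm
  rw [e1, e1, e2, e1, e2]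
  ring

/-- The logarithmic derivative of the speed with respect to `f_Q`. -/
def speedLogDf (Q : Spacetime n) (b ε : ℝ) (p : Spacetime n) : ℝ :=
  betaDf Q b ε p / (1 + betaF Q b ε p) - 1 / fQ Q p - ε ^ 2 / pMinus Q ε p

/-- The logarithmic derivative of the speed with respect to `r_Q`. -/
def speedLogDr (Q : Spacetime n) (b ε : ℝ) (p : Spacetime n) : ℝ :=
  betaDr Q b ε p / (1 + betaF Q b ε p) + ε / pMinus Q ε p

/-- The derivative of `f_Q` along the multiplier field. -/
def fluxF (Q : Spacetime n) (b ε : ℝ) (p : Spacetime n) : ℝ :=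
  2 * alphaF Q b ε p * fQ Q p + deltaF Q b ε p * rQ Q p ^ 2 / 2

/-- The derivative of `r_Q` along the multiplier field. -/
def fluxR (Q : Spacetime n) (b ε : ℝ) (p : Spacetime n) : ℝ :=
  (alphaF Q b ε p + deltaF Q b ε p) * rQ Q p

/-- The convexity function of the phase. -/
def growthF (Q : Spacetime n) (b ε : ℝ) (p : Spacetime n) : ℝ :=
  fluxF Q b ε p * speedLogDf Q b ε p + fluxR Q b ε p * speedLogDr Q b ε p
    + 2 * alphaF Q b ε p + ε * fQ Q p / rQ Q p

/-- The scalar estimates at a point of the good region. -/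
structure ScalarBounds (Q : Spacetime n) (b ε : ℝ) (p : Spacetime n) : Prop where
  theta_ge : 97 / 100 ≤ thetaF Q b ε p
  theta_le : thetaF Q b ε p ≤ 1
  df_ge : 9 / 10 * betaF Q b ε p ≤ -(fQ Q p * thetaDf Q b ε p)
  df_le : -(fQ Q p * thetaDf Q b ε p) ≤ 11 / 10 * betaF Q b ε p
  dr_ge : 4 * (ε * rQ Q p) * betaF Q b ε p ≤ rQ Q p * thetaDr Q b ε p
  dr_le : rQ Q p * thetaDr Q b ε p ≤ 6 * (ε * rQ Q p) * betaF Q b ε p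
  flux_le : fluxF Q b ε p * thetaDf Q b ε p + fluxR Q b ε p * thetaDr Q b ε p ≤ 0
  growth_ge : 39 / 100 * betaF Q b ε p + ε * fQ Q p / rQ Q p ≤ growthF Q b ε p
  growth_le : growthF Q b ε p ≤ betaF Q b ε p + ε * fQ Q p / rQ Q p

/-- In the dimensionless quantities y = εr and κ = f/r² all claims reduce to
`speed_derivative_bounds`, with the derivatives of β and θ scaled by f and r respectively. -/
lemma scalarBounds (hb : 0 < b) (hε : 0 < ε) (hp : p ∈ goodRegion Q b ε) :
    ScalarBounds Q b ε p := by
  have hg := goodBounds hb hε hp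
  have hr := hg.r_pos
  have hf := hg.f_pos
  have hβ := hg.beta_pos
  have hβ1 := hg.beta_lt
  have hm : 0 < pMinus Q ε p := by linarith [hg.pMinus_ge]
  have hpp : 0 < pPlus Q ε p := by linarith [hg.pPlus_ge]
  have h1β : 0 < 1 + betaF Q b ε p := by linarith
  obtain ⟨y, hy⟩ : ∃ y, y = ε * rQ Q p := ⟨_, rfl⟩
  obtain ⟨κ, hκ⟩ : ∃ κ, κ = fQ Q p / rQ Q p ^ 2 := ⟨_, rfl⟩
  have hfκ : fQ Q p = κ * rQ Q p ^ 2 := by rw [hκ]; field_simp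
  have hyκ : y ^ 2 * κ = ε ^ 2 * fQ Q p := by rw [hy, hκ]; field_simp
  have hy0 : 0 < y := by rw [hy]; positivity
  have hκ0 : 0 < κ := by rw [hκ]; positivity
  have hκ1 : κ ≤ 1 / 4 := by
    rw [hκ, div_le_iff₀ (by positivity)]; linarith [hg.four_f_le]
  obtain ⟨u1, hu1⟩ : ∃ u, u = 1 / 2 + y ^ 2 * κ / pMinus Q ε p
    - 3 * (y ^ 2 * κ) / (2 * pPlus Q ε p) := ⟨_, rfl⟩
  obtain ⟨u2, hu2⟩ : ∃ u, u = 1 / pMinus Q ε p + 3 / (2 * pPlus Q ε p) := ⟨_, rfl⟩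
  obtain ⟨b1, hb1⟩ : ∃ b1, b1 = (1 - y * thetaF Q b ε p / 2)
      * (betaF Q b ε p * u1 / (1 + betaF Q b ε p) - 1 - y ^ 2 * κ / pMinus Q ε p)
      + ((1 - y * thetaF Q b ε p) / 2 + y * thetaF Q b ε p * κ)
        * (-(betaF Q b ε p * y * u2) / (1 + betaF Q b ε p) + y / pMinus Q ε p)
      + 1 - y * thetaF Q b ε p + y * κ := ⟨_, rfl⟩
  have e1 : fQ Q p * betaDf Q b ε p = betaF Q b ε p * u1 := by
    rw [hu1, hyκ]; unfold betaDf; field_simp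
  have e2 : rQ Q p * betaDr Q b ε p = -(betaF Q b ε p * y * u2) := by
    rw [hu2, hy]; unfold betaDr; field_simp
  have e3 : fluxF Q b ε p = fQ Q p * (1 - y * thetaF Q b ε p / 2) := by
    rw [hy]; unfold fluxF alphaF deltaF; field_simp; ring
  have e4 : fluxR Q b ε p
      = rQ Q p * ((1 - y * thetaF Q b ε p) / 2 + y * thetaF Q b ε p * κ) := by
    rw [hy, hκ]; unfold fluxR alphaF deltaF; field_simp
  have e5 : y * κ = ε * fQ Q p / rQ Q p := by rw [hy, hκ]; field_simp
  have e6 : growthF Q b ε p = b1 := by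
    have f1 : fQ Q p * speedLogDf Q b ε p
        = betaF Q b ε p * u1 / (1 + betaF Q b ε p) - 1 - y ^ 2 * κ / pMinus Q ε p := by
      rw [← e1, hyκ]; unfold speedLogDf; field_simp
    have f2 : rQ Q p * speedLogDr Q b ε p
        = -(betaF Q b ε p * y * u2) / (1 + betaF Q b ε p) + y / pMinus Q ε p := by
      rw [← e2, hy]; unfold speedLogDr; field_simp
    rw [hb1, ← f1, ← f2, e5]
    unfold growthF
    rw [e3, e4]
    unfold alphaF
    rw [hy]
    ring
  have hPm : pMinus Q ε p = 1 - y + y ^ 2 * κ := by rw [hyκ, hy]; rfl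
  have hPp : pPlus Q ε p = 1 + y + y ^ 2 * κ := by rw [hyκ, hy]; rfl
  have hyle : y ≤ 1 / 100 := by rw [hy]; exact hg.er_lt.le
  obtain ⟨g1, g2, g3, g4, g5, g6, g7, g8, g9⟩ := speed_derivative_bounds hy0 hyle hκ0 hκ1 hβ hβ1.le
    hPm hPp (rfl : thetaF Q b ε p = _) hu1 hu2 hb1
  have hsq : 1 ≤ (1 + betaF Q b ε p) ^ 2 ∧ (1 + betaF Q b ε p) ^ 2 ≤ 103 / 100 := by
    have h1 := mul_le_mul_of_nonneg_left hβ1.le hβ.le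
    have h2 := sq_nonneg (betaF Q b ε p)
    constructor <;> linarith
  have hsq0 : 0 < (1 + betaF Q b ε p) ^ 2 := by linarith
  have e7 : -(fQ Q p * thetaDf Q b ε p)
      = betaF Q b ε p * (2 * u1) / (1 + betaF Q b ε p) ^ 2 := by
    unfold thetaDf
    rw [show -(fQ Q p * (-2 / (1 + betaF Q b ε p) ^ 2 * betaDf Q b ε p))
      = 2 / (1 + betaF Q b ε p) ^ 2 * (fQ Q p * betaDf Q b ε p) by ring, e1]
    ring
  have e8 : rQ Q p * thetaDr Q b ε p
      = betaF Q b ε p * y * (2 * u2) / (1 + betaF Q b ε p) ^ 2 := by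
    unfold thetaDr
    rw [show rQ Q p * (-2 / (1 + betaF Q b ε p) ^ 2 * betaDr Q b ε p)
      = -2 / (1 + betaF Q b ε p) ^ 2 * (rQ Q p * betaDr Q b ε p) by ring, e2]
    ring
  have hβy : 0 < betaF Q b ε p * y := by positivity
  refine ⟨g1, g2, ?_, ?_, ?_, ?_, ?_, ?_, ?_⟩
  · rw [e7, le_div_iff₀ hsq0]
    linarith [mul_le_mul_of_nonneg_left hsq.2 hβ.le, mul_le_mul_of_nonneg_left g3 hβ.le]
  · rw [e7, div_le_iff₀ hsq0]
    linarith [mul_le_mul_of_nonneg_left hsq.1 hβ.le, mul_le_mul_of_nonneg_left g4 hβ.le]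
  · rw [e8, ← hy, le_div_iff₀ hsq0]
    linarith [mul_le_mul_of_nonneg_left hsq.2 hβy.le, mul_le_mul_of_nonneg_left g5 hβy.le]
  · rw [e8, ← hy, div_le_iff₀ hsq0]
    linarith [mul_le_mul_of_nonneg_left hsq.1 hβy.le, mul_le_mul_of_nonneg_left g6 hβy.le]
  · rw [e3, e4]
    unfold thetaDf thetaDr
    have e9 : fQ Q p * (1 - y * thetaF Q b ε p / 2) * (-2 / (1 + betaF Q b ε p) ^ 2 * betaDf Q b ε p)
        + rQ Q p * ((1 - y * thetaF Q b ε p) / 2 + y * thetaF Q b ε p * κ)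
          * (-2 / (1 + betaF Q b ε p) ^ 2 * betaDr Q b ε p)
        = -(2 / (1 + betaF Q b ε p) ^ 2 * (betaF Q b ε p * ((1 - y * thetaF Q b ε p / 2) * u1
          - ((1 - y * thetaF Q b ε p) / 2 + y * thetaF Q b ε p * κ) * (y * u2)))) := by
      have t1 := e1
      have t2 := e2
      calc _ = -2 / (1 + betaF Q b ε p) ^ 2 * ((1 - y * thetaF Q b ε p / 2)
            * (fQ Q p * betaDf Q b ε p) + ((1 - y * thetaF Q b ε p) / 2 + y * thetaF Q b ε p * κ)
              * (rQ Q p * betaDr Q b ε p)) := by ring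
        _ = _ := by rw [t1, t2]; ring
    rw [e9]
    have : 0 ≤ 2 / (1 + betaF Q b ε p) ^ 2 * (betaF Q b ε p * ((1 - y * thetaF Q b ε p / 2) * u1
          - ((1 - y * thetaF Q b ε p) / 2 + y * thetaF Q b ε p * κ) * (y * u2))) := by positivity
    linarith
  · rw [e6, ← e5]; exact g8
  · rw [e6, ← e5]; exact g9

/-- The deformation of the multiplier field, corrected by the zeroth order terms. -/
def deformForm (Q : Spacetime n) (b ε : ℝ) (ξ : Idx n → ℝ) (p : Spacetime n) : ℝ :=
  (∑ i, ∑ j, sgn i * ξ i * pd i (multField Q b ε j) p * ξ j)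
    - (alphaF Q b ε p + ε * fQ Q p / rQ Q p / 2) * ∑ i, sgn i * ξ i ^ 2

/-- A covector enters only through Xξ, xξ, t_Q · ξ_t, |ξ_x|² and |ξ_t|², so `deformation_bound`
applies with y = εr and κ = f/r². The gap it needs is τ² = (1 − 4κ)r². The loss in (Sξ)² is
harmless: its coefficient is small compared with aW. -/
lemma deformForm_ge (hb : 0 < b) (hε : 0 < ε) (hp : p ∈ goodRegion Q b ε) (ξ : Idx n → ℝ) :
    ε / rQ Q p / 8 * energyForm Q ξ p
      - (4 * (ε / rQ Q p) + betaF Q b ε p / (8 * fQ Q p)) * (∑ i, multField Q b ε i p * ξ i) ^ 2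
      ≤ deformForm Q b ε ξ p := by
  have hg := goodBounds hb hε hp
  have hs := scalarBounds hb hε hp
  have hr := hg.r_pos
  have hf := hg.f_pos
  obtain ⟨y, hy⟩ : ∃ y, y = ε * rQ Q p := ⟨_, rfl⟩
  obtain ⟨κ, hκ⟩ : ∃ κ, κ = fQ Q p / rQ Q p ^ 2 := ⟨_, rfl⟩
  have hfκ : fQ Q p = κ * rQ Q p ^ 2 := by rw [hκ]; field_simp
  have hεy : ε = y / rQ Q p := by rw [hy]; field_simp
  have hy0 : 0 < y := by rw [hy]; positivity
  have hκ0 : 0 < κ := by rw [hκ]; positivity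
  have hκ1 : κ ≤ 1 / 4 := by
    rw [hκ, div_le_iff₀ (by positivity)]; linarith [hg.four_f_le]
  have hχ : ∑ i, coord Q i p * ξ i = (∑ i, spat Q i p * ξ i)
      + ∑ k : Fin 2, coord Q (Sum.inl k) p * ξ (Sum.inl k) := by
    rw [sum_spat_mul, Fintype.sum_sum_type, add_comm]
  have hT := sq_sum_time_mul_le (Q := Q) (p := p) ξ
  rw [show tauQ Q p ^ 2 = (1 - 4 * κ) * rQ Q p ^ 2 by
    have := fQ_eq Q p; rw [hκ]; field_simp; linarith] at hT
  have hG : ∑ i, sgn i * ξ i ^ 2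
      = (∑ j : Fin n, ξ (Sum.inr j) ^ 2) - ∑ k : Fin 2, ξ (Sum.inl k) ^ 2 := by
    simp [Fintype.sum_sum_type]; ring
  have hσ : ∑ i, multField Q b ε i p * ξ i
      = (1 - y * thetaF Q b ε p) / 2 * (∑ i, coord Q i p * ξ i)
        + y * thetaF Q b ε p * κ * (∑ i, spat Q i p * ξ i) := by
    rw [sum_radialField_mul, hy, hκ]; unfold alphaF deltaF; field_simp
  have key := deformation_bound (r := rQ Q p) (y := y) (κ := κ) (β := betaF Q b ε p)
    (A := -(fQ Q p * thetaDf Q b ε p)) (B := rQ Q p * thetaDr Q b ε p) hr hy0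
    (by rw [hy]; exact hg.er_lt.le) hκ0 hκ1 hs.theta_ge hs.theta_le hg.beta_pos hs.df_ge hs.df_le
    (by rw [hy]; exact hs.dr_ge) (by rw [hy]; exact hs.dr_le) hχ
    (Finset.sum_nonneg fun _ _ => sq_nonneg _) hT (sq_sum_spat_mul_le ξ) hσ
  have hl : ε / rQ Q p = y / rQ Q p ^ 2 := by rw [hεy]; field_simp
  unfold deformForm
  rw [sum_deformation_radialField (hasFRDeriv_alphaF hg) (hasFRDeriv_deltaF hg), hG]
  have hE : energyForm Q ξ p = (∑ i, coord Q i p * ξ i) ^ 2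
    + κ * rQ Q p ^ 2 * ((∑ j : Fin n, ξ (Sum.inr j) ^ 2)
      - (∑ i, spat Q i p * ξ i) ^ 2 / rQ Q p ^ 2)
    + κ * rQ Q p ^ 2 * ((∑ k : Fin 2, ξ (Sum.inl k) ^ 2)
      - (∑ k : Fin 2, coord Q (Sum.inl k) p * ξ (Sum.inl k)) ^ 2 / rQ Q p ^ 2) := by
    rw [← hfκ]; rfl
  rw [hl, hE, show betaF Q b ε p / (8 * fQ Q p) = betaF Q b ε p / (8 * (κ * rQ Q p ^ 2)) by
    rw [hfκ]]
  refine key.trans (le_of_eq ?_)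
  unfold alphaF deltaF
  generalize ∑ i, coord Q i p * ξ i = χ
  generalize ∑ i, spat Q i p * ξ i = w
  generalize (∑ j : Fin n, ξ (Sum.inr j) ^ 2) = Γ
  generalize ∑ k : Fin 2, ξ (Sum.inl k) ^ 2 = Ξ
  rw [hfκ]
  generalize thetaF Q b ε p = θ
  generalize thetaDf Q b ε p = θf
  generalize thetaDr Q b ε p = θr
  rw [hεy]
  generalize rQ Q p = r at hr
  field_simp
  ring

lemma hasFRDeriv_potential' (h : GoodBounds Q b ε p) :
    HasFRDeriv Q (potential Q a b ε)
      (a ^ 2 * speedF Q b ε p ^ 2 * (2 * speedLogDf Q b ε p * fQ Q p * pTheta Q b ε p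
        + pTheta Q b ε p + fQ Q p * (-(ε * rQ Q p * thetaDf Q b ε p)
          + ε ^ 2 * (thetaF Q b ε p ^ 2 + 2 * thetaF Q b ε p * thetaDf Q b ε p * fQ Q p))))
      (a ^ 2 * speedF Q b ε p ^ 2 * (2 * speedLogDr Q b ε p * fQ Q p * pTheta Q b ε p
        + fQ Q p * (-(ε * (thetaF Q b ε p + rQ Q p * thetaDr Q b ε p))
          + ε ^ 2 * (2 * thetaF Q b ε p * thetaDr Q b ε p * fQ Q p)))) p :=
  hasFRDeriv_potential (hasFRDeriv_speedF h) (hasFRDeriv_pTheta h)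

lemma speedF_ge (h : GoodBounds Q b ε p) : 1 / fQ Q p ≤ speedF Q b ε p := by
  have hf := h.f_pos
  have hm : 0 < pMinus Q ε p := by linarith [h.pMinus_ge]
  unfold speedF
  rw [div_le_div_iff₀ hf (by positivity)]
  nlinarith [h.pMinus_le, h.beta_pos]

lemma speedF_le (h : GoodBounds Q b ε p) : speedF Q b ε p ≤ 103 / 100 * (1 / fQ Q p) := by
  have hf := h.f_pos
  have hm : 0 < pMinus Q ε p := by linarith [h.pMinus_ge]
  unfold speedF
  rw [div_le_iff₀ (by positivity)]
  field_simp
  nlinarith [h.pMinus_ge, h.beta_lt]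

/-- Lower bound for the coefficient of the zeroth order term. -/
lemma potential_bound (hb : 0 < b) (hε : 0 < ε) (hp : p ∈ goodRegion Q b ε) :
    38 / 100 * a ^ 2 * (betaF Q b ε p / fQ Q p) ≤
      (∑ i, multField Q b ε i p * pd i (potential Q a b ε) p) / 2
        + potential Q a b ε p * (alphaF Q b ε p + ε * fQ Q p / rQ Q p / 2) := by
  have hg := goodBounds hb hε hp
  have hs := scalarBounds hb hε hp
  have hr := hg.r_pos
  have hf := hg.f_pos
  have hβ := hg.beta_pos
  rw [sum_radialField_mul_pd (hasFRDeriv_potential' hg) hr]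
  obtain ⟨D, hD⟩ : ∃ D, D = fluxF Q b ε p * thetaDf Q b ε p + fluxR Q b ε p * thetaDr Q b ε p :=
    ⟨_, rfl⟩
  -- An exact identity: the derivative of the potential along S is expressed by `growthF`, up to a
  -- term with D = Sθ.
  have hid : ((2 * alphaF Q b ε p * fQ Q p + deltaF Q b ε p * rQ Q p ^ 2 / 2)
      * (a ^ 2 * speedF Q b ε p ^ 2 * (2 * speedLogDf Q b ε p * fQ Q p * pTheta Q b ε p
        + pTheta Q b ε p + fQ Q p * (-(ε * rQ Q p * thetaDf Q b ε p)
          + ε ^ 2 * (thetaF Q b ε p ^ 2 + 2 * thetaF Q b ε p * thetaDf Q b ε p * fQ Q p))))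
      + (alphaF Q b ε p + deltaF Q b ε p) * rQ Q p
      * (a ^ 2 * speedF Q b ε p ^ 2 * (2 * speedLogDr Q b ε p * fQ Q p * pTheta Q b ε p
        + fQ Q p * (-(ε * (thetaF Q b ε p + rQ Q p * thetaDr Q b ε p))
          + ε ^ 2 * (2 * thetaF Q b ε p * thetaDr Q b ε p * fQ Q p))))) / 2
      + potential Q a b ε p * (alphaF Q b ε p + ε * fQ Q p / rQ Q p / 2)
      = 1 / 2 * a ^ 2 * (speedF Q b ε p ^ 2 * fQ Q p)
        * (pTheta Q b ε p * (2 * growthF Q b ε p - ε * fQ Q p / rQ Q p)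
          + D * (-(ε * rQ Q p) + 2 * (ε ^ 2 * fQ Q p) * thetaF Q b ε p)) := by
    rw [hD]
    unfold growthF fluxF fluxR potential pTheta alphaF deltaF
    field_simp
    ring
  rw [hid]
  have hD0 : D ≤ 0 := by rw [hD]; exact hs.flux_le
  have hθ0 : 0 ≤ thetaF Q b ε p := by linarith [hs.theta_ge]
  have he0 : 0 < ε ^ 2 * fQ Q p := by positivity
  have hy0 : 0 < ε * rQ Q p := by positivity
  -- Both factors are nonpositive: θ does not increase along S, and 2ε²fθ is at most εr/200. So the
  -- term helps and is dropped.
  have h1 : 0 ≤ D * (-(ε * rQ Q p) + 2 * (ε ^ 2 * fQ Q p) * thetaF Q b ε p) := by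
    refine mul_nonneg_of_nonpos_of_nonpos hD0 ?_
    have := mul_le_mul_of_nonneg_left hs.theta_le he0.le
    linarith [hg.ef_le]
  have hP : 98 / 100 ≤ pTheta Q b ε p := by
    unfold pTheta
    have h2 : thetaF Q b ε p * rQ Q p ≤ 1 * rQ Q p := by
      have := hs.theta_le
      gcongr
    have h3 := mul_le_mul_of_nonneg_left h2 hε.le
    have h4 : 0 ≤ ε ^ 2 * (thetaF Q b ε p * thetaF Q b ε p * fQ Q p) := by positivity
    linarith [hg.er_lt]
  have he : 0 < ε * fQ Q p / rQ Q p := by positivity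
  have h5 : 98 / 100 * (78 / 100 * betaF Q b ε p)
      ≤ pTheta Q b ε p * (2 * growthF Q b ε p - ε * fQ Q p / rQ Q p) :=
    mul_le_mul hP (by linarith [hs.growth_ge]) (by positivity) (by linarith)
  have h6 : 1 / fQ Q p ≤ speedF Q b ε p ^ 2 * fQ Q p := by
    calc 1 / fQ Q p = (1 / fQ Q p) ^ 2 * fQ Q p := by field_simp
      _ ≤ _ := by gcongr; exact speedF_ge hg
  calc 38 / 100 * a ^ 2 * (betaF Q b ε p / fQ Q p)
      = 1 / 2 * a ^ 2 * (1 / fQ Q p) * (76 / 100 * betaF Q b ε p) := by ring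
    _ ≤ 1 / 2 * a ^ 2 * (speedF Q b ε p ^ 2 * fQ Q p) *
        (pTheta Q b ε p * (2 * growthF Q b ε p - ε * fQ Q p / rQ Q p)
          + D * (-(ε * rQ Q p) + 2 * (ε ^ 2 * fQ Q p) * thetaF Q b ε p)) := by
        gcongr
        linarith
    _ = _ := by ring

end Pointwise

/-! ### The pointwise Carleman inequality -/

section Carleman

variable {n : ℕ} {Q p : Spacetime n} {a b ε : ℝ} {z : Spacetime n → ℝ}

/-- The explicit formula suits the symbol calculus; this one suits the divergence identity. In it q
− (div S)/2 is precisely the correction subtracted in `deformForm`. -/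
lemma multWeight_eq (hb : 0 < b) (hε : 0 < ε) (hp : p ∈ goodRegion Q b ε) :
    multWeight Q b ε p = (∑ i, pd i (multField Q b ε i) p) / 2 - alphaF Q b ε p
      - ε * fQ Q p / rQ Q p / 2 := by
  have hg := goodBounds hb hε hp
  have hr := hg.r_pos
  have hf := hg.f_pos
  have hβ := hg.beta_pos
  have hm : 0 < pMinus Q ε p := by linarith [hg.pMinus_ge]
  have hpp : 0 < pPlus Q ε p := by linarith [hg.pPlus_ge]
  have h1β : 0 < 1 + betaF Q b ε p := by linarith
  rw [sum_pd_radialField (hasFRDeriv_alphaF hg) (hasFRDeriv_deltaF hg) hr]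
  have e1 : thetaLogF Q b ε p = -(fQ Q p * thetaDf Q b ε p) := by
    unfold thetaLogF thetaDf betaDf betaLogF
    field_simp
  have e2 : thetaLogR Q b ε p = rQ Q p * thetaDr Q b ε p := by
    unfold thetaLogR thetaDr betaDr betaLogR scaledR
    field_simp
  unfold multWeight multCoeff
  rw [e1, e2]
  unfold scaledR ratioF alphaF deltaF
  generalize thetaDf Q b ε p = θf
  generalize thetaDr Q b ε p = θr
  generalize thetaF Q b ε p = θ
  field_simp
  ring

lemma contDiffAt_phase (hb : 0 < b) (hε : 0 < ε) (hp : p ∈ goodRegion Q b ε) {k : WithTop ℕ∞} :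
    ContDiffAt ℝ k (phase Q b ε) p := by
  have hg := goodBounds hb hε hp
  have hf := hg.f_pos
  have hm : 0 < pMinus Q ε p := by linarith [hg.pMinus_ge]
  have hpp : 0 < pPlus Q ε p := by linarith [hg.pPlus_ge]
  have hfc : ContDiffAt ℝ k (fQ Q) p := (contDiff_fQ Q).contDiffAt
  have hrc : ContDiffAt ℝ k (rQ Q) p := contDiffAt_rQ hg.r_pos
  have hmc : ContDiffAt ℝ k (pMinus Q ε) p :=
    (contDiffAt_const.sub (contDiffAt_const.mul hrc)).add (contDiffAt_const.mul hfc)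
  have hpc : ContDiffAt ℝ k (pPlus Q ε) p :=
    (contDiffAt_const.add (contDiffAt_const.mul hrc)).add (contDiffAt_const.mul hfc)
  exact ((hfc.log hf.ne').sub (hmc.log hm.ne')).add (contDiffAt_const.mul
    ((hfc.sqrt hf.ne').div (hpc.sqrt hpp.ne') (Real.sqrt_pos.2 hpp).ne'))

/-- The square root of the weight. -/
def carl (Q : Spacetime n) (a b ε : ℝ) (p : Spacetime n) : ℝ := Real.exp (a * phase Q b ε p)

lemma carl_pos : 0 < carl Q a b ε p := Real.exp_pos _

lemma contDiffAt_carl (hb : 0 < b) (hε : 0 < ε) (hp : p ∈ goodRegion Q b ε) {k : WithTop ℕ∞} :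
    ContDiffAt ℝ k (carl Q a b ε) p :=
  (contDiffAt_const.mul (contDiffAt_phase hb hε hp)).exp

lemma pd_carl (hb : 0 < b) (hε : 0 < ε) (hp : p ∈ goodRegion Q b ε) (i : Idx n) :
    pd i (carl Q a b ε) p
      = carl Q a b ε p * (a * speedF Q b ε p * (sgn i * multField Q b ε i p)) := by
  have hd : DifferentiableAt ℝ (phase Q b ε) p :=
    (contDiffAt_phase hb hε hp (k := 1)).differentiableAt (by norm_num)
  have := pd_comp (i := i) (Real.hasDerivAt_exp (a * phase Q b ε p)) (hd.const_mul a)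
  unfold carl
  rw [this, pd_const_mul a hd, pd_phase (goodBounds hb hε hp)]
  ring

lemma differentiableAt_multField (hb : 0 < b) (hε : 0 < ε) (hp : p ∈ goodRegion Q b ε)
    (i : Idx n) : DifferentiableAt ℝ (multField Q b ε i) p :=
  differentiableAt_radialField (hasFRDeriv_alphaF (goodBounds hb hε hp)).1
    (hasFRDeriv_deltaF (goodBounds hb hε hp)).1 i

/-- □e^{aΦ} = e^{aΦ}(g(∇aΦ, ∇aΦ) + a□Φ). As ∇Φ = W S, the first summand is the potential and □Φ is
SW + W div S. -/
lemma box_carl (hb : 0 < b) (hε : 0 < ε) (hp : p ∈ goodRegion Q b ε) :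
    box (carl Q a b ε) p = carl Q a b ε p * (potential Q a b ε p
      + a * ((∑ i, multField Q b ε i p * pd i (speedF Q b ε) p)
        + speedF Q b ε p * ∑ i, pd i (multField Q b ε i) p)) := by
  have hg := goodBounds hb hε hp
  have hS := differentiableAt_multField hb hε hp
  have hW := (hasFRDeriv_speedF hg).1
  have hC : DifferentiableAt ℝ (carl Q a b ε) p :=
    (contDiffAt_carl hb hε hp (k := 1)).differentiableAt (by norm_num)
  have e : ∀ i : Idx n, sgn i * pd i (pd i (carl Q a b ε)) p
      = carl Q a b ε p * (a ^ 2 * speedF Q b ε p ^ 2 * (sgn i * multField Q b ε i p ^ 2)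
        + a * (multField Q b ε i p * pd i (speedF Q b ε) p)
        + a * speedF Q b ε p * pd i (multField Q b ε i) p) := by
    intro i
    have ev : pd i (carl Q a b ε) =ᶠ[𝓝 p] fun x =>
        carl Q a b ε x * (a * sgn i * (speedF Q b ε x * multField Q b ε i x)) := by
      filter_upwards [isOpen_goodRegion.mem_nhds hp] with x hx
      rw [pd_carl hb hε hx]; ring
    have d1 := hW.fun_mul (hS i)
    rw [pd_congr ev, pd_mul hC (d1.const_mul _), pd_const_mul _ d1, pd_mul hW (hS i),
      pd_carl hb hε hp]
    have s1 := sgn_mul_self i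
    calc _ = carl Q a b ε p * (a ^ 2 * speedF Q b ε p ^ 2
          * ((sgn i * sgn i) * sgn i * multField Q b ε i p ^ 2)
          + (sgn i * sgn i) * (a * (multField Q b ε i p * pd i (speedF Q b ε) p)
            + a * speedF Q b ε p * pd i (multField Q b ε i) p)) := by ring
      _ = _ := by rw [s1]; ring
  rw [box_eq (contDiffAt_carl hb hε hp), Finset.sum_congr rfl fun i _ => e i]
  simp only [Finset.sum_add_distrib, ← Finset.mul_sum]
  rw [sum_sgn_multField_sq hg]
  unfold potential
  ring

/-- The conjugated function. -/
abbrev conj (Q : Spacetime n) (a b ε : ℝ) (z : Spacetime n → ℝ) (p : Spacetime n) : ℝ :=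
  carl Q a b ε p * z p

lemma contDiffAt_conj (hb : 0 < b) (hε : 0 < ε) (hp : p ∈ goodRegion Q b ε) {k : WithTop ℕ∞}
    (hz : ContDiffAt ℝ k z p) : ContDiffAt ℝ k (conj Q a b ε z) p :=
  (contDiffAt_carl hb hε hp).mul hz

lemma pd_conj (hb : 0 < b) (hε : 0 < ε) (hp : p ∈ goodRegion Q b ε) (hz : DifferentiableAt ℝ z p)
    (i : Idx n) : pd i (conj Q a b ε z) p = carl Q a b ε p
      * (pd i z p + a * speedF Q b ε p * (sgn i * multField Q b ε i p) * z p) := by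
  unfold conj
  rw [pd_mul ((contDiffAt_carl hb hε hp (k := 1)).differentiableAt (by norm_num)) hz,
    pd_carl hb hε hp]
  ring

/-- Writing the first order term with Sψ instead of Sz removes the potential twice. It thus enters
with a minus sign although it has a plus sign in `box_carl`. -/
lemma box_conj (hb : 0 < b) (hε : 0 < ε) (hp : p ∈ goodRegion Q b ε) (hz : ContDiffAt ℝ 2 z p) :
    box (conj Q a b ε z) p = carl Q a b ε p * box z p
      + 2 * (a * speedF Q b ε p) * (∑ i, multField Q b ε i p * pd i (conj Q a b ε z) p)
      + (a * ((∑ i, multField Q b ε i p * pd i (speedF Q b ε) p)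
        + speedF Q b ε p * ∑ i, pd i (multField Q b ε i) p) - potential Q a b ε p)
        * conj Q a b ε z p := by
  have hzd : DifferentiableAt ℝ z p := hz.differentiableAt (by norm_num)
  have e1 : ∑ i, multField Q b ε i p * pd i (conj Q a b ε z) p
      = carl Q a b ε p * ((∑ i, multField Q b ε i p * pd i z p)
        + a * speedF Q b ε p * z p * ∑ i, sgn i * multField Q b ε i p ^ 2) := by
    rw [Finset.mul_sum, ← Finset.sum_add_distrib, Finset.mul_sum]
    refine Finset.sum_congr rfl fun i _ => ?_
    rw [pd_conj hb hε hp hzd]; ring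
  have e2 : ∑ i, sgn i * pd i (carl Q a b ε) p * pd i z p
      = carl Q a b ε p * (a * speedF Q b ε p) * ∑ i, multField Q b ε i p * pd i z p := by
    rw [Finset.mul_sum]
    refine Finset.sum_congr rfl fun i _ => ?_
    rw [pd_carl hb hε hp]
    calc _ = (sgn i * sgn i) * (carl Q a b ε p * (a * speedF Q b ε p)
          * (multField Q b ε i p * pd i z p)) := by ring
      _ = _ := by rw [sgn_mul_self, one_mul]
  rw [e1, sum_sgn_multField_sq (goodBounds hb hε hp)]
  unfold conj
  rw [box_mul (contDiffAt_carl hb hε hp) hz, box_carl hb hε hp, e2]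
  unfold potential
  ring

/-- The current of the Carleman estimate for a function with the given value of `z` and the
derivatives `ζ`. -/
def carlemanCurrent (Q : Spacetime n) (a b ε : ℝ) (z : Spacetime n → ℝ)
    (ζ : Idx n → Spacetime n → ℝ) : Idx n → Spacetime n → ℝ :=
  multiplierCurrent (multField Q b ε) (multWeight Q b ε) (potential Q a b ε) (conj Q a b ε z)
    (fun i p => carl Q a b ε p
      * (ζ i p + a * speedF Q b ε p * (sgn i * multField Q b ε i p) * z p))

/-- With Sψ = m − qψ the term 2aW Sψ · m becomes 2aW m² − 2aWqψm, and div S = 2q + 2α + εf/r makes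
the terms 2aWqψm cancel. What remains of the mixed terms is `growthF` alone, of size β. The
potential terms combine to (SA)/2 + A(α + εf/(2r)). -/
lemma sum_pd_carlemanCurrent (hb : 0 < b) (hε : 0 < ε) (hp : p ∈ goodRegion Q b ε)
    (hq : ContDiffAt ℝ 2 (multWeight Q b ε) p) (hz : ContDiffAt ℝ 2 z p) {m : ℝ}
    (hm : m = (∑ i, multField Q b ε i p * pd i (conj Q a b ε z) p)
      + multWeight Q b ε p * conj Q a b ε z p) :
    ∑ i, pd i (carlemanCurrent Q a b ε z (fun j => pd j z) i) p =
      carl Q a b ε p * box z p * m + deformForm Q b ε (fun i => pd i (conj Q a b ε z) p) p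
      + 2 * a * speedF Q b ε p * m ^ 2
      + a * speedF Q b ε p * growthF Q b ε p * conj Q a b ε z p * m
      + ((∑ i, multField Q b ε i p * pd i (potential Q a b ε) p) / 2
        + potential Q a b ε p * (alphaF Q b ε p + ε * fQ Q p / rQ Q p / 2)
        - box (multWeight Q b ε) p / 2) * conj Q a b ε z p ^ 2 := by
  have hg := goodBounds hb hε hp
  have hev : ∀ i, carlemanCurrent Q a b ε z (fun j => pd j z) i =ᶠ[𝓝 p]
      multiplierCurrent (multField Q b ε) (multWeight Q b ε) (potential Q a b ε) (conj Q a b ε z)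
        (fun j => pd j (conj Q a b ε z)) i := by
    intro i
    filter_upwards [isOpen_goodRegion.mem_nhds hp, eventually_contDiffAt_two hz] with x hx hzx
    have h1 : ∀ j, pd j (conj Q a b ε z) x = carl Q a b ε x
        * (pd j z x + a * speedF Q b ε x * (sgn j * multField Q b ε j x) * z x) := fun j =>
      pd_conj hb hε hx (hzx.differentiableAt (by norm_num)) j
    simp only [carlemanCurrent, multiplierCurrent, h1]
  rw [Finset.sum_congr rfl fun i _ => pd_congr (hev i),
    sum_pd_multiplierCurrent (differentiableAt_multField hb hε hp) hq
      (hasFRDeriv_potential' hg).1 (contDiffAt_conj hb hε hp hz), box_conj hb hε hp hz]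
  have hw := sum_radialField_mul_pd (α := alphaF Q b ε) (δ := deltaF Q b ε)
    (hasFRDeriv_speedF hg) hg.r_pos
  have hw2 : ∑ i, multField Q b ε i p * pd i (speedF Q b ε) p = speedF Q b ε p
      * (growthF Q b ε p - 2 * alphaF Q b ε p - ε * fQ Q p / rQ Q p) := by
    rw [hw]; unfold growthF fluxF fluxR speedLogDf speedLogDr; ring
  rw [hw2]
  have hq2 := multWeight_eq hb hε hp
  unfold deformForm
  generalize box (multWeight Q b ε) p = Bq
  have hσ : ∑ i, multField Q b ε i p * pd i (conj Q a b ε z) p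
      = m - multWeight Q b ε p * conj Q a b ε z p := by linarith
  have hdiv : ∑ i, pd i (multField Q b ε i) p
      = 2 * (multWeight Q b ε p + alphaF Q b ε p) + ε * fQ Q p / rQ Q p := by linarith
  rw [hσ, hdiv]
  ring

/-- The energy of the phase. -/
lemma energyForm_phase_le (hb : 0 < b) (hε : 0 < ε) (hp : p ∈ goodRegion Q b ε) :
    energyForm Q (fun i => a * speedF Q b ε p * (sgn i * multField Q b ε i p)) p
      ≤ 6 * a ^ 2 := by
  have hg := goodBounds hb hε hp
  have hs := scalarBounds hb hε hp
  have hr := hg.r_pos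
  have hf := hg.f_pos
  have hW0 : 0 < speedF Q b ε p := lt_of_lt_of_le (by positivity) (speedF_ge hg)
  have hWf : speedF Q b ε p * fQ Q p ≤ 103 / 100 := by
    have := mul_le_mul_of_nonneg_right (speedF_le hg) hf.le
    calc _ ≤ _ := this
      _ = _ := by field_simp
  obtain ⟨k, hk⟩ : ∃ k, k = a * speedF Q b ε p := ⟨_, rfl⟩
  rw [← hk, energyForm_smul]
  have hθ0 : 0 ≤ thetaF Q b ε p := by linarith [hs.theta_ge]
  have hy0 : 0 < ε * rQ Q p := by positivity
  have hyθ0 : 0 ≤ ε * (thetaF Q b ε p * rQ Q p) := by positivity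
  have hyθ : ε * (thetaF Q b ε p * rQ Q p) ≤ 1 / 100 := by
    have := mul_le_mul_of_nonneg_left hs.theta_le hy0.le
    linarith [hg.er_lt]
  -- contractions of the field
  have s1 : ∑ i, coord Q i p * (sgn i * multField Q b ε i p)
      = fQ Q p * (2 - ε * (thetaF Q b ε p * rQ Q p)) := by
    have e : ∀ i, coord Q i p * (sgn i * multField Q b ε i p)
        = alphaF Q b ε p * (sgn i * coord Q i p ^ 2) + deltaF Q b ε p * spat Q i p ^ 2 := fun i => by
      have h1 := sgn_mul_spat (Q := Q) (p := p) i
      have h2 := coord_mul_spat (Q := Q) (p := p) i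
      calc _ = alphaF Q b ε p * (sgn i * coord Q i p ^ 2)
            + deltaF Q b ε p * (coord Q i p * (sgn i * spat Q i p)) := by
              simp only [multField, radialField]; ring
        _ = _ := by rw [h1, h2]
    rw [Finset.sum_congr rfl fun i _ => e i, Finset.sum_add_distrib, ← Finset.mul_sum,
      ← Finset.mul_sum, sum_sgn_coord_sq, sum_spat_sq]
    unfold alphaF deltaF
    field_simp
    ring
  have s2 : ∀ j : Fin n, sgn (Sum.inr j) * multField Q b ε (Sum.inr j) p
      = (alphaF Q b ε p + deltaF Q b ε p) * coord Q (Sum.inr j) p := fun j => by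
    simp only [multField, radialField, sgn_inr, spat_inr]; ring
  have s3 : ∀ k : Fin 2, sgn (Sum.inl k : Idx n) * multField Q b ε (Sum.inl k) p
      = -alphaF Q b ε p * coord Q (Sum.inl k) p := fun k => by
    simp only [multField, radialField, sgn_inl, spat_inl]; ring
  unfold energyForm
  rw [s1, sum_spat_mul]
  simp only [s2, s3]
  have t1 : ∑ j : Fin n, ((alphaF Q b ε p + deltaF Q b ε p) * coord Q (Sum.inr j) p) ^ 2
      = (alphaF Q b ε p + deltaF Q b ε p) ^ 2 * rQ Q p ^ 2 := by
    rw [rQ_sq, Finset.mul_sum]; exact Finset.sum_congr rfl fun i _ => by ring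
  have t2 : ∑ j : Fin n, coord Q (Sum.inr j) p
      * ((alphaF Q b ε p + deltaF Q b ε p) * coord Q (Sum.inr j) p)
      = (alphaF Q b ε p + deltaF Q b ε p) * rQ Q p ^ 2 := by
    rw [rQ_sq, Finset.mul_sum]; exact Finset.sum_congr rfl fun i _ => by ring
  have t3 : ∑ j : Fin 2, (-alphaF Q b ε p * coord Q (Sum.inl j) p) ^ 2
      = alphaF Q b ε p ^ 2 * tauQ Q p ^ 2 := by
    rw [tauQ_sq, Finset.mul_sum]; exact Finset.sum_congr rfl fun i _ => by ring
  have t4 : ∑ j : Fin 2, coord Q (Sum.inl j) p * (-alphaF Q b ε p * coord Q (Sum.inl j) p)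
      = -alphaF Q b ε p * tauQ Q p ^ 2 := by
    rw [tauQ_sq, Finset.mul_sum]; exact Finset.sum_congr rfl fun i _ => by ring
  rw [t1, t2, t3, t4]
  have hτ : tauQ Q p ^ 2 = rQ Q p ^ 2 - 4 * fQ Q p := by have := fQ_eq Q p; linarith
  have hE : (fQ Q p * (2 - ε * (thetaF Q b ε p * rQ Q p))) ^ 2
      + fQ Q p * ((alphaF Q b ε p + deltaF Q b ε p) ^ 2 * rQ Q p ^ 2
        - ((alphaF Q b ε p + deltaF Q b ε p) * rQ Q p ^ 2) ^ 2 / rQ Q p ^ 2)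
      + fQ Q p * (alphaF Q b ε p ^ 2 * tauQ Q p ^ 2
        - (-alphaF Q b ε p * tauQ Q p ^ 2) ^ 2 / rQ Q p ^ 2)
      = fQ Q p ^ 2 * ((2 - ε * (thetaF Q b ε p * rQ Q p)) ^ 2
        + (2 * alphaF Q b ε p) ^ 2 * (tauQ Q p ^ 2 / rQ Q p ^ 2)) := by
    rw [hτ]; field_simp; ring
  rw [hE]
  have hα : (2 * alphaF Q b ε p) ^ 2 ≤ 1 := by
    have : 2 * alphaF Q b ε p = 1 - ε * (thetaF Q b ε p * rQ Q p) := by unfold alphaF; ring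
    rw [this]
    exact pow_le_one₀ (by linarith) (by linarith)
  have hτr : tauQ Q p ^ 2 / rQ Q p ^ 2 ≤ 1 := by
    rw [div_le_one (by positivity), hτ]; linarith
  have hτr0 : 0 ≤ tauQ Q p ^ 2 / rQ Q p ^ 2 := by positivity
  have h4 : (2 - ε * (thetaF Q b ε p * rQ Q p)) ^ 2 ≤ 2 ^ 2 := by
    gcongr
    · linarith
    · linarith
  have h5 : (speedF Q b ε p * fQ Q p) ^ 2 ≤ (103 / 100) ^ 2 := by gcongr
  calc k ^ 2 * (fQ Q p ^ 2 * ((2 - ε * (thetaF Q b ε p * rQ Q p)) ^ 2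
        + (2 * alphaF Q b ε p) ^ 2 * (tauQ Q p ^ 2 / rQ Q p ^ 2)))
      = a ^ 2 * (speedF Q b ε p * fQ Q p) ^ 2 * ((2 - ε * (thetaF Q b ε p * rQ Q p)) ^ 2
        + (2 * alphaF Q b ε p) ^ 2 * (tauQ Q p ^ 2 / rQ Q p ^ 2)) := by rw [hk]; ring
    -- W f ≤ 1.03, and 1.03² · 5 is below 6.
    _ ≤ a ^ 2 * (103 / 100) ^ 2 * (2 ^ 2 + 1 * 1) := by gcongr
    _ ≤ _ := by nlinarith [sq_nonneg a]

/-- e^{aΦ}∂z = ∂ψ − ψ ∂(aΦ), and the energy of ∂(aΦ) is at most 6a². -/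
lemma energyForm_conj_ge (hb : 0 < b) (hε : 0 < ε) (hp : p ∈ goodRegion Q b ε)
    (hz : DifferentiableAt ℝ z p) :
    carl Q a b ε p ^ 2 * energyForm Q (fun i => pd i z p) p / 2 - 6 * a ^ 2 * conj Q a b ε z p ^ 2
      ≤ energyForm Q (fun i => pd i (conj Q a b ε z) p) p := by
  have h1 := energyForm_sub_le hp.1 (fun i => pd i (conj Q a b ε z) p)
    (fun i => conj Q a b ε z p * (a * speedF Q b ε p * (sgn i * multField Q b ε i p)))
  have e : (fun i => pd i (conj Q a b ε z) p
      - conj Q a b ε z p * (a * speedF Q b ε p * (sgn i * multField Q b ε i p)))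
      = fun i => carl Q a b ε p * pd i z p := by
    funext i
    rw [pd_conj hb hε hp hz]; unfold conj; ring
  rw [e, energyForm_smul, energyForm_smul (Q := Q) (conj Q a b ε z p)] at h1
  have h2 := mul_le_mul_of_nonneg_left (energyForm_phase_le (a := a) hb hε hp)
    (sq_nonneg (conj Q a b ε z p))
  linarith

/-- The square 2aW m² is spent in three parts: aW/2 for the source L m, aW for the mixed term, aW/2
for the loss in σ². In units of a²(β/f)ψ², the coefficient 0.38 pays 0.01, 0.02, 0.02 and 0.0075 for
the mixed term, for qψ inside σ, for □q and for returning to the energy of z. More than 1/5 remains.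
The condition on a enters through q² ≤ a²/36. -/
lemma carleman_scalar {a f e β W q Bq b1 N : ℝ} (hf : 0 < f) (hβ : 0 < β) (hβ1 : β ≤ 1 / 100)
    (hN : 1 ≤ N) (ha : (N + 2) ^ 2 ≤ a) (he0 : 0 < e) (he : e * f ≤ β / 100) (hW0 : 1 / f ≤ W)
    (hW1 : W ≤ 103 / 100 * (1 / f)) (hq : |q| ≤ N / 2) (hBq : |Bq| ≤ 3 * (β / f)) (hb0 : 0 ≤ b1)
    (hb1 : b1 ≤ 101 / 100 * β) {D E ζE L m ψ σ Z : ℝ} (hσ : σ = m - q * ψ)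
    (hD : e / 8 * E - (4 * e + β / (8 * f)) * σ ^ 2 ≤ D) (hE : ζE / 2 - 6 * a ^ 2 * ψ ^ 2 ≤ E)
    (hZ : 38 / 100 * a ^ 2 * (β / f) ≤ Z) :
    e / 16 * ζE + a ^ 2 / 5 * (β / f) * ψ ^ 2 ≤ f / (2 * a) * L ^ 2
      + (L * m + D + 2 * a * W * m ^ 2 + a * W * b1 * ψ * m + (Z - Bq / 2) * ψ ^ 2) := by
  have ha9 : 9 ≤ a := by nlinarith
  have ha0 : 0 < a := by linarith
  have hN2 : N ^ 2 ≤ a ^ 2 / 9 := by nlinarith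
  obtain ⟨B, hB⟩ : ∃ B, B = β / f := ⟨_, rfl⟩
  have hB0 : 0 < B := by rw [hB]; positivity
  have hfB : β = B * f := by rw [hB]; field_simp
  have heB : e ≤ B / 100 := by
    rw [hfB] at he
    exact le_of_mul_le_mul_right (by linarith) hf
  have hWpos : 0 < W := lt_of_lt_of_le (by positivity) hW0
  have hB1 : B ≤ 1 / 100 * (1 / f) := by rw [hB, div_eq_mul_one_div]; gcongr
  have hBW : B ≤ W / 100 := by linarith
  -- the square
  have h1 : -(a * W / 2 * m ^ 2) ≤ f / (2 * a) * L ^ 2 + L * m := by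
    have h2 : 0 ≤ f / (2 * a) * (L + a * m / f) ^ 2 := by positivity
    have h3 : f / (2 * a) * (L + a * m / f) ^ 2
        = f / (2 * a) * L ^ 2 + L * m + a * (1 / f) / 2 * m ^ 2 := by field_simp; ring
    have h4 : a * (1 / f) / 2 * m ^ 2 ≤ a * W / 2 * m ^ 2 := by gcongr
    linarith
  have h2 : -(a * W * m ^ 2) - a * W * b1 ^ 2 / 4 * ψ ^ 2 ≤ a * W * b1 * ψ * m := by
    have : 0 ≤ a * W * (m + b1 * ψ / 2) ^ 2 := by positivity
    linarith
  have h3 : a * W * b1 ^ 2 / 4 * ψ ^ 2 ≤ a ^ 2 * B / 100 * ψ ^ 2 := by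
    have : b1 ^ 2 ≤ (101 / 100 * β) * (102 / 10000) := by
      rw [sq]
      exact mul_le_mul hb1 (by linarith) hb0 (by positivity)
    have h5 : a * W * b1 ^ 2 / 4 ≤ a * (103 / 100 * (1 / f)) * ((101 / 100 * β) * (102 / 10000)) / 4 := by
      gcongr
    have h6 : a * (103 / 100 * (1 / f)) * ((101 / 100 * β) * (102 / 10000)) / 4
        = a * B * (103 / 100 * (101 / 100) * (102 / 10000) / 4) := by rw [hB]; ring
    have h7 : a * B * 9 ≤ a * B * a := by gcongr
    have h8 : 0 < a * B := by positivity
    exact mul_le_mul_of_nonneg_right (by linarith) (sq_nonneg ψ)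
  have h4 : (4 * e + β / (8 * f)) * σ ^ 2
      ≤ a * W / 2 * m ^ 2 + a ^ 2 * B / 50 * ψ ^ 2 := by
    have h5 : β / (8 * f) = B / 8 := by rw [hB]; field_simp
    have h6 : σ ^ 2 ≤ 2 * m ^ 2 + 2 * (q ^ 2 * ψ ^ 2) := by
      rw [hσ]
      have := sq_nonneg (m + q * ψ)
      linarith
    have h7 : q ^ 2 ≤ a ^ 2 / 36 := by
      have : q ^ 2 ≤ (N / 2) ^ 2 := by
        rw [← sq_abs q]; gcongr
      linarith
    have h8 : 4 * e + β / (8 * f) ≤ B / 5 := by rw [h5]; linarith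
    have h9 : B * 9 ≤ W / 100 * a := by gcongr
    have h10 : B * m ^ 2 ≤ a * W / 100 * m ^ 2 := by
      gcongr
      linarith
    have h11 : 0 ≤ a * W * m ^ 2 := by positivity
    have h12 : B * (q ^ 2 * ψ ^ 2) ≤ B * (a ^ 2 / 36 * ψ ^ 2) := by gcongr
    calc _ ≤ B / 5 * (2 * m ^ 2 + 2 * (q ^ 2 * ψ ^ 2)) := by gcongr
      _ ≤ _ := by
        have : 0 ≤ a ^ 2 * B * ψ ^ 2 := by positivity
        linarith
  have h5 : -(a ^ 2 * B / 50 * ψ ^ 2) ≤ -(Bq / 2) * ψ ^ 2 := by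
    have h6 := (abs_le.1 hBq).2
    rw [← hB] at h6
    have h7 : 81 * B ≤ a ^ 2 * B := by
      gcongr; nlinarith
    have : Bq / 2 * ψ ^ 2 ≤ a ^ 2 * B / 50 * ψ ^ 2 :=
      mul_le_mul_of_nonneg_right (by linarith) (sq_nonneg ψ)
    linarith
  have h6 : e / 8 * (ζE / 2 - 6 * a ^ 2 * ψ ^ 2) ≤ e / 8 * E := by gcongr
  have h7 : e / 8 * (6 * a ^ 2 * ψ ^ 2) ≤ B / 100 / 8 * (6 * a ^ 2 * ψ ^ 2) := by gcongr
  have h8 : 38 / 100 * a ^ 2 * B * ψ ^ 2 ≤ Z * ψ ^ 2 := by rw [hB]; gcongr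
  have h9 : 0 ≤ a ^ 2 * B * ψ ^ 2 := by positivity
  rw [← hB]
  linarith

/-- The pointwise Carleman inequality. -/
lemma carleman_pointwise {M c : ℝ} (hb : 0 < b) (hε : 0 < ε) (hp : p ∈ goodRegion Q b ε)
    (hn : 1 ≤ n) (ha : ((n : ℝ) + 2) ^ 2 ≤ a) (hεb : ε ≤ c * b) (hc : c ≤ 1 / 100)
    (hM0 : 0 < M) (hMc : M * c ≤ 1) (hMr : M * (ε * rQ Q p) ≤ 1 / 4)
    (hq : ContDiffAt ℝ 2 (multWeight Q b ε) p)
    (hq1 : |multWeight Q b ε p - n / 4| ≤ M * (ε * rQ Q p))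
    (hq2 : |box (multWeight Q b ε) p| ≤ M * (ε / rQ Q p + ε * rQ Q p * (b / √(fQ Q p))))
    (hz : ContDiffAt ℝ 2 z p) :
    ε / rQ Q p / 16 * (carl Q a b ε p ^ 2 * energyForm Q (fun i => pd i z p) p)
      + a ^ 2 / 5 * (betaF Q b ε p / fQ Q p) * conj Q a b ε z p ^ 2
      ≤ fQ Q p / (2 * a) * (carl Q a b ε p * box z p) ^ 2
        + ∑ i, pd i (carlemanCurrent Q a b ε z (fun j => pd j z) i) p := by
  have hg := goodBounds hb hε hp
  have hs := scalarBounds hb hε hp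
  have hr := hg.r_pos
  have hf := hg.f_pos
  have hβ := hg.beta_pos
  have hsq := Real.sqrt_pos.2 hf
  have hn1 : (1 : ℝ) ≤ n := by exact_mod_cast hn
  have hc0 : 0 < c := by
    by_contra h
    push Not at h
    nlinarith
  -- From f/r ≤ √f/2 and ε ≤ c b, the quantity εf/r is at most c b√f/2, which β dominates. This is
  -- the role of ε being small relative to b.
  have hef : ε / rQ Q p * fQ Q p ≤ c * betaF Q b ε p := by
    have h1 : fQ Q p / rQ Q p ≤ √(fQ Q p) / 2 := by
      rw [div_le_iff₀ hr]
      have h2 : 2 * √(fQ Q p) ≤ rQ Q p := by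
        have := hg.four_f_le
        rw [← Real.sq_sqrt hf.le] at this
        nlinarith
      nth_rewrite 1 [← Real.sq_sqrt hf.le]
      nlinarith
    calc ε / rQ Q p * fQ Q p = ε * (fQ Q p / rQ Q p) := by ring
      _ ≤ c * b * (√(fQ Q p) / 2) := by gcongr
      _ = c * (b * √(fQ Q p) / 2) := by ring
      _ ≤ _ := by gcongr; linarith [hg.beta_ge]
  have hef' : ε * fQ Q p / rQ Q p ≤ betaF Q b ε p / 100 := by
    calc ε * fQ Q p / rQ Q p = ε / rQ Q p * fQ Q p := by ring
      _ ≤ c * betaF Q b ε p := hef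
      _ ≤ 1 / 100 * betaF Q b ε p := by gcongr
      _ = _ := by ring
  have he0 : 0 < ε / rQ Q p := by positivity
  have he1 : 0 < ε * fQ Q p / rQ Q p := by positivity
  have hq' : |multWeight Q b ε p| ≤ n / 2 := by
    have := (abs_le.1 (hq1.trans hMr))
    rw [abs_le]
    constructor <;> linarith
  -- The part ε/r of the bound is at most cβ/f, with M c ≤ 1; the part with b/√f carries the factor
  -- Mεr ≤ 1/4.
  have hBq : |box (multWeight Q b ε) p| ≤ 3 * (betaF Q b ε p / fQ Q p) := by
    refine hq2.trans ?_
    have h1 : ε / rQ Q p ≤ c * (betaF Q b ε p / fQ Q p) := by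
      rw [← mul_div_assoc, le_div_iff₀ hf]; exact hef
    have h2 : b / √(fQ Q p) ≤ 2 * (betaF Q b ε p / fQ Q p) := by
      have : b / √(fQ Q p) = b * √(fQ Q p) / fQ Q p := by
        nth_rewrite 3 [← Real.sq_sqrt hf.le]
        field_simp
      rw [this, ← mul_div_assoc]
      exact div_le_div_of_nonneg_right (by linarith [hg.beta_ge]) hf.le
    have hB0 : 0 < betaF Q b ε p / fQ Q p := by positivity
    calc M * (ε / rQ Q p + ε * rQ Q p * (b / √(fQ Q p)))
        = M * (ε / rQ Q p) + M * (ε * rQ Q p) * (b / √(fQ Q p)) := by ring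
      _ ≤ M * (c * (betaF Q b ε p / fQ Q p)) + 1 / 4 * (2 * (betaF Q b ε p / fQ Q p)) := by
        gcongr
      _ = M * c * (betaF Q b ε p / fQ Q p) + 1 / 2 * (betaF Q b ε p / fQ Q p) := by ring
      _ ≤ 1 * (betaF Q b ε p / fQ Q p) + 1 / 2 * (betaF Q b ε p / fQ Q p) := by gcongr
      _ ≤ _ := by linarith
  have hD := deformForm_ge hb hε hp (fun i => pd i (conj Q a b ε z) p)
  have hE := energyForm_conj_ge (a := a) hb hε hp (hz.differentiableAt (by norm_num) : _)
  rw [sum_pd_carlemanCurrent hb hε hp hq hz rfl]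
  exact carleman_scalar hf hβ hg.beta_lt.le hn1 ha he0
    (by have : ε / rQ Q p * fQ Q p = ε * fQ Q p / rQ Q p := by ring
        linarith) (speedF_ge hg) (speedF_le hg) hq' hBq
    (by linarith [hs.growth_ge]) (by linarith [hs.growth_le]) (by ring) hD hE
    (potential_bound hb hε hp)

end Carleman

/-! ### Cutting off near the observed part of the boundary -/

section Cutoff

variable {n : ℕ} {Q p : Spacetime n} {a b ε N : ℝ} {z φ χ : Spacetime n → ℝ}

/-- The current of the localized energy estimate for the spatial derivatives. -/
def localCurrent (Q : Spacetime n) (a b ε : ℝ) (φ z : Spacetime n → ℝ)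
    (ζ : Idx n → Spacetime n → ℝ) (i : Idx n) (p : Spacetime n) : ℝ :=
  sgn i * (carl Q a b ε p ^ 2 * φ p ^ 2 * z p * ζ i p)

/-- The signature makes |∇_x z|² − |∇_t z|² appear, which allows the spatial derivatives to be
bounded by the time derivatives. -/
lemma sum_pd_localCurrent (hb : 0 < b) (hε : 0 < ε) (hp : p ∈ goodRegion Q b ε)
    (hφ : ContDiffAt ℝ 2 φ p) (hz : ContDiffAt ℝ 2 z p) :
    ∑ i, pd i (localCurrent Q a b ε φ z (fun j => pd j z) i) p =
      carl Q a b ε p ^ 2 * (φ p ^ 2 * (z p * box z p + ∑ i, sgn i * pd i z p ^ 2)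
        + 2 * φ p ^ 2 * (a * speedF Q b ε p) * z p * (∑ i, multField Q b ε i p * pd i z p)
        + 2 * φ p * z p * ∑ i, sgn i * pd i φ p * pd i z p) := by
  have hc : DifferentiableAt ℝ (carl Q a b ε) p :=
    (contDiffAt_carl hb hε hp (k := 1)).differentiableAt (by norm_num)
  have hφd : DifferentiableAt ℝ φ p := hφ.differentiableAt (by norm_num)
  have hzd : DifferentiableAt ℝ z p := hz.differentiableAt (by norm_num)
  have e : ∀ i : Idx n, pd i (localCurrent Q a b ε φ z (fun j => pd j z) i) p =
      carl Q a b ε p ^ 2 * (φ p ^ 2 * (z p * (sgn i * pd i (pd i z) p) + sgn i * pd i z p ^ 2)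
        + 2 * φ p ^ 2 * (a * speedF Q b ε p) * z p * (multField Q b ε i p * pd i z p)
        + 2 * φ p * z p * (sgn i * pd i φ p * pd i z p)) := by
    intro i
    have hzi : DifferentiableAt ℝ (pd i z) p := differentiableAt_pd hz
    have d1 := hc.fun_pow 2
    have d2 := hφd.fun_pow 2
    unfold localCurrent
    rw [pd_const_mul _ (((d1.fun_mul d2).fun_mul hzd).fun_mul hzi),
      pd_mul ((d1.fun_mul d2).fun_mul hzd) hzi, pd_mul (d1.fun_mul d2) hzd, pd_mul d1 d2,
      pd_sq hc, pd_sq hφd, pd_carl hb hε hp]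
    have s1 := sgn_mul_self i
    calc _ = carl Q a b ε p ^ 2 * (φ p ^ 2 * (z p * (sgn i * pd i (pd i z) p)
          + sgn i * pd i z p ^ 2)
        + 2 * φ p ^ 2 * (a * speedF Q b ε p) * z p * ((sgn i * sgn i)
          * multField Q b ε i p * pd i z p)
        + 2 * φ p * z p * (sgn i * pd i φ p * pd i z p)) := by ring
      _ = _ := by rw [s1, one_mul]
  rw [Finset.sum_congr rfl fun i _ => e i, ← Finset.mul_sum]
  simp only [Finset.sum_add_distrib, ← Finset.mul_sum]
  rw [box_eq hz]

lemma sum_multField_sq_le (hb : 0 < b) (hε : 0 < ε) (hp : p ∈ goodRegion Q b ε) :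
    ∑ i, multField Q b ε i p ^ 2 ≤ rQ Q p ^ 2 := by
  have hg := goodBounds hb hε hp
  have hs := scalarBounds hb hε hp
  have hr := hg.r_pos
  have hf := hg.f_pos
  have hθ0 : 0 ≤ thetaF Q b ε p := by linarith [hs.theta_ge]
  have hy0 : 0 < ε * rQ Q p := by positivity
  have hyθ0 : 0 ≤ ε * (thetaF Q b ε p * rQ Q p) := by positivity
  have hyθ : ε * (thetaF Q b ε p * rQ Q p) ≤ 1 / 100 := by
    have := mul_le_mul_of_nonneg_left hs.theta_le hy0.le
    linarith [hg.er_lt]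
  have hα0 : 0 ≤ alphaF Q b ε p := by unfold alphaF; linarith
  have hα1 : alphaF Q b ε p ≤ 1 / 2 := by unfold alphaF; linarith
  have hδ0 : 0 ≤ deltaF Q b ε p := by unfold deltaF; positivity
  have hδ1 : deltaF Q b ε p ≤ 1 / 100 := by
    have : deltaF Q b ε p = ε * (thetaF Q b ε p * rQ Q p) * (fQ Q p / rQ Q p ^ 2) := by
      unfold deltaF; field_simp
    have h4 : fQ Q p / rQ Q p ^ 2 ≤ 1 := by
      rw [div_le_one (by positivity)]; linarith [hg.four_f_le]
    rw [this]
    calc _ ≤ 1 / 100 * (1 : ℝ) := by gcongr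
      _ = _ := by ring
  have hτ : tauQ Q p ^ 2 ≤ rQ Q p ^ 2 := by
    have := fQ_eq Q p; linarith
  have e : ∑ i, multField Q b ε i p ^ 2
      = alphaF Q b ε p ^ 2 * tauQ Q p ^ 2 + (alphaF Q b ε p + deltaF Q b ε p) ^ 2 * rQ Q p ^ 2 := by
    rw [Fintype.sum_sum_type, rQ_sq, tauQ_sq, Finset.mul_sum, Finset.mul_sum]
    congr 1 <;> refine Finset.sum_congr rfl fun i _ => ?_ <;>
      simp only [multField, radialField, spat_inl, spat_inr] <;> ring
  rw [e]
  have h1 : alphaF Q b ε p ^ 2 ≤ (1 / 2) ^ 2 := by gcongr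
  have h2 : (alphaF Q b ε p + deltaF Q b ε p) ^ 2 ≤ (51 / 100) ^ 2 := by
    gcongr; linarith
  calc _ ≤ (1 / 2) ^ 2 * rQ Q p ^ 2 + (51 / 100) ^ 2 * rQ Q p ^ 2 := by gcongr
    _ ≤ _ := by linarith [sq_nonneg (rQ Q p)]

lemma sq_sum_mul_le {ι : Type*} [Fintype ι] {x y : ι → ℝ} {A B : ℝ} (hx : ∑ i, x i ^ 2 ≤ A)
    (hy : ∑ i, y i ^ 2 ≤ B) : (∑ i, x i * y i) ^ 2 ≤ A * B :=
  (Finset.sum_mul_sq_le_sq_mul_sq _ _ _).trans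
    (mul_le_mul hx hy (Finset.sum_nonneg fun _ _ => sq_nonneg _)
      ((Finset.sum_nonneg fun _ _ => sq_nonneg _).trans hx))

lemma sum_sq_eq (ξ : Idx n → ℝ) : ∑ i, ξ i ^ 2
    = (∑ j : Fin n, ξ (Sum.inr j) ^ 2) + ∑ k : Fin 2, ξ (Sum.inl k) ^ 2 := by
  rw [Fintype.sum_sum_type, add_comm]

lemma sum_sgn_mul_sq (ξ : Idx n → ℝ) : ∑ i, sgn i * ξ i ^ 2
    = (∑ j : Fin n, ξ (Sum.inr j) ^ 2) - ∑ k : Fin 2, ξ (Sum.inl k) ^ 2 := by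
  simp [Fintype.sum_sum_type]; ring

/-- Young's inequality without division: (c/4 + 4d x²)² ≥ 4 c d x² ≥ (2xy)². -/
lemma two_mul_le_of_sq_le {x y c d : ℝ} (hc : 0 ≤ c) (hd : 0 ≤ d) (h : y ^ 2 ≤ c * d) :
    2 * (x * y) ≤ c / 4 + 4 * d * x ^ 2 := by
  have h0 : 0 ≤ c / 4 + 4 * d * x ^ 2 := by positivity
  refine le_of_abs_le (abs_le_of_sq_le_sq ?_ h0)
  have h1 := mul_le_mul_of_nonneg_left h (sq_nonneg x)
  have h2 := sq_nonneg (c / 4 - 4 * d * x ^ 2)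
  linarith

/-- The localized energy estimate for the spatial derivatives, pointwise. -/
lemma local_pointwise (ha : 0 < a) (hb : 0 < b) (hε : 0 < ε) (hp : p ∈ goodRegion Q b ε)
    (hφ : ContDiffAt ℝ 2 φ p) (hz : ContDiffAt ℝ 2 z p) :
    carl Q a b ε p ^ 2 * (φ p ^ 2 * (∑ j : Fin n, pd (Sum.inr j) z p ^ 2) / 2) ≤
      (∑ i, pd i (localCurrent Q a b ε φ z (fun j => pd j z) i) p)
      + carl Q a b ε p ^ 2 * (3 / 2 * φ p ^ 2 * (∑ k : Fin 2, pd (Sum.inl k) z p ^ 2)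
        + fQ Q p / (2 * a) * (φ p ^ 2 * box z p ^ 2)
        + (a / (2 * fQ Q p) + 5 * a ^ 2 * rQ Q p ^ 2 / fQ Q p ^ 2) * (φ p ^ 2 * z p ^ 2)
        + 4 * (∑ i, pd i φ p ^ 2) * z p ^ 2) := by
  have hg := goodBounds hb hε hp
  have hf := hg.f_pos
  have hW0 : 0 < speedF Q b ε p := lt_of_lt_of_le (by positivity) (speedF_ge hg)
  rw [sum_pd_localCurrent hb hε hp hφ hz, ← mul_add]
  refine mul_le_mul_of_nonneg_left ?_ (sq_nonneg _)
  rw [sum_sgn_mul_sq]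
  have hY := sum_sq_eq (fun i : Idx n => pd i z p)
  -- Each of the two cross terms costs a quarter of the full gradient. Half of |∇_x z|² survives,
  -- and |∇_t z|² gets the coefficient 1 + 1/4 + 1/4.
  have h1 : 2 * (-(a * speedF Q b ε p * z p) * ∑ i, multField Q b ε i p * pd i z p)
      ≤ (∑ i, pd i z p ^ 2) / 4
        + 4 * rQ Q p ^ 2 * (-(a * speedF Q b ε p * z p)) ^ 2 := by
    refine two_mul_le_of_sq_le (Finset.sum_nonneg fun _ _ => sq_nonneg _) (sq_nonneg _) ?_
    rw [mul_comm (∑ i, pd i z p ^ 2)]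
    exact sq_sum_mul_le (sum_multField_sq_le hb hε hp) le_rfl
  have h2 : 2 * (-z p * (φ p * ∑ i, sgn i * pd i φ p * pd i z p))
      ≤ φ p ^ 2 * (∑ i, pd i z p ^ 2) / 4 + 4 * (∑ i, pd i φ p ^ 2) * (-z p) ^ 2 := by
    refine two_mul_le_of_sq_le (mul_nonneg (sq_nonneg _) (Finset.sum_nonneg fun _ _ => sq_nonneg _))
      (Finset.sum_nonneg fun _ _ => sq_nonneg _) ?_
    rw [mul_pow, mul_assoc, mul_comm (∑ i, pd i z p ^ 2)]
    refine mul_le_mul_of_nonneg_left (sq_sum_mul_le (le_of_eq ?_) le_rfl) (sq_nonneg _)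
    refine Finset.sum_congr rfl fun i _ => ?_
    rw [mul_pow, sq (sgn i), sgn_mul_self, one_mul]
  have h3 : -(z p * box z p) ≤ fQ Q p / (2 * a) * box z p ^ 2 + a / (2 * fQ Q p) * z p ^ 2 := by
    have h4 : 0 ≤ fQ Q p / (2 * a) * (box z p + a / fQ Q p * z p) ^ 2 := by positivity
    have h5 : fQ Q p / (2 * a) * (box z p + a / fQ Q p * z p) ^ 2
        = fQ Q p / (2 * a) * box z p ^ 2 + z p * box z p + a / (2 * fQ Q p) * z p ^ 2 := by
      field_simp; ring
    linarith
  have h6 : 4 * rQ Q p ^ 2 * (-(a * speedF Q b ε p * z p)) ^ 2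
      ≤ 5 * a ^ 2 * rQ Q p ^ 2 / fQ Q p ^ 2 * z p ^ 2 := by
    have h7 : speedF Q b ε p ^ 2 ≤ (103 / 100 * (1 / fQ Q p)) ^ 2 := by
      gcongr; exact speedF_le hg
    calc 4 * rQ Q p ^ 2 * (-(a * speedF Q b ε p * z p)) ^ 2
        = 4 * rQ Q p ^ 2 * a ^ 2 * z p ^ 2 * speedF Q b ε p ^ 2 := by ring
      _ ≤ 4 * rQ Q p ^ 2 * a ^ 2 * z p ^ 2 * (103 / 100 * (1 / fQ Q p)) ^ 2 := by gcongr
      _ = 4 * (103 / 100) ^ 2 * (a ^ 2 * rQ Q p ^ 2 / fQ Q p ^ 2 * z p ^ 2) := by ring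
      _ ≤ 5 * (a ^ 2 * rQ Q p ^ 2 / fQ Q p ^ 2 * z p ^ 2) := by gcongr; norm_num
      _ = _ := by ring
  have h8 := mul_le_mul_of_nonneg_left (h1.trans (add_le_add_right h6 _)) (sq_nonneg (φ p))
  have h9 := mul_le_mul_of_nonneg_left h3 (sq_nonneg (φ p))
  rw [hY] at h2 h8
  linarith

lemma energyForm_le (hp : p ∈ exteriorCone Q) (ξ : Idx n → ℝ) :
    energyForm Q ξ p ≤ 3 * rQ Q p ^ 2 * ∑ i, ξ i ^ 2 := by
  have hr : 0 < rQ Q p := rQ_pos hp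
  have hf : 0 < fQ Q p := hp
  have hfe := fQ_eq Q p
  have h4 := four_fQ_le (Q := Q) (p := p)
  have h1 : (∑ i, coord Q i p * ξ i) ^ 2 ≤ 2 * rQ Q p ^ 2 * ∑ i, ξ i ^ 2 := by
    refine sq_sum_mul_le ?_ le_rfl
    rw [sum_sq_eq (fun i => coord Q i p), ← rQ_sq, ← tauQ_sq]
    linarith
  have h2 : 0 ≤ (∑ i, spat Q i p * ξ i) ^ 2 / rQ Q p ^ 2 := by positivity
  have h3 : 0 ≤ (∑ k : Fin 2, coord Q (Sum.inl k) p * ξ (Sum.inl k)) ^ 2 / rQ Q p ^ 2 := by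
    positivity
  have h5 : fQ Q p * ((∑ j : Fin n, ξ (Sum.inr j) ^ 2)
      - (∑ i, spat Q i p * ξ i) ^ 2 / rQ Q p ^ 2)
      ≤ fQ Q p * ∑ j : Fin n, ξ (Sum.inr j) ^ 2 := by gcongr; linarith
  have h6 : fQ Q p * ((∑ k : Fin 2, ξ (Sum.inl k) ^ 2)
      - (∑ k : Fin 2, coord Q (Sum.inl k) p * ξ (Sum.inl k)) ^ 2 / rQ Q p ^ 2)
      ≤ fQ Q p * ∑ k : Fin 2, ξ (Sum.inl k) ^ 2 := by gcongr; linarith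
  have h7 := sum_sq_eq ξ
  have h8 : 0 ≤ ∑ i, ξ i ^ 2 := Finset.sum_nonneg fun _ _ => sq_nonneg _
  have h9 : fQ Q p * ∑ i, ξ i ^ 2 ≤ rQ Q p ^ 2 * ∑ i, ξ i ^ 2 := by gcongr; linarith
  rw [h7, mul_add] at h9
  unfold energyForm
  rw [h7] at h1 ⊢
  linarith

/-- Two cutoff functions with related supports. -/
structure CutoffBounds (φ χ : Spacetime n → ℝ) (N : ℝ) (p : Spacetime n) : Prop where
  contDiffAt_left : ContDiffAt ℝ 2 φ p
  contDiffAt_right : ContDiffAt ℝ 2 χ p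
  sq_le_one : φ p ^ 2 ≤ 1
  right_nonneg : 0 ≤ χ p
  right_le_one : χ p ≤ 1
  one_sub_sq_le : (1 - χ p) ^ 2 ≤ 4 * φ p ^ 2
  pd_right_le : ∑ i, pd i χ p ^ 2 ≤ N * φ p ^ 2
  box_right_le : box χ p ^ 2 ≤ N * φ p ^ 2
  pd_left_le : ∑ i, pd i φ p ^ 2 ≤ N

/-- The commutator of □ with χ involves only derivatives of χ, and these are bounded by φ. -/
lemma sq_box_cutoff_le (h : CutoffBounds φ χ N p) (hz : ContDiffAt ℝ 2 z p) :
    box (fun x => χ x * z x) p ^ 2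
      ≤ 2 * box z p ^ 2 + N * φ p ^ 2 * (16 * (∑ i, pd i z p ^ 2) + 4 * z p ^ 2) := by
  rw [box_mul h.contDiffAt_right hz]
  set I := ∑ i, sgn i * pd i χ p * pd i z p with hI
  have h1 : I ^ 2 ≤ N * φ p ^ 2 * ∑ i, pd i z p ^ 2 := by
    refine sq_sum_mul_le ((le_of_eq ?_).trans h.pd_right_le) le_rfl
    refine Finset.sum_congr rfl fun i _ => ?_
    rw [mul_pow, sq (sgn i), sgn_mul_self, one_mul]
  have h2 : (box χ p * z p) ^ 2 ≤ N * φ p ^ 2 * z p ^ 2 := by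
    rw [mul_pow]
    exact mul_le_mul_of_nonneg_right h.box_right_le (sq_nonneg _)
  have h3 : (χ p * box z p) ^ 2 ≤ box z p ^ 2 := by
    rw [mul_pow]
    exact mul_le_of_le_one_left (sq_nonneg _) (pow_le_one₀ h.right_nonneg h.right_le_one)
  have h4 := sq_nonneg (box χ p * z p + 2 * I - χ p * box z p)
  have h5 := sq_nonneg (box χ p * z p - 2 * I)
  linarith

/-- ∂z differs from ∂(χz) by z ∂χ − (1 − χ)∂z. Both terms carry a factor φ, since |∂χ|² ≤ Nφ² and |1
− χ| ≤ 2|φ|. -/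
lemma energyForm_cutoff_le (hp : p ∈ exteriorCone Q) (h : CutoffBounds φ χ N p)
    (hz : ContDiffAt ℝ 2 z p) :
    energyForm Q (fun i => pd i z p) p ≤ 2 * energyForm Q (fun i => pd i (fun x => χ x * z x) p) p
      + 6 * rQ Q p ^ 2 * φ p ^ 2 * (8 * (∑ i, pd i z p ^ 2) + 2 * N * z p ^ 2) := by
  have hχ : DifferentiableAt ℝ χ p := h.contDiffAt_right.differentiableAt (by norm_num)
  have hzd : DifferentiableAt ℝ z p := hz.differentiableAt (by norm_num)
  set η : Idx n → ℝ := fun i => pd i χ p * z p - (1 - χ p) * pd i z p with hη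
  have h1 := energyForm_sub_le hp (fun i => pd i (fun x => χ x * z x) p) η
  have e : (fun i => pd i (fun x => χ x * z x) p - η i) = fun i => pd i z p := by
    funext i
    rw [pd_mul hχ hzd, hη]; ring
  rw [e] at h1
  have h2 : ∑ i, η i ^ 2 ≤ φ p ^ 2 * (8 * (∑ i, pd i z p ^ 2) + 2 * N * z p ^ 2) := by
    have h3 : ∀ i, η i ^ 2 ≤ 2 * z p ^ 2 * pd i χ p ^ 2 + 8 * φ p ^ 2 * pd i z p ^ 2 := fun i => by
      have h4 := mul_le_mul_of_nonneg_right h.one_sub_sq_le (sq_nonneg (pd i z p))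
      have h5 := sq_nonneg (pd i χ p * z p + (1 - χ p) * pd i z p)
      simp only [hη]
      linarith
    refine (Finset.sum_le_sum fun i _ => h3 i).trans ?_
    rw [Finset.sum_add_distrib, ← Finset.mul_sum, ← Finset.mul_sum]
    have := mul_le_mul_of_nonneg_left h.pd_right_le (by positivity : 0 ≤ 2 * z p ^ 2)
    linarith
  have h6 := energyForm_le hp η
  have h7 := mul_le_mul_of_nonneg_left h2 (by positivity : 0 ≤ 3 * rQ Q p ^ 2)
  linarith

/-- The constant in `cutoff_scalar`. -/
def cutoffConst (N R : ℝ) : ℝ :=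
  (1 + N) * (3 + 2 * (N * R ^ 2 + 1) * (3 + 2 * R) + (N * R ^ 2 + N + 8 * (N * R ^ 2 + 1)) * R ^ 2)

-- X and T stand for |∇_x z|² and |∇_t z|², D for |∇φ|², C2 for the weight, d₁ and d₂ for the two
-- divergences. The estimate for χz plus a multiple Λ of the localized one absorbs all of X. The
-- remaining terms are dominated by the observed ones, because f ≤ R²/4 and a ≥ 9 make their
-- coefficients large.
set_option maxHeartbeats 1000000 in
lemma cutoff_scalar {a β f r R e N φ2 D X T zz w2 Bz Bw Ez Ew C2 d₁ d₂ : ℝ} (ha : 9 ≤ a)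
    (hβ0 : 0 < β) (hβ : β ≤ 1 / 100) (hf : 0 < f) (hfr : 4 * f ≤ r ^ 2) (hr : 0 < r) (hrR : r ≤ R)
    (he0 : 0 < e) (he : e * r ^ 2 ≤ 1 / 100) (hN : 0 ≤ N) (hφ0 : 0 ≤ φ2) (hφ1 : φ2 ≤ 1)
    (hD0 : 0 ≤ D) (hX : 0 ≤ X) (hT : 0 ≤ T) (hzz : 0 ≤ zz) (hBz : 0 ≤ Bz) (hC : 0 ≤ C2)
    (h₁ : e / 16 * (C2 * Ew) + a ^ 2 / 5 * (β / f) * (C2 * w2) ≤ f / (2 * a) * (C2 * Bw) + d₁)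
    (h₂ : C2 * (φ2 * X / 2) ≤ d₂ + C2 * (3 / 2 * φ2 * T + f / (2 * a) * (φ2 * Bz)
      + (a / (2 * f) + 5 * a ^ 2 * r ^ 2 / f ^ 2) * (φ2 * zz) + 4 * D * zz))
    (h₃ : Bw ≤ 2 * Bz + N * φ2 * (16 * (X + T) + 4 * zz))
    (h₄ : Ez ≤ 2 * Ew + 6 * r ^ 2 * φ2 * (8 * (X + T) + 2 * N * zz))
    (h₅ : zz ≤ 2 * w2 + 8 * φ2 * zz) :
    e / 32 * (C2 * Ez) + a ^ 2 / 10 * (β / f) * (C2 * zz) ≤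
      cutoffConst N R * (f / a * (C2 * Bz) + C2 * ((φ2 + D) / (1 + N))
        * (a ^ 2 * R ^ 3 / f ^ 2 * T + a ^ 4 * R ^ 4 / f ^ 3 * zz))
      + (d₁ + 2 * (N * R ^ 2 + 1) * d₂) := by
  have ha0 : 0 < a := by linarith
  have hR : 0 < R := hr.trans_le hrR
  have hrR2 : r ^ 2 ≤ R ^ 2 := by gcongr
  have hfR : 4 * f ≤ R ^ 2 := hfr.trans hrR2
  -- The commutators produce X with coefficient (NR² + 1)/2, by `q1` and `q2`. The localized
  -- estimate times Λ offers Λ/2 = NR² + 1.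
  obtain ⟨Λ, hΛ⟩ : ∃ Λ, Λ = 2 * (N * R ^ 2 + 1) := ⟨_, rfl⟩
  have hΛ0 : 0 < Λ := by rw [hΛ]; positivity
  obtain ⟨B, hB⟩ : ∃ B, B = β / f := ⟨_, rfl⟩
  have hB0 : 0 < B := by rw [hB]; positivity
  obtain ⟨F, hF⟩ : ∃ F, F = f / a := ⟨_, rfl⟩
  have hF0 : 0 < F := by rw [hF]; positivity
  have hFR : F ≤ R ^ 2 / 36 := by
    rw [hF, div_le_iff₀ ha0]
    have := mul_le_mul_of_nonneg_left ha (sq_nonneg R)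
    linarith
  have hF2 : f / (2 * a) = F / 2 := by rw [hF]; field_simp
  obtain ⟨P, hP⟩ : ∃ P, P = a ^ 4 * R ^ 4 / f ^ 3 := ⟨_, rfl⟩
  have hP0 : 0 < P := by rw [hP]; positivity
  obtain ⟨P₁, hP₁⟩ : ∃ P, P = a ^ 2 * R ^ 3 / f ^ 2 := ⟨_, rfl⟩
  have hP₁0 : 0 < P₁ := by rw [hP₁]; positivity
  have ha2 : 81 ≤ a ^ 2 := by
    have := mul_self_le_mul_self (by norm_num) ha
    linarith
  have ha4 : 81 * a ^ 2 ≤ a ^ 4 := by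
    have := mul_le_mul_of_nonneg_right ha2 (sq_nonneg a)
    linarith
  have hf2 : 16 * f ^ 2 ≤ R ^ 4 := by
    calc 16 * f ^ 2 = (4 * f) ^ 2 := by ring
      _ ≤ (R ^ 2) ^ 2 := by gcongr
      _ = _ := by ring
  -- `k1` to `k5` compare every coefficient that occurs with the two observation coefficients P₁ and
  -- P, up to powers of R.
  have k1 : 1 ≤ P₁ * R := by
    rw [hP₁, div_mul_eq_mul_div, one_le_div (by positivity)]
    calc f ^ 2 ≤ 1 * R ^ 4 := by linarith [sq_nonneg f]
      _ ≤ a ^ 2 * R ^ 4 := by gcongr; linarith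
      _ = _ := by ring
  have k2 : 1 ≤ P * R ^ 2 := by
    rw [hP, div_mul_eq_mul_div, one_le_div (by positivity)]
    have : f ^ 3 ≤ R ^ 4 * R ^ 2 := by
      calc f ^ 3 = f ^ 2 * f := by ring
        _ ≤ R ^ 4 * R ^ 2 := by
          gcongr
          · linarith [sq_nonneg f]
          · linarith
    calc f ^ 3 ≤ 1 * (R ^ 4 * R ^ 2) := by linarith
      _ ≤ a ^ 4 * (R ^ 4 * R ^ 2) := by gcongr; linarith
      _ = _ := by ring
  have k3 : a ^ 2 * B ≤ P := by
    rw [hB, hP, ← mul_div_assoc, div_le_div_iff₀ hf (by positivity)]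
    calc a ^ 2 * β * f ^ 3 ≤ a ^ 2 * 1 * f ^ 3 := by gcongr; linarith
      _ = a ^ 2 * (f ^ 2) * f := by ring
      _ ≤ a ^ 4 * R ^ 4 * f := by
        have h2 : f ^ 2 ≤ R ^ 4 := by linarith [sq_nonneg f]
        have h3 : a ^ 2 ≤ a ^ 4 := by linarith
        gcongr
  have k4 : a / (2 * f) ≤ P := by
    rw [hP, div_le_div_iff₀ (by positivity) (by positivity)]
    calc a * f ^ 3 = a * f ^ 2 * f := by ring
      _ ≤ a ^ 4 * R ^ 4 * (2 * f) := by
        have : a ≤ a ^ 4 := le_self_pow₀ (by linarith) (by norm_num)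
        have h2 : f ^ 2 ≤ R ^ 4 := by linarith [sq_nonneg f]
        gcongr
        linarith
  have k5 : 5 * a ^ 2 * r ^ 2 / f ^ 2 ≤ P := by
    rw [hP, div_le_div_iff₀ (by positivity) (by positivity)]
    calc 5 * a ^ 2 * r ^ 2 * f ^ 3 = (5 * a ^ 2) * (r ^ 2 * f) * f ^ 2 := by ring
      _ ≤ a ^ 4 * (R ^ 2 * R ^ 2) * f ^ 2 := by
        have h2 : 5 * a ^ 2 ≤ a ^ 4 := by linarith
        have h3 : f ≤ R ^ 2 := by linarith
        gcongr
      _ = _ := by ring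
  rw [hF2] at h₁ h₂
  rw [← hB] at h₁ ⊢
  rw [← hF, ← hP, ← hP₁, ← hΛ]
  have m3 := mul_le_mul_of_nonneg_left h₃ (by positivity : 0 ≤ F / 2 * C2)
  have m4 := mul_le_mul_of_nonneg_left h₄ (by positivity : 0 ≤ e / 32 * C2)
  have m5 := mul_le_mul_of_nonneg_left h₅ (by positivity : 0 ≤ a ^ 2 / 10 * B * C2)
  have m2 := mul_le_mul_of_nonneg_left h₂ hΛ0.le
  have hCφ : 0 ≤ C2 * φ2 := by positivity
  have q1 : F / 2 * C2 * (N * φ2 * (16 * (X + T) + 4 * zz))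
      ≤ C2 * φ2 * (N * R ^ 2 * (X + T) / 2 + N * R ^ 2 * zz) := by
    calc _ = C2 * φ2 * (F * (N * (8 * (X + T) + 2 * zz))) := by ring
      _ ≤ C2 * φ2 * (R ^ 2 / 36 * (N * (8 * (X + T) + 2 * zz))) := by gcongr
      _ ≤ _ := by
        refine mul_le_mul_of_nonneg_left ?_ hCφ
        have : 0 ≤ N * R ^ 2 * (X + T) := by positivity
        have : 0 ≤ N * R ^ 2 * zz := by positivity
        linarith
  have q2 : e / 32 * C2 * (6 * r ^ 2 * φ2 * (8 * (X + T) + 2 * N * zz))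
      ≤ C2 * φ2 * ((X + T) / 2 + N * zz) := by
    calc _ = C2 * φ2 * (e * r ^ 2 * (6 / 32 * (8 * (X + T) + 2 * N * zz))) := by ring
      _ ≤ C2 * φ2 * (1 / 100 * (6 / 32 * (8 * (X + T) + 2 * N * zz))) := by gcongr
      _ ≤ _ := by
        refine mul_le_mul_of_nonneg_left ?_ hCφ
        have : 0 ≤ N * zz := by positivity
        linarith
  -- the terms with the squares of `z` and of its time derivatives
  have q3 : C2 * φ2 * (N * R ^ 2 * zz + N * zz + a ^ 2 * B * zz
      + Λ * ((a / (2 * f) + 5 * a ^ 2 * r ^ 2 / f ^ 2) * zz)) + Λ * C2 * (4 * D * zz)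
      ≤ C2 * (φ2 + D) * (((N * R ^ 2 + N + 4 * Λ) * R ^ 2 + 1 + 2 * Λ) * (P * zz)) := by
    have t1 : N * R ^ 2 * zz + N * zz + a ^ 2 * B * zz
        + Λ * ((a / (2 * f) + 5 * a ^ 2 * r ^ 2 / f ^ 2) * zz)
        ≤ ((N * R ^ 2 + N + 4 * Λ) * R ^ 2 + 1 + 2 * Λ) * (P * zz) := by
      calc _ = ((N * R ^ 2 + N) * 1 + a ^ 2 * B
            + Λ * (a / (2 * f) + 5 * a ^ 2 * r ^ 2 / f ^ 2)) * zz := by ring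
        _ ≤ ((N * R ^ 2 + N) * (P * R ^ 2) + P + Λ * (P + P)) * zz := by gcongr
        _ ≤ _ := by
          have : 0 ≤ Λ * R ^ 2 * P * zz := by positivity
          linarith
    have t2 : Λ * (4 * zz) ≤ ((N * R ^ 2 + N + 4 * Λ) * R ^ 2 + 1 + 2 * Λ) * (P * zz) := by
      calc Λ * (4 * zz) = 4 * Λ * 1 * zz := by ring
        _ ≤ 4 * Λ * (P * R ^ 2) * zz := by gcongr
        _ ≤ _ := by
          have : 0 ≤ (N * R ^ 2 + N) * R ^ 2 * (P * zz) := by positivity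
          have : 0 ≤ P * zz := by positivity
          have : 0 ≤ Λ * (P * zz) := by positivity
          linarith
    have t3 := mul_le_mul_of_nonneg_left t1 hCφ
    have t4 := mul_le_mul_of_nonneg_left t2 (by positivity : 0 ≤ C2 * D)
    linarith
  have q4 : C2 * φ2 * (2 * Λ * T) ≤ C2 * (φ2 + D) * (2 * Λ * R * (P₁ * T)) := by
    have t1 : 2 * Λ * T ≤ 2 * Λ * R * (P₁ * T) := by
      calc 2 * Λ * T = 2 * Λ * 1 * T := by ring
        _ ≤ 2 * Λ * (P₁ * R) * T := by gcongr
        _ = _ := by ring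
    have t2 := mul_le_mul_of_nonneg_left t1 hCφ
    have : 0 ≤ C2 * D * (2 * Λ * R * (P₁ * T)) := by positivity
    linarith
  have q5 : Λ * C2 * (F / 2 * (φ2 * Bz)) ≤ Λ / 2 * (F * (C2 * Bz)) := by
    have t1 : φ2 * Bz ≤ 1 * Bz := by gcongr
    calc _ ≤ Λ * C2 * (F / 2 * (1 * Bz)) := by gcongr
      _ = _ := by ring
  have hK : cutoffConst N R = (1 + N) * (3 + Λ * (3 + 2 * R) + (N * R ^ 2 + N + 4 * Λ) * R ^ 2) := by
    rw [hΛ]; unfold cutoffConst; ring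
  have r1 : (1 + Λ / 2) * (F * (C2 * Bz)) ≤ cutoffConst N R * (F * (C2 * Bz)) := by
    have : 1 + Λ / 2 ≤ cutoffConst N R := by
      rw [hK]
      calc 1 + Λ / 2 ≤ 1 * (3 + Λ * (3 + 2 * R) + (N * R ^ 2 + N + 4 * Λ) * R ^ 2) := by
            have : 0 ≤ (N * R ^ 2 + N + 4 * Λ) * R ^ 2 := by positivity
            have : 0 ≤ Λ * R := by positivity
            linarith
        _ ≤ _ := by gcongr; linarith
    gcongr
  have r2 : C2 * (φ2 + D) * (2 * Λ * R * (P₁ * T))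
      + C2 * (φ2 + D) * (((N * R ^ 2 + N + 4 * Λ) * R ^ 2 + 1 + 2 * Λ) * (P * zz))
      ≤ cutoffConst N R * (C2 * ((φ2 + D) / (1 + N)) * (P₁ * T + P * zz)) := by
    have e1 : cutoffConst N R * (C2 * ((φ2 + D) / (1 + N)) * (P₁ * T + P * zz))
        = C2 * (φ2 + D) * ((3 + Λ * (3 + 2 * R) + (N * R ^ 2 + N + 4 * Λ) * R ^ 2)
          * (P₁ * T + P * zz)) := by
      rw [hK]; field_simp
    rw [e1, ← mul_add]
    refine mul_le_mul_of_nonneg_left ?_ (by positivity)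
    have : 0 ≤ (3 + 3 * Λ + (N * R ^ 2 + N + 4 * Λ) * R ^ 2) * (P₁ * T) := by positivity
    have : 0 ≤ (2 + Λ + 2 * Λ * R) * (P * zz) := by positivity
    linarith
  have hΛe : Λ * (C2 * (φ2 * X / 2)) = C2 * φ2 * ((N * R ^ 2 + 1) * X) := by rw [hΛ]; ring
  have hTe : C2 * φ2 * (N * R ^ 2 * T / 2 + T / 2) = C2 * φ2 * (Λ / 4 * T) := by rw [hΛ]; ring
  have s1 : 0 ≤ C2 * φ2 * ((N * R ^ 2 + 1) * X) := by positivity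
  have s2 : 0 ≤ Λ * (C2 * φ2 * T) := by positivity
  have s3 : 0 ≤ C2 * φ2 * (a ^ 2 * B * zz) := by positivity
  linarith

end Cutoff

/-! ### Regularity and decay of the currents -/

section Regularity

variable {n : ℕ} {Q p : Spacetime n} {a b ε : ℝ} {z φ : Spacetime n → ℝ}
  {ζ : Idx n → Spacetime n → ℝ} {s : Set (Spacetime n)} {k : ℕ∞}

lemma contDiffAt_betaF (hb : 0 < b) (hε : 0 < ε) (hp : p ∈ goodRegion Q b ε) :
    ContDiffAt ℝ 2 (betaF Q b ε) p := by
  obtain ⟨M, -, h⟩ := isSymbol_betaF (n := n)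
  exact (h Q b ε p hb hε hp).contDiffAt

lemma contDiffAt_thetaF (hb : 0 < b) (hε : 0 < ε) (hp : p ∈ goodRegion Q b ε) :
    ContDiffAt ℝ 2 (thetaF Q b ε) p := by
  obtain ⟨M, -, h⟩ := isSymbol_thetaF (n := n)
  exact (h Q b ε p hb hε hp).contDiffAt

lemma contDiffAt_multField (hb : 0 < b) (hε : 0 < ε) (hp : p ∈ goodRegion Q b ε) (i : Idx n) :
    ContDiffAt ℝ 2 (multField Q b ε i) p := by
  have hθ := contDiffAt_thetaF hb hε hp
  have hg := goodBounds hb hε hp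
  have hr : ContDiffAt ℝ 2 (rQ Q) p := contDiffAt_rQ hg.r_pos
  have hf : ContDiffAt ℝ 2 (fQ Q) p := (contDiff_fQ Q).contDiffAt
  have hα : ContDiffAt ℝ 2 (alphaF Q b ε) p :=
    contDiffAt_const.mul (contDiffAt_const.sub (contDiffAt_const.mul (hθ.mul hr)))
  have hδ : ContDiffAt ℝ 2 (deltaF Q b ε) p :=
    contDiffAt_const.mul ((hθ.mul hf).div hr hg.r_pos.ne')
  exact (hα.mul (contDiff_coord Q i).contDiffAt).add (hδ.mul (contDiff_spat i).contDiffAt)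

lemma contDiffAt_speedF (hb : 0 < b) (hε : 0 < ε) (hp : p ∈ goodRegion Q b ε) :
    ContDiffAt ℝ 2 (speedF Q b ε) p := by
  have hg := goodBounds hb hε hp
  have hr : ContDiffAt ℝ 2 (rQ Q) p := contDiffAt_rQ hg.r_pos
  have hf : ContDiffAt ℝ 2 (fQ Q) p := (contDiff_fQ Q).contDiffAt
  have hm : ContDiffAt ℝ 2 (pMinus Q ε) p :=
    (contDiffAt_const.sub (contDiffAt_const.mul hr)).add (contDiffAt_const.mul hf)
  have hm0 : 0 < pMinus Q ε p := by linarith [hg.pMinus_ge]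
  exact (contDiffAt_const.add (contDiffAt_betaF hb hε hp)).div (hf.mul hm)
    (mul_pos hg.f_pos hm0).ne'

lemma contDiffAt_potential (hb : 0 < b) (hε : 0 < ε) (hp : p ∈ goodRegion Q b ε) :
    ContDiffAt ℝ 2 (potential Q a b ε) p := by
  have hg := goodBounds hb hε hp
  have hr : ContDiffAt ℝ 2 (rQ Q) p := contDiffAt_rQ hg.r_pos
  have hf : ContDiffAt ℝ 2 (fQ Q) p := (contDiff_fQ Q).contDiffAt
  have hθ := contDiffAt_thetaF hb hε hp
  have hW := contDiffAt_speedF hb hε hp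
  have hP : ContDiffAt ℝ 2 (pTheta Q b ε) p :=
    (contDiffAt_const.sub (contDiffAt_const.mul (hθ.mul hr))).add
      (contDiffAt_const.mul ((hθ.mul hθ).mul hf))
  exact contDiffAt_const.mul ((hW.mul hW).mul (hf.mul hP))

lemma contDiffOn_carlemanCurrent (hb : 0 < b) (hε : 0 < ε) (hs : s ⊆ goodRegion Q b ε)
    (hk : k ≤ 1) (hq : ∀ p ∈ s, ContDiffAt ℝ 2 (multWeight Q b ε) p) (hz : ContDiffOn ℝ k z s)
    (hζ : ∀ i, ContDiffOn ℝ k (ζ i) s) (i : Idx n) :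
    ContDiffOn ℝ k (carlemanCurrent Q a b ε z ζ i) s := by
  have hk2 : (k : WithTop ℕ∞) ≤ 2 := by
    have : k ≤ ((2 : ℕ) : ℕ∞) := hk.trans (by norm_num)
    exact WithTop.coe_le_coe.2 this
  have on : ∀ {h : Spacetime n → ℝ}, (∀ p ∈ s, ContDiffAt ℝ 2 h p) → ContDiffOn ℝ k h s :=
    fun h p hp => ((h p hp).of_le hk2).contDiffWithinAt
  have hS : ∀ j, ContDiffOn ℝ k (multField Q b ε j) s := fun j =>
    on fun p hp => contDiffAt_multField hb hε (hs hp) j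
  have hW : ContDiffOn ℝ k (speedF Q b ε) s := on fun p hp => contDiffAt_speedF hb hε (hs hp)
  have hA : ContDiffOn ℝ k (potential Q a b ε) s := on fun p hp => contDiffAt_potential hb hε (hs hp)
  have hC : ContDiffOn ℝ k (carl Q a b ε) s := on fun p hp => contDiffAt_carl hb hε (hs hp)
  have hqi : ContDiffOn ℝ k (pd i (multWeight Q b ε)) s := fun p hp =>
    (contDiffAt_pd (k := k) (m := 2) (by
      calc k + 1 ≤ 1 + 1 := by gcongr
        _ = 2 := by norm_num) (hq p hp)).contDiffWithinAt
  have hψ : ContDiffOn ℝ k (conj Q a b ε z) s := hC.mul hz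
  have hξ : ∀ j, ContDiffOn ℝ k (fun p => carl Q a b ε p
      * (ζ j p + a * speedF Q b ε p * (sgn j * multField Q b ε j p) * z p)) s := fun j =>
    hC.mul ((hζ j).add (((contDiffOn_const.mul hW).mul (contDiffOn_const.mul (hS j))).mul hz))
  unfold carlemanCurrent multiplierCurrent
  exact (((contDiffOn_const.mul ((hξ i).mul ((ContDiffOn.sum fun j _ => (hS j).mul (hξ j)).add
    ((on hq).mul hψ)))).sub (contDiffOn_const.mul ((hS i).mul (ContDiffOn.sum fun j _ =>
      contDiffOn_const.mul ((hξ j).pow 2))))).sub (contDiffOn_const.mul ((hψ.pow 2).mul hqi))).add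
    (contDiffOn_const.mul ((hA.mul (hψ.pow 2)).mul (hS i)))

lemma contDiffOn_localCurrent (hb : 0 < b) (hε : 0 < ε) (hs : s ⊆ goodRegion Q b ε)
    (hφ : ContDiffOn ℝ k φ s) (hz : ContDiffOn ℝ k z s) (hζ : ∀ i, ContDiffOn ℝ k (ζ i) s)
    (i : Idx n) : ContDiffOn ℝ k (localCurrent Q a b ε φ z ζ i) s := by
  have hC : ContDiffOn ℝ k (carl Q a b ε) s := fun p hp =>
    (contDiffAt_carl hb hε (hs hp)).contDiffWithinAt
  exact contDiffOn_const.mul ((((hC.pow 2).mul (hφ.pow 2)).mul hz).mul (hζ i))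

/-- The weight vanishes to high order on the null cone. -/
lemma exists_carl_sq_le (R : ℝ) (ha : 2 ≤ a) :
    ∃ C, 0 < C ∧ ∀ p : Spacetime n, p ∈ goodRegion Q b ε → 0 < b → 0 < ε → rQ Q p ≤ R →
      carl Q a b ε p ^ 2 ≤ C * fQ Q p ^ 4 := by
  refine ⟨Real.exp (2 * a + (2 * a - 4) * Real.log (R ^ 2)), Real.exp_pos _,
    fun p hp hb hε hpR => ?_⟩
  have hg := goodBounds hb hε hp
  have hf := hg.f_pos
  have hm : 0 < pMinus Q ε p := by linarith [hg.pMinus_ge]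
  -- Hence the weight is at most e^{2a} f^{2a}. The surplus power f^{2a−4}, with nonnegative
  -- exponent as a ≥ 2, is bounded through f ≤ R².
  have h1 : phase Q b ε p ≤ Real.log (fQ Q p) + 1 := by
    have h2 : -Real.log (pMinus Q ε p) ≤ 1 / 2 := by
      rw [← Real.log_inv]
      refine (Real.log_le_sub_one_of_pos (inv_pos.2 hm)).trans ?_
      have : (pMinus Q ε p)⁻¹ ≤ 3 / 2 := by
        rw [inv_le_comm₀ hm (by norm_num)]
        linarith [hg.pMinus_ge]
      linarith
    have h3 : √(fQ Q p) / √(pPlus Q ε p) ≤ √(fQ Q p) :=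
      div_le_self (Real.sqrt_nonneg _) (Real.one_le_sqrt.2 hg.pPlus_ge)
    have h4 : 2 * b * (√(fQ Q p) / √(pPlus Q ε p)) ≤ 2 * b * √(fQ Q p) := by gcongr
    have h5 : b * √(fQ Q p) < 1 / 100 := hp.2.2
    unfold phase
    linarith
  have h6 : Real.log (fQ Q p) ≤ Real.log (R ^ 2) := by
    refine Real.log_le_log hf ?_
    have : rQ Q p ^ 2 ≤ R ^ 2 := by have := hg.r_pos; gcongr
    linarith [hg.four_f_le]
  have h7 : fQ Q p ^ 4 = Real.exp (4 * Real.log (fQ Q p)) := by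
    rw [show 4 * Real.log (fQ Q p) = ((4 : ℕ) : ℝ) * Real.log (fQ Q p) by norm_num,
      Real.exp_nat_mul, Real.exp_log hf]
  unfold carl
  rw [h7, ← Real.exp_add, ← Real.exp_nat_mul]
  refine Real.exp_le_exp.2 ?_
  have h8 := mul_le_mul_of_nonneg_left h1 (by linarith : 0 ≤ a)
  have h9 := mul_le_mul_of_nonneg_left h6 (by linarith : 0 ≤ 2 * a - 4)
  push_cast
  linarith

lemma abs_sgn (i : Idx n) : |sgn i| = 1 := by rcases i with i | i <;> simp

lemma abs_multiplierCurrent_le {S : Idx n → Spacetime n → ℝ} {q A ψ : Spacetime n → ℝ}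
    {ξ : Idx n → Spacetime n → ℝ} {s x q₀ q₁ y A₀ : ℝ} (hS : ∀ i, |S i p| ≤ s)
    (hξ : ∀ i, |ξ i p| ≤ x) (hq : |q p| ≤ q₀) (hψ : |ψ p| ≤ y) (hA : |A p| ≤ A₀) {i : Idx n}
    (hqi : |pd i q p| ≤ q₁) :
    |multiplierCurrent S q A ψ ξ i p| ≤
      x * ((n + 2) * (s * x) + q₀ * y) + 1 / 2 * (s * ((n + 2) * x ^ 2)) + 1 / 2 * (y ^ 2 * q₁)
        + 1 / 2 * (A₀ * y ^ 2 * s) := by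
  have hs : 0 ≤ s := (abs_nonneg _).trans (hS i)
  have hx : 0 ≤ x := (abs_nonneg _).trans (hξ i)
  have hy : 0 ≤ y := (abs_nonneg _).trans hψ
  have hA0 : 0 ≤ A₀ := (abs_nonneg _).trans hA
  have hq1 : 0 ≤ q₁ := (abs_nonneg _).trans hqi
  have hq0 : 0 ≤ q₀ := (abs_nonneg _).trans hq
  have card : ∀ c : ℝ, ∑ _j : Idx n, c = (n + 2) * c := fun c => by
    rw [Finset.sum_const, nsmul_eq_mul]; congr 1; simp [add_comm]
  have e1 : |∑ j, S j p * ξ j p| ≤ (n + 2) * (s * x) := by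
    rw [← card]
    refine (Finset.abs_sum_le_sum_abs _ _).trans (Finset.sum_le_sum fun j _ => ?_)
    rw [abs_mul]
    exact mul_le_mul (hS j) (hξ j) (abs_nonneg _) hs
  have e2 : |∑ j, sgn j * ξ j p ^ 2| ≤ (n + 2) * x ^ 2 := by
    rw [← card]
    refine (Finset.abs_sum_le_sum_abs _ _).trans (Finset.sum_le_sum fun j _ => ?_)
    rw [abs_mul, abs_sgn, one_mul, abs_pow]
    exact pow_le_pow_left₀ (abs_nonneg _) (hξ j) 2
  have t1 : |sgn i * (ξ i p * ((∑ j, S j p * ξ j p) + q p * ψ p))|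
      ≤ x * ((n + 2) * (s * x) + q₀ * y) := by
    rw [abs_mul, abs_sgn, one_mul, abs_mul]
    refine mul_le_mul (hξ i) ((abs_add_le _ _).trans (add_le_add e1 ?_)) (abs_nonneg _) hx
    rw [abs_mul]
    exact mul_le_mul hq hψ (abs_nonneg _) hq0
  have t2 : |1 / 2 * (S i p * ∑ j, sgn j * ξ j p ^ 2)| ≤ 1 / 2 * (s * ((n + 2) * x ^ 2)) := by
    rw [abs_mul, abs_mul, abs_of_pos (by norm_num : (0 : ℝ) < 1 / 2)]
    exact mul_le_mul_of_nonneg_left (mul_le_mul (hS i) e2 (abs_nonneg _) hs) (by norm_num)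
  have t3 : |1 / 2 * sgn i * (ψ p ^ 2 * pd i q p)| ≤ 1 / 2 * (y ^ 2 * q₁) := by
    rw [abs_mul, abs_mul, abs_mul, abs_sgn, mul_one, abs_of_pos (by norm_num : (0 : ℝ) < 1 / 2),
      abs_pow]
    have := pow_le_pow_left₀ (abs_nonneg _) hψ 2
    exact mul_le_mul_of_nonneg_left (mul_le_mul this hqi (abs_nonneg _) (by positivity))
      (by norm_num)
  have t4 : |1 / 2 * (A p * ψ p ^ 2 * S i p)| ≤ 1 / 2 * (A₀ * y ^ 2 * s) := by
    rw [abs_mul, abs_mul, abs_mul, abs_of_pos (by norm_num : (0 : ℝ) < 1 / 2), abs_pow]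
    have := pow_le_pow_left₀ (abs_nonneg _) hψ 2
    exact mul_le_mul_of_nonneg_left (mul_le_mul (mul_le_mul hA this (by positivity) hA0) (hS i)
      (abs_nonneg _) (by positivity)) (by norm_num)
  unfold multiplierCurrent
  rw [abs_le] at t1 t2 t3 t4 ⊢
  constructor <;> linarith [t1.1, t1.2, t2.1, t2.2, t3.1, t3.2, t4.1, t4.2]

/-- The current of the Carleman estimate vanishes on the null cone. -/
lemma exists_carlemanCurrent_bound {R M Z : ℝ} (ha : 2 ≤ a) (hb : 0 < b) (hε : 0 < ε) (hR : 0 < R)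
    (hZ : 0 ≤ Z) (hs : s ⊆ goodRegion Q b ε) (hr : ∀ p ∈ s, rQ Q p ≤ R)
    (hq0 : ∀ p ∈ s, |multWeight Q b ε p| ≤ n)
    (hq1 : ∀ p ∈ s, ∀ i, fQ Q p * |pd i (multWeight Q b ε) p| ≤ M * rQ Q p)
    (hz : ∀ p ∈ s, |z p| ≤ Z) (hζ : ∀ p ∈ s, ∀ i, |ζ i p| ≤ Z) :
    ∃ K : ℝ, ∀ i, ∀ p ∈ s, |carlemanCurrent Q a b ε z ζ i p| ≤ K * fQ Q p ^ 2 := by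
  obtain ⟨C, hC0, hC⟩ := exists_carl_sq_le (n := n) (Q := Q) (b := b) (ε := ε) R ha
  obtain ⟨Y, hY⟩ : ∃ Y, Y = R ^ 2 * Z + 2 * a * R * Z := ⟨_, rfl⟩
  refine ⟨C * (Y * ((n + 2) * (R * Y) + n * R ^ 2 * Z) + 1 / 2 * (R * ((n + 2) * Y ^ 2))
    + 1 / 2 * (Z ^ 2 * (|M| * R * R ^ 2)) + 1 / 2 * (4 * a ^ 2 * R ^ 2 * Z ^ 2 * R)), ?_⟩
  intro i p hp
  have hg := goodBounds hb hε (hs hp)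
  have hsb := scalarBounds hb hε (hs hp)
  have hf := hg.f_pos
  have hr0 := hg.r_pos
  have hrR := hr p hp
  have hc0 : 0 < carl Q a b ε p := carl_pos
  have hW0 : 0 < speedF Q b ε p := lt_of_lt_of_le (by positivity) (speedF_ge hg)
  have hW : speedF Q b ε p ≤ 2 / fQ Q p := by
    refine (speedF_le hg).trans ?_
    rw [mul_one_div]
    exact div_le_div_of_nonneg_right (by norm_num) hf.le
  have hfR : fQ Q p ≤ R ^ 2 := by
    have : rQ Q p ^ 2 ≤ R ^ 2 := by gcongr
    linarith [hg.four_f_le]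
  have hS : ∀ i, |multField Q b ε i p| ≤ R := fun i => by
    have h1 := Finset.single_le_sum (f := fun i => multField Q b ε i p ^ 2)
      (fun i _ => sq_nonneg _) (Finset.mem_univ i)
    have h2 := h1.trans (sum_multField_sq_le hb hε (hs hp))
    exact (abs_le_of_sq_le_sq h2 hr0.le).trans hrR
  have hξ : ∀ i, |carl Q a b ε p * (ζ i p + a * speedF Q b ε p * (sgn i * multField Q b ε i p)
      * z p)| ≤ carl Q a b ε p * (Y / fQ Q p) := fun i => by
    rw [abs_mul, abs_of_pos hc0]
    refine mul_le_mul_of_nonneg_left ((abs_add_le _ _).trans ?_) hc0.le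
    rw [abs_mul, abs_mul, abs_mul (sgn i), abs_sgn, one_mul,
      abs_of_pos (by positivity : 0 < a * speedF Q b ε p)]
    calc |ζ i p| + a * speedF Q b ε p * |multField Q b ε i p| * |z p|
        ≤ Z + a * (2 / fQ Q p) * R * Z := by
          gcongr
          · exact hζ p hp i
          · exact hS i
          · exact hz p hp
      _ = (fQ Q p * Z + 2 * a * R * Z) / fQ Q p := by field_simp
      _ ≤ _ := by rw [hY]; gcongr
  have hψ : |conj Q a b ε z p| ≤ carl Q a b ε p * Z := by
    unfold conj
    rw [abs_mul, abs_of_pos hc0]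
    exact mul_le_mul_of_nonneg_left (hz p hp) hc0.le
  have hqi : |pd i (multWeight Q b ε) p| ≤ |M| * R / fQ Q p := by
    rw [le_div_iff₀ hf, mul_comm]
    refine (hq1 p hp i).trans ?_
    calc M * rQ Q p ≤ |M| * rQ Q p := by gcongr; exact le_abs_self M
      _ ≤ _ := by gcongr
  have hA : |potential Q a b ε p| ≤ 4 * a ^ 2 / fQ Q p * 1 := by
    have hP0 : 0 ≤ pTheta Q b ε p ∧ pTheta Q b ε p ≤ 1 := by
      have h2 : thetaF Q b ε p * rQ Q p ≤ 1 * rQ Q p := by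
        have := hsb.theta_le
        gcongr
      have hθ0 : 0 ≤ thetaF Q b ε p := by linarith [hsb.theta_ge]
      have h3 := mul_le_mul_of_nonneg_left h2 hε.le
      have h4 : 0 ≤ ε ^ 2 * (thetaF Q b ε p * thetaF Q b ε p * fQ Q p) := by positivity
      have h5 : ε ^ 2 * (thetaF Q b ε p * thetaF Q b ε p * fQ Q p)
          ≤ ε * (thetaF Q b ε p * rQ Q p) := by
        calc _ = thetaF Q b ε p * thetaF Q b ε p * (ε ^ 2 * fQ Q p) := by ring
          _ ≤ thetaF Q b ε p * 1 * (ε * rQ Q p) := by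
            have h6 : 0 < ε * rQ Q p := by positivity
            have h7 : ε ^ 2 * fQ Q p ≤ ε * rQ Q p := by linarith [hg.ef_le]
            exact mul_le_mul (mul_le_mul_of_nonneg_left hsb.theta_le hθ0) h7 (by positivity)
              (by linarith)
          _ = _ := by ring
      unfold pTheta
      constructor <;> linarith [hg.er_lt]
    have h1 : 0 ≤ potential Q a b ε p := by
      have := hP0.1
      unfold potential; positivity
    rw [abs_of_nonneg h1]
    unfold potential
    calc a ^ 2 * (speedF Q b ε p * speedF Q b ε p * (fQ Q p * pTheta Q b ε p))
        ≤ a ^ 2 * (2 / fQ Q p * (2 / fQ Q p) * (fQ Q p * 1)) := by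
          have := hP0.1
          have := hP0.2
          gcongr
      _ = _ := by field_simp; norm_num
  have key := abs_multiplierCurrent_le hS (ξ := fun i p => carl Q a b ε p
    * (ζ i p + a * speedF Q b ε p * (sgn i * multField Q b ε i p) * z p)) hξ (hq0 p hp) hψ hA hqi
  refine key.trans ?_
  have hCp := hC p (hs hp) hb hε hrR
  have hY0 : 0 ≤ Y := by rw [hY]; positivity
  have hn0 : (0 : ℝ) ≤ n := n.cast_nonneg
  -- Differentiating the conjugating factor costs 1/f each time, so a quadratic current loses at
  -- most f². The weight is O(f⁴), which leaves O(f²).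
  calc _ = carl Q a b ε p ^ 2 / fQ Q p ^ 2 * (Y * ((n + 2) * (R * Y) + n * fQ Q p * Z)
          + 1 / 2 * (R * ((n + 2) * Y ^ 2)) + 1 / 2 * (Z ^ 2 * (|M| * R * fQ Q p))
          + 1 / 2 * (4 * a ^ 2 * fQ Q p * Z ^ 2 * R)) := by field_simp
    _ ≤ C * fQ Q p ^ 2 * (Y * ((n + 2) * (R * Y) + n * R ^ 2 * Z)
          + 1 / 2 * (R * ((n + 2) * Y ^ 2)) + 1 / 2 * (Z ^ 2 * (|M| * R * R ^ 2))
          + 1 / 2 * (4 * a ^ 2 * R ^ 2 * Z ^ 2 * R)) := by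
        gcongr
        rw [div_le_iff₀ (by positivity)]
        calc _ ≤ _ := hCp
          _ = _ := by ring
    _ = _ := by ring

lemma exists_localCurrent_bound {R Z : ℝ} (ha : 2 ≤ a) (hb : 0 < b) (hε : 0 < ε)
    (hZ : 0 ≤ Z) (hs : s ⊆ goodRegion Q b ε) (hr : ∀ p ∈ s, rQ Q p ≤ R)
    (hφ : ∀ p ∈ s, φ p ^ 2 ≤ 1) (hz : ∀ p ∈ s, |z p| ≤ Z) (hζ : ∀ p ∈ s, ∀ i, |ζ i p| ≤ Z) :
    ∃ K : ℝ, ∀ i, ∀ p ∈ s, |localCurrent Q a b ε φ z ζ i p| ≤ K * fQ Q p ^ 2 := by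
  obtain ⟨C, hC0, hC⟩ := exists_carl_sq_le (n := n) (Q := Q) (b := b) (ε := ε) R ha
  refine ⟨C * (R ^ 2) ^ 2 * Z ^ 2, fun i p hp => ?_⟩
  have hg := goodBounds hb hε (hs hp)
  have hf := hg.f_pos
  have hr0 := hg.r_pos
  have hrR := hr p hp
  have hfR : fQ Q p ≤ R ^ 2 := by
    have : rQ Q p ^ 2 ≤ R ^ 2 := by gcongr
    linarith [hg.four_f_le]
  unfold localCurrent
  rw [abs_mul, abs_sgn, one_mul, abs_mul, abs_mul, abs_mul, abs_of_nonneg (sq_nonneg _),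
    abs_of_nonneg (sq_nonneg (φ p))]
  calc carl Q a b ε p ^ 2 * φ p ^ 2 * |z p| * |ζ i p|
      ≤ (C * fQ Q p ^ 4) * 1 * Z * Z := by
        gcongr
        · exact hC p (hs hp) hb hε hrR
        · exact hφ p hp
        · exact hz p hp
        · exact hζ p hp i
    _ = C * fQ Q p ^ 2 * Z ^ 2 * fQ Q p ^ 2 := by ring
    _ ≤ C * (R ^ 2) ^ 2 * Z ^ 2 * fQ Q p ^ 2 := by gcongr

/-- The flux of the Carleman current through the boundary. -/
lemma carlemanCurrent_flux (hb : 0 < b) (hε : 0 < ε) (hp : p ∈ goodRegion Q b ε) (hz : z p = 0)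
    {c : ℝ} {g : Fin n → ℝ} (hζ : ∀ i, ζ i p = c * Sum.elim (fun _ => 0) g i)
    (hg : c ≠ 0 → ∑ j, coord Q (Sum.inr j) p * g j ≤ 0) :
    ∑ j, carlemanCurrent Q a b ε z ζ (Sum.inr j) p * g j ≤ 0 := by
  have hgb := goodBounds hb hε hp
  have hsb := scalarBounds hb hε hp
  have hψ : conj Q a b ε z p = 0 := by unfold conj; rw [hz, mul_zero]
  have hα : 0 ≤ alphaF Q b ε p + deltaF Q b ε p := by
    have hf := hgb.f_pos
    have hr := hgb.r_pos
    have hθ0 : 0 ≤ thetaF Q b ε p := by linarith [hsb.theta_ge]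
    have h1 : 0 ≤ deltaF Q b ε p := by unfold deltaF; positivity
    have h2 : thetaF Q b ε p * rQ Q p ≤ 1 * rQ Q p := by
      have := hsb.theta_le
      gcongr
    have h3 := mul_le_mul_of_nonneg_left h2 hε.le
    have h4 : 0 ≤ alphaF Q b ε p := by unfold alphaF; linarith [hgb.er_lt]
    linarith
  have hS : ∀ j : Fin n, multField Q b ε (Sum.inr j) p
      = (alphaF Q b ε p + deltaF Q b ε p) * coord Q (Sum.inr j) p := fun j => by
    simp only [multField, radialField, spat_inr]; ring
  set C := carl Q a b ε p
  -- With ψ = 0 and a gradient along g the flux collapses to C²c²|g|²/2 times S · g. The spatial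
  -- part of S is a nonnegative multiple of x, so the sign is that of x · g.
  have e : ∀ j : Fin n, carlemanCurrent Q a b ε z ζ (Sum.inr j) p * g j =
      C ^ 2 * c ^ 2 * ((∑ k, multField Q b ε (Sum.inr k) p * g k) * g j ^ 2
        - 1 / 2 * (∑ k, g k ^ 2) * (multField Q b ε (Sum.inr j) p * g j)) := by
    intro j
    have h1 : ∑ k : Idx n, multField Q b ε k p * (C * (c * Sum.elim (fun _ => 0) g k))
        = C * c * ∑ k, multField Q b ε (Sum.inr k) p * g k := by
      rw [Fintype.sum_sum_type, Finset.mul_sum]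
      simp only [Sum.elim_inl, Sum.elim_inr, mul_zero, Finset.sum_const_zero, zero_add]
      exact Finset.sum_congr rfl fun k _ => by ring
    have h2 : ∑ k : Idx n, sgn k * (C * (c * Sum.elim (fun _ => 0) g k)) ^ 2
        = C ^ 2 * c ^ 2 * ∑ k, g k ^ 2 := by
      rw [Fintype.sum_sum_type, Finset.mul_sum]
      simp only [Sum.elim_inl, Sum.elim_inr, mul_zero, ne_eq, OfNat.ofNat_ne_zero,
        not_false_eq_true, zero_pow, Finset.sum_const_zero, zero_add, sgn_inr]
      exact Finset.sum_congr rfl fun k _ => by ring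
    simp only [carlemanCurrent, multiplierCurrent, hψ, hζ, hz, mul_zero, add_zero]
    rw [h1, h2]
    simp only [sgn_inr, Sum.elim_inr]
    ring
  rw [Finset.sum_congr rfl fun j _ => e j, ← Finset.mul_sum, Finset.sum_sub_distrib,
    ← Finset.mul_sum, ← Finset.mul_sum]
  have hX : ∑ j, multField Q b ε (Sum.inr j) p * g j
      = (alphaF Q b ε p + deltaF Q b ε p) * ∑ j, coord Q (Sum.inr j) p * g j := by
    rw [Finset.mul_sum]
    exact Finset.sum_congr rfl fun j _ => by rw [hS]; ring
  rw [hX]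
  have hG : 0 ≤ ∑ k, g k ^ 2 := Finset.sum_nonneg fun _ _ => sq_nonneg _
  rcases eq_or_ne c 0 with rfl | hc
  · simp
  · have h1 := hg hc
    have h2 : 0 ≤ C ^ 2 * c ^ 2 * ((alphaF Q b ε p + deltaF Q b ε p) * (∑ k, g k ^ 2) / 2) := by
      positivity
    have h3 := mul_nonpos_of_nonneg_of_nonpos h2 h1
    linarith

end Regularity

/-! ### The integrated estimate with a cutoff -/

section Integrated

variable {n : ℕ} {Ω : Set (EuclideanSpace ℝ (Fin n))} {Q p : Spacetime n} {a b ε R c M N : ℝ}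
  {z φ χ : Spacetime n → ℝ}

/-- The left-hand density of the Carleman estimate. -/
def bulkDensity (Q : Spacetime n) (a b ε : ℝ) (z : Spacetime n → ℝ) (p : Spacetime n) : ℝ :=
  ε / rQ Q p / 32 * (carl Q a b ε p ^ 2 * energyForm Q (fun i => pd i z p) p)
    + a ^ 2 / 10 * (betaF Q b ε p / fQ Q p) * (carl Q a b ε p ^ 2 * z p ^ 2)

/-- The right-hand density of the Carleman estimate. -/
def sourceDensity (Q : Spacetime n) (a b ε R N : ℝ) (φ z : Spacetime n → ℝ) (p : Spacetime n) :
    ℝ :=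
  fQ Q p / a * (carl Q a b ε p ^ 2 * box z p ^ 2)
    + carl Q a b ε p ^ 2 * ((φ p ^ 2 + ∑ i, pd i φ p ^ 2) / (1 + N))
      * (a ^ 2 * R ^ 3 / fQ Q p ^ 2 * (∑ k : Fin 2, pd (Sum.inl k) z p ^ 2)
        + a ^ 4 * R ^ 4 / fQ Q p ^ 3 * z p ^ 2)

/-- The Carleman inequality is applied to χz and the localized energy inequality to z;
`cutoff_scalar` combines them so that no spatial derivative of z is left in the source. -/
lemma bulkDensity_le (hb : 0 < b) (hε : 0 < ε) (hp : p ∈ goodRegion Q b ε)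
    (hn : 1 ≤ n) (ha : ((n : ℝ) + 2) ^ 2 ≤ a) (hεb : ε ≤ c * b) (hc : c ≤ 1 / 100)
    (hM0 : 0 < M) (hMc : M * c ≤ 1) (hMr : M * (ε * rQ Q p) ≤ 1 / 4)
    (hq : ContDiffAt ℝ 2 (multWeight Q b ε) p)
    (hq1 : |multWeight Q b ε p - n / 4| ≤ M * (ε * rQ Q p))
    (hq2 : |box (multWeight Q b ε) p| ≤ M * (ε / rQ Q p + ε * rQ Q p * (b / √(fQ Q p))))
    (hN : 0 ≤ N) (hcut : CutoffBounds φ χ N p) (hrR : rQ Q p ≤ R) (hz : ContDiffAt ℝ 2 z p) :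
    bulkDensity Q a b ε z p ≤ cutoffConst N R * sourceDensity Q a b ε R N φ z p
      + ((∑ i, pd i (carlemanCurrent Q a b ε (fun x => χ x * z x)
          (fun j => pd j (fun x => χ x * z x)) i) p)
        + 2 * (N * R ^ 2 + 1) * ∑ i, pd i (localCurrent Q a b ε φ z (fun j => pd j z) i) p) := by
  have hg := goodBounds hb hε hp
  have hn1 : (1 : ℝ) ≤ n := by exact_mod_cast hn
  have ha9 : 9 ≤ a := by
    have := mul_self_le_mul_self (by norm_num) (by linarith : (3 : ℝ) ≤ n + 2)
    linarith
  have ha0 : 0 < a := by linarith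
  have hχ := hcut.contDiffAt_right
  have h1 := carleman_pointwise hb hε hp hn ha hεb hc hM0 hMc hMr hq hq1 hq2
    (z := fun x => χ x * z x) (hχ.mul hz)
  have h2 := local_pointwise ha0 hb hε hp hcut.contDiffAt_left hz
  have h3 := sq_box_cutoff_le hcut hz
  have h4 := energyForm_cutoff_le hp.1 hcut hz
  have hsum : ∑ i, pd i z p ^ 2 = (∑ j : Fin n, pd (Sum.inr j) z p ^ 2)
      + ∑ k : Fin 2, pd (Sum.inl k) z p ^ 2 := by
    rw [Fintype.sum_sum_type, add_comm]
  rw [hsum] at h3 h4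
  have h5 : z p ^ 2 ≤ 2 * (χ p * z p) ^ 2 + 8 * φ p ^ 2 * z p ^ 2 := by
    have e1 := mul_le_mul_of_nonneg_right hcut.one_sub_sq_le (sq_nonneg (z p))
    have e2 := sq_nonneg (χ p * z p - (1 - χ p) * z p)
    linarith
  unfold conj at h1
  rw [mul_pow (carl Q a b ε p), mul_pow (carl Q a b ε p)] at h1
  refine cutoff_scalar ha9 hg.beta_pos hg.beta_lt.le hg.f_pos hg.four_f_le hg.r_pos hrR
    (div_pos hε hg.r_pos) ?_ hN (sq_nonneg _) hcut.sq_le_one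
    (Finset.sum_nonneg fun _ _ => sq_nonneg _) (Finset.sum_nonneg fun _ _ => sq_nonneg _)
    (Finset.sum_nonneg fun _ _ => sq_nonneg _) (sq_nonneg _) (sq_nonneg _) (sq_nonneg _)
    h1 h2 h3 h4 h5
  have : ε / rQ Q p * rQ Q p ^ 2 = ε * rQ Q p := by
    have := hg.r_pos.ne'
    field_simp
  linarith [hg.er_lt]

lemma continuousOn_energyForm {ζ : Idx n → Spacetime n → ℝ} {s : Set (Spacetime n)}
    (hs : s ⊆ exteriorCone Q) (hζ : ∀ i, ContinuousOn (ζ i) s) :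
    ContinuousOn (fun p => energyForm Q (fun i => ζ i p) p) s := by
  have hf : ContinuousOn (fQ Q) s := (contDiff_fQ Q (k := 0)).continuous.continuousOn
  have hr : ContinuousOn (fun p => rQ Q p ^ 2) s := (continuous_rQ.pow 2).continuousOn
  have hr0 : ∀ p ∈ s, rQ Q p ^ 2 ≠ 0 := fun p hp => (pow_pos (rQ_pos (hs hp)) 2).ne'
  have hco : ∀ i : Idx n, ContinuousOn (coord Q i) s := fun i =>
    (contDiff_coord Q i (k := 0)).continuous.continuousOn
  have hsp : ∀ i : Idx n, ContinuousOn (spat Q i) s := fun i =>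
    (contDiff_spat (Q := Q) i (k := 0)).continuous.continuousOn
  unfold energyForm
  refine (((continuousOn_finsetSum _ fun i _ => (hco i).mul (hζ i)).pow 2).add (hf.mul
    ((continuousOn_finsetSum _ fun j _ => (hζ _).pow 2).sub
      (((continuousOn_finsetSum _ fun i _ => (hsp i).mul (hζ i)).pow 2).div hr hr0)))).add (hf.mul
    ((continuousOn_finsetSum _ fun j _ => (hζ _).pow 2).sub
      (((continuousOn_finsetSum _ fun i _ => (hco _).mul (hζ _)).pow 2).div hr hr0)))

lemma continuousOn_bulkDensity {s : Set (Spacetime n)} (hb : 0 < b) (hε : 0 < ε)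
    (hs : s ⊆ goodRegion Q b ε) (hz : ∀ p ∈ s, ContDiffAt ℝ 2 z p) :
    ContinuousOn (bulkDensity Q a b ε z) s := by
  have hf : ContinuousOn (fQ Q) s := (contDiff_fQ Q (k := 0)).continuous.continuousOn
  have hC : ContinuousOn (carl Q a b ε) s := fun p hp =>
    (contDiffAt_carl hb hε (hs hp) (k := 0)).continuousAt.continuousWithinAt
  have hβ : ContinuousOn (betaF Q b ε) s := fun p hp =>
    (contDiffAt_betaF hb hε (hs hp)).continuousAt.continuousWithinAt
  have hzc : ContinuousOn z s := fun p hp => (hz p hp).continuousAt.continuousWithinAt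
  have hE : ContinuousOn (fun p => energyForm Q (fun i => pd i z p) p) s :=
    continuousOn_energyForm (fun p hp => (hs hp).1) fun i p hp =>
      (differentiableAt_pd (hz p hp)).continuousAt.continuousWithinAt
  exact (((continuousOn_const.div continuous_rQ.continuousOn
    fun p hp => (rQ_pos (hs hp).1).ne').div_const _).mul ((hC.pow 2).mul hE)).add
    ((continuousOn_const.mul (hβ.div hf fun p hp => (hs hp).1.ne')).mul
      ((hC.pow 2).mul (hzc.pow 2)))

lemma continuousOn_box {s : Set (Spacetime n)} (hs : IsOpen s) (hz : ContDiffOn ℝ 2 z s) :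
    ContinuousOn (box z) s := by
  have hza : ∀ p ∈ s, ContDiffAt ℝ 2 z p := fun p hp => hz.contDiffAt (hs.mem_nhds hp)
  have h : ContinuousOn (fun p => ∑ i, sgn i * pd i (pd i z) p) s :=
    continuousOn_finsetSum _ fun i _ => continuousOn_const.mul fun p hp =>
      (contDiffAt_pd (k := 0) (m := 1) (by norm_num)
        (contDiffAt_pd (k := 1) (m := 2) (by norm_num)
          (hza p hp))).continuousAt.continuousWithinAt
  exact h.congr fun p hp => box_eq (hza p hp)

lemma continuousOn_sourceDensity {s : Set (Spacetime n)} (hb : 0 < b) (hε : 0 < ε)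
    (hs : s ⊆ goodRegion Q b ε) (hso : IsOpen s) (hφ : ContDiff ℝ 2 φ) (hz : ContDiffOn ℝ 2 z s) :
    ContinuousOn (sourceDensity Q a b ε R N φ z) s := by
  have hza : ∀ p ∈ s, ContDiffAt ℝ 2 z p := fun p hp => hz.contDiffAt (hso.mem_nhds hp)
  have hf : ContinuousOn (fQ Q) s := (contDiff_fQ Q (k := 0)).continuous.continuousOn
  have hf0 : ∀ p ∈ s, fQ Q p ≠ 0 := fun p hp => (hs hp).1.ne'
  have hC : ContinuousOn (carl Q a b ε) s := fun p hp =>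
    (contDiffAt_carl hb hε (hs hp) (k := 0)).continuousAt.continuousWithinAt
  have hzi : ∀ i, ContinuousOn (pd i z) s := fun i p hp =>
    (differentiableAt_pd (hza p hp)).continuousAt.continuousWithinAt
  have hφi : ∀ i, ContinuousOn (pd i φ) s := fun i p hp =>
    (differentiableAt_pd hφ.contDiffAt).continuousAt.continuousWithinAt
  exact ((hf.div_const _).mul ((hC.pow 2).mul ((continuousOn_box hso hz).pow 2))).add
    (((hC.pow 2).mul (((hφ.continuous.continuousOn.pow 2).add
      (continuousOn_finsetSum _ fun i _ => (hφi i).pow 2)).div_const _)).mul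
    (((continuousOn_const.div (hf.pow 2) fun p hp => pow_ne_zero _ (hf0 p hp)).mul
      (continuousOn_finsetSum _ fun i _ => (hzi _).pow 2)).add
    ((continuousOn_const.div (hf.pow 3) fun p hp => pow_ne_zero _ (hf0 p hp)).mul
      (hz.continuousOn.pow 2))))

/-- The divergence inequality applied to the sum of the two currents. Inside, the currents are built
from derivatives of z; on the boundary they use the continuous extension of those derivatives, since
z is only C¹ there. -/
theorem integralOn_bulkDensity_le (hn : 1 ≤ n) (hΩ : IsOpen Ω) (hs : HasSmoothBoundary Ω)
    (hR0 : 0 < R) (hR : ∀ x ∈ Ω, ‖x - Q.2‖ < R) (hb : 0 < b) (hε : 0 < ε)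
    (ha : ((n : ℝ) + 2) ^ 2 ≤ a) (hεb : ε ≤ c * b) (hc : c ≤ 1 / 100) (hM0 : 0 < M)
    (hMc : M * c ≤ 1) (hreg : closure (cylinder Ω) ∩ exteriorCone Q ⊆ goodRegion Q b ε)
    (hMr : ∀ p ∈ closure (cylinder Ω) ∩ exteriorCone Q, M * (ε * rQ Q p) ≤ 1 / 4)
    (hq : ∀ p ∈ goodRegion Q b ε, ContDiffAt ℝ 2 (multWeight Q b ε) p ∧
      |multWeight Q b ε p - n / 4| ≤ M * (ε * rQ Q p) ∧
      |box (multWeight Q b ε) p| ≤ M * (ε / rQ Q p + ε * rQ Q p * (b / √(fQ Q p))) ∧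
      ∀ i, fQ Q p * |pd i (multWeight Q b ε) p| ≤ M * rQ Q p)
    (hN : 0 ≤ N) (hφ : ContDiff ℝ 2 φ) (hχ : ContDiff ℝ 2 χ)
    (hcut : ∀ p ∈ cylinder Ω ∩ exteriorCone Q, CutoffBounds φ χ N p)
    (hχ0 : ∀ p : Spacetime n, p.2 ∈ gammaPlus Ω Q → χ p = 0)
    (hz : ContDiffOn ℝ 2 z (cylinder Ω)) (hzc : ContDiffOn ℝ 1 z (closure (cylinder Ω)))
    (hz0 : ∀ p ∈ frontier (cylinder Ω) ∩ exteriorCone Q, z p = 0) :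
    integralOn (cylinder Ω ∩ exteriorCone Q) (bulkDensity Q a b ε z) ≤
      integralOn (cylinder Ω ∩ exteriorCone Q)
        (fun p => cutoffConst N R * sourceDensity Q a b ε R N φ z p) := by
  obtain ⟨G, hGc, hGz, hGf⟩ := exists_fderiv_extension (isOpen_cylinder hΩ) hzc
  obtain ⟨ζ, hζ⟩ : ∃ ζ : Idx n → Spacetime n → ℝ, ∀ i p, ζ i p = G p (stdVec i) := ⟨_, fun _ _ => rfl⟩
  obtain ⟨w, hw⟩ : ∃ w : Spacetime n → ℝ, w = fun p => χ p * z p := ⟨_, rfl⟩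
  obtain ⟨η, hη⟩ : ∃ η : Idx n → Spacetime n → ℝ, η = fun i p => χ p * ζ i p + pd i χ p * z p :=
    ⟨_, rfl⟩
  set O := cylinder Ω ∩ exteriorCone Q with hO
  have hOo : IsOpen O := (isOpen_cylinder hΩ).inter (isOpen_exteriorCone Q)
  have hOC : O ⊆ closure (cylinder Ω) ∩ exteriorCone Q := inter_subset_inter_left _ subset_closure
  have hOg : O ⊆ goodRegion Q b ε := hOC.trans hreg
  have hza : ∀ p ∈ O, ContDiffAt ℝ 2 z p := fun p hp =>
    hz.contDiffAt ((isOpen_cylinder hΩ).mem_nhds hp.1)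
  have hζz : ∀ i, ∀ p ∈ O, ζ i p = pd i z p := fun i p hp => by rw [hζ, hGz p hp.1]; rfl
  have hζc : ∀ i, ContinuousOn (ζ i) (closure (cylinder Ω)) := fun i =>
    (hGc.clm_apply continuousOn_const).congr fun p _ => hζ i p
  have hχi : ∀ i, ContDiff ℝ 1 (pd i χ) := fun i => contDiff_iff_contDiffAt.2 fun p =>
    contDiffAt_pd (k := 1) (m := 2) (by norm_num) hχ.contDiffAt
  have hηz : ∀ i, ∀ p ∈ O, η i p = pd i w p := fun i p hp => by
    rw [hη, hw, pd_mul (hχ.contDiffAt.differentiableAt (by norm_num))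
      ((hza p hp).differentiableAt (by norm_num)), ← hζz i p hp]
    ring
  have hwc : ContinuousOn w (closure (cylinder Ω)) := by
    rw [hw]; exact hχ.continuous.continuousOn.mul hzc.continuousOn
  have hηc : ∀ i, ContinuousOn (η i) (closure (cylinder Ω)) := fun i => by
    rw [hη]
    exact (hχ.continuous.continuousOn.mul (hζc i)).add
      ((hχi i).continuous.continuousOn.mul hzc.continuousOn)
  have hz1 : ContDiffOn ℝ 1 z O := fun p hp => ((hza p hp).of_le (by norm_num)).contDiffWithinAt
  have hζ1 : ∀ i, ContDiffOn ℝ 1 (ζ i) O := fun i =>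
    ContDiffOn.congr (fun p hp => (contDiffAt_pd (k := 1) (m := 2) (by norm_num)
      (hza p hp)).contDiffWithinAt) (hζz i)
  have hw1 : ContDiffOn ℝ 1 w O := by
    rw [hw]; exact (hχ.of_le (by norm_num)).contDiffOn.mul hz1
  have hη1 : ∀ i, ContDiffOn ℝ 1 (η i) O := fun i => by
    rw [hη]
    exact ((hχ.of_le (by norm_num)).contDiffOn.mul (hζ1 i)).add ((hχi i).contDiffOn.mul hz1)
  have ha2 : 2 ≤ a := by
    have hn1 : (0 : ℝ) ≤ n := n.cast_nonneg
    have := mul_self_le_mul_self (by norm_num) (by linarith : (2 : ℝ) ≤ n + 2)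
    linarith
  -- bounds on the compact part of the closure
  obtain ⟨Z, hZ0, hZ⟩ : ∃ Z : ℝ, 0 ≤ Z ∧ ∀ p ∈ O, (|z p| ≤ Z ∧ ∀ i, |ζ i p| ≤ Z) ∧
      |w p| ≤ Z ∧ ∀ i, |η i p| ≤ Z := by
    have hcomp : IsCompact (closure (cylinder Ω) ∩ Metric.closedBall Q R) :=
      (isCompact_closedBall Q R).inter_left isClosed_closure
    have hc1 : ContinuousOn (fun p => |z p| + (∑ i, |ζ i p|) + |w p| + ∑ i, |η i p|)
        (closure (cylinder Ω) ∩ Metric.closedBall Q R) :=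
      (((hzc.continuousOn.abs.add (continuousOn_finsetSum _ fun i _ => (hζc i).abs)).add
        hwc.abs).add (continuousOn_finsetSum _ fun i _ => (hηc i).abs)).mono inter_subset_left
    obtain ⟨Z, hZ⟩ := hcomp.exists_bound_of_continuousOn hc1
    refine ⟨|Z|, abs_nonneg _, fun p hp => ?_⟩
    have h1 := hZ p ⟨subset_closure hp.1, mem_closedBall_of_mem_exteriorCone hp.2
      (rQ_lt_of_mem hR hp.1).le⟩
    have h2 := (le_abs_self _).trans (h1.trans (le_abs_self Z))
    have s1 : 0 ≤ ∑ i, |ζ i p| := Finset.sum_nonneg fun _ _ => abs_nonneg _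
    have s2 : 0 ≤ ∑ i, |η i p| := Finset.sum_nonneg fun _ _ => abs_nonneg _
    have s3 := abs_nonneg (z p)
    have s4 := abs_nonneg (w p)
    refine ⟨⟨by linarith, fun i => ?_⟩, by linarith, fun i => ?_⟩
    · have := Finset.single_le_sum (f := fun i => |ζ i p|) (fun _ _ => abs_nonneg _)
        (Finset.mem_univ i)
      linarith
    · have := Finset.single_le_sum (f := fun i => |η i p|) (fun _ _ => abs_nonneg _)
        (Finset.mem_univ i)
      linarith
  have hrR : ∀ p ∈ O, rQ Q p ≤ R := fun p hp => (rQ_lt_of_mem hR hp.1).le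
  have hqn : ∀ p ∈ O, |multWeight Q b ε p| ≤ n := fun p hp => by
    have h1 := (hq p (hOg hp)).2.1.trans (hMr p (hOC hp))
    have hn1 : (1 : ℝ) ≤ n := by exact_mod_cast hn
    rw [abs_le] at h1 ⊢
    constructor <;> linarith [h1.1, h1.2]
  obtain ⟨K₁, hK₁⟩ := exists_carlemanCurrent_bound (M := M) ha2 hb hε hR0 hZ0 hOg hrR hqn
    (fun p hp => (hq p (hOg hp)).2.2.2) (fun p hp => (hZ p hp).2.1) (fun p hp => (hZ p hp).2.2)
  obtain ⟨K₂, hK₂⟩ := exists_localCurrent_bound (φ := φ) ha2 hb hε hZ0 hOg hrR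
    (fun p hp => (hcut p hp).sq_le_one) (fun p hp => (hZ p hp).1.1) (fun p hp => (hZ p hp).1.2)
  have hΛ : 0 ≤ 2 * (N * R ^ 2 + 1) := by positivity
  have hK : 0 ≤ cutoffConst N R := by unfold cutoffConst; positivity
  have hJ₁ : ∀ i, ContDiffOn ℝ 1 (carlemanCurrent Q a b ε w η i) O :=
    contDiffOn_carlemanCurrent (k := 1) hb hε hOg le_rfl (fun p hp => (hq p (hOg hp)).1) hw1 hη1
  have hJ₂ : ∀ i, ContDiffOn ℝ 1 (localCurrent Q a b ε φ z ζ i) O :=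
    contDiffOn_localCurrent (k := 1) hb hε hOg (hφ.of_le (by norm_num)).contDiffOn hz1 hζ1
  refine lintegral_le_of_le_add_div hΩ hs hR0 hR (J := fun i p => carlemanCurrent Q a b ε w η i p
    + 2 * (N * R ^ 2 + 1) * localCurrent Q a b ε φ z ζ i p) ?_ ?_ ?_ ?_ ?_ ?_ ?_ ?_ ?_
  · exact fun i => (hJ₁ i).add (contDiffOn_const.mul (hJ₂ i))
  · intro i
    have h1 := contDiffOn_carlemanCurrent (a := a) (k := 0) hb hε hreg (by norm_num)
      (fun p hp => (hq p (hreg hp)).1) (contDiffOn_zero.2 (hwc.mono inter_subset_left))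
      (fun i => contDiffOn_zero.2 ((hηc i).mono inter_subset_left)) i
    have h2 := contDiffOn_localCurrent (a := a) (k := 0) hb hε hreg
      (contDiffOn_zero.2 hφ.continuous.continuousOn)
      (contDiffOn_zero.2 (hzc.continuousOn.mono inter_subset_left))
      (fun i => contDiffOn_zero.2 ((hζc i).mono inter_subset_left)) i
    exact h1.continuousOn.add (continuousOn_const.mul h2.continuousOn)
  · refine ⟨K₁ + 2 * (N * R ^ 2 + 1) * K₂, fun i p hp => (abs_add_le _ _).trans ?_⟩
    rw [abs_mul, abs_of_nonneg hΛ]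
    have := mul_le_mul_of_nonneg_left (hK₂ i p hp) hΛ
    linarith [hK₁ i p hp]
  · intro q hq0 V ρ hV hdef
    have hqC : q ∈ closure (cylinder Ω) ∩ exteriorCone Q := ⟨frontier_subset_closure hq0.1, hq0.2⟩
    have hzq := hz0 q hq0
    obtain ⟨k, hk⟩ := exists_fderiv_extension_normal hΩ hz0 hq0 (hGf q hqC.1) hV hdef
    -- The localized current contains the factor z, so it has no flux through the boundary.
    have h1 : ∀ j : Fin n, localCurrent Q a b ε φ z ζ (Sum.inr j) q = 0 := fun j => by
      unfold localCurrent; rw [hzq]; ring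
    simp only [h1, mul_zero, add_zero]
    refine carlemanCurrent_flux hb hε (hreg hqC) (by rw [hw]; simp [hzq]) (c := χ q * k)
      (fun i => ?_) fun hck => ?_
    · rw [hη]
      simp only [hzq, mul_zero, add_zero, hζ, hk i, mul_assoc]
    -- Were x · ∇ρ positive, the point would lie in Γ₊. There χ = 0, so the normal derivative χk of
    -- χz would vanish.
    · by_contra hpos
      push Not at hpos
      apply hck
      rw [hχ0 q, zero_mul]
      have hqf : q.2 ∈ frontier Ω := by
        have := hq0.1
        rw [frontier_cylinder] at this
        exact this.2
      refine ⟨hqf, _, ⟨V, ρ, hV, hdef, rfl⟩, ?_⟩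
      rw [real_inner_smul_left]
      refine mul_pos (inv_pos.2 (norm_pos_iff.2 (hdef.2.2.1 _ hV))) ?_
      rw [PiLp.inner_apply]
      refine hpos.trans_eq (Finset.sum_congr rfl fun j _ => ?_)
      simp [coord, xShift]
  · exact continuousOn_bulkDensity hb hε hOg hza
  · exact continuousOn_const.mul (continuousOn_sourceDensity hb hε hOg hOo hφ
      (hz.mono inter_subset_left))
  · intro p hp
    have hg := goodBounds hb hε (hOg hp)
    have := hg.r_pos
    have := hg.f_pos
    have := hg.beta_pos
    have := energyForm_nonneg hp.2 (fun i => pd i z p)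
    unfold bulkDensity
    positivity
  · intro p hp
    have hg := goodBounds hb hε (hOg hp)
    have := hg.f_pos
    have h1 : 0 ≤ ∑ i, pd i φ p ^ 2 := Finset.sum_nonneg fun _ _ => sq_nonneg _
    have h2 : 0 ≤ ∑ k : Fin 2, pd (Sum.inl k) z p ^ 2 := Finset.sum_nonneg fun _ _ => sq_nonneg _
    unfold sourceDensity
    positivity
  · intro p hp
    have hqp := hq p (hOg hp)
    refine (bulkDensity_le hb hε (hOg hp) hn ha hεb hc hM0 hMc (hMr p (hOC hp)) hqp.1 hqp.2.1
      hqp.2.2.1 hN (hcut p hp) (hrR p hp) (hza p hp)).trans_eq ?_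
    have hev : ∀ᶠ x in 𝓝 p, x ∈ O := hOo.mem_nhds hp
    have e1 : ∀ i, pd i (carlemanCurrent Q a b ε (fun x => χ x * z x)
        (fun j => pd j (fun x => χ x * z x)) i) p = pd i (carlemanCurrent Q a b ε w η i) p := by
      intro i
      refine pd_congr (hev.mono fun x hx => ?_)
      simp only [carlemanCurrent, multiplierCurrent, hηz _ x hx, hw]
    have e2 : ∀ i, pd i (localCurrent Q a b ε φ z (fun j => pd j z) i) p
        = pd i (localCurrent Q a b ε φ z ζ i) p := by
      intro i
      refine pd_congr (hev.mono fun x hx => ?_)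
      simp only [localCurrent, hζz _ x hx]
    have d1 : ∀ i, DifferentiableAt ℝ (carlemanCurrent Q a b ε w η i) p := fun i =>
      ((hJ₁ i).contDiffAt (hOo.mem_nhds hp)).differentiableAt (by norm_num)
    have d2 : ∀ i, DifferentiableAt ℝ (localCurrent Q a b ε φ z ζ i) p := fun i =>
      ((hJ₂ i).contDiffAt (hOo.mem_nhds hp)).differentiableAt (by norm_num)
    congr 1
    rw [Finset.mul_sum, ← Finset.sum_add_distrib]
    refine Finset.sum_congr rfl fun i _ => ?_
    rw [pd_add (d1 i) ((d2 i).const_mul _), pd_const_mul _ (d2 i), e1, e2]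

end Integrated

/-! ### The cutoff functions -/

section CutoffExists

variable {n : ℕ}

-- The closure of Γ lies in the open σ-neighbourhood, whatever Γ is. Vanishing near each outside
-- point, and not only at it, makes the derivatives vanish there too.
open scoped Manifold in
lemma exists_smooth_cutoff {σ : ℝ} (hσ : 0 < σ) (Γ : Set (EuclideanSpace ℝ (Fin n))) :
    ∃ f : EuclideanSpace ℝ (Fin n) → ℝ, ContDiff ℝ 2 f ∧ (∀ x ∈ Γ, f x = 1) ∧
      (∀ x ∉ Metric.thickening σ Γ, ∀ᶠ y in 𝓝 x, f y = 0) ∧ ∀ x, f x ∈ Icc (0 : ℝ) 1 := by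
  obtain ⟨f, h0, h1, h01⟩ := exists_contMDiffMap_zero_one_nhds_of_isClosed (n := 2)
    𝓘(ℝ, EuclideanSpace ℝ (Fin n)) (s := (Metric.thickening σ Γ)ᶜ) (t := closure Γ)
    Metric.isOpen_thickening.isClosed_compl isClosed_closure
    (disjoint_compl_left_iff_subset.2 (Metric.closure_subset_thickening hσ Γ))
  exact ⟨f, f.contMDiff.contDiff, fun x hx => h1.self_of_nhdsSet x (subset_closure hx),
    fun x hx => h0.filter_mono (nhds_le_nhdsSet hx), h01⟩

/-- Taking χ = 1 − η(2φ − 1) ties the two cutoffs together: χ = 0 where φ = 1, and χ is constant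
where φ < 1/2. The derivatives of χ thus live where φ is bounded below and can be estimated by φ. -/
lemma exists_cutoffBounds (Q : Spacetime n) (R : ℝ) {σ : ℝ} (hσ : 0 < σ)
    (Γ : Set (EuclideanSpace ℝ (Fin n))) :
    ∃ (φ χ : Spacetime n → ℝ) (N : ℝ), 0 ≤ N ∧ ContDiff ℝ 2 φ ∧ ContDiff ℝ 2 χ ∧
      (∀ p ∈ Metric.closedBall Q R, CutoffBounds φ χ N p) ∧ (∀ p, p.2 ∈ Γ → χ p = 0) ∧
      ∀ p, p.2 ∉ Metric.thickening σ Γ → φ p ^ 2 + ∑ i, pd i φ p ^ 2 = 0 := by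
  obtain ⟨f, hf, hf1, hf0, hf01⟩ := exists_smooth_cutoff hσ Γ
  obtain ⟨φ, hφ⟩ : ∃ φ : Spacetime n → ℝ, φ = fun p => f p.2 := ⟨_, rfl⟩
  obtain ⟨χ, hχ⟩ : ∃ χ : Spacetime n → ℝ, χ = fun p => 1 - (2 * φ p - 1).smoothTransition :=
    ⟨_, rfl⟩
  have cφ : ContDiff ℝ 2 φ := by rw [hφ]; exact hf.comp contDiff_snd
  have cχ : ContDiff ℝ 2 χ := by
    rw [hχ]
    exact contDiff_const.sub ((Real.smoothTransition.contDiff (n := 2)).comp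
      ((contDiff_const.mul cφ).sub contDiff_const))
  have φ01 : ∀ p, φ p ∈ Icc (0 : ℝ) 1 := fun p => by rw [hφ]; exact hf01 _
  have cpd : ∀ {g : Spacetime n → ℝ}, ContDiff ℝ 2 g → ∀ i, Continuous (pd i g) := fun hg i =>
    continuous_iff_continuousAt.2 fun p => (differentiableAt_pd hg.contDiffAt).continuousAt
  have cbox : Continuous (box χ) :=
    continuousOn_univ.1 (continuousOn_box isOpen_univ cχ.contDiffOn)
  have hcont : Continuous fun p =>
      (∑ i, pd i χ p ^ 2) + box χ p ^ 2 + ∑ i, pd i φ p ^ 2 :=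
    ((continuous_finsetSum _ fun i _ => (cpd cχ i).pow 2).add (cbox.pow 2)).add
      (continuous_finsetSum _ fun i _ => (cpd cφ i).pow 2)
  obtain ⟨N, hN⟩ := (isCompact_closedBall Q R).exists_bound_of_continuousOn hcont.continuousOn
  refine ⟨φ, χ, 4 * |N|, by positivity, cφ, cχ, fun p hp => ?_, fun p hp => ?_, fun p hp => ?_⟩
  · have hNp := (le_abs_self _).trans ((hN p hp).trans (le_abs_self N))
    have s1 : 0 ≤ ∑ i, pd i χ p ^ 2 := Finset.sum_nonneg fun _ _ => sq_nonneg _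
    have s2 : 0 ≤ box χ p ^ 2 := sq_nonneg _
    have s3 : 0 ≤ ∑ i, pd i φ p ^ 2 := Finset.sum_nonneg fun _ _ => sq_nonneg _
    have hχ0 : 0 ≤ χ p := by rw [hχ]; linarith [Real.smoothTransition.le_one (2 * φ p - 1)]
    have hχ1 : χ p ≤ 1 := by rw [hχ]; linarith [Real.smoothTransition.nonneg (2 * φ p - 1)]
    have hφ1 : φ p ^ 2 ≤ 1 := pow_le_one₀ (φ01 p).1 (φ01 p).2
    have hN0 := abs_nonneg N
    -- For φ < 1/2 all quantities built from 1 − χ vanish nearby. For φ ≥ 1/2 one has 1 ≤ 4φ²,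
    -- whence the constant 4|N|.
    rcases lt_or_ge (φ p) (1 / 2) with hlt | hge
    · have hev : χ =ᶠ[𝓝 p] fun _ => 1 := by
        filter_upwards [cφ.continuous.continuousAt.eventually_lt continuousAt_const hlt] with q hq
        rw [hχ]
        simp only
        rw [Real.smoothTransition.zero_of_nonpos (by linarith), sub_zero]
      have e1 : ∑ i, pd i χ p ^ 2 = 0 := Finset.sum_eq_zero fun i _ => by
        rw [pd_congr hev, pd_const]; norm_num
      have e2 : box χ p = 0 := by rw [box_congr cχ.contDiffAt hev, box_const]
      refine ⟨cφ.contDiffAt, cχ.contDiffAt, hφ1, hχ0, hχ1, ?_, ?_, ?_, ?_⟩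
      · rw [hev.self_of_nhds]; norm_num; positivity
      · rw [e1]; positivity
      · rw [e2]; norm_num; positivity
      · linarith
    · have h4 : 1 ≤ 4 * φ p ^ 2 := by
        have := mul_self_le_mul_self (by norm_num) hge
        linarith
      have h5 := mul_le_mul_of_nonneg_left h4 hN0
      refine ⟨cφ.contDiffAt, cχ.contDiffAt, hφ1, hχ0, hχ1, ?_, ?_, ?_, ?_⟩
      · exact (pow_le_one₀ (by linarith) (by linarith)).trans h4
      · linarith
      · linarith
      · linarith
  · rw [hχ, hφ]
    simp only
    rw [hf1 _ hp]
    norm_num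
  · have hev : φ =ᶠ[𝓝 p] fun _ => 0 := by
      rw [hφ]; exact continuousAt_snd.eventually (hf0 _ hp)
    rw [hev.self_of_nhds, Finset.sum_eq_zero fun i _ => by rw [pd_congr hev, pd_const]; norm_num]
    norm_num

end CutoffExists

/-! ### Comparison with the null frame -/

section Comparison

variable {n : ℕ} {Q p : Spacetime n} {a b ε R N : ℝ} {z φ : Spacetime n → ℝ}

lemma weight_eq (hb : 0 < b) (hε : 0 < ε) (hp : p ∈ goodRegion Q b ε) :
    weight Q a b ε p = carl Q a b ε p ^ 2 := by
  have hg := goodBounds hb hε hp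
  have hτ := tauQ_lt_rQ hp.1
  have hτ0 : 0 ≤ tauQ Q p := norm_nonneg _
  have hm : 0 < pMinus Q ε p := by linarith [hg.pMinus_ge]
  have hr := hg.r_pos
  have e1 : (1 + ε * uQ Q p) * (1 - ε * vQ Q p) = pMinus Q ε p := by
    unfold pMinus fQ uQ vQ; ring
  have e2 : (1 - ε * uQ Q p) * (1 + ε * vQ Q p) = pPlus Q ε p := by
    unfold pPlus fQ uQ vQ; ring
  -- Nonnegative bases are required to merge the two half powers into one.
  have hu : 0 ≤ 1 - ε * uQ Q p := by
    have := mul_nonneg hε.le (sub_nonneg.2 hτ.le)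
    unfold uQ
    linarith
  have hv : 0 ≤ 1 + ε * vQ Q p := by
    have := mul_nonneg hε.le (add_nonneg hτ0 hr.le)
    unfold vQ
    linarith
  unfold weight
  rw [e1, ← Real.mul_rpow hu hv, e2, ← Real.sqrt_eq_rpow, ← Real.sqrt_eq_rpow]
  have e3 : fQ Q p / pMinus Q ε p * Real.exp (2 * b * √(fQ Q p) / √(pPlus Q ε p))
      = Real.exp (phase Q b ε p) := by
    unfold phase
    rw [Real.exp_add, Real.exp_sub, Real.exp_log hg.f_pos, Real.exp_log hm, mul_div_assoc]
  rw [e3, ← Real.exp_mul, carl, ← Real.exp_nat_mul]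
  congr 1
  push_cast
  ring

/-- The null frame form of the gradient is controlled by `energyForm`. -/
lemma null_frame_le (hp : p ∈ exteriorCone Q) (hz : DifferentiableAt ℝ z p) :
    (uQ Q p * dU Q z p) ^ 2 + (vQ Q p * dV Q z p) ^ 2 + fQ Q p * gAngX Q z p
      - fQ Q p * gAngT Q z p ≤ 4 * energyForm Q (fun i => pd i z p) p := by
  have hf : 0 < fQ Q p := hp
  have hr := rQ_pos hp
  have hfe : 4 * fQ Q p = rQ Q p ^ 2 - tauQ Q p ^ 2 := by unfold fQ uQ vQ; ring
  obtain ⟨T, hT⟩ : ∃ T, T = dTau Q z p := ⟨_, rfl⟩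
  obtain ⟨D, hD⟩ : ∃ D, D = dR Q z p := ⟨_, rfl⟩
  have e1 : ∑ k : Fin 2, coord Q (Sum.inl k) p * pd (Sum.inl k) z p
      = inner ℝ (tShift Q p) (gradT z p) := by
    rw [PiLp.inner_apply]
    exact Finset.sum_congr rfl fun k _ => by rw [gradT_apply hz]; simp [coord, mul_comm]
  have e2 : ∑ j : Fin n, coord Q (Sum.inr j) p * pd (Sum.inr j) z p
      = inner ℝ (xShift Q p) (gradX z p) := by
    rw [PiLp.inner_apply]
    exact Finset.sum_congr rfl fun k _ => by rw [gradX_apply hz]; simp [coord, mul_comm]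
  have e3 : inner ℝ (tShift Q p) (gradT z p) = tauQ Q p * T := by
    rw [hT, dTau, omegaT, real_inner_smul_left]
    rcases eq_or_ne (tauQ Q p) 0 with h0 | h0
    · rw [norm_eq_zero.1 h0]; simp
    · field_simp
  have e4 : inner ℝ (xShift Q p) (gradX z p) = rQ Q p * D := by
    rw [hD, dR, omegaX, real_inner_smul_left]
    field_simp
  have e5 : ∑ k : Fin 2, pd (Sum.inl k) z p ^ 2 = ‖gradT z p‖ ^ 2 := by
    rw [EuclideanSpace.norm_sq_eq]
    exact Finset.sum_congr rfl fun k _ => by rw [gradT_apply hz]; simp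
  have e6 : ∑ k : Fin n, pd (Sum.inr k) z p ^ 2 = ‖gradX z p‖ ^ 2 := by
    rw [EuclideanSpace.norm_sq_eq]
    exact Finset.sum_congr rfl fun k _ => by rw [gradX_apply hz]; simp
  have e7 : ‖gradT z p‖ ^ 2 = ‖angGradT Q z p‖ ^ 2 + T ^ 2 := by
    have h1 : inner ℝ (gradT z p) (omegaT Q p) = T := by rw [hT, dTau, real_inner_comm]
    rw [angGradT, ← hT, norm_sub_sq_real, real_inner_smul_right, h1, norm_smul, mul_pow,
      Real.norm_eq_abs, sq_abs]
    -- At τ = 0 the convention 0⁻¹ = 0 gives a zero temporal angle and T = 0, so the whole time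
    -- gradient counts as angular.
    rcases eq_or_ne (tauQ Q p) 0 with h0 | h0
    · have : T = 0 := by rw [hT, dTau, omegaT, h0]; simp
      rw [this]; ring
    · have : ‖omegaT Q p‖ = 1 := by
        rw [omegaT, norm_smul, norm_inv, Real.norm_eq_abs, tauQ, abs_norm]
        exact inv_mul_cancel₀ h0
      rw [this]; ring
  have e8 : ‖gradX z p‖ ^ 2 = ‖angGradX Q z p‖ ^ 2 + D ^ 2 := by
    have h1 : inner ℝ (gradX z p) (omegaX Q p) = D := by rw [hD, dR, real_inner_comm]
    have : ‖omegaX Q p‖ = 1 := by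
      rw [omegaX, norm_smul, norm_inv, Real.norm_eq_abs, rQ, abs_norm]
      exact inv_mul_cancel₀ hr.ne'
    rw [angGradX, ← hD, norm_sub_sq_real, real_inner_smul_right, h1, norm_smul, mul_pow,
      Real.norm_eq_abs, sq_abs, this]
    ring
  -- Subtracting τ²T²/r² instead of T² leaves f T²(1 − τ²/r²) = 4(fT/r)², a control of the radial
  -- time derivative.
  have hE : energyForm Q (fun i => pd i z p) p = (tauQ Q p * T + rQ Q p * D) ^ 2
      + fQ Q p * ‖angGradX Q z p‖ ^ 2 + fQ Q p * ‖angGradT Q z p‖ ^ 2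
      + 4 * (fQ Q p * T / rQ Q p) ^ 2 := by
    unfold energyForm
    rw [sum_spat_mul, Fintype.sum_sum_type, e1, e2, e3, e4, e5, e6, e7, e8]
    field_simp
    linear_combination (-T ^ 2 * fQ Q p) * hfe
  have hU : (uQ Q p * dU Q z p) ^ 2 + (vQ Q p * dV Q z p) ^ 2
      = 1 / 2 * (tauQ Q p * T + rQ Q p * D) ^ 2 + 1 / 2 * (rQ Q p * T + tauQ Q p * D) ^ 2 := by
    unfold dU dV uQ vQ
    rw [← hT, ← hD]
    ring
  -- r² − τ² = 4f expresses the second null combination through the two quantities whose squares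
  -- occur in `hE`.
  have h9 : rQ Q p * T + tauQ Q p * D = tauQ Q p / rQ Q p * (tauQ Q p * T + rQ Q p * D)
      + 4 * (fQ Q p * T / rQ Q p) := by
    field_simp
    linear_combination (-T) * hfe
  have h10 : (tauQ Q p / rQ Q p) ^ 2 ≤ 1 :=
    pow_le_one₀ (div_nonneg (norm_nonneg _) hr.le) ((div_le_one hr).2 (tauQ_lt_rQ hp).le)
  have h11 : (rQ Q p * T + tauQ Q p * D) ^ 2 ≤ 2 * (tauQ Q p * T + rQ Q p * D) ^ 2
      + 32 * (fQ Q p * T / rQ Q p) ^ 2 := by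
    rw [h9]
    have h12 := mul_le_mul_of_nonneg_right h10 (sq_nonneg (tauQ Q p * T + rQ Q p * D))
    have h13 := sq_nonneg (tauQ Q p / rQ Q p * (tauQ Q p * T + rQ Q p * D)
      - 4 * (fQ Q p * T / rQ Q p))
    linarith
  have h14 : 0 ≤ fQ Q p * ‖angGradX Q z p‖ ^ 2 := by positivity
  have h15 : 0 ≤ fQ Q p * ‖angGradT Q z p‖ ^ 2 := by positivity
  have h16 := sq_nonneg (tauQ Q p * T + rQ Q p * D)
  rw [hE, hU]
  unfold gAngX gAngT
  linarith

/-- The null frame form is at most 4 times the energy and the bulk density carries 1/32 in front of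
it, hence 128. For z² one needs b/√f ≤ 12.8 β/f, and β ≥ 0.95 b√f. -/
lemma lhs_density_le {C : ℝ} (hC : 0 ≤ C) (hb : 0 < b) (hε : 0 < ε) (hp : p ∈ goodRegion Q b ε)
    (hz : DifferentiableAt ℝ z p) :
    C * ε * (weight Q a b ε p * (rQ Q p)⁻¹ * ((uQ Q p * dU Q z p) ^ 2
        + (vQ Q p * dV Q z p) ^ 2 + fQ Q p * gAngX Q z p - fQ Q p * gAngT Q z p))
      + C * b * a ^ 2 * (weight Q a b ε p * fQ Q p ^ (-(1 / 2) : ℝ) * z p ^ 2)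
      ≤ 128 * C * bulkDensity Q a b ε z p := by
  have hg := goodBounds hb hε hp
  have hf := hg.f_pos
  have hr := hg.r_pos
  have hsq := Real.sqrt_pos.2 hf
  have e1 : fQ Q p ^ (-(1 / 2) : ℝ) = 1 / √(fQ Q p) := by
    rw [Real.rpow_neg hf.le, ← Real.sqrt_eq_rpow, one_div]
  rw [weight_eq hb hε hp, e1]
  have h1 := mul_le_mul_of_nonneg_left (null_frame_le hp.1 hz)
    (by positivity : 0 ≤ C * ε * (carl Q a b ε p ^ 2 * (rQ Q p)⁻¹))
  have h2 : b / √(fQ Q p) ≤ 128 / 10 * (betaF Q b ε p / fQ Q p) := by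
    rw [← mul_div_assoc, div_le_div_iff₀ hsq hf]
    have h3 := mul_le_mul_of_nonneg_right hg.beta_ge hsq.le
    have h4 : b * √(fQ Q p) * √(fQ Q p) = b * fQ Q p := by
      rw [mul_assoc, Real.mul_self_sqrt hf.le]
    have h5 : 0 < b * fQ Q p := by positivity
    linarith
  have h3 := mul_le_mul_of_nonneg_left h2
    (by positivity : 0 ≤ C * a ^ 2 * (carl Q a b ε p ^ 2 * z p ^ 2))
  unfold bulkDensity
  calc _ = C * ε * (carl Q a b ε p ^ 2 * (rQ Q p)⁻¹) * ((uQ Q p * dU Q z p) ^ 2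
        + (vQ Q p * dV Q z p) ^ 2 + fQ Q p * gAngX Q z p - fQ Q p * gAngT Q z p)
        + C * a ^ 2 * (carl Q a b ε p ^ 2 * z p ^ 2) * (b / √(fQ Q p)) := by ring
    _ ≤ _ := add_le_add h1 h3
    _ = _ := by ring

end Comparison

/-! ### Splitting the integrals -/

section Splitting

variable {n : ℕ} {Ω : Set (EuclideanSpace ℝ (Fin n))} {Q : Spacetime n} {a b ε R N σ : ℝ}
  {z φ : Spacetime n → ℝ}

lemma integralOn_mono {s : Set (Spacetime n)} (hs : MeasurableSet s) {g h : Spacetime n → ℝ}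
    (hgh : ∀ p ∈ s, g p ≤ h p) : integralOn s g ≤ integralOn s h :=
  setLIntegral_mono' hs fun p hp => ENNReal.ofReal_le_ofReal (hgh p hp)

lemma integralOn_const_mul {s : Set (Spacetime n)} {g : Spacetime n → ℝ} {C : ℝ} (hC : 0 ≤ C) :
    integralOn s (fun p => C * g p) = ENNReal.ofReal C * integralOn s g := by
  unfold integralOn
  rw [← lintegral_const_mul' _ _ ENNReal.ofReal_ne_top]
  exact lintegral_congr fun p => ENNReal.ofReal_mul hC

/-- Superadditivity of the lower integral requires no measurability of the densities. -/
lemma add_integralOn_le {s : Set (Spacetime n)} (hs : MeasurableSet s) {g h : Spacetime n → ℝ}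
    (hg : ∀ p ∈ s, 0 ≤ g p) (hh : ∀ p ∈ s, 0 ≤ h p) :
    integralOn s g + integralOn s h ≤ integralOn s (fun p => g p + h p) := by
  unfold integralOn
  refine (le_lintegral_add _ _).trans_eq (setLIntegral_congr_fun hs fun p hp => ?_)
  exact (ENNReal.ofReal_add (hg p hp) (hh p hp)).symm

/-- Continuity of one summand provides the measurability needed for this direction. -/
lemma integralOn_add_le {s : Set (Spacetime n)} (hs : MeasurableSet s) {g h : Spacetime n → ℝ}
    (hg : ContinuousOn g s) :
    integralOn s (fun p => g p + h p) ≤ integralOn s g + integralOn s h := by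
  unfold integralOn
  rw [← lintegral_add_left' (hg.aemeasurable hs).ennreal_ofReal]
  exact lintegral_mono fun p => ENNReal.ofReal_add_le

lemma integralOn_inter_of_eq_zero {s t : Set (Spacetime n)} (hs : MeasurableSet s)
    (ht : MeasurableSet t) {g : Spacetime n → ℝ} (hg : ∀ p ∈ s, p ∉ t → g p = 0) :
    integralOn s g = integralOn (s ∩ t) g := by
  unfold integralOn
  rw [← lintegral_inter_add_sdiff (fun p => ENNReal.ofReal (g p)) s ht,
    setLIntegral_congr_fun (hs.diff ht) (g := fun _ => 0) fun p hp => by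
      simp [hg p hp.1 hp.2]]
  simp

end Splitting

/-! ### Parameter conditions and the observed terms. -/

section Main

variable {n : ℕ} {Ω : Set (EuclideanSpace ℝ (Fin n))} {Q p : Spacetime n} {a b c ε R N σ : ℝ}
  {z φ : Spacetime n → ℝ}

lemma isOpen_observationSet (hΩ : IsOpen Ω) : IsOpen (observationSet Ω Q σ) := by
  have : {y | ∃ x ∈ gammaPlus Ω Q, ‖y - x‖ < σ} = Metric.thickening σ (gammaPlus Ω Q) := by
    ext y
    simp [Metric.mem_thickening_iff, dist_eq_norm]
  rw [observationSet, this]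
  exact Metric.isOpen_thickening.inter hΩ

/-- The parameter conditions place the closure of the domain in the region of good bounds. -/
lemma closure_inter_subset_goodRegion (hR0 : 0 < R) (hR : ∀ x ∈ Ω, ‖x - Q.2‖ < R) (hb : 0 < b)
    (hεb : ε ≤ c * b) (hc : c ≤ 1 / 100) (hbR : b ≤ 1 / 100 * R⁻¹) :
    closure (cylinder Ω) ∩ exteriorCone Q ⊆ goodRegion Q b ε := by
  intro p hp
  have hr := rQ_le_of_mem_closure hR hp.1
  have hr0 := rQ_pos hp.2
  have hbR' : b * R ≤ 1 / 100 := by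
    have := mul_le_mul_of_nonneg_right hbR hR0.le
    rwa [mul_assoc, inv_mul_cancel₀ hR0.ne', mul_one] at this
  have hsq : √(fQ Q p) ≤ R / 2 := by
    refine Real.sqrt_le_iff.2 ⟨by positivity, ?_⟩
    have h1 : rQ Q p ^ 2 ≤ R ^ 2 := by gcongr
    have h2 := four_fQ_le (Q := Q) (p := p)
    linarith
  refine ⟨hp.2, ?_, ?_⟩
  · calc ε * rQ Q p ≤ (1 / 100 * b) * R := by
          gcongr
          exact hεb.trans (mul_le_mul_of_nonneg_right hc hb.le)
      _ = 1 / 100 * (b * R) := by ring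
      _ < 1 / 100 := by linarith
  · calc b * √(fQ Q p) ≤ b * (R / 2) := by gcongr
      _ < 1 / 100 := by linarith

/-- The localizing factor (φ² + |∇φ|²)/(1 + N) is at most 1 and vanishes off the observation set. -/
lemma integralOn_sourceDensity_le (hΩ : IsOpen Ω) (ha : 0 < a) (hb : 0 < b) (hε : 0 < ε)
    (hR0 : 0 < R) (hreg : cylinder Ω ∩ exteriorCone Q ⊆ goodRegion Q b ε) (hN : 0 ≤ N)
    (hφ1 : ∀ p ∈ cylinder Ω ∩ exteriorCone Q, φ p ^ 2 + ∑ i, pd i φ p ^ 2 ≤ 1 + N)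
    (hφ0 : ∀ p ∈ cylinder Ω ∩ exteriorCone Q, p.2 ∉ observationSet Ω Q σ →
      φ p ^ 2 + ∑ i, pd i φ p ^ 2 = 0)
    (hz : ContDiffOn ℝ 2 z (cylinder Ω)) :
    integralOn (cylinder Ω ∩ exteriorCone Q) (sourceDensity Q a b ε R N φ z) ≤
      ENNReal.ofReal (1 / a) * integralOn (cylinder Ω ∩ exteriorCone Q)
          (fun p => weight Q a b ε p * fQ Q p * box z p ^ 2)
        + ENNReal.ofReal (a ^ 2 * R ^ 3) *
          integralOn (cylinder (observationSet Ω Q σ) ∩ exteriorCone Q)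
            (fun p => weight Q a b ε p * (fQ Q p ^ 2)⁻¹ * (gradT z p 0 ^ 2 + gradT z p 1 ^ 2))
        + ENNReal.ofReal (a ^ 4 * R ^ 4) *
          integralOn (cylinder (observationSet Ω Q σ) ∩ exteriorCone Q)
            (fun p => weight Q a b ε p * (fQ Q p ^ 3)⁻¹ * z p ^ 2) := by
  set O := cylinder Ω ∩ exteriorCone Q with hO
  have hOo : IsOpen O := (isOpen_cylinder hΩ).inter (isOpen_exteriorCone Q)
  have hωo : IsOpen (cylinder (observationSet Ω Q σ)) := isOpen_cylinder (isOpen_observationSet hΩ)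
  set O' := cylinder (observationSet Ω Q σ) ∩ exteriorCone Q with hO'
  have hO'o : IsOpen O' := hωo.inter (isOpen_exteriorCone Q)
  have hinter : O ∩ cylinder (observationSet Ω Q σ) = O' := by
    ext p
    simp only [hO, hO', cylinder, observationSet, mem_inter_iff, mem_prod, mem_univ, true_and]
    tauto
  have hsub : O' ⊆ O := hinter ▸ inter_subset_left
  have hza : ∀ p ∈ O, ContDiffAt ℝ 2 z p := fun p hp =>
    hz.contDiffAt ((isOpen_cylinder hΩ).mem_nhds hp.1)
  have hf : ContinuousOn (fQ Q) O := (contDiff_fQ Q (k := 0)).continuous.continuousOn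
  have hC : ContinuousOn (carl Q a b ε) O := fun p hp =>
    (contDiffAt_carl hb hε (hreg hp) (k := 0)).continuousAt.continuousWithinAt
  have hzi : ∀ i, ContinuousOn (pd i z) O := fun i p hp =>
    (differentiableAt_pd (hza p hp)).continuousAt.continuousWithinAt
  obtain ⟨A, hA⟩ : ∃ A : Spacetime n → ℝ,
      A = fun p => fQ Q p / a * (carl Q a b ε p ^ 2 * box z p ^ 2) := ⟨_, rfl⟩
  obtain ⟨B, hB⟩ : ∃ B : Spacetime n → ℝ,
      B = fun p => carl Q a b ε p ^ 2 * ((φ p ^ 2 + ∑ i, pd i φ p ^ 2) / (1 + N))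
      * (a ^ 2 * R ^ 3 / fQ Q p ^ 2 * (∑ k : Fin 2, pd (Sum.inl k) z p ^ 2)
        + a ^ 4 * R ^ 4 / fQ Q p ^ 3 * z p ^ 2) := ⟨_, rfl⟩
  obtain ⟨B₁, hB₁⟩ : ∃ B : Spacetime n → ℝ, B = fun p => carl Q a b ε p ^ 2
      * (a ^ 2 * R ^ 3 / fQ Q p ^ 2 * (∑ k : Fin 2, pd (Sum.inl k) z p ^ 2)) := ⟨_, rfl⟩
  obtain ⟨B₂, hB₂⟩ : ∃ B : Spacetime n → ℝ, B = fun p => carl Q a b ε p ^ 2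
      * (a ^ 4 * R ^ 4 / fQ Q p ^ 3 * z p ^ 2) := ⟨_, rfl⟩
  have hAc : ContinuousOn A O := by
    rw [hA]
    exact (hf.div_const _).mul ((hC.pow 2).mul
      ((continuousOn_box hOo (hz.mono inter_subset_left)).pow 2))
  have hB₁c : ContinuousOn B₁ O' := by
    rw [hB₁]
    refine ContinuousOn.mono ?_ hsub
    exact (hC.pow 2).mul ((continuousOn_const.div (hf.pow 2)
      fun p hp => pow_ne_zero _ hp.2.ne').mul (continuousOn_finsetSum _ fun i _ => (hzi _).pow 2))
  have e1 : integralOn O A = ENNReal.ofReal (1 / a) * integralOn O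
      (fun p => weight Q a b ε p * fQ Q p * box z p ^ 2) := by
    rw [← integralOn_const_mul (by positivity)]
    refine setLIntegral_congr_fun hOo.measurableSet fun p hp => ?_
    simp only [hA]
    rw [weight_eq hb hε (hreg hp)]
    congr 1
    ring
  have e2 : integralOn O' B₁ = ENNReal.ofReal (a ^ 2 * R ^ 3) * integralOn O'
      (fun p => weight Q a b ε p * (fQ Q p ^ 2)⁻¹ * (gradT z p 0 ^ 2 + gradT z p 1 ^ 2)) := by
    rw [← integralOn_const_mul (by positivity)]
    refine setLIntegral_congr_fun hO'o.measurableSet fun p hp => ?_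
    have hzd := (hza p (hsub hp)).differentiableAt (by norm_num)
    simp only [hB₁]
    rw [weight_eq hb hε (hreg (hsub hp)), gradT_apply hzd, gradT_apply hzd, Fin.sum_univ_two]
    congr 1
    ring
  have e3 : integralOn O' B₂ = ENNReal.ofReal (a ^ 4 * R ^ 4) * integralOn O'
      (fun p => weight Q a b ε p * (fQ Q p ^ 3)⁻¹ * z p ^ 2) := by
    rw [← integralOn_const_mul (by positivity)]
    refine setLIntegral_congr_fun hO'o.measurableSet fun p hp => ?_
    simp only [hB₂]
    rw [weight_eq hb hε (hreg (hsub hp))]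
    congr 1
    ring
  rw [← e1, ← e2, ← e3]
  have hAB : sourceDensity Q a b ε R N φ z = fun p => A p + B p := by
    funext p; simp only [hA, hB, sourceDensity]
  rw [hAB, add_assoc]
  refine (integralOn_add_le hOo.measurableSet hAc).trans (add_le_add_right ?_ _)
  -- The localizing factor restricts the domain of integration before it is bounded by 1.
  rw [integralOn_inter_of_eq_zero hOo.measurableSet hωo.measurableSet fun p hp hpω => ?_, hinter]
  · refine le_trans ?_ (integralOn_add_le hO'o.measurableSet hB₁c)
    refine integralOn_mono hO'o.measurableSet fun p hp => ?_
    have hfp : 0 < fQ Q p := hp.2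
    have h1 : (φ p ^ 2 + ∑ i, pd i φ p ^ 2) / (1 + N) ≤ 1 :=
      (div_le_one (by positivity)).2 (hφ1 p (hsub hp))
    have hT : 0 ≤ ∑ k : Fin 2, pd (Sum.inl k) z p ^ 2 := Finset.sum_nonneg fun _ _ => sq_nonneg _
    simp only [hB, hB₁, hB₂]
    rw [← mul_add]
    refine mul_le_mul_of_nonneg_right ?_ (by positivity)
    exact mul_le_of_le_one_right (sq_nonneg _) h1
  · simp only [hB]
    rw [hφ0 p hp fun h => hpω ⟨trivial, h⟩]
    ring

end Main

end ShiftedCarleman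

end

/-! ### Choice of constants and conclusion. -/

theorem mainTheorem8 :
    -- absolute constants for `a ≫ R` and `b ≪ R⁻¹`
    ∃ K : ℝ, 0 < K ∧ ∃ c : ℝ, 0 < c ∧
    ∀ n : ℕ, 1 ≤ n →
    -- a constant depending only on `n`, for `ε ≪_n b`
    ∃ cn : ℝ, 0 < cn ∧
    ∀ (Ω : Set (EuclideanSpace ℝ (Fin n))) (Q : ShiftedCarleman.Spacetime n) (R σ : ℝ),
      IsOpen Ω → ShiftedCarleman.HasSmoothBoundary Ω →
      0 < R → (∀ x ∈ Ω, ‖x - Q.2‖ < R) → 0 < σ →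
    ∃ C : ℝ, 0 < C ∧
    ∀ a b ε : ℝ, 0 < a → 0 < b → 0 < ε →
      ((n : ℝ) + 2) ^ 2 ≤ a → K * R ≤ a → ε ≤ cn * b → b ≤ c * R⁻¹ →
    ∀ z : ShiftedCarleman.Spacetime n → ℝ,
      ContDiffOn ℝ 2 z (ShiftedCarleman.cylinder Ω) →
      ContDiffOn ℝ 1 z (closure (ShiftedCarleman.cylinder Ω)) →
      (∀ p ∈ frontier (ShiftedCarleman.cylinder Ω) ∩ ShiftedCarleman.exteriorCone Q, z p = 0) →
      ENNReal.ofReal (C * ε) *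
          ShiftedCarleman.integralOn
            (ShiftedCarleman.cylinder Ω ∩ ShiftedCarleman.exteriorCone Q)
            (fun p => ShiftedCarleman.weight Q a b ε p * (ShiftedCarleman.rQ Q p)⁻¹ *
              ((ShiftedCarleman.uQ Q p * ShiftedCarleman.dU Q z p) ^ 2
                + (ShiftedCarleman.vQ Q p * ShiftedCarleman.dV Q z p) ^ 2
                + ShiftedCarleman.fQ Q p * ShiftedCarleman.gAngX Q z p
                - ShiftedCarleman.fQ Q p * ShiftedCarleman.gAngT Q z p))
        + ENNReal.ofReal (C * b * a ^ 2) *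
          ShiftedCarleman.integralOn
            (ShiftedCarleman.cylinder Ω ∩ ShiftedCarleman.exteriorCone Q)
            (fun p => ShiftedCarleman.weight Q a b ε p *
              ShiftedCarleman.fQ Q p ^ (-(1 / 2) : ℝ) * z p ^ 2)
      ≤ ENNReal.ofReal (1 / a) *
          ShiftedCarleman.integralOn
            (ShiftedCarleman.cylinder Ω ∩ ShiftedCarleman.exteriorCone Q)
            (fun p => ShiftedCarleman.weight Q a b ε p * ShiftedCarleman.fQ Q p *
              ShiftedCarleman.box z p ^ 2)
        + ENNReal.ofReal (a ^ 2 * R ^ 3) *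
          ShiftedCarleman.integralOn
            (ShiftedCarleman.cylinder (ShiftedCarleman.observationSet Ω Q σ) ∩
              ShiftedCarleman.exteriorCone Q)
            (fun p => ShiftedCarleman.weight Q a b ε p * (ShiftedCarleman.fQ Q p ^ 2)⁻¹ *
              (ShiftedCarleman.gradT z p 0 ^ 2 + ShiftedCarleman.gradT z p 1 ^ 2))
        + ENNReal.ofReal (a ^ 4 * R ^ 4) *
          ShiftedCarleman.integralOn
            (ShiftedCarleman.cylinder (ShiftedCarleman.observationSet Ω Q σ) ∩
              ShiftedCarleman.exteriorCone Q)
            (fun p => ShiftedCarleman.weight Q a b ε p * (ShiftedCarleman.fQ Q p ^ 3)⁻¹ *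
              z p ^ 2) := by
  -- With bR ≤ 1/100 one gets b√f ≤ bR/2 < 1/100, and, since ε ≤ b/100, also εr < 1/100.
  refine ⟨1, one_pos, 1 / 100, by norm_num, fun n hn => ?_⟩
  obtain ⟨M, hM0, hM⟩ := ShiftedCarleman.exists_multWeight_bounds n
  have hM1 : 0 < 100 + M := by linarith
  -- This value is at most 1/100, and its product with M is at most 1; M depends on n only.
  refine ⟨1 / (100 + M), by positivity, fun Ω Q R σ hΩ hs hR0 hR hσ => ?_⟩
  obtain ⟨φ, χ, N, hN, hφ, hχ, hcut, hχ0, hφ0⟩ :=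
    ShiftedCarleman.exists_cutoffBounds Q R hσ (ShiftedCarleman.gammaPlus Ω Q)
  have hK : 0 < ShiftedCarleman.cutoffConst N R := by
    unfold ShiftedCarleman.cutoffConst; positivity
  set κ := ShiftedCarleman.cutoffConst N R
  -- 128 is the comparison constant of `lhs_density_le` and κ the factor in front of the source
  -- density. The latter depends on the cutoffs, hence on Ω, Q, R and σ, but not on a, b, ε.
  refine ⟨1 / (128 * κ), by positivity, fun a b ε ha0 hb hε ha _ hεb hbR z hz hzc hz0 => ?_⟩
  have hc : 1 / (100 + M) ≤ 1 / 100 := by gcongr; linarith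
  have hreg := ShiftedCarleman.closure_inter_subset_goodRegion hR0 hR hb hεb hc hbR
  set O := ShiftedCarleman.cylinder Ω ∩ ShiftedCarleman.exteriorCone Q with hO
  have hOo : IsOpen O :=
    (ShiftedCarleman.isOpen_cylinder hΩ).inter (ShiftedCarleman.isOpen_exteriorCone Q)
  have hOC : O ⊆ closure (ShiftedCarleman.cylinder Ω) ∩ ShiftedCarleman.exteriorCone Q :=
    Set.inter_subset_inter_left _ subset_closure
  have hOg := hOC.trans hreg
  have hcutO : ∀ p ∈ O, ShiftedCarleman.CutoffBounds φ χ N p := fun p hp =>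
    hcut p (ShiftedCarleman.mem_closedBall_of_mem_exteriorCone hp.2
      (ShiftedCarleman.rQ_lt_of_mem hR hp.1).le)
  have hMr : ∀ p ∈ closure (ShiftedCarleman.cylinder Ω) ∩ ShiftedCarleman.exteriorCone Q,
      M * (ε * ShiftedCarleman.rQ Q p) ≤ 1 / 4 := by
    intro p hp
    have hr := ShiftedCarleman.rQ_le_of_mem_closure hR hp.1
    have hr0 := ShiftedCarleman.rQ_pos hp.2
    have hbR' : b * R ≤ 1 / 100 := by
      have := mul_le_mul_of_nonneg_right hbR hR0.le
      rwa [mul_assoc, inv_mul_cancel₀ hR0.ne', mul_one] at this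
    calc M * (ε * ShiftedCarleman.rQ Q p) ≤ M * (1 / (100 + M) * b * R) := by gcongr
      _ = M / (100 + M) * (b * R) := by ring
      _ ≤ 1 * (1 / 100) := by
        gcongr
        exact (div_le_one hM1).2 (by linarith)
      _ ≤ 1 / 4 := by norm_num
  have hmain := ShiftedCarleman.integralOn_bulkDensity_le hn hΩ hs hR0 hR hb hε ha hεb hc hM0
    (by rw [mul_one_div]; exact (div_le_one hM1).2 (by linarith)) hreg hMr
    (fun p hp => hM Q b ε p hb hε hp) hN hφ hχ hcutO hχ0 hz hzc hz0
  have hsource := ShiftedCarleman.integralOn_sourceDensity_le (σ := σ) hΩ ha0 hb hε hR0 hOg hN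
    (fun p hp => add_le_add (hcutO p hp).sq_le_one (hcutO p hp).pd_left_le)
    (fun p hp hpω => hφ0 p fun h => hpω ⟨by
      obtain ⟨x, hx, hd⟩ := Metric.mem_thickening_iff.1 h
      exact ⟨x, hx, by rwa [dist_eq_norm] at hd⟩, hp.1.2⟩) hz
  refine le_trans ?_ hsource
  have hzd : ∀ p ∈ O, DifferentiableAt ℝ z p := fun p hp =>
    (hz.contDiffAt ((ShiftedCarleman.isOpen_cylinder hΩ).mem_nhds hp.1)).differentiableAt
      (by norm_num)
  have hC : 0 ≤ 1 / (128 * κ) := by positivity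
  rw [← ShiftedCarleman.integralOn_const_mul (by positivity),
    ← ShiftedCarleman.integralOn_const_mul (by positivity)]
  refine (ShiftedCarleman.add_integralOn_le hOo.measurableSet (fun p hp => ?_)
    fun p hp => ?_).trans ?_
  · have hf : 0 < ShiftedCarleman.fQ Q p := hp.2
    have hr := ShiftedCarleman.rQ_pos hp.2
    rw [ShiftedCarleman.weight_eq hb hε (hOg hp)]
    have h1 : ShiftedCarleman.fQ Q p * ShiftedCarleman.gAngT Q z p ≤ 0 :=
      mul_nonpos_of_nonneg_of_nonpos hf.le (neg_nonpos.2 (sq_nonneg _))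
    have h2 : 0 ≤ ShiftedCarleman.fQ Q p * ShiftedCarleman.gAngX Q z p :=
      mul_nonneg hf.le (sq_nonneg _)
    refine mul_nonneg (by positivity) (mul_nonneg (by positivity) ?_)
    have := sq_nonneg (ShiftedCarleman.uQ Q p * ShiftedCarleman.dU Q z p)
    have := sq_nonneg (ShiftedCarleman.vQ Q p * ShiftedCarleman.dV Q z p)
    linarith
  · have hf : 0 < ShiftedCarleman.fQ Q p := hp.2
    rw [ShiftedCarleman.weight_eq hb hε (hOg hp)]
    positivity
  · have h1 := ShiftedCarleman.integralOn_mono hOo.measurableSet fun p hp =>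
      ShiftedCarleman.lhs_density_le (a := a) hC hb hε (hOg hp) (hzd p hp)
    refine h1.trans ?_
    have h2 : 128 * (1 / (128 * κ)) = κ⁻¹ := by field_simp
    rw [h2, ShiftedCarleman.integralOn_const_mul (by positivity)]
    refine (mul_le_mul_right hmain _).trans_eq ?_
    rw [ShiftedCarleman.integralOn_const_mul hK.le, ← mul_assoc,
      ← ENNReal.ofReal_mul (by positivity), inv_mul_cancel₀ hK.ne', ENNReal.ofReal_one, one_mul]
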